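/- **Setting.** Let $X$ be a complex manifold of dimension $m+l$ with a holomorphic action of a finite group $G$, let $H\le G$, and let $Y$ be a complex manifold of dimension $m$, embedded in $X$ as an open subset of a connected component of $X_H=\{x:\mathrm{Stab}(x)=H\}$ (for instance the whole component). Let $\mathcal N\to Y$ be the normal bundle, with fibre the $H$-invariant complement of $(T_xX)^H$ in $T_xX$, and let $\sigma:H\to\mathrm{GL}(l,\mathbb C)$ be equivalent to the representation of $H$ on its fibres. Let $\mathcal S\subseteq H$ be the set of complex reflections of $\mathbb C^l$, $\alpha_s$ a linear form with kernel the reflecting hyperplane of $s\in\mathcal S$, $\lambda_s=\det\sigma(s)^{-1}$, and $c$ a conjugation invariant function on $\mathcal S$. Let $x=(x_1,\dots,x_m)$ and $y=(y_1,\dots,y_l)$. *The algebras.* $\widehat D_m\subset\mathrm{End}_{\mathbb C}\,\mathbb C[[x]]$ is generated by $\mathbb C[[x]]$ and $\partial_1,\dots,\partial_m$. The algebra $\mathcal A=\mathcal A^H_{m,l}=\widehat D_m\hat\otimes\widehat H_{1,c}(\mathbb C^l,H)$ is generated by $\mathbb C[[x,y]]$, commuting derivations $\partial_i=\partial/\partial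 x_i$, commuting basis vectors $u_1,\dots,u_l$ of $\mathbb C^l$ and the group $H$. In it $H$ commutes with the $\partial_i$ and acts by conjugation in the natural way on $\mathbb C[[x,y]]$ and on $\mathbb C^l$; moreover $[\partial_i,u_j]=0$, $[\partial_i,f]=\partial f/\partial x_i$, and $$[u,f]=\partial_uf-\sum_{s\in\mathcal S}\frac{2c(s)}{1-\lambda_s}(u,\alpha_s)\frac{f-s f}{\alpha_s}\,s .$$ Its elements are the finite sums $\sum f_{\alpha Jh}(x,y)\,\partial^\alpha u^Jh$ with $f_{\alpha Jh}\in\mathbb C[[x,y]]$. Let $\mathfrak z$ be the Lie algebra of the centralizer $Z$ of $\sigma(H)$, and for $A\in\mathfrak z$ let $\lambda_{A,s}$ be the number with $-\alpha_s\circ A=\lambda_{A,s}\alpha_s$. Put $$\varphi_c(A)=-\sum_{i,j}A_{ij}y_ju_i+\sum_{s\in\mathcal S}\frac{2c(s)}{1-\lambda_s}\lambda_{A,s}(1-s),$$ extend it $\mathbb C[[x]]$-linearly to $\mathfrak z\otimes\mathbb C[[x]]$, and define $\Phi_c:W_m\ltimes\mathfrak z\otimes\mathbb C[[x]]\to\mathcal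 A$ by $\Phi_c(v+A)=\sum_iv_i\partial_i+\varphi_c(A)$, where $W_m$ is the Lie algebra of formal vector fields $v=\sum_i v_i(x)\partial_i$. *The torsors.* For an $n$-dimensional complex manifold $U$ let $\mathrm{Coor}(U)$ be the space of formal coordinate systems $[\phi]$, i.e. infinite jets at $0$ of local parametrizations $\phi$, and let $\mathrm{Coor}(\mathcal N)$ be the space of infinite jets of local parametrizations $\phi(x,y)=(\phi_0(x),B(x)y)$ of $\mathcal N$ with $B(x):\mathbb C^l\to\mathcal N_{\phi_0(x)}$ linear and $H$-equivariant. A function on one of these spaces is holomorphic if it is locally a holomorphic function of finitely many jet coordinates. The group $\mathrm{Aut}_n$ of formal automorphisms of $(\mathbb C^n,0)$ acts on $\mathrm{Coor}(U)$, and the formal automorphisms $\rho(x,y)=(\rho_0(x),b(x)y)$, with $\rho_0\in\mathrm{Aut}_m$ and $b\in Z(\mathbb C[[x]])$, act on $\mathrm{Coor}(\mathcal N)$, by $[\phi]\mapsto[\phi\circ\rho]$. Let $\omega$ be the connection form $\omega(\tfrac{d}{dt}|_{0}[\phi\circ\rho_t])=-\tfrac{d}{dt}|_{0}\rho_t$,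 a pointwise isomorphism of the tangent spaces onto $W_n$, respectively $W_m\ltimes\mathfrak z\otimes\mathbb C[[x]]$, where $A\in\mathfrak z\otimes\mathbb C[[x]]$ is embedded in such a way that on columns $p\in\mathbb C[[x]]^l$ (sections of $\mathcal N$ in the frame $B$) the vector $\omega^{-1}(v+A)$ acts by $p\mapsto-(v(p)+Ap)$. A *flat section* of $\mathrm{Coor}(\mathcal N)\times\mathcal A$ is a map $$s([\phi])=\sum_{\alpha,\beta}S_{\alpha\beta}([\phi])x^\beta\partial^\alpha,\qquad S_{\alpha\beta}=\sum_{h,I,J}F^{hIJ}_{\alpha\beta}\,y^Iu^Jh\in\widehat H_{1,c}(\mathbb C^l,H),$$ with holomorphic coefficients $F^{hIJ}_{\alpha\beta}$ and $ds+[\Phi_c\circ\omega,s]=0$. A flat section of $\mathrm{Coor}(U)\times\widehat D_n$ is a map $s([\phi])=\sum_{\alpha,\beta}f_{\alpha\beta}([\phi])x^\beta\partial^\alpha$ with holomorphic coefficients and $ds+[\omega,s]=0$. **Theorem.** (A) Let $s$ be a flat section of $\mathrm{Coor}(\mathcal N)\times\mathcal A$. 1. $s$ is equivariant: for all $\rho_0\in\mathrm{Aut}_m$,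 $b\in Z(\mathbb C[[x]])$ and $\rho(x,y)=(\rho_0(x),b(x)y)$ one has $s([\phi\circ\rho])=\rho^*\circ s([\phi])\circ(\rho^*)^{-1}$ for all $[\phi]$. Here the right-hand side is the action of $\rho$ on $\mathcal A$, i.e. the algebra automorphism $f\mapsto\rho^*f$, $h\mapsto h$, $u_j\mapsto\sum_k(b^{-1})_{kj}u_k$, $\partial_j\mapsto\sum_k((D\rho_0)^{-1})_{kj}\big(\partial_k+\varphi_c(b^{-1}\partial_kb)\big)$ (which exists). 2. $s$ is uniquely determined by its coefficients of order zero in $x$: if $s'$ is a flat section and $F'^{hIJ}_{\alpha0}=F^{hIJ}_{\alpha0}$ for all $\alpha,h,I,J$, then $s=s'$, and all coefficients agree. 3. The other coefficients are given recursively. Let $\xi^1+A^1,\dots,\xi^m+A^m\in W_m\ltimes\mathfrak z\otimes\mathbb C[[x]]$ be such that the matrix $V=(\xi^{r}_{i,0})_{r,i}$ of constant terms is invertible, and let $X_r=\omega^{-1}(\xi^r+A^r)$ at $[\phi]$. Write $\xi^r_i=\sum_\mu\xi^r_{i,\mu}x^\mu$ and $A^r=\sum_\mu A^r_\mu x^\mu$.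 Then for all $\alpha,\beta,j$, at $[\phi]$, $$(\beta_j+1)\,S_{\alpha,\beta+\epsilon_j}=\sum_r(V^{-1})_{jr}\Big(-X_rS_{\alpha\beta}+P^r_{\alpha\beta}+Q^r_{\alpha\beta}\Big),$$ $$P^r_{\alpha\beta}=-\sum_{i}\sum_{\mu\neq0}\xi^r_{i,\mu}(\beta_i-\mu_i+1)S_{\alpha,\beta-\mu+\epsilon_i}+\sum_{i:\,\alpha\ge\epsilon_i}\ \sum_{\kappa\le\beta}\ \sum_{\gamma\ne0}\xi^r_{i,\kappa+\gamma}\binom{\alpha+\gamma-\epsilon_i}{\gamma}\frac{(\kappa+\gamma)!}{\kappa!}S_{\alpha+\gamma-\epsilon_i,\,\beta-\kappa},$$ $$Q^r_{\alpha\beta}=-\sum_{\kappa\le\beta}[\varphi_c(A^r_\kappa),S_{\alpha,\beta-\kappa}]+\sum_{\kappa\le\beta}\ \sum_{\gamma\neq0}\binom{\alpha+\gamma}{\gamma}\frac{(\kappa+\gamma)!}{\kappa!}S_{\alpha+\gamma,\,\beta-\kappa}\,\varphi_c(A^r_{\kappa+\gamma}).$$ (B) Let $U$ be a complex manifold of dimension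 $n$ (for instance an open subset of the principal stratum of $X$) and $s=\sum f_{\alpha\beta}x^\beta\partial^\alpha$ a flat section of $\mathrm{Coor}(U)\times\widehat D_n$. Then $s([\phi\circ\rho])=\rho^*\circ s([\phi])\circ(\rho^*)^{-1}$ for all $\rho\in\mathrm{Aut}_n$; $s$ is uniquely determined, together with all its coefficients, by the functions $f_{\alpha0}$; and for $X_r=\omega^{-1}(\xi^r)$, $r=1,\dots,n$, with invertible $V=(\xi^r_{i,0})$, $$(\beta_j+1)f_{\alpha,\beta+\epsilon_j}=\sum_r(V^{-1})_{jr}\big(-X_rf_{\alpha\beta}+P^r_{\alpha\beta}\big),$$ with $P^r_{\alpha\beta}$ as above, $f$ in place of $S$ and $n$ in place of $m$. -/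

import Mathlib

open scoped Manifold ContDiff Topology

noncomputable section

namespace FormalGeometry

/-! ### Formal power series, formal vector fields, formal differential operators -/

/-- The ring `ℂ⟦x₁, …, xₘ⟧` of functions on the formal `m`-disc. -/
abbrev FPS (m : ℕ) : Type := MvPowerSeries (Fin m) ℂ

/-- The ring `ℂ⟦x₁, …, xₘ, y₁, …, yₗ⟧`. -/
abbrev FPS2 (m l : ℕ) : Type := MvPowerSeries (Fin m ⊕ Fin l) ℂ

/-- The maximal ideal of `ℂ⟦x₁, …, xₘ⟧`. -/
def maxIdeal (m : ℕ) : Ideal (FPS m) :=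
  RingHom.ker (MvPowerSeries.constantCoeff (σ := Fin m) (R := ℂ))

/-- The inclusion `ℂ⟦x⟧ ⊆ ℂ⟦x, y⟧`. -/
def inX {m : ℕ} (l : ℕ) (f : FPS m) : FPS2 m l := MvPowerSeries.rename Sum.inl f

/-- The formal vector field `∑ᵢ vᵢ ∂/∂xᵢ`, an element of the Lie algebra `Wₘ`, as an operator. -/
def vecField {m : ℕ} (v : Fin m → FPS m) : Module.End ℂ (FPS m) :=
  ∑ i, LinearMap.mulLeft ℂ (v i) * (MvPowerSeries.pderiv ℂ i).toLinearMap

/-- The algebra of formal differential operators, generated inside `End_ℂ ℂ⟦x₁, …, xₘ⟧` by the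
multiplication operators and the partial derivatives. -/
def DHat (m : ℕ) : Subalgebra ℂ (Module.End ℂ (FPS m)) :=
  Algebra.adjoin ℂ
    (Set.range (fun f : FPS m => LinearMap.mulLeft ℂ f) ∪
      Set.range (fun i : Fin m => (MvPowerSeries.pderiv ℂ i).toLinearMap))

/-- The operator `∑_α f_α ∂^α` of a finitely supported family `(f_α)`. -/
def diffOp {m : ℕ} (a : (Fin m →₀ ℕ) →₀ FPS m) : Module.End ℂ (FPS m) :=
  a.sum fun α f => LinearMap.mulLeft ℂ f *
    (List.ofFn fun i => (MvPowerSeries.pderiv ℂ i).toLinearMap ^ α i).prod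

lemma mem_maxIdeal_iff {m : ℕ} (p : FPS m) : p ∈ maxIdeal m ↔ ¬ IsUnit p := by
  rw [maxIdeal, RingHom.mem_ker, MvPowerSeries.isUnit_iff_constantCoeff, isUnit_iff_ne_zero,
    not_not]

lemma comap_maxIdeal_pow {m : ℕ} (g : FPS m ≃ₐ[ℂ] FPS m) (k : ℕ) :
    Ideal.comap (g : FPS m →+* FPS m) (maxIdeal m ^ k) = maxIdeal m ^ k := by
  have h1 : ∀ e : FPS m ≃ₐ[ℂ] FPS m,
      Ideal.map (e : FPS m →+* FPS m) (maxIdeal m ^ k) ≤ maxIdeal m ^ k := by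
    intro e
    rw [Ideal.map_pow]
    refine Ideal.pow_right_mono ?_ k
    rw [Ideal.map_le_iff_le_comap]
    intro p hp
    rw [Ideal.mem_comap, mem_maxIdeal_iff]
    rw [mem_maxIdeal_iff] at hp
    intro h
    exact hp ((MulEquiv.isUnit_map e).1 h)
  apply le_antisymm
  · intro p hp
    have := h1 g.symm (Ideal.mem_map_of_mem _ (Ideal.mem_comap.1 hp))
    simpa using this
  · exact Ideal.map_le_iff_le_comap.1 (h1 g)

/-! ### Holomorphic functions in infinitely many coordinates

A space of formal coordinate systems is a projective limit of finite-dimensional complex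
manifolds.  A function on it is holomorphic when it is, locally, a holomorphic function of
finitely many of the jet coordinates. -/

/-- Near `p`, on the neighbourhood `{q ∈ O | (z_i(q))_{i ∈ S} ∈ V}`, the function `f` is the
holomorphic function `h` of the finitely many coordinates `z_i`, `i ∈ S`. -/
def IsCoordRep {Pt κ : Type*} (O : Set Pt) (z : Pt → κ → ℂ) (f : Pt → ℂ) (p : Pt)
    (S : Finset κ) (V : Set (S → ℂ)) (h : (S → ℂ) → ℂ) : Prop :=
  p ∈ O ∧ IsOpen V ∧ (fun i : S => z p i) ∈ V ∧ DifferentiableOn ℂ h V ∧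
    ∀ q ∈ O, (fun i : S => z q i) ∈ V → f q = h (fun i : S => z q i)

/-- `f` is holomorphic near `p`, with derivative `d` along the tangent vector whose components in
the coordinates `z` are `w`. -/
def HasCoordDeriv {Pt κ : Type*} (O : Set Pt) (z : Pt → κ → ℂ) (f : Pt → ℂ) (p : Pt)
    (w : κ → ℂ) (d : ℂ) : Prop :=
  ∃ (S : Finset κ) (V : Set (S → ℂ)) (h : (S → ℂ) → ℂ), IsCoordRep O z f p S V h ∧
    fderiv ℂ h (fun i : S => z p i) (fun i : S => w i) = d

/-! ### The bundle of formal coordinate systems of a complex manifold -/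

section Coor

variable (m : ℕ) {Y : Type*} [TopologicalSpace Y] [ChartedSpace (Fin m → ℂ) Y]

/-- The ring `𝒪_{Y,y}` of germs at `y` of holomorphic functions. -/
def holGerms (y : Y) : Subring (Filter.Germ (𝓝 y) ℂ) where
  carrier := {g | ∃ f : Y → ℂ, (f : Filter.Germ (𝓝 y) ℂ) = g ∧
    ∀ᶠ p in 𝓝 y, MDifferentiableAt 𝓘(ℂ, Fin m → ℂ) 𝓘(ℂ) f p}
  zero_mem' := ⟨0, rfl, .of_forall fun _ => mdifferentiableAt_const⟩
  one_mem' := ⟨1, rfl, .of_forall fun _ => mdifferentiableAt_const⟩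
  add_mem' := by
    rintro _ _ ⟨f, rfl, hf⟩ ⟨g, rfl, hg⟩
    exact ⟨f + g, rfl, by filter_upwards [hf, hg] with p h1 h2 using h1.add h2⟩
  mul_mem' := by
    rintro _ _ ⟨f, rfl, hf⟩ ⟨g, rfl, hg⟩
    exact ⟨f * g, rfl, by filter_upwards [hf, hg] with p h1 h2 using h1.mul h2⟩
  neg_mem' := by
    rintro _ ⟨f, rfl, hf⟩
    exact ⟨-f, rfl, by filter_upwards [hf] with p h1 using h1.neg⟩

/-- The constant germ. -/
def constGerm (y : Y) (a : ℂ) : holGerms m y :=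
  ⟨((fun _ => a : Y → ℂ) : Filter.Germ (𝓝 y) ℂ),
    ⟨fun _ => a, rfl, .of_forall fun _ => mdifferentiableAt_const⟩⟩

/-- The maximal ideal of `𝒪_{Y,y}`: the germs that vanish at `y`. -/
def germIdeal (y : Y) : Ideal (holGerms m y) :=
  RingHom.ker (Filter.Germ.valueRingHom.comp (holGerms m y).subtype)

variable (Y)

/-- A formal coordinate system `[φ]` on the `m`-dimensional complex manifold `Y`: a point `y` and
a compatible family of isomorphisms of `ℂ`-algebras `𝒪_{Y,y}/𝔪^{k+1} ≅ ℂ⟦x⟧/𝔪^{k+1}`, i.e. a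
homomorphism `f ↦ f ∘ φ` of `ℂ`-algebras `𝒪_{Y,y} → ℂ⟦x⟧` that induces such isomorphisms. -/
structure FormalCoord where
  base : Y
  hom : holGerms m base →+* FPS m
  hom_const : ∀ a : ℂ, hom (constGerm m base a) = MvPowerSeries.C a
  comap_pow : ∀ k : ℕ, Ideal.comap hom (maxIdeal m ^ (k + 1)) = germIdeal m base ^ (k + 1)
  surj_mod : ∀ (k : ℕ) (p : FPS m), ∃ f, hom f - p ∈ maxIdeal m ^ (k + 1)

variable {m Y}

/-- The power series `f ∘ φ` of a function `f` that is holomorphic near the base point. -/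
def FormalCoord.pull (φ : FormalCoord m Y) (f : Y → ℂ) : FPS m := by
  classical
  exact if h : (f : Filter.Germ (𝓝 φ.base) ℂ) ∈ holGerms m φ.base then φ.hom ⟨_, h⟩ else 0

/-- The coordinates on the space of formal coordinate systems given by the preferred chart `ψ` at
`y₀`: the coefficients of the power series `ψ_j ∘ φ`. -/
def FormalCoord.jetCoord (y₀ : Y) (φ : FormalCoord m Y) (i : Fin m × (Fin m →₀ ℕ)) : ℂ :=
  MvPowerSeries.coeff i.2 (φ.pull fun p => chartAt (Fin m → ℂ) y₀ p i.1)

/-- The components, in these coordinates, of the tangent vector `ω⁻¹(v)` at `[φ]`.  The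
connection form is `ω(X) = -(dφ)⁻¹ (d/dt φ_t)`, so that `ω⁻¹(v)` is the velocity of a path
`φ ∘ ρ_t` with `d/dt ρ_t = -v`, along which `f ∘ φ` changes at the rate `-v(f ∘ φ)`. -/
def FormalCoord.jetVelocity (y₀ : Y) (φ : FormalCoord m Y) (v : Fin m → FPS m)
    (i : Fin m × (Fin m →₀ ℕ)) : ℂ :=
  -MvPowerSeries.coeff i.2 (vecField v (φ.pull fun p => chartAt (Fin m → ℂ) y₀ p i.1))

/-- The formal coordinate systems whose base point lies in `O`. -/
def FormalCoord.over (O : Set Y) : Set (FormalCoord m Y) := {φ | φ.base ∈ O}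

/-- `f` is holomorphic near `[φ]`, and its derivative along `X = ω⁻¹(v)` is `d`. -/
def FormalCoord.HasLieDeriv (f : FormalCoord m Y → ℂ) (φ : FormalCoord m Y)
    (v : Fin m → FPS m) (d : ℂ) : Prop :=
  ∃ O : Set Y, IsOpen O ∧ O ⊆ (chartAt (Fin m → ℂ) φ.base).source ∧
    HasCoordDeriv (FormalCoord.over O) (FormalCoord.jetCoord φ.base) f φ
      (φ.jetVelocity φ.base v) d

/-- `f` is a holomorphic function on the space of formal coordinate systems. -/
def FormalCoord.IsHolomorphic (f : FormalCoord m Y → ℂ) : Prop :=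
  ∀ φ : FormalCoord m Y, ∃ O : Set Y, IsOpen O ∧ O ⊆ (chartAt (Fin m → ℂ) φ.base).source ∧
    ∃ S V h, IsCoordRep (FormalCoord.over O) (FormalCoord.jetCoord φ.base) f φ S V h

/-- The action of `Autₘ`.  An element `ρ` of `Autₘ` is given by the automorphism `g = ρ*` of
`ℂ⟦x⟧`, and it takes `[φ]` to `[φ ∘ ρ]`. -/
def FormalCoord.act (g : FPS m ≃ₐ[ℂ] FPS m) (φ : FormalCoord m Y) : FormalCoord m Y where
  base := φ.base
  hom := (g : FPS m →+* FPS m).comp φ.hom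
  hom_const a := by
    rw [RingHom.comp_apply, φ.hom_const]
    exact g.commutes a
  comap_pow k := by
    rw [← Ideal.comap_comap, comap_maxIdeal_pow, φ.comap_pow]
  surj_mod k p := by
    obtain ⟨f, hf⟩ := φ.surj_mod k (g.symm p)
    refine ⟨f, ?_⟩
    rw [← comap_maxIdeal_pow g] at hf
    simpa using hf

end Coor

/-! ### Flat sections of `Coor(U) × D̂` -/

section FlatD

variable {m : ℕ} {Y : Type*} [TopologicalSpace Y] [ChartedSpace (Fin m → ℂ) Y]

/-- `s : [φ] ↦ ∑_{α,β} f_{αβ}([φ]) x^β ∂^α` is a holomorphic section that is flat for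
`∇ = d + [ω, ·]`.  Here `F [φ] α` is the power series `∑_β f_{αβ}([φ]) x^β`. -/
structure IsFlatDSection (s : FormalCoord m Y → DHat m)
    (F : FormalCoord m Y → ((Fin m →₀ ℕ) →₀ FPS m)) : Prop where
  expansion : ∀ φ, (s φ : Module.End ℂ (FPS m)) = diffOp (F φ)
  holomorphic : ∀ α β, FormalCoord.IsHolomorphic fun φ => MvPowerSeries.coeff β (F φ α)
  flat : ∀ (φ : FormalCoord m Y) (v : Fin m → FPS m),
    ∃ dF : (Fin m →₀ ℕ) →₀ FPS m,
      (∀ α β, FormalCoord.HasLieDeriv (fun φ => MvPowerSeries.coeff β (F φ α)) φ v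
        (MvPowerSeries.coeff β (dF α))) ∧
      diffOp dF + ⁅vecField v, (s φ : Module.End ℂ (FPS m))⁆ = 0

/-- The `x^β ∂^α`-coefficient of `[ω₀ - v, ∑ S_{αβ} x^β ∂^α]`, where `ω₀` is the constant term of
the formal vector field `v = ∑ᵢ vᵢ ∂/∂xᵢ`:
`- ∑_i ∑_{μ ≠ 0} v_{i,μ} (β_i - μ_i + 1) S_{α, β - μ + ε_i}
 + ∑_{i, α ≥ ε_i} ∑_κ ∑_{γ ≠ 0} v_{i,κ+γ} binom(α + γ - ε_i, γ) (κ + γ)!/κ! S_{α+γ-ε_i, β-κ}`. -/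
def vecFieldTerm {m : ℕ} {M : Type*} [AddCommGroup M] [Module ℂ M]
    (S : (Fin m →₀ ℕ) → (Fin m →₀ ℕ) → M) (v : Fin m → FPS m) (α β : Fin m →₀ ℕ) : M :=
  -(∑ i, ∑ p ∈ Finset.HasAntidiagonal.antidiagonal (β + Finsupp.single i 1),
      if p.1 = 0 then 0 else (MvPowerSeries.coeff p.1 (v i) * (p.2 i : ℂ)) • S α p.2) +
  ∑ i, if α i = 0 then 0 else
    ∑ p ∈ Finset.HasAntidiagonal.antidiagonal β, ∑ᶠ (γ : Fin m →₀ ℕ) (_ : γ ≠ 0),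
      (MvPowerSeries.coeff (p.1 + γ) (v i) *
        ((∏ k, ((α + γ - Finsupp.single i 1 : Fin m →₀ ℕ) k).choose (γ k) : ℕ) : ℂ) *
        ((∏ k, ((p.1 + γ) k).descFactorial (γ k) : ℕ) : ℂ)) •
          S (α + γ - Finsupp.single i 1) p.2

/-- The matrix `(ξ₀^{r i})` of the constant terms of the formal vector fields `ξ¹, …, ξᵐ`. -/
def constMatrix {m : ℕ} (ξ : Fin m → Fin m → FPS m) : Matrix (Fin m) (Fin m) ℂ :=
  Matrix.of fun r i => MvPowerSeries.constantCoeff (ξ r i)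

end FlatD

/-! ### The algebra `D̂ₘ ⊗̂ Ĥ_{1,c}(ℂˡ, H)` -/

section Algebra

variable (m : ℕ) {l : ℕ} {H : Type*} [Group H] [Fintype H]
  (σ : H →* GL (Fin l) ℂ) (c : H → ℂ)

/-- The matrix of `h`. -/
def repMat (h : H) : Matrix (Fin l) (Fin l) ℂ := (σ h).1

/-- `s` acts on `ℂˡ` as a complex reflection (elements of finite order are semisimple). -/
def IsReflection (s : H) : Prop := (1 - repMat σ s).rank = 1

open Classical in
/-- The set `𝒮` of complex reflections in `H`. -/
def reflections : Finset H := Finset.univ.filter (IsReflection σ)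

/-- The nontrivial eigenvalue `λ_s` of a reflection `s` on the dual space `(ℂˡ)*`. -/
def reflEigenvalue (s : H) : ℂ := ((repMat σ s).det)⁻¹

open Classical in
/-- A coroot `α_s`: a nonzero linear form with kernel the reflecting hyperplane of `s`, namely a
nonzero row of `1 - s`.  All formulas below are independent of the scaling of `α_s`. -/
def coroot (s : H) : Fin l → ℂ :=
  if h : ∃ i, (1 - repMat σ s) i ≠ 0 then (1 - repMat σ s) h.choose else 0

/-- The coroot as a linear function of `y`. -/
def corootForm (s : H) : FPS2 m l :=
  ∑ k, coroot σ s k • (MvPowerSeries.X (Sum.inr k) : FPS2 m l)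

/-- The number `2 c(s) / (1 - λ_s)`. -/
def dunklConst (s : H) : ℂ := 2 * c s / (1 - reflEigenvalue σ s)

/-- The action of `H` on `ℂ⟦x, y⟧`: `(h f)(x, y) = f(x, h⁻¹ y)`. -/
def grpAct (h : H) (f : FPS2 m l) : FPS2 m l :=
  MvPowerSeries.subst (Sum.elim (fun i => (MvPowerSeries.X (Sum.inl i) : FPS2 m l))
    (fun j => ∑ k, repMat σ h⁻¹ j k • (MvPowerSeries.X (Sum.inr k) : FPS2 m l))) f

/-- Generators of the algebra: functions `f ∈ ℂ⟦x, y⟧`, the derivations `∂/∂xᵢ`, the basis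
vectors `u_j` of `ℂˡ`, and the group elements. -/
inductive Gen (m l : ℕ) (H : Type*)
  | fn (f : FPS2 m l)
  | dx (i : Fin m)
  | vec (j : Fin l)
  | grp (h : H)

/-- A generator as an element of the free algebra. -/
abbrev gen {m l : ℕ} {H : Type*} (a : Gen m l H) : FreeAlgebra ℂ (Gen m l H) := FreeAlgebra.ι ℂ a

/-- The defining relations.  The first group makes `ℂ⟦x, y⟧` a subalgebra, the second one says
that `H` acts by conjugation, the third one is that of the formal Weyl algebra, and the last ones
are those of the rational Cherednik algebra with parameters `1, c`, where
`[u, f] = ∂_u f - ∑_s 2 c(s)/(1 - λ_s) (u, α_s) (f - s f)/α_s · s`;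
for linear forms `f = y` this reads `[u, y] = (u, y) - ∑_s c(s) (u, α_s) (α_s^∨, y) s` with the
root `α_s^∨` normalized by `(α_s, α_s^∨) = 2`. -/
inductive Rel : FreeAlgebra ℂ (Gen m l H) → FreeAlgebra ℂ (Gen m l H) → Prop
  | fn_scalar (a : ℂ) : Rel (gen (.fn (MvPowerSeries.C a))) (algebraMap ℂ _ a)
  | fn_add (f g : FPS2 m l) : Rel (gen (.fn (f + g))) (gen (.fn f) + gen (.fn g))
  | fn_mul (f g : FPS2 m l) : Rel (gen (.fn (f * g))) (gen (.fn f) * gen (.fn g))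
  | grp_one : Rel (gen (.grp 1)) 1
  | grp_mul (h k : H) : Rel (gen (.grp (h * k))) (gen (.grp h) * gen (.grp k))
  | grp_fn (h : H) (f : FPS2 m l) :
      Rel (gen (.grp h) * gen (.fn f)) (gen (.fn (grpAct m σ h f)) * gen (.grp h))
  | grp_dx (h : H) (i : Fin m) : Rel (gen (.grp h) * gen (.dx i)) (gen (.dx i) * gen (.grp h))
  | grp_vec (h : H) (j : Fin l) :
      Rel (gen (.grp h) * gen (.vec j)) ((∑ k, repMat σ h k j • gen (.vec k)) * gen (.grp h))
  | dx_dx (i j : Fin m) : Rel (gen (.dx i) * gen (.dx j)) (gen (.dx j) * gen (.dx i))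
  | dx_vec (i : Fin m) (j : Fin l) :
      Rel (gen (.dx i) * gen (.vec j)) (gen (.vec j) * gen (.dx i))
  | dx_fn (i : Fin m) (f : FPS2 m l) :
      Rel (gen (.dx i) * gen (.fn f))
        (gen (.fn f) * gen (.dx i) + gen (.fn (MvPowerSeries.pderiv ℂ (Sum.inl i) f)))
  | vec_vec (i j : Fin l) : Rel (gen (.vec i) * gen (.vec j)) (gen (.vec j) * gen (.vec i))
  | vec_fn (j : Fin l) (f : FPS2 m l) (q : H → FPS2 m l)
      (hq : ∀ s ∈ reflections σ, corootForm m σ s * q s = f - grpAct m σ s f) :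
      Rel (gen (.vec j) * gen (.fn f))
        (gen (.fn f) * gen (.vec j) + gen (.fn (MvPowerSeries.pderiv ℂ (Sum.inr j) f)) -
          ∑ s ∈ reflections σ,
            (dunklConst σ c s * coroot σ s j) • (gen (.fn (q s)) * gen (.grp s)))

/-- The algebra `𝒜 = D̂ₘ ⊗̂ Ĥ_{1,c}(ℂˡ, H)`: the degree-wise completion (coefficients in
`ℂ⟦x, y⟧`, finite order in `∂` and `u`) of the tensor product of the Weyl algebra and the rational
Cherednik algebra. -/
abbrev HCAlg : Type _ := RingQuot (Rel m σ c)

/-- A generator as an element of `𝒜`. -/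
def el (a : Gen m l H) : HCAlg m σ c := RingQuot.mkAlgHom ℂ (Rel m σ c) (gen a)

/-- Index set of the expansions: multi-indices `α` and `J`, and `h ∈ H`. -/
abbrev Idx (m l : ℕ) (H : Type*) : Type _ := (Fin m →₀ ℕ) × (Fin l →₀ ℕ) × H

/-- The monomial `u^J h`. -/
def vecMonomial (J : Fin l →₀ ℕ) (h : H) : HCAlg m σ c :=
  (List.ofFn fun j => el m σ c (.vec j) ^ J j).prod * el m σ c (.grp h)

/-- The element `∑_{α,J,h} f_{αJh}(x, y) ∂^α u^J h` of a finitely supported family. -/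
def expand (a : Idx m l H →₀ FPS2 m l) : HCAlg m σ c :=
  a.sum fun i f => el m σ c (.fn f) * (List.ofFn fun k => el m σ c (.dx k) ^ i.1 k).prod *
    vecMonomial m σ c i.2.1 i.2.2

/-- The series in `y` that is the coefficient of `x^β` in `f(x, y)`. -/
def xCoeff {m : ℕ} (β : Fin m →₀ ℕ) (f : FPS2 m l) : MvPowerSeries (Fin l) ℂ :=
  fun I => MvPowerSeries.coeff (Finsupp.sumElim β I) f

open Classical in
/-- The coefficient `S_{αβ} = ∑_{I,J,h} F_{αβ}^{hIJ} y^I u^J h ∈ Ĥ_{1,c}(ℂˡ, H) ⊆ 𝒜` of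
`x^β ∂^α` in an expansion. -/
def xComponent (a : Idx m l H →₀ FPS2 m l) (α β : Fin m →₀ ℕ) : HCAlg m σ c :=
  a.sum fun i f => if i.1 = α then
    el m σ c (.fn (MvPowerSeries.rename Sum.inr (xCoeff β f))) *
      vecMonomial m σ c i.2.1 i.2.2 else 0

/-- A matrix of power series that commutes with `H`.  These matrices form `𝔷 ⊗ ℂ⟦x⟧`, where `𝔷`
is the Lie algebra of the centralizer `Z` of `H` in `GL(l, ℂ)`. -/
def CommutesWith {m : ℕ} (B : Matrix (Fin l) (Fin l) (FPS m)) : Prop :=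
  ∀ h : H, B * (repMat σ h).map (MvPowerSeries.C (σ := Fin m)) =
    (repMat σ h).map (MvPowerSeries.C (σ := Fin m)) * B

/-- The scalar `λ_{B,s}` with `B · α_s = λ_{B,s} α_s`.  An element `B` of `𝔷` acts on linear forms
by `α ↦ -α B` and on the line `Im(1 - s)` by `-λ_{B,s}`, so that
`tr ((1 - s) B) = -λ_{B,s} tr (1 - s)`. -/
def corootScalar {m : ℕ} (B : Matrix (Fin l) (Fin l) (FPS m)) (s : H) : FPS m :=
  -((1 - repMat σ s).trace)⁻¹ •
    ((1 - repMat σ s).map (MvPowerSeries.C (σ := Fin m)) * B).trace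

/-- The `ℂ⟦x⟧`-linear extension of the Lie algebra embedding `φ_c : 𝔷 → Ĥ_{1,c}(ℂˡ, H)`,
`A ↦ -∑ A_{ij} y_j u_i + ∑_s 2 c(s)/(1 - λ_s) λ_{A,s} (1 - s)`. -/
def phiC {m : ℕ} (B : Matrix (Fin l) (Fin l) (FPS m)) : HCAlg m σ c :=
  -(∑ i, ∑ j, el m σ c (.fn (inX l (B i j) * MvPowerSeries.X (Sum.inr j))) *
      el m σ c (.vec i)) +
  ∑ s ∈ reflections σ, dunklConst σ c s •
    (el m σ c (.fn (inX l (corootScalar σ B s))) * (1 - el m σ c (.grp s)))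

/-- The Lie algebra embedding `Φ_c : Wₘ ⋉ 𝔷 ⊗ ℂ⟦x⟧ → 𝒜`. -/
def PhiC {m : ℕ} (v : Fin m → FPS m) (B : Matrix (Fin l) (Fin l) (FPS m)) : HCAlg m σ c :=
  ∑ i, el m σ c (.fn (inX l (v i))) * el m σ c (.dx i) + phiC σ c B

/-- The coefficient `A_μ ∈ 𝔷` of `x^μ` in a matrix `A ∈ 𝔷 ⊗ ℂ⟦x⟧`, as a constant matrix. -/
def matCoeff {m : ℕ} (B : Matrix (Fin l) (Fin l) (FPS m)) (μ : Fin m →₀ ℕ) :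
    Matrix (Fin l) (Fin l) (FPS m) :=
  B.map fun p => MvPowerSeries.C (MvPowerSeries.coeff μ p)

/-- The `x^β ∂^α`-coefficient of `-[φ_c(A), ∑ S_{αβ} x^β ∂^α]`, where `A = ∑_μ x^μ A_μ`:
`- ∑_κ [φ_c(A_κ), S_{α, β-κ}]
 + ∑_κ ∑_{γ ≠ 0} binom(α + γ, γ) (κ + γ)!/κ! S_{α+γ, β-κ} φ_c(A_{κ+γ})`. -/
def matrixTerm {m : ℕ} (S : (Fin m →₀ ℕ) → (Fin m →₀ ℕ) → HCAlg m σ c)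
    (B : Matrix (Fin l) (Fin l) (FPS m)) (α β : Fin m →₀ ℕ) : HCAlg m σ c :=
  -(∑ p ∈ Finset.HasAntidiagonal.antidiagonal β, ⁅phiC σ c (matCoeff B p.1), S α p.2⁆) +
  ∑ p ∈ Finset.HasAntidiagonal.antidiagonal β, ∑ᶠ (γ : Fin m →₀ ℕ) (_ : γ ≠ 0),
    (((∏ k, ((α + γ : Fin m →₀ ℕ) k).choose (γ k) : ℕ) : ℂ) *
      ((∏ k, ((p.1 + γ) k).descFactorial (γ k) : ℕ) : ℂ)) •
        (S (α + γ) p.2 * phiC σ c (matCoeff B (p.1 + γ)))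

/-- The group `Z(ℂ⟦x⟧)` of invertible matrices of power series that commute with `H`. -/
def ZGroup : Subgroup (GL (Fin l) (FPS m)) where
  carrier := {b | CommutesWith σ b.1}
  one_mem' := fun h => by simp
  mul_mem' := by
    intro a b ha hb h
    change a.1 * b.1 * _ = _ * (a.1 * b.1)
    rw [mul_assoc, hb h, ← mul_assoc, ha h, mul_assoc]
  inv_mem' := by
    intro a ha h
    change CommutesWith σ a.1 at ha
    calc a.inv * (repMat σ h).map (MvPowerSeries.C (σ := Fin m))
        = a.inv * ((repMat σ h).map (MvPowerSeries.C (σ := Fin m)) * a.1) * a.inv := by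
          rw [mul_assoc, mul_assoc, a.val_inv, mul_one]
      _ = (repMat σ h).map (MvPowerSeries.C (σ := Fin m)) * a.inv := by
          rw [← ha h, ← mul_assoc, a.inv_val, one_mul]

/-- The pullback `ρ* f (x, y) = f(ρ₀(x), b(x) y)` by the formal automorphism
`ρ(x, y) = (ρ₀(x), b(x) y)`, where `g = ρ₀*`. -/
def pullback {m : ℕ} (g : FPS m ≃ₐ[ℂ] FPS m) (b : GL (Fin l) (FPS m)) (f : FPS2 m l) :
    FPS2 m l :=
  MvPowerSeries.subst (Sum.elim (fun i => inX l (g (MvPowerSeries.X i)))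
    (fun j => ∑ k, inX l (b.1 j k) * MvPowerSeries.X (Sum.inr k))) f

/-- `τ` is the action `D ↦ ρ* ∘ D ∘ (ρ*)⁻¹` of `ρ(x, y) = (ρ₀(x), b(x) y)` on `𝒜`, given by its
values on the generators: `f ↦ ρ* f`, `h ↦ h`, `u ↦ b⁻¹ u`, and `∂/∂x_j` goes to the vector field
`∑_k ((Dρ₀)⁻¹)_{kj} (∂/∂x_k - (b⁻¹ ∂_k b y) · ∂/∂y)`, where, as under the Dunkl embedding, the
vector field `-(B y) · ∂/∂y` corresponds to `φ_c(B)`. -/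
structure IsConjAction {m : ℕ} (g : FPS m ≃ₐ[ℂ] FPS m) (b : GL (Fin l) (FPS m))
    (τ : HCAlg m σ c ≃ₐ[ℂ] HCAlg m σ c) : Prop where
  map_fn : ∀ f, τ (el m σ c (.fn f)) = el m σ c (.fn (pullback g b f))
  map_grp : ∀ h, τ (el m σ c (.grp h)) = el m σ c (.grp h)
  map_vec : ∀ j, τ (el m σ c (.vec j)) =
    ∑ k, el m σ c (.fn (inX l ((b⁻¹).1 k j))) * el m σ c (.vec k)
  map_dx : ∀ j, τ (el m σ c (.dx j)) =
    ∑ k, el m σ c (.fn (inX l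
        (((Matrix.of fun i k => MvPowerSeries.pderiv ℂ k (g (MvPowerSeries.X i)))⁻¹ :
          Matrix (Fin m) (Fin m) (FPS m)) k j))) *
      (el m σ c (.dx k) +
        phiC σ c ((b⁻¹).1 * b.1.map fun p => MvPowerSeries.pderiv ℂ k p))

end Algebra

/-! ### Strata and the formal coordinate bundle of their normal bundle -/

section Normal

variable {m l : ℕ} {X Y G : Type*} [TopologicalSpace X] [ChartedSpace (Fin (m + l) → ℂ) X]
  [IsManifold 𝓘(ℂ, Fin (m + l) → ℂ) ω X] [Group G] [MulAction G X]
  [TopologicalSpace Y] [ChartedSpace (Fin m → ℂ) Y]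
  (H : Subgroup G) [Fintype H] (σ : H →* GL (Fin l) ℂ) (ι : Y → X)

/-- The isotropy type `X_H`: the points with stabilizer `H`. -/
def isotropyType (X : Type*) [MulAction G X] (H : Subgroup G) : Set X :=
  {x | MulAction.stabilizer G x = H}

/-- The differential at `x` of the action of `g`.  It is the isotropy representation when `g`
fixes `x`. -/
def isotropyMap (m l : ℕ) {X G : Type*} [TopologicalSpace X]
    [ChartedSpace (Fin (m + l) → ℂ) X] [Group G] [MulAction G X] (g : G) (x : X) :
    (Fin (m + l) → ℂ) →L[ℂ] (Fin (m + l) → ℂ) :=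
  mfderiv 𝓘(ℂ, Fin (m + l) → ℂ) 𝓘(ℂ, Fin (m + l) → ℂ) (fun z : X => g • z) x

/-- The fibre of the normal bundle: the `H`-invariant complement, i.e. the kernel of the averaging
operator over `H`, of the fixed subspace of the tangent space at `x`. -/
def normalSpace (m l : ℕ) {X G : Type*} [TopologicalSpace X]
    [ChartedSpace (Fin (m + l) → ℂ) X] [Group G] [MulAction G X] (H : Subgroup G) [Fintype H]
    (x : X) : Submodule ℂ (Fin (m + l) → ℂ) :=
  LinearMap.ker (∑ h : H, (isotropyMap m l (h : G) x).toLinearMap)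

variable (m l) in
/-- `ι` identifies the `m`-dimensional complex manifold `Y` with an open subset of a connected
component `X_H^i` of the isotropy type `X_H` (for instance with all of it). -/
structure IsStratumPiece : Prop where
  holomorphic : MDifferentiable 𝓘(ℂ, Fin m → ℂ) 𝓘(ℂ, Fin (m + l) → ℂ) ι
  immersion : ∀ y, Function.Injective
    (mfderiv 𝓘(ℂ, Fin m → ℂ) 𝓘(ℂ, Fin (m + l) → ℂ) ι y)
  embedding : Topology.IsEmbedding ι
  range_eq : ∃ x₀ ∈ isotropyType X H, ∃ O : Set X, IsOpen O ∧
    Set.range ι = O ∩ connectedComponentIn (isotropyType X H) x₀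

variable (m) in
/-- `σ` is equivalent to the slice representation of `H` (at some point, hence at all of them). -/
def IsSliceRep : Prop :=
  ∃ (y : Y) (e : (Fin l → ℂ) ≃ₗ[ℂ] normalSpace m l H (ι y)), ∀ (h : H) (w : Fin l → ℂ),
    isotropyMap m l (h : G) (ι y) (e w) = e ((repMat σ h).mulVec w)

/-- The local expression, in the preferred chart of `TX` at `ι y`, of a section `a` of the bundle
`ι* TX`. -/
def localExpr (y : Y) (a : Y → (Fin (m + l) → ℂ)) (p : Y) : Fin (m + l) → ℂ :=
  (trivializationAt (Fin (m + l) → ℂ) (TangentSpace 𝓘(ℂ, Fin (m + l) → ℂ)) (ι y)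
    ).continuousLinearMapAt ℂ (ι p) (a p)

/-- The `𝒪_{Y,y}`-module `𝒩_y` of germs at `y` of holomorphic sections of the normal bundle. -/
def normalGerms (y : Y) :
    Submodule (holGerms m y) (Filter.Germ (𝓝 y) (Fin (m + l) → ℂ)) where
  carrier := {g | ∃ a : Y → (Fin (m + l) → ℂ),
    (a : Filter.Germ (𝓝 y) (Fin (m + l) → ℂ)) = g ∧
    (∀ᶠ p in 𝓝 y, a p ∈ normalSpace m l H (ι p)) ∧
    ∀ᶠ p in 𝓝 y, MDifferentiableAt 𝓘(ℂ, Fin m → ℂ) 𝓘(ℂ, Fin (m + l) → ℂ) (localExpr ι y a) p}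
  zero_mem' := ⟨0, rfl, .of_forall fun _ => Submodule.zero_mem _, .of_forall fun _ => by
    have : localExpr ι y (0 : Y → (Fin (m + l) → ℂ)) = fun _ => 0 := by
      funext p; exact map_zero _
    rw [this]; exact mdifferentiableAt_const⟩
  add_mem' := by
    rintro _ _ ⟨a, rfl, ha, ha'⟩ ⟨b, rfl, hb, hb'⟩
    refine ⟨a + b, rfl, ?_, ?_⟩
    · filter_upwards [ha, hb] with p h1 h2 using Submodule.add_mem _ h1 h2
    · have : localExpr ι y (a + b) = localExpr ι y a + localExpr ι y b := by
        funext p; exact map_add _ _ _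
      rw [this]
      filter_upwards [ha', hb'] with p h1 h2 using h1.add h2
  smul_mem' := by
    rintro ⟨_, f, rfl, hf⟩ _ ⟨a, rfl, ha, ha'⟩
    refine ⟨fun p => f p • a p, rfl, ?_, ?_⟩
    · filter_upwards [ha] with p h1 using Submodule.smul_mem _ _ h1
    · have : localExpr ι y (fun p => f p • a p) = fun p => f p • localExpr ι y a p := by
        funext p; exact map_smul _ _ _
      rw [this]
      filter_upwards [hf, ha'] with p h1 h2 using h1.smul h2

/-- The germ `n'` is the image of the germ `n` under the fibrewise action of `h ∈ H` on the normal
bundle. -/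
def IsTranslate (h : H) {y : Y} (n n' : Filter.Germ (𝓝 y) (Fin (m + l) → ℂ)) : Prop :=
  ∃ a a' : Y → (Fin (m + l) → ℂ), (a : Filter.Germ (𝓝 y) (Fin (m + l) → ℂ)) = n ∧
    (a' : Filter.Germ (𝓝 y) (Fin (m + l) → ℂ)) = n' ∧
    ∀ᶠ p in 𝓝 y, a' p = isotropyMap m l (h : G) (ι p) (a p)

variable (m) in
/-- A point of `Coor(𝒩)`, i.e. the infinite jet `[φ]` of a local parametrization
`φ(x, y) = (φ₀(x), B(x) y)` of the normal bundle that is compatible with its structure group `Z`: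
a formal coordinate system on `Y` together with an `H`-equivariant isomorphism
`ℂ⟦x⟧ ⊗ 𝒩_y ≅ ℂ⟦x⟧^l`, given by the semilinear map `frame : n ↦ B⁻¹ (n ∘ φ₀)`.  As both modules
are free of rank `l`, its linear extension is an isomorphism when it is surjective. -/
structure NormalCoord extends FormalCoord m Y where
  frame : normalGerms (m := m) (l := l) H ι base →ₛₗ[hom] (Fin l → FPS m)
  frame_span : Submodule.span (FPS m) (Set.range frame) = ⊤
  frame_equivariant : ∀ (h : H) (n n' : normalGerms (m := m) (l := l) H ι base),
    IsTranslate (m := m) (l := l) H ι h n.1 n'.1 →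
      frame n' = ((repMat σ h).map (MvPowerSeries.C (σ := Fin m))).mulVec (frame n)

variable {H σ ι}

/-- The column `B⁻¹ (a ∘ φ₀)` of a section `a` of the normal bundle that is holomorphic near the
base point. -/
def NormalCoord.pullSection (φ : NormalCoord m H σ ι) (a : Y → (Fin (m + l) → ℂ)) :
    Fin l → FPS m := by
  classical
  exact if h : (a : Filter.Germ (𝓝 φ.base) (Fin (m + l) → ℂ)) ∈ normalGerms H ι φ.base
    then φ.frame ⟨_, h⟩ else 0

variable (m H σ ι) in
/-- `e` is a holomorphic frame over `O` of the normal bundle in which `H` acts by `σ`. -/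
def IsLocalFrame (O : Set Y) (e : Fin l → Y → (Fin (m + l) → ℂ)) : Prop :=
  ∀ p ∈ O, (∀ j, (e j : Filter.Germ (𝓝 p) (Fin (m + l) → ℂ)) ∈ normalGerms H ι p) ∧
    LinearIndependent ℂ (fun j => e j p) ∧
    ∀ (h : H) (j : Fin l),
      isotropyMap m l (h : G) (ι p) (e j p) = ∑ i, repMat σ h i j • e i p

/-- Index set of the jet coordinates on `Coor(𝒩)`. -/
abbrev NIdx (m l : ℕ) : Type :=
  (Fin m × (Fin m →₀ ℕ)) ⊕ ((Fin l × Fin l) × (Fin m →₀ ℕ))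

/-- The coordinates on `Coor(𝒩)` given by the preferred chart `ψ` at `y₀` and a local frame `e`:
the coefficients of `ψ_j ∘ φ₀` and of the matrix with columns `B⁻¹ (e_j ∘ φ₀)`. -/
def NormalCoord.jetCoord (y₀ : Y) (e : Fin l → Y → (Fin (m + l) → ℂ)) (φ : NormalCoord m H σ ι) :
    NIdx m l → ℂ
  | .inl i => φ.toFormalCoord.jetCoord y₀ i
  | .inr i => MvPowerSeries.coeff i.2 (φ.pullSection (e i.1.2) i.1.1)

/-- The components, in these coordinates, of the tangent vector `ω⁻¹(v + A)` at `[φ]`, where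
`v + A ∈ Wₘ ⋉ 𝔷 ⊗ ℂ⟦x⟧` acts on columns of power series by `n ↦ v(n) + A n`. -/
def NormalCoord.jetVelocity (y₀ : Y) (e : Fin l → Y → (Fin (m + l) → ℂ)) (φ : NormalCoord m H σ ι)
    (v : Fin m → FPS m) (A : Matrix (Fin l) (Fin l) (FPS m)) : NIdx m l → ℂ
  | .inl i => φ.toFormalCoord.jetVelocity y₀ v i
  | .inr i => -MvPowerSeries.coeff i.2
      (vecField v (φ.pullSection (e i.1.2) i.1.1) + A.mulVec (φ.pullSection (e i.1.2)) i.1.1)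

/-- The points of `Coor(𝒩)` whose base point lies in `O`. -/
def NormalCoord.over (O : Set Y) : Set (NormalCoord m H σ ι) := {φ | φ.base ∈ O}

/-- `f` is holomorphic near `[φ]`, and its derivative along `X = ω⁻¹(v + A)` is `d`. -/
def NormalCoord.HasLieDeriv (f : NormalCoord m H σ ι → ℂ) (φ : NormalCoord m H σ ι)
    (v : Fin m → FPS m) (A : Matrix (Fin l) (Fin l) (FPS m)) (d : ℂ) : Prop :=
  ∃ (O : Set Y) (e : Fin l → Y → (Fin (m + l) → ℂ)), IsOpen O ∧
    O ⊆ (chartAt (Fin m → ℂ) φ.base).source ∧ IsLocalFrame m H σ ι O e ∧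
    HasCoordDeriv (NormalCoord.over O) (NormalCoord.jetCoord φ.base e) f φ
      (φ.jetVelocity φ.base e v A) d

/-- `f` is a holomorphic function on `Coor(𝒩)`. -/
def NormalCoord.IsHolomorphic (f : NormalCoord m H σ ι → ℂ) : Prop :=
  ∀ φ : NormalCoord m H σ ι, ∃ (O : Set Y) (e : Fin l → Y → (Fin (m + l) → ℂ)), IsOpen O ∧
    O ⊆ (chartAt (Fin m → ℂ) φ.base).source ∧ IsLocalFrame m H σ ι O e ∧
    ∃ S V h, IsCoordRep (NormalCoord.over O) (NormalCoord.jetCoord φ.base e) f φ S V h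

/-- The frame `n ↦ b⁻¹ · (B⁻¹ (n ∘ φ₀)) ∘ ρ₀` of `[φ ∘ ρ]`. -/
def NormalCoord.actFrame (g : FPS m ≃ₐ[ℂ] FPS m) (b : ZGroup m σ) (φ : NormalCoord m H σ ι) :
    normalGerms (m := m) (l := l) H ι φ.base →ₛₗ[(g : FPS m →+* FPS m).comp φ.hom]
      (Fin l → FPS m) where
  toFun n := ((b⁻¹ : ZGroup m σ) : GL (Fin l) (FPS m)).1.mulVec (fun i => g (φ.frame n i))
  map_add' n n' := by
    rw [← Matrix.mulVec_add]
    congr 1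
    funext i
    simp
  map_smul' f n := by
    rw [← Matrix.mulVec_smul]
    congr 1
    funext i
    simp [map_smulₛₗ]

/-- The action of `Autₘ ⋉ Z(ℂ⟦x⟧)` on `Coor(𝒩)`: the formal automorphism
`ρ(x, y) = (ρ₀(x), b(x) y)`, with `g = ρ₀*`, takes `[φ]` to `[φ ∘ ρ]`. -/
def NormalCoord.act (g : FPS m ≃ₐ[ℂ] FPS m) (b : ZGroup m σ) (φ : NormalCoord m H σ ι) :
    NormalCoord m H σ ι where
  toFormalCoord := φ.toFormalCoord.act g
  frame := φ.actFrame g b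
  frame_span := by
    have hbb : ((b : GL (Fin l) (FPS m))).1 * ((b⁻¹ : ZGroup m σ) : GL (Fin l) (FPS m)).1 = 1 := by
      rw [Subgroup.coe_inv]; exact (b : GL (Fin l) (FPS m)).mul_inv
    have hbb' : ((b⁻¹ : ZGroup m σ) : GL (Fin l) (FPS m)).1 * ((b : GL (Fin l) (FPS m))).1 = 1 := by
      rw [Subgroup.coe_inv]; exact (b : GL (Fin l) (FPS m)).inv_mul
    rw [eq_top_iff]
    intro p _
    have key : ∀ q ∈ Submodule.span (FPS m) (Set.range φ.frame),
        ((b⁻¹ : ZGroup m σ) : GL (Fin l) (FPS m)).1.mulVec (fun i => g (q i)) ∈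
          Submodule.span (FPS m) (Set.range fun n =>
            ((b⁻¹ : ZGroup m σ) : GL (Fin l) (FPS m)).1.mulVec (fun i => g (φ.frame n i))) := by
      intro q hq
      induction hq using Submodule.span_induction with
      | mem q hq =>
        obtain ⟨n, rfl⟩ := hq
        exact Submodule.subset_span ⟨n, rfl⟩
      | zero =>
        have : (fun i : Fin l => g ((0 : Fin l → FPS m) i)) = 0 := by
          funext i; exact map_zero g
        rw [this, Matrix.mulVec_zero]
        exact Submodule.zero_mem _
      | add q r _ _ hq hr =>
        have : (fun i : Fin l => g ((q + r) i)) = (fun i => g (q i)) + fun i => g (r i) := by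
          funext i; exact map_add g _ _
        rw [this, Matrix.mulVec_add]
        exact Submodule.add_mem _ hq hr
      | smul a q _ hq =>
        have : (fun i : Fin l => g ((a • q) i)) = g a • fun i => g (q i) := by
          funext i; exact map_mul g _ _
        rw [this, Matrix.mulVec_smul]
        exact Submodule.smul_mem _ _ hq
    have h1 := key (fun i => g.symm ((b : GL (Fin l) (FPS m)).1.mulVec p i))
      (by rw [φ.frame_span]; trivial)
    simp only [AlgEquiv.apply_symm_apply] at h1
    have h2 : ((b⁻¹ : ZGroup m σ) : GL (Fin l) (FPS m)).1.mulVec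
        (fun i => (b : GL (Fin l) (FPS m)).1.mulVec p i) = p := by
      change ((b⁻¹ : ZGroup m σ) : GL (Fin l) (FPS m)).1.mulVec
        ((b : GL (Fin l) (FPS m)).1.mulVec p) = p
      rw [Matrix.mulVec_mulVec, hbb', Matrix.one_mulVec]
    rw [h2] at h1
    exact h1
  frame_equivariant := by
    intro h n n' hn
    have h1 := φ.frame_equivariant h n n' hn
    change ((b⁻¹ : ZGroup m σ) : GL (Fin l) (FPS m)).1.mulVec (fun i => g (φ.frame n' i)) =
      ((repMat σ h).map (MvPowerSeries.C (σ := Fin m))).mulVec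
        (((b⁻¹ : ZGroup m σ) : GL (Fin l) (FPS m)).1.mulVec (fun i => g (φ.frame n i)))
    have h2 : (fun i => g (φ.frame n' i)) =
        ((repMat σ h).map (MvPowerSeries.C (σ := Fin m))).mulVec (fun i => g (φ.frame n i)) := by
      funext i
      rw [h1]
      simp only [Matrix.mulVec, dotProduct, map_sum, map_mul, Matrix.map_apply]
      refine Finset.sum_congr rfl fun k _ => ?_
      congr 1
      exact g.commutes _
    rw [h2, Matrix.mulVec_mulVec, Matrix.mulVec_mulVec, (b⁻¹).2 h]

/-! ### Flat sections of `Coor(𝒩) × 𝒜` -/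

/-- `s : [φ] ↦ ∑_{α,β} ∑_{I,J,h} F_{αβ}^{hIJ}([φ]) x^β ∂^α ⊗ y^I u^J h` is a holomorphic section
that is flat for `∇ = d + [Φ_c ∘ ω, ·]`.  Here `F [φ] (α, J, h)` is the power series
`∑_{β,I} F_{αβ}^{hIJ}([φ]) x^β y^I`. -/
structure IsFlatSection (c : H → ℂ) (s : NormalCoord m H σ ι → HCAlg m σ c)
    (F : NormalCoord m H σ ι → (Idx m l H →₀ FPS2 m l)) : Prop where
  expansion : ∀ φ, s φ = expand m σ c (F φ)
  holomorphic : ∀ i d, NormalCoord.IsHolomorphic fun φ => MvPowerSeries.coeff d (F φ i)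
  flat : ∀ (φ : NormalCoord m H σ ι) (v : Fin m → FPS m) (A : Matrix (Fin l) (Fin l) (FPS m)),
    CommutesWith σ A → ∃ dF : Idx m l H →₀ FPS2 m l,
      (∀ i d, NormalCoord.HasLieDeriv (fun φ => MvPowerSeries.coeff d (F φ i)) φ v A
        (MvPowerSeries.coeff d (dF i))) ∧
      expand m σ c dF + ⁅PhiC σ c v A, s φ⁆ = 0

end Normal

end FormalGeometry
end

/-!
Everything rests on the Poincaré–Birkhoff–Witt theorem for `𝒜` (`coefs`): the algebra acts on
`ℂ⟦x, y⟧ ⊗ ℂ[∂, u] ⊗ ℂ[H]` by Dunkl operators, which commute (`vVec_comm`), and applying an element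
to the cyclic vector reads off its coefficients. So a flat section may be treated through
its coefficients, and an element of `𝒜` that depends on a complex parameter may be differentiated
coefficientwise. The other algebraic input is that `φ_c` is a homomorphism of Lie algebras
commuting with `H`, that `[φ_c(A), f]` and `[φ_c(A), u]` are given by the natural action of `𝔷`,
and that `[∂_k, φ_c(A)] = φ_c(∂_k A)`; the sum over reflections in `φ_c` is what makes this true
for `u`.

**Equivariance.** A formal automorphism `ρ` is joined to the identity by an affine linear path
`ρ_t` over the complement of a finite set in `ℂ` (`exists_autPath`). The prescribed images under
`ρ_t` of any word in the generators solve `w' = -[Φ_c(ω(ρ̇_t)), w]` (`AutPath.flat_gen`). A solution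
that vanishes at one parameter vanishes identically (`AutPath.Flat.eq_zero`): by the equation all
derivatives of its coefficients vanish there, and the coefficients are holomorphic on a connected
domain. Hence the relations of `𝒜`, which hold at the identity, hold at `ρ`, and the action of `ρ`
exists; it is injective by the same uniqueness statement (`autAlg`, `isConjAction_autAlg`). A flat
section along the orbit `[φ ∘ ρ_t]` solves the same equation as the transported value
`ρ_t* ∘ s([φ]) ∘ (ρ_t*)⁻¹`, so the two agree (`IsFlatSection.equivariant`). That the section is
a finite sum of terms uniformly in `t` follows from holomorphy, because countably many discrete sets
do not cover the domain (`exists_uniform_support`).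

**Uniqueness and recursion.** The derivative of a flat section along `ω⁻¹(∂_j)` is `-∂/∂x_j` on
coefficients (`flat_single`), so the coefficients of order zero in `x` determine the others. The
recursion is the component of `x^β ∂^α` in the flatness equation, computed by the Leibniz rule
(`comp_lie_vecField`, `comp_lie_phi`) and solved for the terms with the constant parts of the
vector fields by means of `V⁻¹` (`xComponent_recursion`). Both need that a derivative along a
tangent vector is independent of the chart, the frame and the finitely many coordinates in which it
is computed (`NormalCoord.HasLieDeriv.unique`). To see this, every `ω⁻¹(v + A)` is realized as the
velocity of a path, composed of a translation in a chart and a path of formal automorphisms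
(`FormalCoord.exists_splitting`).

**Formal differential operators.** `D̂ₙ` is the algebra `𝒜` for `l = 0` and the trivial group, and acts
faithfully on power series, as is seen on exponential series (`diffOp_injective`); this reduces
the statements about `Coor(U) × D̂ₙ` to the same algebraic facts.
-/

noncomputable section

namespace FormalGeometry

open Finset (sum_congr sum_mul mul_sum sum_comm sum_add_distrib sum_neg_distrib smul_sum sum_eq_single sum_sub_distrib sum_eq_zero sum_smul sum_insert sum_const_zero prod_congr)
open Finsupp (single sumElim single_eq_of_ne tsub_apply sumElim_inl sumElim_inr)
open Matrix (mul_apply map_apply one_apply of_apply mulVec_mulVec one_mulVec one_apply_ne)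
open LinearMap (mulLeft mulLeft_apply mulRight_apply)
open MvPolynomial (aeval aeval_X)
open Filter (Germ)
open Submodule (subset_span span_induction smul_mem)
open MvPowerSeries

variable {m l : ℕ} {H : Type*} [Group H] [Fintype H] {σ : H →* GL (Fin l) ℂ} {c : H → ℂ}

local notation "𝕄" => Matrix (Fin l) (Fin l) (FPS m)
local notation "chart" => chartAt (Fin m → ℂ)

set_option linter.unusedSectionVars false

/-! ### Formal power series: order, substitution and the chain rule -/

section Series

variable {σ τ : Type*}

lemma le_order_iff_coeff {f : MvPowerSeries σ ℂ} {N : ℕ} :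
    (N : ℕ∞) ≤ f.order ↔ ∀ d : σ →₀ ℕ, d.degree < N → coeff d f = 0 :=
  ⟨fun h _ hd => coeff_of_lt_order (lt_of_lt_of_le (by exact_mod_cast hd) h),
    fun h => nat_le_order h⟩

lemma le_order_add' {f g : MvPowerSeries σ ℂ} {N : ℕ∞} (hf : N ≤ f.order) (hg : N ≤ g.order) :
    N ≤ (f + g).order := (le_min hf hg).trans min_order_le_add

lemma le_order_sub' {f g : MvPowerSeries σ ℂ} {N : ℕ∞} (hf : N ≤ f.order) (hg : N ≤ g.order) :
    N ≤ (f - g).order := by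
  rw [sub_eq_add_neg]; exact le_order_add' hf (by rwa [order_neg])

lemma le_order_sum' {ι : Type*} {s : Finset ι} {f : ι → MvPowerSeries σ ℂ} {N : ℕ∞}
    (hf : ∀ i ∈ s, N ≤ (f i).order) : N ≤ (∑ i ∈ s, f i).order := by
  classical
  induction s using Finset.induction_on with
  | empty => simp
  | insert i s hi ih =>
    rw [sum_insert hi]
    exact le_order_add' (hf _ (by simp)) (ih fun j hj => hf j (by simp [hj]))

lemma le_order_mul_of_le {f g : MvPowerSeries σ ℂ} {M N : ℕ∞} (hf : M ≤ f.order)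
    (hg : N ≤ g.order) : M + N ≤ (f * g).order := (add_le_add hf hg).trans le_order_mul

lemma eq_zero_of_forall_le_order {f : MvPowerSeries σ ℂ} (h : ∀ N : ℕ, (N : ℕ∞) ≤ f.order) :
    f = 0 := by
  ext d
  exact le_order_iff_coeff.1 (h (d.degree + 1)) d (Nat.lt_succ_self _)

lemma one_le_order_iff {f : MvPowerSeries σ ℂ} :
    ((1 : ℕ) : ℕ∞) ≤ f.order ↔ constantCoeff f = 0 := by
  rw [← one_le_order_iff_constCoeff_eq_zero]; simp

lemma le_order_iff_truncTotal [Finite σ] {f : MvPowerSeries σ ℂ} {N : ℕ} :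
    (N : ℕ∞) ≤ f.order ↔ truncTotal N f = 0 := by
  rw [le_order_iff_coeff]
  constructor
  · intro h
    ext d
    by_cases hd : d.degree < N
    · rw [coeff_truncTotal f hd, h d hd]; simp
    · rw [coeff_truncTotal_eq_zero f (not_lt.1 hd)]; simp
  · intro h d hd
    rw [← coeff_truncTotal f hd, h]; simp

lemma le_order_sub_truncTotal [Finite σ] (f : MvPowerSeries σ ℂ) (N : ℕ) :
    (N : ℕ∞) ≤ (f - (truncTotal N f : MvPolynomial σ ℂ)).order := by
  rw [le_order_iff_coeff]
  intro d hd
  rw [map_sub, MvPolynomial.coeff_coe, coeff_truncTotal f hd, sub_self]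

/-- A series without constant term is a combination of the variables, with coefficients of the
expected order. -/
lemma exists_eq_sum_X_mul [Fintype σ] (f : MvPowerSeries σ ℂ) (hf : constantCoeff f = 0) :
    ∃ q : σ → MvPowerSeries σ ℂ, f = ∑ i, X i * q i ∧
      ∀ N : ℕ, ((N + 1 : ℕ) : ℕ∞) ≤ f.order → ∀ i, (N : ℕ∞) ≤ (q i).order := by
  classical
  have hch : ∀ d : σ →₀ ℕ, d ≠ 0 → ∃ i, d i ≠ 0 := fun d hd => Finsupp.ne_iff.1 hd
  let P : (σ →₀ ℕ) → σ → Prop := fun d i => ∃ h : d ≠ 0, (hch d h).choose = i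
  let q : σ → MvPowerSeries σ ℂ := fun i d => if P (d + single i 1) i
    then coeff (d + single i 1) f else 0
  have hq : ∀ i d, coeff d (q i) = if P (d + single i 1) i
    then coeff (d + single i 1) f else 0 := fun i d => rfl
  refine ⟨q, ?_, ?_⟩
  · ext d
    rw [map_sum]
    have key : ∀ i, coeff d (X i * q i) = if P d i then coeff d f else 0 := by
      intro i
      rw [X_def, coeff_monomial_mul, one_mul]
      by_cases hi : single i 1 ≤ d
      · rw [if_pos hi, hq, tsub_add_cancel_of_le hi]
      · rw [if_neg hi, if_neg]
        rintro ⟨h, rfl⟩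
        apply hi
        have := (hch d h).choose_spec
        intro j
        by_cases hj : (hch d h).choose = j
        · subst hj; simp; omega
        · rw [single_eq_of_ne (Ne.symm hj)]; exact Nat.zero_le _
    rw [sum_congr rfl fun i _ => key i]
    by_cases hd : d = 0
    · subst hd
      have : ∀ i, ¬ P 0 i := fun i h => h.1 rfl
      simp [this, hf]
    · rw [sum_eq_single (hch d hd).choose, if_pos ⟨hd, rfl⟩]
      · intro i _ hi
        rw [if_neg]
        rintro ⟨h, h'⟩
        exact hi h'.symm
      · simp
  · intro N hN i
    rw [le_order_iff_coeff] at hN ⊢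
    intro d hd
    rw [hq]
    split_ifs
    · apply hN
      simp; omega
    · rfl

lemma hasSubst_of_zero [Finite σ] {a : σ → MvPowerSeries τ ℂ}
    (ha : ∀ i, constantCoeff (a i) = 0) : HasSubst a := hasSubst_of_constantCoeff_zero ha

lemma le_order_subst_of_le [Finite σ] [Finite τ] {a : σ → MvPowerSeries τ ℂ}
    (ha : ∀ i, constantCoeff (a i) = 0) {f : MvPowerSeries σ ℂ} {N : ℕ}
    (hf : (N : ℕ∞) ≤ f.order) : (N : ℕ∞) ≤ (subst a f).order := by
  rw [le_order_iff_truncTotal] at hf ⊢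
  rw [truncTotal_subst ha, hf, MvPolynomial.coe_zero, ← coe_substAlgHom, map_zero, map_zero]
  apply hasSubst_of_zero
  intro i
  rw [← coeff_zero_eq_constantCoeff_apply, MvPolynomial.coeff_coe,
    ← MvPolynomial.constantCoeff_eq, constantCoeff_truncTotal_eq_ite, ha i, ite_self]

lemma coeff_subst_truncTotal [Finite σ] [Finite τ] {a : σ → MvPowerSeries τ ℂ}
    (ha : ∀ i, constantCoeff (a i) = 0) (f : MvPowerSeries σ ℂ) (d : τ →₀ ℕ) {N : ℕ}
    (hN : d.degree < N) :
    coeff d (subst a f) = coeff d (aeval a (truncTotal N f)) := by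
  rw [← subst_coe, ← sub_eq_zero, ← map_sub, ← subst_sub (hasSubst_of_zero ha)]
  exact le_order_iff_coeff.1 (le_order_subst_of_le ha (le_order_sub_truncTotal f N)) d hN

lemma constantCoeff_subst_zero [Finite σ] {a : σ → MvPowerSeries τ ℂ} [Finite τ]
    (ha : ∀ i, constantCoeff (a i) = 0) (f : MvPowerSeries σ ℂ) :
    constantCoeff (subst a f) = constantCoeff f := by
  have h1 : ((1 : ℕ) : ℕ∞) ≤ (subst a (f - C (constantCoeff f))).order := by
    apply le_order_subst_of_le ha
    rw [one_le_order_iff]; simp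
  rw [one_le_order_iff, subst_sub (hasSubst_of_zero ha), map_sub, sub_eq_zero] at h1
  rw [h1]
  rw [subst_C]; simp

/-- Two homomorphisms of algebras that do not lower orders agree if they agree on variables. -/
lemma eq_subst_of_map_X [Finite σ] [Finite τ] (φ : MvPowerSeries σ ℂ →ₐ[ℂ] MvPowerSeries τ ℂ)
    (hφ : ∀ (N : ℕ) f, (N : ℕ∞) ≤ f.order → (N : ℕ∞) ≤ (φ f).order) (f : MvPowerSeries σ ℂ) :
    φ f = subst (fun i => φ (X i)) f := by
  have ha : ∀ i, constantCoeff (φ (X i)) = 0 := fun i => by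
    rw [← one_le_order_iff]
    apply hφ
    rw [one_le_order_iff]; simp
  have hp : ∀ p : MvPolynomial σ ℂ, φ p = subst (fun i => φ (X i)) (p : MvPowerSeries σ ℂ) := by
    intro p
    rw [subst_coe]
    have : φ.comp (MvPolynomial.coeToMvPowerSeries.algHom ℂ) =
        aeval (fun i => φ (X i)) := by
      apply MvPolynomial.algHom_ext
      intro i
      simp [MvPolynomial.coeToMvPowerSeries.algHom_apply]
    have h2 := DFunLike.congr_fun this p
    simpa [MvPolynomial.coeToMvPowerSeries.algHom_apply] using h2
  rw [← sub_eq_zero]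
  apply eq_zero_of_forall_le_order
  intro N
  have h1 := hφ N _ (le_order_sub_truncTotal f N)
  have h2 := le_order_subst_of_le ha (le_order_sub_truncTotal f N)
  have h3 := le_order_sub' h1 h2
  rwa [map_sub, subst_sub (hasSubst_of_zero ha), hp, sub_sub_sub_cancel_right] at h3

lemma subst_algHom_ext [Finite σ] [Finite τ] {ι : Type*} [Finite ι]
    {a : σ → MvPowerSeries τ ℂ} {b : τ → MvPowerSeries ι ℂ} {c : σ → MvPowerSeries ι ℂ}
    (ha : ∀ i, constantCoeff (a i) = 0) (hb : ∀ i, constantCoeff (b i) = 0)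
    (h : ∀ i, subst b (a i) = c i) (f : MvPowerSeries σ ℂ) :
    subst b (subst a f) = subst c f := by
  rw [subst_comp_subst_apply (hasSubst_of_zero ha) (hasSubst_of_zero hb)]
  congr 1; funext i; exact h i

lemma pderiv_aeval [Fintype σ] (a : σ → MvPowerSeries τ ℂ) (p : MvPolynomial σ ℂ) (i : τ) :
    pderiv ℂ i (aeval a p) = ∑ j, pderiv ℂ i (a j) * aeval a (MvPolynomial.pderiv j p) := by
  classical
  induction p using MvPolynomial.induction_on with
  | C r => simp [← MvPolynomial.algebraMap_eq]
  | add p q hp hq => simp [hp, hq, mul_add, sum_add_distrib]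
  | mul_X p k hp =>
    have h1 : ∀ j, pderiv ℂ i (a j) * aeval a
        (MvPolynomial.pderiv j (p * MvPolynomial.X k)) =
        (if j = k then aeval a p * pderiv ℂ i (a k) else 0) +
          a k * (pderiv ℂ i (a j) * aeval a (MvPolynomial.pderiv j p)) := by
      intro j
      rw [Derivation.leibniz, MvPolynomial.pderiv_X]
      by_cases hj : j = k
      · subst hj; simp; ring
      · rw [if_neg hj, Pi.single_eq_of_ne (Ne.symm hj)]; simp; ring
    rw [sum_congr rfl fun j _ => h1 j, sum_add_distrib, ← mul_sum, ← hp,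
      map_mul, aeval_X, Derivation.leibniz]
    simp

lemma le_order_pderiv {f : MvPowerSeries σ ℂ} {N : ℕ} (i : σ)
    (hf : ((N + 1 : ℕ) : ℕ∞) ≤ f.order) : (N : ℕ∞) ≤ (pderiv ℂ i f).order := by
  rw [le_order_iff_coeff] at hf ⊢
  intro d hd
  rw [coeff_pderiv, hf _ (by simp; omega), zero_mul]

/-- The chain rule for substitution into a formal power series. -/
lemma pderiv_subst [Fintype σ] [Finite τ] {a : σ → MvPowerSeries τ ℂ}
    (ha : ∀ i, constantCoeff (a i) = 0) (f : MvPowerSeries σ ℂ) (i : τ) :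
    pderiv ℂ i (subst a f) = ∑ j, pderiv ℂ i (a j) * subst a (pderiv ℂ j f) := by
  have hs := hasSubst_of_zero ha
  rw [← sub_eq_zero]
  apply eq_zero_of_forall_le_order
  intro N
  set p := truncTotal (N + 1) f
  have h0 := le_order_sub_truncTotal f (N + 1)
  have h1 : (N : ℕ∞) ≤ (pderiv ℂ i (subst a (f - (p : MvPowerSeries σ ℂ)))).order :=
    le_order_pderiv i (le_order_subst_of_le ha h0)
  have h2 : (N : ℕ∞) ≤ (∑ j, pderiv ℂ i (a j) *
      subst a (pderiv ℂ j (f - (p : MvPowerSeries σ ℂ)))).order := by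
    apply le_order_sum'
    intro j _
    have := le_order_mul_of_le (zero_le (a := (pderiv ℂ i (a j)).order))
      (le_order_subst_of_le ha (le_order_pderiv j h0))
    rwa [zero_add] at this
  have h3 := le_order_sub' h1 h2
  have hp := pderiv_aeval a p i
  convert h3 using 2
  simp only [subst_sub hs, map_sub, mul_sub, sum_sub_distrib]
  rw [subst_coe, hp]
  simp only [pderiv_coe, subst_coe]
  ring

end Series

section Inverse

variable {σ : Type*}

/-- The matrix of the linear terms of a tuple of power series. -/
def linMat (a : σ → MvPowerSeries σ ℂ) : Matrix σ σ ℂ :=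
  Matrix.of fun i j => coeff (single j 1) (a i)

lemma le_order_iterate {n : MvPowerSeries σ ℂ →ₗ[ℂ] MvPowerSeries σ ℂ}
    (hn : ∀ (N : ℕ) f, (N : ℕ∞) ≤ f.order → ((N + 1 : ℕ) : ℕ∞) ≤ (n f).order)
    (f : MvPowerSeries σ ℂ) (k : ℕ) : (k : ℕ∞) ≤ ((n ^ k) f).order := by
  induction k with
  | zero => simp
  | succ k ih => rw [pow_succ', Module.End.mul_apply]; exact hn _ _ ih

/-- If `n` raises orders then `1 - n` is invertible, by the geometric series. -/
lemma bijective_one_sub {n : MvPowerSeries σ ℂ →ₗ[ℂ] MvPowerSeries σ ℂ}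
    (hn : ∀ (N : ℕ) f, (N : ℕ∞) ≤ f.order → ((N + 1 : ℕ) : ℕ∞) ≤ (n f).order) :
    Function.Bijective (fun f => f - n f) := by
  constructor
  · intro f g h
    rw [← sub_eq_zero]
    apply eq_zero_of_forall_le_order
    have h1 : f - g = n (f - g) := by
      rw [map_sub]
      have : f - n f = g - n g := h
      linear_combination this
    intro N
    induction N with
    | zero => simp
    | succ N ih => rw [h1]; exact hn _ _ ih
  · intro q
    let p : MvPowerSeries σ ℂ := fun d => coeff d (∑ k ∈ Finset.range (d.degree + 1), (n ^ k) q)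
    have hp : ∀ N : ℕ, (N : ℕ∞) ≤ (p - ∑ k ∈ Finset.range N, (n ^ k) q).order := by
      intro N
      rw [le_order_iff_coeff]
      intro d hd
      rw [map_sub, sub_eq_zero]
      change coeff d (∑ k ∈ Finset.range (d.degree + 1), (n ^ k) q) = _
      obtain ⟨M, rfl⟩ := Nat.exists_eq_add_of_le (Nat.succ_le_of_lt hd)
      rw [Finset.sum_range_add _ (d.degree + 1) M, map_add, left_eq_add, map_sum]
      apply sum_eq_zero
      intro k _
      exact le_order_iff_coeff.1 (le_order_iterate hn q (d.degree + 1 + k)) d (by omega)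
    refine ⟨p, ?_⟩
    rw [← sub_eq_zero]
    apply eq_zero_of_forall_le_order
    intro N
    have h1 := hp N
    have h2 := hn _ _ h1
    have h3 := le_order_sub' h1 (le_trans (by exact_mod_cast Nat.le_succ N) h2)
    have h4 := le_order_sub' h3 (le_order_iterate hn q N)
    convert h4 using 2
    have := Finset.sum_range_succ (fun k => (n ^ k) q) N
    have h5 : ∑ k ∈ Finset.range N, (n ^ k) q + (n ^ N) q =
        q + n (∑ k ∈ Finset.range N, (n ^ k) q) := by
      rw [← this, Finset.sum_range_succ', map_sum, add_comm]
      congr 1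
      exact sum_congr rfl fun k _ => by rw [pow_succ', Module.End.mul_apply]
    rw [map_sub]
    linear_combination h5

lemma bijective_subst_of_linMat_eq_one [Fintype σ] {a : σ → MvPowerSeries σ ℂ}
    (ha : ∀ i, constantCoeff (a i) = 0) [DecidableEq σ] (h1 : linMat a = 1) :
    Function.Bijective (subst a : MvPowerSeries σ ℂ → MvPowerSeries σ ℂ) := by
  have hs := hasSubst_of_zero ha
  let n : MvPowerSeries σ ℂ →ₗ[ℂ] MvPowerSeries σ ℂ :=
    LinearMap.id - (substAlgHom (R := ℂ) hs).toLinearMap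
  have hnv : ∀ f, n f = f - subst a f := fun f => by simp [n, substAlgHom_apply]
  have hX : ∀ i, ((2 : ℕ) : ℕ∞) ≤ (X i - a i).order := by
    intro i
    rw [le_order_iff_coeff]
    intro d hd
    rcases Nat.lt_or_ge d.degree 1 with h | h
    · have : d = 0 := by
        rw [← Finsupp.degree_eq_zero_iff]; omega
      subst this
      simp [ha]
    · have h' : d.degree = 1 := by omega
      obtain ⟨j, rfl⟩ := (Finsupp.sum_eq_one_iff d).1 h'
      have := congrFun (congrFun h1 i) j
      rw [linMat, of_apply] at this
      rw [map_sub, this, coeff_X, one_apply]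
      by_cases hij : i = j
      · subst hij; simp
      · rw [if_neg, if_neg hij, sub_zero]
        intro h
        exact hij ((Finsupp.single_left_inj one_ne_zero).1 h).symm
  have hn : ∀ (N : ℕ) f, (N : ℕ∞) ≤ f.order → ((N + 1 : ℕ) : ℕ∞) ≤ (n f).order := by
    intro N
    induction N with
    | zero =>
      intro f _
      rw [zero_add, one_le_order_iff, hnv, map_sub, constantCoeff_subst_zero ha, sub_self]
    | succ N ih =>
      intro f hf
      have hf0 : constantCoeff f = 0 := by
        rw [← one_le_order_iff]
        exact le_trans (by exact_mod_cast Nat.succ_le_succ (Nat.zero_le N)) hf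
      obtain ⟨q, hq, hqN⟩ := exists_eq_sum_X_mul f hf0
      rw [hq, map_sum]
      apply le_order_sum'
      intro i _
      have e : n (X i * q i) = (X i - a i) * q i + a i * n (q i) := by
        rw [hnv, hnv, subst_mul hs, subst_X hs]; ring
      rw [e]
      apply le_order_add'
      · have := le_order_mul_of_le (hX i) (hqN N hf i)
        refine le_trans ?_ this
        norm_cast; omega
      · have := le_order_mul_of_le (one_le_order_iff.2 (ha i)) (ih _ (hqN N hf i))
        refine le_trans ?_ this
        norm_cast; omega
  have := bijective_one_sub hn
  convert this using 2 with f
  rw [hnv]; ring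

lemma constantCoeff_sum_smul [Fintype σ] (L : Matrix σ σ ℂ) {a : σ → MvPowerSeries σ ℂ}
    (ha : ∀ i, constantCoeff (a i) = 0) (i : σ) :
    constantCoeff (∑ j, L i j • a j) = 0 := by
  simp [map_sum, ha, smul_eq_C_mul]

/-- The formal inverse function theorem. -/
lemma bijective_subst [Fintype σ] [DecidableEq σ] {a : σ → MvPowerSeries σ ℂ}
    (ha : ∀ i, constantCoeff (a i) = 0) (h1 : IsUnit (linMat a).det) :
    Function.Bijective (subst a : MvPowerSeries σ ℂ → MvPowerSeries σ ℂ) := by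
  have hs := hasSubst_of_zero ha
  set L := linMat a with hL
  have hX0 : ∀ i, constantCoeff (X i : MvPowerSeries σ ℂ) = 0 := fun i => constantCoeff_X i
  -- linear changes of variables reduce this to the case of linear terms `X i`
  let lin : Matrix σ σ ℂ → σ → MvPowerSeries σ ℂ := fun M i => ∑ j, M i j • X j
  have hlin0 : ∀ M i, constantCoeff (lin M i) = 0 := fun M i => constantCoeff_sum_smul M hX0 i
  have hcomp : ∀ (M : Matrix σ σ ℂ) (b : σ → MvPowerSeries σ ℂ)
      (_ : ∀ i, constantCoeff (b i) = 0) (f : MvPowerSeries σ ℂ),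
      subst b (subst (lin M) f) = subst (fun i => ∑ j, M i j • b j) f := by
    intro M b hb f
    apply subst_algHom_ext (hlin0 M) hb
    intro i
    rw [← coe_substAlgHom (hasSubst_of_zero hb), map_sum]
    refine sum_congr rfl fun j _ => ?_
    rw [map_smul, substAlgHom_X]
  have hinv : ∀ M M' : Matrix σ σ ℂ, M * M' = 1 → ∀ f : MvPowerSeries σ ℂ, subst (lin M') (subst (lin M) f) = f := by
    intro M M' h f
    rw [hcomp M _ (hlin0 M')]
    have : (fun i => ∑ j, M i j • lin M' j) = X := by
      funext i
      simp only [lin, smul_sum, smul_smul]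
      rw [sum_comm]
      simp only [← sum_smul]
      have : ∀ k, ∑ j, M i j * M' j k = (1 : Matrix σ σ ℂ) i k := fun k => by rw [← h, mul_apply]
      simp [this, one_apply]
    rw [this, subst_self, id]
  have hlinbij : Function.Bijective
      (subst (lin L) : MvPowerSeries σ ℂ → MvPowerSeries σ ℂ) :=
    Function.bijective_iff_has_inverse.2 ⟨subst (lin L⁻¹),
      hinv L L⁻¹ (Matrix.mul_nonsing_inv _ h1), hinv L⁻¹ L (Matrix.nonsing_inv_mul _ h1)⟩
  have h2 := bijective_subst_of_linMat_eq_one (a := fun i => ∑ j, L⁻¹ i j • a j)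
    (constantCoeff_sum_smul _ ha) (by
      ext i j
      rw [linMat, of_apply, map_sum, ← Matrix.nonsing_inv_mul _ h1, mul_apply]
      rfl)
  have h3 : (subst a : MvPowerSeries σ ℂ → MvPowerSeries σ ℂ) =
      subst (fun i => ∑ j, L⁻¹ i j • a j) ∘ subst (lin L) := by
    funext f
    rw [Function.comp_apply, hcomp L _ (constantCoeff_sum_smul _ ha)]
    congr 1
    funext i
    simp only [smul_sum, smul_smul]
    rw [sum_comm]
    simp only [← sum_smul]
    have : ∀ k, ∑ j, L i j * L⁻¹ j k = (1 : Matrix σ σ ℂ) i k := fun k => by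
      rw [← Matrix.mul_nonsing_inv _ h1, mul_apply]
    simp [this, one_apply]
  rw [h3]
  exact h2.comp hlinbij

end Inverse

section FPSAut

lemma mem_maxIdeal_pow_iff {f : FPS m} {N : ℕ} : f ∈ maxIdeal m ^ N ↔ (N : ℕ∞) ≤ f.order := by
  constructor
  · intro h
    induction N generalizing f with
    | zero => simp
    | succ N ih =>
      rw [pow_succ] at h
      refine Submodule.mul_induction_on h (fun a ha b hb => ?_) fun a b ha hb => le_order_add' ha hb
      have hb' : constantCoeff b = 0 := hb
      have := le_order_mul_of_le (ih ha) (one_le_order_iff.2 hb')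
      exact_mod_cast this
  · intro h
    induction N generalizing f with
    | zero => simp
    | succ N ih =>
      have hf0 : constantCoeff f = 0 := by
        rw [← one_le_order_iff]
        exact le_trans (by exact_mod_cast Nat.succ_le_succ (Nat.zero_le N)) h
      obtain ⟨q, hq, hqN⟩ := exists_eq_sum_X_mul f hf0
      rw [hq, pow_succ']
      refine Ideal.sum_mem _ fun i _ => Ideal.mul_mem_mul ?_ (ih (hqN N h i))
      change constantCoeff (X i) = 0
      exact constantCoeff_X i

lemma le_order_algEquiv (g : FPS m ≃ₐ[ℂ] FPS m) (N : ℕ) (f : FPS m) (h : (N : ℕ∞) ≤ f.order) :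
    (N : ℕ∞) ≤ (g f).order := by
  rw [← mem_maxIdeal_pow_iff] at h ⊢
  rw [← comap_maxIdeal_pow g] at h
  exact h

lemma constantCoeff_algEquiv (g : FPS m ≃ₐ[ℂ] FPS m) (f : FPS m) (hf : constantCoeff f = 0) :
    constantCoeff (g f) = 0 := by
  rw [← one_le_order_iff] at hf ⊢
  exact le_order_algEquiv g 1 f hf

lemma algEquiv_X (g : FPS m ≃ₐ[ℂ] FPS m) (i : Fin m) : constantCoeff (g (X i)) = 0 :=
  constantCoeff_algEquiv g _ (constantCoeff_X i)

/-- Automorphisms of `ℂ⟦x⟧` are continuous, hence given by a formal change of coordinates. -/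
lemma algEquiv_eq_subst (g : FPS m ≃ₐ[ℂ] FPS m) (f : FPS m) :
    g f = subst (fun i => g (X i)) f :=
  eq_subst_of_map_X g.toAlgHom (le_order_algEquiv g) f

/-- The automorphism of `ℂ⟦x⟧` given by a formal change of coordinates. -/
def substEquiv (a : Fin m → FPS m) (ha : ∀ i, constantCoeff (a i) = 0)
    (h : IsUnit (linMat a).det) : FPS m ≃ₐ[ℂ] FPS m :=
  AlgEquiv.ofBijective (substAlgHom (R := ℂ) (hasSubst_of_zero ha)) (by
    rw [coe_substAlgHom]; exact bijective_subst ha h)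

lemma substEquiv_apply (a : Fin m → FPS m) (ha : ∀ i, constantCoeff (a i) = 0)
    (h : IsUnit (linMat a).det) (f : FPS m) : substEquiv a ha h f = subst a f := by
  change substAlgHom (R := ℂ) (hasSubst_of_zero ha) f = _
  rw [substAlgHom_apply]

lemma substEquiv_X (a : Fin m → FPS m) (ha : ∀ i, constantCoeff (a i) = 0)
    (h : IsUnit (linMat a).det) (i : Fin m) : substEquiv a ha h (X i) = a i := by
  rw [substEquiv_apply, subst_X (hasSubst_of_zero ha)]

/-- The Jacobian matrix `∂ρ_i/∂x_k` of a formal automorphism. -/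
def jac (a : Fin m → FPS m) : Matrix (Fin m) (Fin m) (FPS m) :=
  Matrix.of fun i k => pderiv ℂ k (a i)

lemma pderiv_algEquiv (g : FPS m ≃ₐ[ℂ] FPS m) (f : FPS m) (k : Fin m) :
    pderiv ℂ k (g f) = ∑ j, pderiv ℂ k (g (X j)) * g (pderiv ℂ j f) := by
  rw [algEquiv_eq_subst g f, pderiv_subst (algEquiv_X g)]
  simp only [← algEquiv_eq_subst g]

lemma isUnit_jac_algEquiv (g : FPS m ≃ₐ[ℂ] FPS m) :
    IsUnit (jac fun i => g (X i)).det := by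
  classical
  have : (jac fun i => g.symm (X i)).map g * (jac fun i => g (X i)) = 1 := by
    ext i k : 1
    rw [mul_apply]
    have := pderiv_algEquiv g (g.symm (X i)) k
    rw [AlgEquiv.apply_symm_apply, pderiv_X] at this
    simp only [jac, map_apply, of_apply]
    rw [one_apply, sum_congr rfl fun j _ => mul_comm _ _, ← this]
    by_cases h : i = k
    · subst h; simp
    · rw [if_neg h, Pi.single_eq_of_ne (by tauto)]
  exact Matrix.isUnit_det_of_left_inverse this

lemma constantCoeff_jac (a : Fin m → FPS m) : (jac a).map (constantCoeff (R := ℂ)) = linMat a := by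
  ext i k
  simp only [jac, linMat, map_apply, of_apply]
  rw [← coeff_zero_eq_constantCoeff_apply, coeff_pderiv]; simp

lemma isUnit_det_iff_constantCoeff {n : Type*} [Fintype n] [DecidableEq n] {σ : Type*}
    (M : Matrix n n (MvPowerSeries σ ℂ)) :
    IsUnit M.det ↔ IsUnit (M.map (constantCoeff (R := ℂ))).det := by
  rw [isUnit_iff_constantCoeff, RingHom.map_det]; rfl

lemma isUnit_linMat_algEquiv (g : FPS m ≃ₐ[ℂ] FPS m) :
    IsUnit (linMat fun i => g (X i)).det := by
  rw [← constantCoeff_jac, ← isUnit_det_iff_constantCoeff]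
  exact isUnit_jac_algEquiv g

end FPSAut

/-! ### Reflections and divided differences -/

section DivDiff

variable {σ : Type*}

/-- Principal ideals generated by a series of order one are closed. -/
lemma dvd_of_forall_le_order {p f : MvPowerSeries σ ℂ} (hp : p.order = 1)
    (h : ∀ N : ℕ, ∃ r, (N : ℕ∞) ≤ (f - p * r).order) : p ∣ f := by
  choose r hr using h
  have hdiv : ∀ {q : MvPowerSeries σ ℂ} {N : ℕ}, ((N + 1 : ℕ) : ℕ∞) ≤ (p * q).order →
      (N : ℕ∞) ≤ q.order := by
    intro q N h
    rw [order_mul, hp, add_comm N 1, Nat.cast_add, Nat.cast_one] at h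
    exact (ENat.add_le_add_iff_left (by simp)).1 h
  have hcauchy : ∀ M N : ℕ, N ≤ M → ((N : ℕ) : ℕ∞) ≤ (r (M + 1) - r (N + 1)).order := by
    intro M N hMN
    apply hdiv
    have h1 := le_order_sub' (hr (N + 1))
      (le_trans (by exact_mod_cast Nat.succ_le_succ hMN) (hr (M + 1)))
    convert h1 using 2
    ring
  let q : MvPowerSeries σ ℂ := fun d => coeff d (r (d.degree + 2))
  have hq : ∀ N : ℕ, (N : ℕ∞) ≤ (q - r (N + 1)).order := by
    intro N
    rw [le_order_iff_coeff]
    intro d hd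
    have := le_order_iff_coeff.1 (hcauchy N (d.degree + 1) hd) d (Nat.lt_succ_self _)
    rw [map_sub, sub_eq_zero] at this ⊢
    exact this.symm
  refine ⟨q, ?_⟩
  rw [← sub_eq_zero]
  apply eq_zero_of_forall_le_order
  intro N
  have h1 := le_order_mul_of_le (zero_le (a := p.order)) (hq N)
  rw [zero_add] at h1
  have h2 := le_order_sub' (le_trans (by exact_mod_cast Nat.le_succ N) (hr (N + 1))) h1
  convert h2 using 2
  ring

/-- If the tuples `a` and `b` agree modulo `p`, then so do the substitutions. -/
lemma dvd_subst_sub_subst [Finite σ] {τ : Type*} [Finite τ] {p : MvPowerSeries τ ℂ}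
    (hp : p.order = 1) {a b : σ → MvPowerSeries τ ℂ} (ha : ∀ i, constantCoeff (a i) = 0)
    (hb : ∀ i, constantCoeff (b i) = 0) (h : ∀ i, p ∣ a i - b i) (f : MvPowerSeries σ ℂ) :
    p ∣ subst a f - subst b f := by
  apply dvd_of_forall_le_order hp
  intro N
  have hpoly : ∀ P : MvPolynomial σ ℂ, p ∣ aeval a P - aeval b P := by
    intro P
    induction P using MvPolynomial.induction_on with
    | C r => simp
    | add P Q hP hQ =>
      rw [map_add, map_add, add_sub_add_comm]
      exact dvd_add hP hQ
    | mul_X P i hP =>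
      rw [map_mul, map_mul, aeval_X, aeval_X]
      have e : aeval a P * a i - aeval b P * b i =
        (aeval a P - aeval b P) * a i +
          aeval b P * (a i - b i) := by ring
      rw [e]
      exact dvd_add (Dvd.dvd.mul_right hP _) (Dvd.dvd.mul_left (h i) _)
  obtain ⟨r, hr⟩ := hpoly (truncTotal N f)
  refine ⟨r, ?_⟩
  rw [← hr, ← subst_coe, ← subst_coe]
  have h1 := le_order_subst_of_le ha (le_order_sub_truncTotal f N)
  have h2 := le_order_subst_of_le hb (le_order_sub_truncTotal f N)
  rw [subst_sub (hasSubst_of_zero ha)] at h1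
  rw [subst_sub (hasSubst_of_zero hb)] at h2
  convert le_order_sub' h1 h2 using 2
  ring

end DivDiff

section GroupAction

variable (m : ℕ) {l : ℕ} {H : Type*} [Group H] (σ : H →* GL (Fin l) ℂ)

lemma repMat_mul (h k : H) : repMat σ (h * k) = repMat σ h * repMat σ k := by simp [repMat]

lemma repMat_one : repMat σ (1 : H) = 1 := by simp [repMat]

lemma repMat_mul_inv (h : H) : repMat σ h * repMat σ h⁻¹ = 1 := by
  rw [← repMat_mul, mul_inv_cancel, repMat_one]

lemma repMat_inv_mul (h : H) : repMat σ h⁻¹ * repMat σ h = 1 := by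
  rw [← repMat_mul, inv_mul_cancel, repMat_one]

/-- The images of the coordinates under the action of `h` on `ℂ⟦x, y⟧`. -/
def grpVar (h : H) : Fin m ⊕ Fin l → FPS2 m l :=
  Sum.elim (fun i => (X (Sum.inl i) : FPS2 m l))
    (fun j => ∑ k, repMat σ h⁻¹ j k • (X (Sum.inr k) : FPS2 m l))

lemma constantCoeff_grpVar (h : H) (i : Fin m ⊕ Fin l) : constantCoeff (grpVar m σ h i) = 0 := by
  rcases i with i | j
  · exact constantCoeff_X _
  · simp [grpVar, smul_eq_C_mul]

/-- The action of `h` on `ℂ⟦x, y⟧` as a homomorphism. -/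
def grpHom (h : H) : FPS2 m l →ₐ[ℂ] FPS2 m l :=
  substAlgHom (hasSubst_of_zero (constantCoeff_grpVar m σ h))

lemma grpAct_eq (h : H) (f : FPS2 m l) : grpAct m σ h f = grpHom m σ h f := by
  rw [grpHom, substAlgHom_apply]; rfl

lemma grpHom_eq_subst (h : H) (f : FPS2 m l) : grpHom m σ h f = subst (grpVar m σ h) f := by
  rw [grpHom, substAlgHom_apply]

@[simp] lemma grpHom_X_inl (h : H) (i : Fin m) : grpHom m σ h (X (Sum.inl i)) = X (Sum.inl i) := by
  rw [grpHom, substAlgHom_X]; rfl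

lemma grpHom_X_inr (h : H) (j : Fin l) :
    grpHom m σ h (X (Sum.inr j)) = ∑ k, repMat σ h⁻¹ j k • (X (Sum.inr k) : FPS2 m l) := by
  rw [grpHom, substAlgHom_X]; rfl

lemma grpHom_grpHom (h k : H) (f : FPS2 m l) :
    grpHom m σ h (grpHom m σ k f) = grpHom m σ (h * k) f := by
  rw [grpHom_eq_subst, grpHom_eq_subst, grpHom_eq_subst]
  apply subst_algHom_ext (constantCoeff_grpVar m σ k) (constantCoeff_grpVar m σ h)
  rintro (i | j)
  · rw [← grpHom_eq_subst]
    exact grpHom_X_inl m σ h i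
  · rw [← grpHom_eq_subst]
    change grpHom m σ h (∑ q, repMat σ k⁻¹ j q • (X (Sum.inr q) : FPS2 m l)) =
      ∑ q, repMat σ (h * k)⁻¹ j q • (X (Sum.inr q) : FPS2 m l)
    simp only [map_sum, map_smul, grpHom_X_inr, smul_sum, smul_smul]
    rw [sum_comm]
    refine sum_congr rfl fun q _ => ?_
    rw [← sum_smul, mul_inv_rev, repMat_mul, mul_apply]

lemma grpHom_one (f : FPS2 m l) : grpHom m σ 1 f = f := by
  have h : grpVar m σ (1 : H) = X := by
    funext i
    rcases i with i | j
    · rfl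
    · simp [grpVar, repMat_one, one_apply]
  rw [grpHom_eq_subst, h, subst_self, id]

lemma le_order_grpHom (h : H) {f : FPS2 m l} {N : ℕ} (hf : (N : ℕ∞) ≤ f.order) :
    (N : ℕ∞) ≤ (grpHom m σ h f).order := by
  rw [grpHom_eq_subst]
  exact le_order_subst_of_le (constantCoeff_grpVar m σ h) hf

lemma pderiv_inl_grpHom (h : H) (f : FPS2 m l) (i : Fin m) :
    pderiv ℂ (Sum.inl i) (grpHom m σ h f) = grpHom m σ h (pderiv ℂ (Sum.inl i) f) := by
  classical
  rw [grpHom_eq_subst, pderiv_subst (constantCoeff_grpVar m σ h), Fintype.sum_sum_type,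
    sum_eq_single i]
  · rw [grpHom_eq_subst]
    simp [grpVar]
  · intro j _ hj
    simp [grpVar, hj]
  · simp

lemma pderiv_inr_grpHom (h : H) (f : FPS2 m l) (j : Fin l) : pderiv ℂ (Sum.inr j) (grpHom m σ h f) =
      ∑ k, repMat σ h⁻¹ k j • grpHom m σ h (pderiv ℂ (Sum.inr k) f) := by
  classical
  rw [grpHom_eq_subst, pderiv_subst (constantCoeff_grpVar m σ h), Fintype.sum_sum_type]
  have h1 : ∀ i : Fin m, pderiv ℂ (Sum.inr j) (grpVar m σ h (Sum.inl i)) = 0 := by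
    intro i; simp [grpVar]
  have h2 : ∀ k : Fin l, pderiv ℂ (Sum.inr j) (grpVar m σ h (Sum.inr k)) =
      C (repMat σ h⁻¹ k j) := by
    intro k
    simp only [grpVar, Sum.elim_inr, map_sum, Derivation.map_smul, pderiv_X]
    rw [sum_eq_single j]
    · simp [smul_eq_C_mul]
    · intro b _ hb
      rw [Pi.single_eq_of_ne (by simpa using hb)]; simp
    · simp
  simp only [h1, h2, zero_mul, sum_const_zero, zero_add, ← smul_eq_C_mul, ← grpHom_eq_subst]

lemma grpHom_pderiv_inr (h : H) (f : FPS2 m l) (j : Fin l) : grpHom m σ h (pderiv ℂ (Sum.inr j) f) =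
      ∑ k, repMat σ h k j • pderiv ℂ (Sum.inr k) (grpHom m σ h f) := by
  simp only [pderiv_inr_grpHom, smul_sum, smul_smul]
  rw [sum_comm]
  have : ∀ q, ∑ k, repMat σ h k j * repMat σ h⁻¹ q k = if q = j then 1 else 0 := by
    intro q
    rw [← one_apply, ← repMat_inv_mul σ h, mul_apply]
    exact sum_congr rfl fun _ _ => mul_comm _ _
  simp only [← sum_smul, this]
  simp

end GroupAction

section Reflection

variable (m) (σ)

variable {σ} in
lemma mem_reflections {s : H} : s ∈ reflections σ ↔ IsReflection σ s := by simp [reflections]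

variable {σ} in
lemma coroot_ne_zero {s : H} (hs : s ∈ reflections σ) : coroot σ s ≠ 0 := by
  have h : ∃ i, (1 - repMat σ s) i ≠ 0 := by
    by_contra! h
    have h0 : (1 - repMat σ s) = 0 := funext h
    have := mem_reflections.1 hs
    rw [IsReflection, h0, Matrix.rank_zero] at this
    exact zero_ne_one this
  rw [coroot, dif_pos h]
  exact h.choose_spec

variable {σ} in
/-- The decomposition `1 - s = c ⊗ α_s` of a reflection. -/
lemma exists_root {s : H} (hs : s ∈ reflections σ) :
    ∃ c : Fin l → ℂ, ∀ i j, (1 - repMat σ s) i j = c i * coroot σ s j := by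
  have h : ∃ i, (1 - repMat σ s) i ≠ 0 := by
    by_contra! h
    have h0 : (1 - repMat σ s) = 0 := funext h
    have := mem_reflections.1 hs
    rw [IsReflection, h0, Matrix.rank_zero] at this
    exact zero_ne_one this
  have h1 := mem_reflections.1 hs
  rw [IsReflection, Matrix.rank_eq_finrank_span_row] at h1
  have hmem : coroot σ s ∈ Submodule.span ℂ (Set.range (1 - repMat σ s).row) := by
    rw [coroot, dif_pos h]
    exact subset_span ⟨_, rfl⟩
  have h2 := (finrank_eq_one_iff_of_nonzero' (⟨coroot σ s, hmem⟩ :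
    Submodule.span ℂ (Set.range (1 - repMat σ s).row)) (by
      intro h0; exact coroot_ne_zero hs (congrArg Subtype.val h0))).1 h1
  choose c hc using fun i => h2 ⟨(1 - repMat σ s).row i, subset_span ⟨i, rfl⟩⟩
  refine ⟨c, fun i j => ?_⟩
  have := congrFun (congrArg Subtype.val (hc i)) j
  simpa using this.symm

/-- The vector `c` in the decomposition `1 - s = c ⊗ α_s`: a vector that spans the image of
`1 - s`. -/
def rootVec (s : H) : Fin l → ℂ := by
  classical
  exact if hs : s ∈ reflections σ then (exists_root hs).choose else 0

variable {σ} in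
lemma one_sub_repMat_apply {s : H} (hs : s ∈ reflections σ) (i j : Fin l) :
    (1 - repMat σ s) i j = rootVec σ s i * coroot σ s j := by
  rw [rootVec, dif_pos hs]
  exact (exists_root hs).choose_spec i j

variable {σ} in
lemma repMat_apply_of_reflection {s : H} (hs : s ∈ reflections σ) (i j : Fin l) :
    repMat σ s i j = (if i = j then 1 else 0) - rootVec σ s i * coroot σ s j := by
  rw [← one_sub_repMat_apply hs, Matrix.sub_apply, one_apply]; ring

variable {σ} in
/-- As `s` has finite order it is semisimple, so that `tr (1 - s) ≠ 0`. -/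
lemma trace_one_sub_ne_zero {s : H} (hs : s ∈ reflections σ) : (1 - repMat σ s).trace ≠ 0 := by
  intro h0
  have hsq : (1 - repMat σ s) * (1 - repMat σ s) = 0 := by
    ext i j
    rw [mul_apply]
    simp only [one_sub_repMat_apply hs]
    have : ∑ k, rootVec σ s k * coroot σ s k = 0 := by
      rw [← h0, Matrix.trace]
      exact sum_congr rfl fun k _ => (one_sub_repMat_apply hs k k).symm
    rw [sum_congr rfl fun k _ => show rootVec σ s i * coroot σ s k *
      (rootVec σ s k * coroot σ s j) = rootVec σ s i * coroot σ s j *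
        (rootVec σ s k * coroot σ s k) by ring, ← mul_sum, this]
    simp
  set N := 1 - repMat σ s with hN
  have hs1 : repMat σ s = 1 - N := by rw [hN]; abel
  -- `sⁿ = 1 - n N` is not the identity for any `n > 0`
  have hpow : ∀ n : ℕ, repMat σ (s ^ n) = 1 - (n : ℂ) • N := by
    intro n
    induction n with
    | zero => simp [repMat_one]
    | succ n ih =>
      rw [pow_succ, repMat_mul, ih, hs1, sub_mul, one_mul, smul_mul_assoc, mul_sub, hsq, mul_one]
      push_cast
      rw [add_smul, one_smul, sub_zero]; abel
  have h1 := hpow (orderOf s)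
  rw [pow_orderOf_eq_one, repMat_one] at h1
  have h2 : (orderOf s : ℂ) • N = 0 := by
    have : (1 : Matrix (Fin l) (Fin l) ℂ) - (orderOf s : ℂ) • N = 1 := h1.symm
    simpa using this
  rcases smul_eq_zero.1 h2 with h3 | h3
  · exact (orderOf_pos s).ne' (by exact_mod_cast h3)
  · have := mem_reflections.1 hs
    rw [IsReflection, ← hN, h3, Matrix.rank_zero] at this
    exact zero_ne_one this

variable {σ} in
lemma conj_mem_reflections {s : H} (hs : s ∈ reflections σ) (h : H) :
    h * s * h⁻¹ ∈ reflections σ := by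
  rw [mem_reflections, IsReflection] at hs ⊢
  have e : 1 - repMat σ (h * s * h⁻¹) = repMat σ h * (1 - repMat σ s) * repMat σ h⁻¹ := by
    rw [repMat_mul, repMat_mul, mul_sub, sub_mul, mul_one, repMat_mul_inv]
  have hu : ∀ k : H, IsUnit (repMat σ k).det := fun k =>
    (Matrix.isUnit_iff_isUnit_det _).1 ⟨σ k, rfl⟩
  rw [e, Matrix.rank_mul_eq_left_of_isUnit_det _ _ (hu h⁻¹),
    Matrix.rank_mul_eq_right_of_isUnit_det _ _ (hu h), hs]

variable {σ} in
lemma exists_ne_zero_rootVec {s : H} (hs : s ∈ reflections σ) : ∃ i, rootVec σ s i ≠ 0 := by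
  by_contra! h
  apply trace_one_sub_ne_zero hs
  rw [Matrix.trace]
  apply sum_eq_zero
  intro i _
  rw [Matrix.diag_apply, one_sub_repMat_apply hs, h, zero_mul]

variable {σ} in
/-- `α_{hsh⁻¹} ∘ h` is proportional to `α_s`. -/
lemma exists_coroot_conj {s : H} (hs : s ∈ reflections σ) (h : H) :
    ∃ μ : ℂ, μ ≠ 0 ∧ ∀ j, ∑ k, coroot σ (h * s * h⁻¹) k * repMat σ h k j = μ * coroot σ s j := by
  have hs' := conj_mem_reflections hs h
  obtain ⟨i, hi⟩ := exists_ne_zero_rootVec hs'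
  have key : ∀ j, rootVec σ (h * s * h⁻¹) i *
      ∑ k, coroot σ (h * s * h⁻¹) k * repMat σ h k j =
      (∑ k, repMat σ h i k * rootVec σ s k) * coroot σ s j := by
    intro j
    have e : (1 - repMat σ (h * s * h⁻¹)) * repMat σ h = repMat σ h * (1 - repMat σ s) := by
      rw [sub_mul, mul_sub, one_mul, mul_one, ← repMat_mul, ← repMat_mul]
      simp
    have := congrFun (congrFun e i) j
    rw [mul_apply, mul_apply] at this
    simp only [one_sub_repMat_apply hs, one_sub_repMat_apply hs'] at this
    rw [mul_sum, sum_mul]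
    simpa only [mul_assoc] using this
  refine ⟨(rootVec σ (h * s * h⁻¹) i)⁻¹ * ∑ k, repMat σ h i k * rootVec σ s k, ?_, ?_⟩
  · intro h0
    have hz : ∀ j, ∑ k, coroot σ (h * s * h⁻¹) k * repMat σ h k j = 0 := by
      intro j
      apply mul_left_cancel₀ hi
      rw [key, mul_zero]
      rcases mul_eq_zero.1 h0 with h1 | h1
      · exact absurd (inv_eq_zero.1 h1) hi
      · rw [h1, zero_mul]
    apply coroot_ne_zero hs'
    have : Matrix.vecMul (coroot σ (h * s * h⁻¹)) (repMat σ h) = 0 := by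
      funext j
      exact hz j
    have h2 := congrArg (fun v => Matrix.vecMul v (repMat σ h⁻¹)) this
    simpa [Matrix.vecMul_vecMul, repMat_mul_inv] using h2
  · intro j
    apply mul_left_cancel₀ hi
    rw [key, ← mul_assoc, mul_inv_cancel_left₀ hi]

lemma corootForm_order {s : H} (hs : s ∈ reflections σ) : (corootForm m σ s).order = 1 := by
  obtain ⟨k, hk⟩ := Function.ne_iff.1 (coroot_ne_zero hs)
  apply le_antisymm
  · have hc : coeff (single (Sum.inr k) 1) (corootForm m σ s) ≠ 0 := by
      classical
      rw [corootForm, map_sum, sum_eq_single k]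
      · simpa using hk
      · intro j _ hj
        rw [map_smul, coeff_X, if_neg, smul_zero]
        intro h
        have := (Finsupp.single_left_inj one_ne_zero).1 h
        exact hj (by simpa using this.symm)
      · simp
    have := order_le hc
    simpa using this
  · have : ((1 : ℕ) : ℕ∞) ≤ (corootForm m σ s).order := by
      rw [one_le_order_iff, corootForm]
      simp [smul_eq_C_mul]
    exact_mod_cast this

lemma corootForm_ne_zero {s : H} (hs : s ∈ reflections σ) : corootForm m σ s ≠ 0 := by
  intro h
  have := corootForm_order m σ hs
  rw [h, order_zero] at this
  exact absurd this (by simp)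

/-- The vector `w` with `s y = y - α_s(y) w` for the linear functions `y`. -/
def dualRootVec (s : H) : Fin l → ℂ := fun i => -∑ k, repMat σ s⁻¹ i k * rootVec σ s k

lemma grpHom_X_inr_of_reflection {s : H} (hs : s ∈ reflections σ) (k : Fin l) :
    grpHom m σ s (X (Sum.inr k)) = X (Sum.inr k) - dualRootVec σ s k • corootForm m σ s := by
  have h1 : ∀ j, repMat σ s⁻¹ k j =
      (if k = j then 1 else 0) - dualRootVec σ s k * coroot σ s j := by
    intro j
    have e : repMat σ s⁻¹ = 1 + repMat σ s⁻¹ * (1 - repMat σ s) := by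
      rw [mul_sub, repMat_inv_mul, mul_one]; abel
    have := congrFun (congrFun e k) j
    rw [Matrix.add_apply, one_apply, mul_apply] at this
    rw [this]
    simp only [one_sub_repMat_apply hs, dualRootVec]
    rw [neg_mul, sum_mul, sub_neg_eq_add]
    simp only [mul_assoc]
  rw [grpHom_X_inr]
  simp only [h1, sub_smul, sum_sub_distrib, corootForm, smul_sum, smul_smul]
  congr 1
  simp

lemma corootForm_dvd {s : H} (hs : s ∈ reflections σ) (f : FPS2 m l) :
    corootForm m σ s ∣ f - grpHom m σ s f := by
  have h1 : f = subst X f := by rw [subst_self, id]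
  have h2 : f - grpHom m σ s f = subst X f - subst (grpVar m σ s) f := by rw [← h1, grpHom_eq_subst]
  rw [h2]
  apply dvd_subst_sub_subst (corootForm_order m σ hs) (fun i => constantCoeff_X i)
    (constantCoeff_grpVar m σ s)
  rintro (i | j)
  · simp [grpVar]
  · have := grpHom_X_inr_of_reflection m σ hs j
    rw [grpHom_X_inr] at this
    change corootForm m σ s ∣ X (Sum.inr j) - ∑ k, repMat σ s⁻¹ j k • (X (Sum.inr k) : FPS2 m l)
    rw [this, sub_sub_cancel, smul_eq_C_mul]
    exact Dvd.intro_left _ rfl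

/-- The divided difference `f ↦ (f - s f)/α_s`. -/
def divDiff (s : H) : FPS2 m l →ₗ[ℂ] FPS2 m l := by
  classical
  exact if hs : s ∈ reflections σ then
    { toFun := fun f => (corootForm_dvd m σ hs f).choose
      map_add' := fun f g => by
        apply mul_left_cancel₀ (corootForm_ne_zero m σ hs)
        rw [mul_add, ← (corootForm_dvd m σ hs (f + g)).choose_spec,
          ← (corootForm_dvd m σ hs f).choose_spec, ← (corootForm_dvd m σ hs g).choose_spec, map_add]
        ring
      map_smul' := fun a f => by
        apply mul_left_cancel₀ (corootForm_ne_zero m σ hs)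
        rw [RingHom.id_apply, mul_smul_comm, ← (corootForm_dvd m σ hs (a • f)).choose_spec,
          ← (corootForm_dvd m σ hs f).choose_spec, map_smul, smul_sub] }
  else 0

lemma corootForm_mul_divDiff {s : H} (hs : s ∈ reflections σ) (f : FPS2 m l) :
    corootForm m σ s * divDiff m σ s f = f - grpHom m σ s f := by
  rw [divDiff, dif_pos hs]
  exact (corootForm_dvd m σ hs f).choose_spec.symm

lemma eq_divDiff {s : H} (hs : s ∈ reflections σ) {f q : FPS2 m l}
    (hq : corootForm m σ s * q = f - grpHom m σ s f) : q = divDiff m σ s f := by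
  apply mul_left_cancel₀ (corootForm_ne_zero m σ hs)
  rw [hq, corootForm_mul_divDiff m σ hs]

lemma le_order_divDiff {s : H} {f : FPS2 m l} {N : ℕ} (hf : ((N + 1 : ℕ) : ℕ∞) ≤ f.order) :
    (N : ℕ∞) ≤ (divDiff m σ s f).order := by
  by_cases hs : s ∈ reflections σ
  · have h1 := le_order_sub' hf (le_order_grpHom m σ s hf)
    rw [← corootForm_mul_divDiff m σ hs, order_mul, corootForm_order m σ hs, add_comm N 1,
      Nat.cast_add, Nat.cast_one] at h1
    exact (ENat.add_le_add_iff_left (by simp)).1 h1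
  · rw [divDiff, dif_neg hs]; simp

lemma divDiff_mul {s : H} (hs : s ∈ reflections σ) (f g : FPS2 m l) :
    divDiff m σ s (f * g) = f * divDiff m σ s g + divDiff m σ s f * grpHom m σ s g := by
  symm
  apply eq_divDiff m σ hs
  rw [mul_add, mul_left_comm, corootForm_mul_divDiff m σ hs, ← mul_assoc,
    corootForm_mul_divDiff m σ hs, map_mul]
  ring

lemma divDiff_of_invariant {s : H} (hs : s ∈ reflections σ) {f : FPS2 m l}
    (hf : grpHom m σ s f = f) : divDiff m σ s f = 0 := by
  symm
  apply eq_divDiff m σ hs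
  rw [hf]; simp

lemma divDiff_X_inr {s : H} (hs : s ∈ reflections σ) (k : Fin l) :
    divDiff m σ s (X (Sum.inr k)) = C (dualRootVec σ s k) := by
  symm
  apply eq_divDiff m σ hs
  rw [grpHom_X_inr_of_reflection m σ hs, sub_sub_cancel, smul_eq_C_mul, mul_comm]

lemma pderiv_inl_divDiff (s : H) (f : FPS2 m l) (i : Fin m) :
    pderiv ℂ (Sum.inl i) (divDiff m σ s f) = divDiff m σ s (pderiv ℂ (Sum.inl i) f) := by
  by_cases hs : s ∈ reflections σ
  · apply eq_divDiff m σ hs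
    have h := congrArg (pderiv ℂ (Sum.inl i)) (corootForm_mul_divDiff m σ hs f)
    have h0 : pderiv ℂ (Sum.inl i) (corootForm m σ s) = 0 := by
      classical
      rw [corootForm, map_sum]
      apply sum_eq_zero
      intro k _
      rw [Derivation.map_smul, pderiv_X, Pi.single_eq_of_ne (by simp), smul_zero]
    rw [Derivation.leibniz, h0, smul_zero, add_zero, smul_eq_mul, map_sub, pderiv_inl_grpHom] at h
    exact h
  · rw [divDiff, dif_neg hs]; simp

lemma grpHom_corootForm {s : H} (hs : s ∈ reflections σ) (h : H) {μ : ℂ}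
    (hμ : ∀ j, ∑ k, coroot σ (h * s * h⁻¹) k * repMat σ h k j = μ * coroot σ s j) :
    μ • grpHom m σ h (corootForm m σ s) = corootForm m σ (h * s * h⁻¹) := by
  simp only [corootForm, map_sum, map_smul, grpHom_X_inr, smul_sum, smul_smul]
  rw [sum_comm]
  refine sum_congr rfl fun q _ => ?_
  rw [← sum_smul]
  congr 1
  have h1 : Matrix.vecMul (Matrix.vecMul (coroot σ (h * s * h⁻¹)) (repMat σ h))
      (repMat σ h⁻¹) q = coroot σ (h * s * h⁻¹) q := by
    rw [Matrix.vecMul_vecMul, repMat_mul_inv, Matrix.vecMul_one]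
  rw [← h1]
  refine sum_congr rfl fun k _ => ?_
  rw [← mul_assoc, ← hμ]
  rfl

lemma grpHom_divDiff {s : H} (hs : s ∈ reflections σ) (h : H) {μ : ℂ}
    (hμ : ∀ j, ∑ k, coroot σ (h * s * h⁻¹) k * repMat σ h k j = μ * coroot σ s j)
    (f : FPS2 m l) :
    grpHom m σ h (divDiff m σ s f) = μ • divDiff m σ (h * s * h⁻¹) (grpHom m σ h f) := by
  by_cases h0 : μ = 0
  · exfalso
    have := grpHom_corootForm m σ hs h hμ
    rw [h0, zero_smul] at this
    exact corootForm_ne_zero m σ (conj_mem_reflections hs h) this.symm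
  have e : μ⁻¹ • grpHom m σ h (divDiff m σ s f) =
      divDiff m σ (h * s * h⁻¹) (grpHom m σ h f) := by
    apply eq_divDiff m σ (conj_mem_reflections hs h)
    rw [← grpHom_corootForm m σ hs h hμ, smul_mul_smul_comm, mul_inv_cancel₀ h0, one_smul,
      ← map_mul, corootForm_mul_divDiff m σ hs, map_sub, grpHom_grpHom, grpHom_grpHom]
    simp
  rw [← e, smul_smul, mul_inv_cancel₀ h0, one_smul]

/-- The function `c` on the complex reflections in `H` is invariant under conjugation. -/
def IsClassFun (σ : H →* GL (Fin l) ℂ) (c : H → ℂ) : Prop :=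
  ∀ h s : H, IsReflection σ s → c (h * s * h⁻¹) = c s

variable {σ} in
lemma dunklConst_conj {c : H → ℂ} (hc : IsClassFun σ c) {s : H} (hs : s ∈ reflections σ)
    (h : H) : dunklConst σ c (h * s * h⁻¹) = dunklConst σ c s := by
  rw [dunklConst, dunklConst, hc h s (mem_reflections.1 hs)]
  have : reflEigenvalue σ (h * s * h⁻¹) = reflEigenvalue σ s := by
    have h1 := congrArg Matrix.det (repMat_mul_inv σ h)
    rw [Matrix.det_mul, Matrix.det_one] at h1
    rw [reflEigenvalue, reflEigenvalue, repMat_mul, repMat_mul, Matrix.det_mul, Matrix.det_mul,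
      mul_right_comm, h1, one_mul]
  rw [this]

end Reflection

/-! ### The Poincaré–Birkhoff–Witt theorem for `𝒜` -/

section Rels

variable (m) (σ) (c)

lemma mk_rel {a b : FreeAlgebra ℂ (Gen m l H)} (h : Rel m σ c a b) :
    RingQuot.mkAlgHom ℂ (Rel m σ c) a = RingQuot.mkAlgHom ℂ (Rel m σ c) b :=
  RingQuot.mkAlgHom_rel ℂ h

/-- The subalgebra `ℂ⟦x, y⟧` of `𝒜`. -/
def fnHom : FPS2 m l →ₐ[ℂ] HCAlg m σ c where
  toFun f := el m σ c (.fn f)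
  map_one' := by
    have := mk_rel m σ c (.fn_scalar 1)
    simpa [el] using this
  map_mul' f g := by simpa [el] using mk_rel m σ c (.fn_mul f g)
  map_zero' := by simpa [el] using mk_rel m σ c (.fn_scalar 0)
  map_add' f g := by simpa [el] using mk_rel m σ c (.fn_add f g)
  commutes' a := by
    have := mk_rel m σ c (.fn_scalar a)
    simpa [el, MvPowerSeries.algebraMap_apply] using this

/-- The derivation `∂/∂xᵢ` in `𝒜`. -/
def dxA (i : Fin m) : HCAlg m σ c := el m σ c (.dx i)

/-- The basis vector `u_j` in `𝒜`. -/
def vecA (j : Fin l) : HCAlg m σ c := el m σ c (.vec j)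

/-- The group elements in `𝒜`. -/
def grpA : H →* HCAlg m σ c where
  toFun h := el m σ c (.grp h)
  map_one' := by simpa [el] using mk_rel m σ c .grp_one
  map_mul' h k := by simpa [el] using mk_rel m σ c (.grp_mul h k)

lemma el_fn (f : FPS2 m l) : el m σ c (.fn f) = fnHom m σ c f := rfl

lemma grpA_mul_fn (h : H) (f : FPS2 m l) :
    grpA m σ c h * fnHom m σ c f = fnHom m σ c (grpHom m σ h f) * grpA m σ c h := by
  have := mk_rel m σ c (.grp_fn h f)
  rw [grpAct_eq] at this
  simp only [map_mul] at this
  exact this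

lemma grpA_mul_dx (h : H) (i : Fin m) :
    grpA m σ c h * dxA m σ c i = dxA m σ c i * grpA m σ c h := by
  have := mk_rel m σ c (.grp_dx h i)
  simp only [map_mul] at this
  exact this

lemma grpA_mul_vec (h : H) (j : Fin l) :
    grpA m σ c h * vecA m σ c j = (∑ k, repMat σ h k j • vecA m σ c k) * grpA m σ c h := by
  have := mk_rel m σ c (.grp_vec h j)
  simp only [map_mul, map_sum, map_smul] at this
  exact this

lemma dxA_comm (i j : Fin m) : dxA m σ c i * dxA m σ c j = dxA m σ c j * dxA m σ c i := by
  have := mk_rel m σ c (.dx_dx i j)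
  simp only [map_mul] at this
  exact this

lemma dxA_mul_vec (i : Fin m) (j : Fin l) :
    dxA m σ c i * vecA m σ c j = vecA m σ c j * dxA m σ c i := by
  have := mk_rel m σ c (.dx_vec i j)
  simp only [map_mul] at this
  exact this

lemma dxA_mul_fn (i : Fin m) (f : FPS2 m l) : dxA m σ c i * fnHom m σ c f =
      fnHom m σ c f * dxA m σ c i + fnHom m σ c (pderiv ℂ (Sum.inl i) f) := by
  have := mk_rel m σ c (.dx_fn i f)
  simp only [map_mul, map_add] at this
  exact this

lemma vecA_comm (i j : Fin l) : vecA m σ c i * vecA m σ c j = vecA m σ c j * vecA m σ c i := by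
  have := mk_rel m σ c (.vec_vec i j)
  simp only [map_mul] at this
  exact this

lemma vecA_mul_fn (j : Fin l) (f : FPS2 m l) : vecA m σ c j * fnHom m σ c f =
      fnHom m σ c f * vecA m σ c j + fnHom m σ c (pderiv ℂ (Sum.inr j) f) -
        ∑ s ∈ reflections σ, (dunklConst σ c s * coroot σ s j) •
          (fnHom m σ c (divDiff m σ s f) * grpA m σ c s) := by
  have := mk_rel m σ c (.vec_fn j f (fun s => divDiff m σ s f) fun s hs => by
    rw [corootForm_mul_divDiff m σ hs, grpAct_eq])
  simp only [map_mul, map_sum, map_smul, map_add, map_sub] at this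
  exact this

variable {m σ c} in
/-- A subalgebra that contains the generators is everything. -/
lemma HCAlg.mem_of_generators (S : Subalgebra ℂ (HCAlg m σ c)) (h1 : ∀ f, fnHom m σ c f ∈ S)
    (h2 : ∀ i, dxA m σ c i ∈ S) (h3 : ∀ j, vecA m σ c j ∈ S) (h4 : ∀ h, grpA m σ c h ∈ S)
    (a : HCAlg m σ c) : a ∈ S := by
  obtain ⟨a, rfl⟩ := RingQuot.mkAlgHom_surjective ℂ (Rel m σ c) a
  induction a using FreeAlgebra.induction with
  | grade0 r => rw [AlgHom.commutes]; exact S.algebraMap_mem r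
  | grade1 a =>
    cases a with
    | fn f => exact h1 f
    | dx i => exact h2 i
    | vec j => exact h3 j
    | grp h => exact h4 h
  | mul a b ha hb => rw [map_mul]; exact S.mul_mem ha hb
  | add a b ha hb => rw [map_add]; exact S.add_mem ha hb

/-- Homomorphisms out of `𝒜`, given by images of the generators that satisfy the relations. -/
lemma exists_lift {B : Type*} [Ring B] [Algebra ℂ B] (F : FPS2 m l →ₐ[ℂ] B) (D : Fin m → B)
    (U : Fin l → B) (K : H →* B)
    (h1 : ∀ h f, K h * F f = F (grpHom m σ h f) * K h)
    (h2 : ∀ h i, K h * D i = D i * K h)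
    (h3 : ∀ h j, K h * U j = (∑ k, repMat σ h k j • U k) * K h)
    (h4 : ∀ i j, D i * D j = D j * D i)
    (h5 : ∀ i j, D i * U j = U j * D i)
    (h6 : ∀ i f, D i * F f = F f * D i + F (pderiv ℂ (Sum.inl i) f))
    (h7 : ∀ i j, U i * U j = U j * U i)
    (h8 : ∀ j f, U j * F f = F f * U j + F (pderiv ℂ (Sum.inr j) f) -
      ∑ s ∈ reflections σ, (dunklConst σ c s * coroot σ s j) • (F (divDiff m σ s f) * K s)) :
    ∃ φ : HCAlg m σ c →ₐ[ℂ] B, (∀ f, φ (fnHom m σ c f) = F f) ∧ (∀ i, φ (dxA m σ c i) = D i) ∧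
      (∀ j, φ (vecA m σ c j) = U j) ∧ ∀ h, φ (grpA m σ c h) = K h := by
  let G : Gen m l H → B := fun a => match a with
    | .fn f => F f
    | .dx i => D i
    | .vec j => U j
    | .grp h => K h
  have hrel : ∀ ⦃a b⦄, Rel m σ c a b → FreeAlgebra.lift ℂ G a = FreeAlgebra.lift ℂ G b := by
    intro a b hab
    cases hab with
    | fn_scalar a =>
      have := F.commutes a
      rw [MvPowerSeries.algebraMap_apply] at this
      simpa [G] using this
    | fn_add f g => simp [G]
    | fn_mul f g => simp [G]
    | grp_one => simp [G]
    | grp_mul h k => simp [G]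
    | grp_fn h f => simpa [G, grpAct_eq] using h1 h f
    | grp_dx h i => simpa [G] using h2 h i
    | grp_vec h j => simpa [G] using h3 h j
    | dx_dx i j => simpa [G] using h4 i j
    | dx_vec i j => simpa [G] using h5 i j
    | dx_fn i f => simpa [G] using h6 i f
    | vec_vec i j => simpa [G] using h7 i j
    | vec_fn j f q hq =>
      have e : ∀ s ∈ reflections σ, (dunklConst σ c s * coroot σ s j) • (F (q s) * K s) =
          (dunklConst σ c s * coroot σ s j) • (F (divDiff m σ s f) * K s) := by
        intro s hs
        have e0 : q s = divDiff m σ s f := eq_divDiff m σ hs (by rw [hq s hs, grpAct_eq])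
        rw [e0]
      have := h8 j f
      rw [← sum_congr rfl e] at this
      simpa [G] using this
  refine ⟨RingQuot.liftAlgHom ℂ ⟨FreeAlgebra.lift ℂ G, hrel⟩, ?_, ?_, ?_, ?_⟩
  · intro f
    change RingQuot.liftAlgHom ℂ ⟨_, hrel⟩ (RingQuot.mkAlgHom ℂ _ _) = _
    rw [RingQuot.liftAlgHom_mkAlgHom_apply, FreeAlgebra.lift_ι_apply]
  · intro f
    change RingQuot.liftAlgHom ℂ ⟨_, hrel⟩ (RingQuot.mkAlgHom ℂ _ _) = _
    rw [RingQuot.liftAlgHom_mkAlgHom_apply, FreeAlgebra.lift_ι_apply]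
  · intro f
    change RingQuot.liftAlgHom ℂ ⟨_, hrel⟩ (RingQuot.mkAlgHom ℂ _ _) = _
    rw [RingQuot.liftAlgHom_mkAlgHom_apply, FreeAlgebra.lift_ι_apply]
  · intro f
    change RingQuot.liftAlgHom ℂ ⟨_, hrel⟩ (RingQuot.mkAlgHom ℂ _ _) = _
    rw [RingQuot.liftAlgHom_mkAlgHom_apply, FreeAlgebra.lift_ι_apply]

end Rels

section Verma

open TensorProduct

variable (m) (σ) (c)

/-- The algebra `ℂ[∂, u]`. -/
abbrev Sym (m l : ℕ) : Type := MvPolynomial (Fin m ⊕ Fin l) ℂ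

/-- The left regular representation of `ℂ[∂, u] ⋊ H`, with basis `∂^α u^J h`. -/
abbrev RegRep (m l : ℕ) (H : Type*) : Type _ := Sym m l ⊗[ℂ] (H →₀ ℂ)

/-- The action of `H` on `ℂ[∂, u]`. -/
def symAct (h : H) : Sym m l →ₐ[ℂ] Sym m l :=
  aeval (Sum.elim (fun i => MvPolynomial.X (Sum.inl i))
    (fun j => ∑ k, repMat σ h k j • MvPolynomial.X (Sum.inr k)))

lemma symAct_mul (h k : H) (p : Sym m l) :
    symAct m σ (h * k) p = symAct m σ h (symAct m σ k p) := by
  have : symAct m σ (h * k) = (symAct m σ h).comp (symAct m σ k) := by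
    apply MvPolynomial.algHom_ext
    rintro (i | j)
    · simp [symAct]
    · simp only [symAct, AlgHom.comp_apply, aeval_X, Sum.elim_inr, map_sum, map_smul,
        smul_sum, smul_smul]
      rw [sum_comm]
      refine sum_congr rfl fun q _ => ?_
      rw [← sum_smul, repMat_mul, mul_apply]
      congr 1
      exact sum_congr rfl fun _ _ => mul_comm _ _
  rw [this]; rfl

lemma symAct_one (p : Sym m l) : symAct m σ (1 : H) p = p := by
  have : symAct m σ (1 : H) = AlgHom.id ℂ _ := by
    apply MvPolynomial.algHom_ext
    rintro (i | j)
    · simp [symAct]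
    · simp [symAct, repMat_one, one_apply]
  rw [this]; rfl

/-- The action of `h` on `ℂ[∂, u] ⋊ H`. -/
def regGrp (h : H) : RegRep m l H →ₗ[ℂ] RegRep m l H :=
  TensorProduct.map (symAct m σ h).toLinearMap (Finsupp.lmapDomain ℂ ℂ (fun k => h * k))

/-- Multiplication by a polynomial in `∂, u` from the left. -/
def regMul (p : Sym m l) : RegRep m l H →ₗ[ℂ] RegRep m l H :=
  TensorProduct.map (mulLeft ℂ p) LinearMap.id

lemma regGrp_mul (h k : H) (e : RegRep m l H) :
    regGrp m σ (h * k) e = regGrp m σ h (regGrp m σ k e) := by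
  have : regGrp m σ (h * k) = regGrp m σ h ∘ₗ regGrp m σ k := by
    rw [regGrp, regGrp, regGrp, ← TensorProduct.map_comp]
    congr 1
    · ext p
      simp [symAct_mul]
    · ext x : 2
      simp [mul_assoc]
  rw [this]; rfl

lemma regGrp_one (e : RegRep m l H) : regGrp m σ (1 : H) e = e := by
  have : regGrp m σ (1 : H) = LinearMap.id := by
    rw [regGrp, ← TensorProduct.map_id]
    congr 1
    · ext p
      simp [symAct_one]
    · ext x : 2
      simp
  rw [this]; rfl

lemma regMul_regMul (p q : Sym m l) (e : RegRep m l H) :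
    regMul m p (regMul m q e) = regMul m (p * q) e := by
  have : regMul (H := H) m (p * q) = regMul m p ∘ₗ regMul m q := by
    rw [regMul, regMul, regMul, ← TensorProduct.map_comp]
    congr 1
    ext x
    simp [mul_assoc]
  rw [this]; rfl

lemma regMul_comm (p q : Sym m l) (e : RegRep m l H) :
    regMul m p (regMul m q e) = regMul m q (regMul m p e) := by
  rw [regMul_regMul, regMul_regMul, mul_comm]

lemma regGrp_regMul (h : H) (p : Sym m l) (e : RegRep m l H) :
    regGrp m σ h (regMul m p e) = regMul m (symAct m σ h p) (regGrp m σ h e) := by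
  have : regGrp m σ h ∘ₗ regMul m p = regMul m (symAct m σ h p) ∘ₗ regGrp m σ h := by
    rw [regMul, regMul, regGrp, ← TensorProduct.map_comp, ← TensorProduct.map_comp]
    congr 1
    ext x
    simp
  exact LinearMap.congr_fun this e

lemma regMul_sum_smul {ι : Type*} (s : Finset ι) (a : ι → ℂ) (p : ι → Sym m l) (e : RegRep m l H) :
    regMul m (∑ i ∈ s, a i • p i) e = ∑ i ∈ s, a i • regMul m (p i) e := by
  have : ∀ q : Sym m l, regMul m q e =
      (TensorProduct.mapBilinear (RingHom.id ℂ) _ _ _ _ (LinearMap.mul ℂ (Sym m l) q)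
        (LinearMap.id : (H →₀ ℂ) →ₗ[ℂ] _)) e := fun q => rfl
  simp only [this, map_sum, map_smul, LinearMap.sum_apply, LinearMap.smul_apply]

/-- The left regular representation of `𝒜`, as the module induced from `ℂ[∂, u] ⋊ H`. -/
abbrev Verma (m l : ℕ) (H : Type*) : Type _ := FPS2 m l ⊗[ℂ] RegRep m l H

/-- Multiplication by a function. -/
def vFn : FPS2 m l →ₐ[ℂ] Module.End ℂ (Verma m l H) :=
  AlgHom.ofLinearMap
    { toFun := fun f => TensorProduct.map (mulLeft ℂ f) LinearMap.id
      map_add' := fun f g => by ext a e; simp [add_mul, add_tmul]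
      map_smul' := fun r f => by ext a e; simp [smul_tmul'] }
    (by ext a e; simp)
    (fun f g => by ext a e; simp [mul_assoc])

lemma vFn_tmul (f g : FPS2 m l) (e : RegRep m l H) : vFn m f (g ⊗ₜ e) = (f * g) ⊗ₜ e := rfl

/-- The action of `H`. -/
def vGrp : H →* Module.End ℂ (Verma m l H) where
  toFun h := TensorProduct.map (grpHom m σ h).toLinearMap (regGrp m σ h)
  map_one' := by
    apply ext'
    intro f e
    simp [grpHom_one, regGrp_one]
  map_mul' h k := by
    apply ext'
    intro f e
    simp [grpHom_grpHom, regGrp_mul]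

lemma vGrp_tmul (h : H) (f : FPS2 m l) (e : RegRep m l H) :
    vGrp m σ h (f ⊗ₜ e) = grpHom m σ h f ⊗ₜ regGrp m σ h e := rfl

/-- The action of `∂/∂xᵢ`. -/
def vDx (i : Fin m) : Module.End ℂ (Verma m l H) :=
  TensorProduct.map (pderiv ℂ (Sum.inl i)).toLinearMap LinearMap.id +
    TensorProduct.map LinearMap.id (regMul m (MvPolynomial.X (Sum.inl i)))

lemma vDx_tmul (i : Fin m) (f : FPS2 m l) (e : RegRep m l H) :
    vDx m i (f ⊗ₜ e) = pderiv ℂ (Sum.inl i) f ⊗ₜ e +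
      f ⊗ₜ regMul m (MvPolynomial.X (Sum.inl i)) e := rfl

/-- The action of `u_j`, by a Dunkl operator. -/
def vVec (j : Fin l) : Module.End ℂ (Verma m l H) :=
  TensorProduct.map (pderiv ℂ (Sum.inr j)).toLinearMap LinearMap.id +
    TensorProduct.map LinearMap.id (regMul m (MvPolynomial.X (Sum.inr j))) -
    ∑ s ∈ reflections σ, (dunklConst σ c s * coroot σ s j) •
      TensorProduct.map (divDiff m σ s) (regGrp m σ s)

lemma vVec_tmul (j : Fin l) (f : FPS2 m l) (e : RegRep m l H) :
    vVec m σ c j (f ⊗ₜ e) = pderiv ℂ (Sum.inr j) f ⊗ₜ e +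
      f ⊗ₜ regMul m (MvPolynomial.X (Sum.inr j)) e -
      ∑ s ∈ reflections σ, (dunklConst σ c s * coroot σ s j) •
        (divDiff m σ s f ⊗ₜ regGrp m σ s e) := by
  simp [vVec, LinearMap.sum_apply]

lemma vGrp_vFn (h : H) (f : FPS2 m l) :
    vGrp m σ h * vFn m f = vFn m (grpHom m σ h f) * vGrp m σ h := by
  apply ext'
  intro g e
  simp [vGrp_tmul, vFn_tmul]

lemma vGrp_vDx (h : H) (i : Fin m) : vGrp m σ h * vDx m i = vDx m i * vGrp m σ h := by
  apply ext'
  intro g e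
  simp [vGrp_tmul, vDx_tmul, pderiv_inl_grpHom, regGrp_regMul, symAct]

lemma vGrp_vVec (hc : IsClassFun σ c) (h : H) (j : Fin l) :
    vGrp m σ h * vVec m σ c j = (∑ k, repMat σ h k j • vVec m σ c k) * vGrp m σ h := by
  apply ext'
  intro f e
  have h1 : regGrp m σ h (regMul m (MvPolynomial.X (Sum.inr j)) e) =
      ∑ k, repMat σ h k j • regMul m (MvPolynomial.X (Sum.inr k)) (regGrp m σ h e) := by
    rw [regGrp_regMul, ← regMul_sum_smul]
    simp [symAct]
  have h2 : ∑ s ∈ reflections σ, (dunklConst σ c s * coroot σ s j) •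
      (grpHom m σ h (divDiff m σ s f) ⊗ₜ[ℂ] regGrp m σ h (regGrp m σ s e)) =
      ∑ k, repMat σ h k j • ∑ s ∈ reflections σ, (dunklConst σ c s * coroot σ s k) •
        (divDiff m σ s (grpHom m σ h f) ⊗ₜ[ℂ] regGrp m σ s (regGrp m σ h e)) := by
    simp only [smul_sum, smul_smul]
    rw [sum_comm]
    refine Finset.sum_bij' (fun s _ => h * s * h⁻¹) (fun s _ => h⁻¹ * s * h)
      (fun s hs => conj_mem_reflections hs h)
      (fun s hs => by simpa using conj_mem_reflections hs h⁻¹)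
      (fun s _ => by group) (fun s _ => by group) ?_
    intro s hs
    obtain ⟨μ, -, hμ⟩ := exists_coroot_conj hs h
    rw [grpHom_divDiff m σ hs h hμ, ← regGrp_mul, ← regGrp_mul, inv_mul_cancel_right,
      ← sum_smul, dunklConst_conj hc hs, ← smul_tmul', smul_smul]
    have e : dunklConst σ c s * coroot σ s j * μ =
        ∑ k, repMat σ h k j * (dunklConst σ c s * coroot σ (h * s * h⁻¹) k) := by
      rw [mul_assoc, mul_comm (coroot σ s j), ← hμ, mul_sum]
      exact sum_congr rfl fun k _ => by ring
    rw [e]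
  simp only [Module.End.mul_apply, vVec_tmul, vGrp_tmul, map_add, map_sub, map_sum, map_smul,
    LinearMap.sum_apply, LinearMap.smul_apply, smul_add, smul_sub, sum_add_distrib,
    sum_sub_distrib]
  rw [h2, h1, grpHom_pderiv_inr, sum_tmul, tmul_sum]
  simp only [smul_tmul', tmul_smul]

lemma pderiv_pderiv_comm {τ : Type*} (i j : τ) (f : MvPowerSeries τ ℂ) :
    pderiv ℂ i (pderiv ℂ j f) = pderiv ℂ j (pderiv ℂ i f) := by
  classical
  ext d
  simp only [coeff_pderiv, add_right_comm d, Finsupp.add_apply]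
  by_cases hij : i = j
  · subst hij; rfl
  · rw [single_eq_of_ne (Ne.symm hij), single_eq_of_ne hij]
    push_cast; ring

lemma vDx_comm (i j : Fin m) : vDx (l := l) (H := H) m i * vDx m j = vDx m j * vDx m i := by
  apply ext'
  intro f e
  simp only [Module.End.mul_apply, vDx_tmul, map_add, pderiv_pderiv_comm (Sum.inl i), regMul_comm m (MvPolynomial.X (Sum.inl i))]
  abel

lemma vDx_vVec (i : Fin m) (j : Fin l) : vDx m i * vVec m σ c j = vVec m σ c j * vDx m i := by
  apply ext'
  intro f e
  have h2 : ∀ s, regGrp m σ s (regMul m (MvPolynomial.X (Sum.inl i)) e) =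
      regMul m (MvPolynomial.X (Sum.inl i)) (regGrp m σ s e) := by
    intro s
    rw [regGrp_regMul]; simp [symAct]
  simp only [Module.End.mul_apply, vDx_tmul, vVec_tmul, map_add, map_sub, map_sum, map_smul,
    pderiv_pderiv_comm (Sum.inl i) (Sum.inr j), regMul_comm m (MvPolynomial.X (Sum.inl i)) (MvPolynomial.X (Sum.inr j)), h2,
    pderiv_inl_divDiff, smul_add, sum_add_distrib]
  abel

lemma vDx_vFn (i : Fin m) (f : FPS2 m l) :
    vDx (H := H) m i * vFn m f = vFn m f * vDx m i + vFn m (pderiv ℂ (Sum.inl i) f) := by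
  apply ext'
  intro g e
  simp only [Module.End.mul_apply, LinearMap.add_apply, vDx_tmul, vFn_tmul, map_add,
    Derivation.leibniz, smul_eq_mul, add_tmul]
  rw [mul_comm g]
  abel

lemma vVec_vFn (j : Fin l) (f : FPS2 m l) :
    vVec m σ c j * vFn m f = vFn m f * vVec m σ c j + vFn m (pderiv ℂ (Sum.inr j) f) -
      ∑ s ∈ reflections σ, (dunklConst σ c s * coroot σ s j) •
        (vFn m (divDiff m σ s f) * vGrp m σ s) := by
  apply ext'
  intro g e
  simp only [Module.End.mul_apply, LinearMap.add_apply, LinearMap.sub_apply, LinearMap.sum_apply,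
    LinearMap.smul_apply, vVec_tmul, vFn_tmul, vGrp_tmul, map_add, map_sub, map_sum, map_smul,
    Derivation.leibniz, smul_eq_mul, add_tmul]
  rw [sum_congr rfl fun s hs => by
    rw [divDiff_mul m σ hs, add_tmul, smul_add], sum_add_distrib, mul_comm g]
  abel

lemma vVec_vFn_X_inl (j : Fin l) (i : Fin m) :
    vVec m σ c j * vFn m (X (Sum.inl i)) = vFn m (X (Sum.inl i)) * vVec m σ c j := by
  rw [vVec_vFn, sum_eq_zero]
  · rw [pderiv_X_of_ne (by simp), map_zero, add_zero]
    exact sub_zero (vFn (H := H) m (X (Sum.inl i)) * vVec m σ c j)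
  · intro s hs
    rw [divDiff_of_invariant m σ hs (grpHom_X_inl m σ s i), map_zero, zero_mul, smul_zero]

lemma vVec_vFn_X_inr (j : Fin l) (k : Fin l) :
    vVec m σ c j * vFn m (X (Sum.inr k)) = vFn m (X (Sum.inr k)) * vVec m σ c j +
      algebraMap ℂ _ (if j = k then 1 else 0) -
      ∑ s ∈ reflections σ, (dunklConst σ c s * coroot σ s j * dualRootVec σ s k) • vGrp m σ s := by
  classical
  rw [vVec_vFn]
  congr 1
  · congr 1
    rw [pderiv_X]
    by_cases hk : j = k
    · subst hk; simp
    · rw [Pi.single_eq_of_ne (by simpa using Ne.symm hk), if_neg hk]; simp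
  · refine sum_congr rfl fun s hs => ?_
    rw [divDiff_X_inr m σ hs, c_eq_algebraMap, AlgHom.commutes, ← Algebra.smul_def, smul_smul]

lemma smul_sum_single_sub {B ι : Type*} [Ring B] [Algebra ℂ B] [Fintype ι] [DecidableEq ι]
    (r a : ι → ℂ) (v : ι → B) (j : ι) :
    (∑ k, ((if k = j then 1 else 0) - r k * a j) • v k) = v j - a j • ∑ k, r k • v k := by
  simp [sub_smul, sum_sub_distrib, smul_sum, smul_smul, mul_comm (a j)]

lemma mul_eq_mul_add_of_mul_eq {B : Type*} [Ring B] [Algebra ℂ B] {g v w : B} {r : ℂ}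
    (h : g * v = (v - r • w) * g) : v * g = g * v + r • (w * g) := by
  rw [h, sub_mul, smul_mul_assoc]; abel

/-- `[u_j, s] = (u_j, α_s) · c · s` for a reflection `s` with `1 - s = c ⊗ α_s`. -/
lemma vVec_vGrp (hc : IsClassFun σ c) {s : H} (hs : s ∈ reflections σ) (j : Fin l) :
    vVec m σ c j * vGrp m σ s = vGrp m σ s * vVec m σ c j +
      coroot σ s j • ((∑ k, rootVec σ s k • vVec m σ c k) * vGrp m σ s) := by
  refine mul_eq_mul_add_of_mul_eq (B := Module.End ℂ (Verma m l H)) ?_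
  have h1 := vGrp_vVec m σ c hc s j
  simp only [repMat_apply_of_reflection hs] at h1
  rw [smul_sum_single_sub (rootVec σ s) (coroot σ s) (vVec m σ c) j] at h1
  exact h1

/-- If the commutators of `a` and `b` with `x` are those of Dunkl operators with a coordinate
function, then `[a, b]` commutes with `x`. -/
lemma commutator_mul_comm {B ι : Type*} [Ring B] [Algebra ℂ B] (R : Finset ι) (a b x : B)
    (g w : ι → B) (pa pb : ℂ) (r p q : ι → ℂ)
    (ha : a * x = x * a + algebraMap ℂ B pa - ∑ s ∈ R, (r s * p s) • g s)
    (hb : b * x = x * b + algebraMap ℂ B pb - ∑ s ∈ R, (r s * q s) • g s)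
    (hag : ∀ s ∈ R, a * g s = g s * a + p s • w s)
    (hbg : ∀ s ∈ R, b * g s = g s * b + q s • w s) :
    (a * b - b * a) * x = x * (a * b - b * a) := by
  have key : ∀ (a b : B) (pa pb : ℂ) (p q : ι → ℂ)
      (_ : a * x = x * a + algebraMap ℂ B pa - ∑ s ∈ R, (r s * p s) • g s)
      (_ : b * x = x * b + algebraMap ℂ B pb - ∑ s ∈ R, (r s * q s) • g s)
      (_ : ∀ s ∈ R, a * g s = g s * a + p s • w s),
      a * b * x = x * (a * b) + (pa • b + pb • a) -
        ∑ s ∈ R, ((r s * p s) • (g s * b) + (r s * q s) • (g s * a)) -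
        ∑ s ∈ R, (r s * (p s * q s)) • w s := by
    intro a b pa pb p q ha hb hag
    have e : ∀ s ∈ R, a * ((r s * q s) • g s) =
        (r s * q s) • (g s * a) + (r s * (p s * q s)) • w s := by
      intro s hs
      rw [mul_smul_comm, hag s hs, smul_add, smul_smul]
      congr 2; ring
    rw [mul_assoc, hb, mul_sub, mul_add, ← mul_assoc a x, ha, mul_sum,
      sum_congr rfl e, sub_mul, add_mul, sum_mul, sum_add_distrib,
      ← Algebra.commutes (R := ℂ), ← Algebra.smul_def, ← Algebra.smul_def,
      sum_add_distrib]
    simp only [smul_mul_assoc, mul_assoc]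
    abel
  have k1 := key a b pa pb p q ha hb hag
  have k2 := key b a pb pa q p hb ha hbg
  simp only [mul_comm (q _) (p _)] at k2
  rw [sub_mul, mul_sub, k1, k2, sum_add_distrib, sum_add_distrib]
  abel

lemma commutator_mul_comm_of_commute {B : Type*} [Ring B] {a b x : B} (ha : a * x = x * a)
    (hb : b * x = x * b) : (a * b - b * a) * x = x * (a * b - b * a) :=
  ((Commute.mul_left ha hb).sub_left (Commute.mul_left hb ha))

/-- The elements of order at least `N` in the coefficients. -/
def vFil (N : ℕ) : Submodule ℂ (Verma m l H) :=
  Submodule.span ℂ {n | ∃ (f : FPS2 m l) (e : RegRep m l H), (N : ℕ∞) ≤ f.order ∧ n = f ⊗ₜ e}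

lemma tmul_mem_vFil {N : ℕ} {f : FPS2 m l} (hf : (N : ℕ∞) ≤ f.order) (e : RegRep m l H) :
    f ⊗ₜ e ∈ vFil m N := subset_span ⟨f, e, hf, rfl⟩

lemma vVec_mem_vFil {N : ℕ} {n : Verma m l H} (hn : n ∈ vFil m (N + 1)) (j : Fin l) :
    vVec m σ c j n ∈ vFil m N := by
  induction hn using span_induction with
  | mem n hn =>
    obtain ⟨f, e, hf, rfl⟩ := hn
    rw [vVec_tmul]
    refine Submodule.sub_mem _ (Submodule.add_mem _ ?_ ?_) (Submodule.sum_mem _ fun s _ => ?_)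
    · exact tmul_mem_vFil m (le_order_pderiv _ hf) e
    · exact tmul_mem_vFil m (le_trans (by exact_mod_cast Nat.le_succ N) hf) _
    · exact smul_mem _ _ (tmul_mem_vFil m (le_order_divDiff m σ hf) _)
  | zero => rw [map_zero]; exact Submodule.zero_mem _
  | add a b _ _ ha hb => rw [map_add]; exact Submodule.add_mem _ ha hb
  | smul r a _ ha => rw [map_smul]; exact smul_mem _ _ ha

/-- The basis `∂^α u^J h` of `ℂ[∂, u] ⋊ H`. -/
def regBasis : Module.Basis (Idx m l H) ℂ (RegRep m l H) :=
  (((MvPolynomial.basisMonomials (Fin m ⊕ Fin l) ℂ).tensorProduct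
    (Finsupp.basisSingleOne : Module.Basis H ℂ (H →₀ ℂ))).reindex
      ((Equiv.prodCongr (Finsupp.sumFinsuppEquivProdFinsupp) (Equiv.refl H)).trans
        (Equiv.prodAssoc _ _ _)))

lemma regBasis_apply (i : Idx m l H) : regBasis m i =
    (MvPolynomial.monomial (sumElim i.1 i.2.1) 1) ⊗ₜ single i.2.2 1 := by
  rw [regBasis, Module.Basis.reindex_apply]
  simp [Module.Basis.tensorProduct_apply]

/-- Coordinates on the regular representation. -/
def vCoord : Verma m l H ≃ₗ[ℂ] (Idx m l H →₀ FPS2 m l) :=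
  by classical exact TensorProduct.equivFinsuppOfBasisRight (regBasis m)

lemma vCoord_tmul (f : FPS2 m l) (e : RegRep m l H) (i : Idx m l H) :
    vCoord m (f ⊗ₜ e) i = (regBasis m).repr e i • f := by
  classical exact TensorProduct.equivFinsuppOfBasisRight_apply_tmul_apply _ _ _ _

lemma eq_zero_of_forall_mem_vFil {n : Verma m l H} (hn : ∀ N, n ∈ vFil m N) : n = 0 := by
  rw [← (vCoord m).map_eq_zero_iff]
  ext i : 1
  apply eq_zero_of_forall_le_order
  intro N
  have h := hn N
  clear hn
  induction h using span_induction with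
  | mem n hn =>
    obtain ⟨f, e, hf, rfl⟩ := hn
    rw [vCoord_tmul]
    exact hf.trans le_order_smul
  | zero => simp
  | add a b _ _ ha hb => rw [map_add, Finsupp.add_apply]; exact le_order_add' ha hb
  | smul r a _ ha => rw [map_smul, Finsupp.smul_apply]; exact ha.trans le_order_smul

/-- Dunkl operators commute. -/
lemma vVec_comm (hc : IsClassFun σ c) (i j : Fin l) :
    vVec m σ c i * vVec m σ c j = vVec m σ c j * vVec m σ c i := by
  set K := vVec m σ c i * vVec m σ c j - vVec m σ c j * vVec m σ c i with hK
  suffices h : K = 0 from sub_eq_zero.1 h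
  -- the commutator `K` commutes with the coordinate functions
  have hX : ∀ a, K * vFn m (X a) = vFn m (X a) * K := by
    rintro (a | k)
    · exact commutator_mul_comm_of_commute (B := Module.End ℂ (Verma m l H)) (vVec_vFn_X_inl m σ c i a) (vVec_vFn_X_inl m σ c j a)
    · refine commutator_mul_comm (reflections σ) (vVec m σ c i) (vVec m σ c j)
        (vFn m (X (Sum.inr k))) (vGrp m σ)
        (fun s => (∑ k, rootVec σ s k • vVec m σ c k) * vGrp m σ s)
        (if i = k then 1 else 0) (if j = k then 1 else 0)
        (fun s => dunklConst σ c s * dualRootVec σ s k) (fun s => coroot σ s i)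
        (fun s => coroot σ s j) ?_ ?_ (fun s hs => vVec_vGrp m σ c hc hs i)
        (fun s hs => vVec_vGrp m σ c hc hs j)
      · rw [vVec_vFn_X_inr]
        simp only [mul_right_comm _ (dualRootVec _ _ _)]
      · rw [vVec_vFn_X_inr]
        simp only [mul_right_comm _ (dualRootVec _ _ _)]
  -- and it kills the vectors `1 ⊗ e`
  have h1 : ∀ e, K ((1 : FPS2 m l) ⊗ₜ e) = 0 := by
    have hv : ∀ (p : Fin l) e, vVec m σ c p ((1 : FPS2 m l) ⊗ₜ e) =
        (1 : FPS2 m l) ⊗ₜ regMul m (MvPolynomial.X (Sum.inr p)) e := by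
      intro p e
      rw [vVec_tmul, sum_eq_zero, (pderiv ℂ _).map_one_eq_zero]
      · simp
      · intro s hs
        rw [divDiff_of_invariant m σ hs (map_one _)]; simp
    intro e
    rw [hK, LinearMap.sub_apply, Module.End.mul_apply, Module.End.mul_apply, hv, hv, hv, hv,
      regMul_comm, sub_self]
  -- hence the vectors `p ⊗ e` for polynomials `p`, and by continuity all vectors
  have hp : ∀ (p : MvPolynomial (Fin m ⊕ Fin l) ℂ) e, K ((p : FPS2 m l) ⊗ₜ e) = 0 := by
    intro p e
    induction p using MvPolynomial.induction_on with
    | C r =>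
      rw [MvPolynomial.coe_C, ← mul_one (C r), ← smul_eq_C_mul, ← smul_tmul',
        map_smul, h1, smul_zero]
    | add p q hp hq => rw [MvPolynomial.coe_add, add_tmul, map_add, hp, hq, add_zero]
    | mul_X p a hp =>
      have := LinearMap.congr_fun (hX a) ((p : FPS2 m l) ⊗ₜ e)
      rw [Module.End.mul_apply, Module.End.mul_apply, hp, map_zero, vFn_tmul] at this
      rw [MvPolynomial.coe_mul, MvPolynomial.coe_X, mul_comm]
      exact this
  apply ext'
  intro f e
  rw [LinearMap.zero_apply]
  apply eq_zero_of_forall_mem_vFil m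
  intro N
  have h2 : K (f ⊗ₜ e) =
      K ((f - (truncTotal (N + 2) f : MvPolynomial (Fin m ⊕ Fin l) ℂ)) ⊗ₜ e) := by
    rw [sub_tmul, map_sub, hp, sub_zero]
  rw [h2, hK]
  have h3 := tmul_mem_vFil m (le_order_sub_truncTotal f (N + 2)) e
  exact Submodule.sub_mem _ (vVec_mem_vFil m σ c (vVec_mem_vFil m σ c h3 j) i)
    (vVec_mem_vFil m σ c (vVec_mem_vFil m σ c h3 i) j)

end Verma

section PBW

open TensorProduct

variable (m) (σ) (c)

lemma vVec_one_tmul (j : Fin l) (e : RegRep m l H) : vVec m σ c j ((1 : FPS2 m l) ⊗ₜ e) =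
      (1 : FPS2 m l) ⊗ₜ regMul m (MvPolynomial.X (Sum.inr j)) e := by
  rw [vVec_tmul, sum_eq_zero, (pderiv ℂ _).map_one_eq_zero]
  · simp
  · intro s hs
    rw [divDiff_of_invariant m σ hs (map_one _)]; simp

/-- The commuting elements `∂ᵢ` and `u_j`. -/
def symGen : Fin m ⊕ Fin l → HCAlg m σ c := Sum.elim (dxA m σ c) (vecA m σ c)

lemma symGen_comm : ∀ a ∈ Set.range (symGen m σ c), ∀ b ∈ Set.range (symGen m σ c),
    a * b = b * a := by
  rintro _ ⟨(i | i), rfl⟩ _ ⟨(j | j), rfl⟩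
  · exact dxA_comm m σ c i j
  · exact dxA_mul_vec m σ c i j
  · exact (dxA_mul_vec m σ c j i).symm
  · exact vecA_comm m σ c i j

/-- The subalgebra `ℂ[∂, u]` of `𝒜`. -/
def symHom : Sym m l →ₐ[ℂ] HCAlg m σ c :=
  letI := Algebra.adjoinCommRingOfComm ℂ (symGen_comm m σ c)
  (Algebra.adjoin ℂ (Set.range (symGen m σ c))).val.comp
    (aeval fun i =>
      (⟨symGen m σ c i, Algebra.subset_adjoin ⟨i, rfl⟩⟩ :
        Algebra.adjoin ℂ (Set.range (symGen m σ c))))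

lemma symHom_X (i : Fin m ⊕ Fin l) : symHom m σ c (MvPolynomial.X i) = symGen m σ c i := by
  letI := Algebra.adjoinCommRingOfComm ℂ (symGen_comm m σ c)
  change (Algebra.adjoin ℂ (Set.range (symGen m σ c))).val (aeval _ _) = _
  rw [aeval_X]; rfl

lemma symHom_monomial (α : Fin m →₀ ℕ) (J : Fin l →₀ ℕ) :
    symHom m σ c (MvPolynomial.monomial (sumElim α J) 1) =
      (List.ofFn fun k => dxA m σ c k ^ α k).prod * (List.ofFn fun j => vecA m σ c j ^ J j).prod := by
  have h : (MvPolynomial.monomial (sumElim α J) 1 : Sym m l) =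
      (List.ofFn fun k => (MvPolynomial.X (Sum.inl k) : Sym m l) ^ α k).prod *
        (List.ofFn fun j => (MvPolynomial.X (Sum.inr j) : Sym m l) ^ J j).prod := by
    rw [List.prod_ofFn, List.prod_ofFn, MvPolynomial.monomial_eq, map_one, one_mul,
      Finsupp.prod_fintype _ _ (fun i => pow_zero _), Fintype.prod_sum_type]
    rfl
  rw [h, map_mul, map_list_prod, map_list_prod, List.map_ofFn, List.map_ofFn]
  congr 3
  · congr 1; funext k
    simp [symHom_X, symGen]
  · congr 1; funext k
    simp [symHom_X, symGen]

lemma grpA_mul_symHom (h : H) (p : Sym m l) :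
    grpA m σ c h * symHom m σ c p = symHom m σ c (symAct m σ h p) * grpA m σ c h := by
  induction p using MvPolynomial.induction_on with
  | C r =>
    rw [← MvPolynomial.algebraMap_eq, AlgHom.commutes, AlgHom.commutes, AlgHom.commutes,
      Algebra.commutes]
  | add p q hp hq => rw [map_add, map_add, map_add, mul_add, add_mul, hp, hq]
  | mul_X p a hp =>
    rw [map_mul, map_mul, map_mul, ← mul_assoc, hp, mul_assoc, mul_assoc]
    congr 1
    rcases a with i | j
    · rw [symHom_X]
      change grpA m σ c h * dxA m σ c i = _
      rw [grpA_mul_dx]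
      simp [symAct, symHom_X, symGen]
    · rw [symHom_X]
      change grpA m σ c h * vecA m σ c j = _
      rw [grpA_mul_vec]
      simp [symAct, symHom_X, symGen]

/-- `p ⊗ k ↦ p k`. -/
def regHom : RegRep m l H →ₗ[ℂ] HCAlg m σ c :=
  TensorProduct.lift ((LinearMap.mul ℂ (HCAlg m σ c)).compl₁₂ (symHom m σ c).toLinearMap
    (Finsupp.linearCombination ℂ (grpA m σ c)))

lemma regHom_tmul (p : Sym m l) (k : H) :
    regHom m σ c (p ⊗ₜ single k 1) = symHom m σ c p * grpA m σ c k := by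
  simp [regHom]

lemma regHom_regMul (p : Sym m l) (e : RegRep m l H) :
    regHom m σ c (regMul m p e) = symHom m σ c p * regHom m σ c e := by
  induction e using TensorProduct.induction_on with
  | zero => simp
  | add a b ha hb => rw [map_add, map_add, map_add, mul_add, ha, hb]
  | tmul q x => simp [regMul, regHom, mul_assoc]

lemma regHom_regGrp (h : H) (e : RegRep m l H) :
    regHom m σ c (regGrp m σ h e) = grpA m σ c h * regHom m σ c e := by
  induction e using TensorProduct.induction_on with
  | zero => simp
  | add a b ha hb => rw [map_add, map_add, map_add, mul_add, ha, hb]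
  | tmul q x =>
    induction x using Finsupp.induction_linear with
    | zero => simp
    | add a b ha hb => simp only [TensorProduct.tmul_add, map_add, ha, hb, mul_add]
    | single k r =>
      rw [← mul_one r, ← smul_eq_mul, ← Finsupp.smul_single, TensorProduct.tmul_smul]
      simp only [map_smul, mul_smul_comm]
      congr 1
      rw [regHom_tmul, regGrp, TensorProduct.map_tmul]
      simp only [AlgHom.toLinearMap_apply, Finsupp.lmapDomain_apply, Finsupp.mapDomain_single]
      rw [regHom_tmul, map_mul, ← mul_assoc, ← mul_assoc, grpA_mul_symHom]

/-- `f ⊗ e ↦ f e`. -/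
def vermaHom : Verma m l H →ₗ[ℂ] HCAlg m σ c :=
  TensorProduct.lift ((LinearMap.mul ℂ (HCAlg m σ c)).compl₁₂ (fnHom m σ c).toLinearMap
    (regHom m σ c))

lemma vermaHom_tmul (f : FPS2 m l) (e : RegRep m l H) :
    vermaHom m σ c (f ⊗ₜ e) = fnHom m σ c f * regHom m σ c e := by
  simp [vermaHom]

/-- The left regular representation of `𝒜`. -/
lemma exists_vermaRep (hc : IsClassFun σ c) : ∃ ρ : HCAlg m σ c →ₐ[ℂ] Module.End ℂ (Verma m l H),
      (∀ f, ρ (fnHom m σ c f) = vFn m f) ∧ (∀ i, ρ (dxA m σ c i) = vDx m i) ∧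
      (∀ j, ρ (vecA m σ c j) = vVec m σ c j) ∧ ∀ h, ρ (grpA m σ c h) = vGrp m σ h := by
  refine exists_lift (B := Module.End ℂ (Verma m l H)) m σ c (vFn m) (vDx m) (vVec m σ c)
    (vGrp m σ) (vGrp_vFn m σ) (vGrp_vDx m σ) (fun h j => ?_) (vDx_comm m) (vDx_vVec m σ c)
    (vDx_vFn m) (vVec_comm m σ c hc) (fun j f => ?_)
  · exact vGrp_vVec m σ c hc h j
  · exact vVec_vFn m σ c j f

/-- The left regular representation of `𝒜` on `ℂ⟦x, y⟧ ⊗ ℂ[∂, u] ⊗ ℂ[H]`. -/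
def vermaRep (hc : IsClassFun σ c) :
    HCAlg m σ c →ₐ[ℂ] Module.End ℂ (Verma m l H) := (exists_vermaRep m σ c hc).choose

variable (hc : IsClassFun σ c)

lemma vermaHom_rep (a : HCAlg m σ c) (n : Verma m l H) :
    vermaHom m σ c (vermaRep m σ c hc a n) = a * vermaHom m σ c n := by
  obtain ⟨h1, h2, h3, h4⟩ := (exists_vermaRep m σ c hc).choose_spec
  let S : Subalgebra ℂ (HCAlg m σ c) :=
    { carrier := {a | ∀ n, vermaHom m σ c (vermaRep m σ c hc a n) = a * vermaHom m σ c n}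
      mul_mem' := fun {a b} ha hb n => by rw [map_mul, Module.End.mul_apply, ha, hb, mul_assoc]
      add_mem' := fun {a b} ha hb n => by
        rw [map_add, LinearMap.add_apply, map_add, ha, hb, add_mul]
      algebraMap_mem' := fun r n => by
        rw [AlgHom.commutes, Module.algebraMap_end_apply, map_smul, Algebra.smul_def] }
  have ext' : ∀ {P Q : Verma m l H →ₗ[ℂ] HCAlg m σ c},
      (∀ f e, P (f ⊗ₜ e) = Q (f ⊗ₜ e)) → ∀ n, P n = Q n := fun h n =>
    LinearMap.congr_fun (TensorProduct.ext' h) n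
  refine HCAlg.mem_of_generators S ?_ ?_ ?_ ?_ a n
  · intro f
    refine ext' (P := vermaHom m σ c ∘ₗ vermaRep m σ c hc (fnHom m σ c f))
      (Q := mulLeft ℂ (fnHom m σ c f) ∘ₗ vermaHom m σ c) fun g e => ?_
    rw [LinearMap.comp_apply, LinearMap.comp_apply, mulLeft_apply, vermaRep, h1,
      vFn_tmul, vermaHom_tmul, vermaHom_tmul, map_mul, mul_assoc]
  · intro i
    refine ext' (P := vermaHom m σ c ∘ₗ vermaRep m σ c hc (dxA m σ c i))
      (Q := mulLeft ℂ (dxA m σ c i) ∘ₗ vermaHom m σ c) fun g e => ?_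
    rw [LinearMap.comp_apply, LinearMap.comp_apply, mulLeft_apply, vermaRep, h2,
      vDx_tmul, map_add, vermaHom_tmul, vermaHom_tmul, vermaHom_tmul, regHom_regMul, symHom_X,
      ← mul_assoc, ← mul_assoc, dxA_mul_fn, add_mul, add_comm]
    rfl
  · intro j
    refine ext' (P := vermaHom m σ c ∘ₗ vermaRep m σ c hc (vecA m σ c j))
      (Q := mulLeft ℂ (vecA m σ c j) ∘ₗ vermaHom m σ c) fun g e => ?_
    rw [LinearMap.comp_apply, LinearMap.comp_apply, mulLeft_apply, vermaRep, h3,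
      vVec_tmul, map_sub, map_add, map_sum]
    simp only [map_smul, vermaHom_tmul, regHom_regMul, regHom_regGrp, symHom_X]
    rw [← mul_assoc, ← mul_assoc, vecA_mul_fn, sub_mul, add_mul, sum_mul]
    simp only [smul_mul_assoc, mul_assoc]
    rw [add_comm (fnHom m σ c _ * _)]
    rfl
  · intro h
    refine ext' (P := vermaHom m σ c ∘ₗ vermaRep m σ c hc (grpA m σ c h))
      (Q := mulLeft ℂ (grpA m σ c h) ∘ₗ vermaHom m σ c) fun g e => ?_
    rw [LinearMap.comp_apply, LinearMap.comp_apply, mulLeft_apply, vermaRep, h4,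
      vGrp_tmul, vermaHom_tmul, vermaHom_tmul, regHom_regGrp, ← mul_assoc, ← mul_assoc,
      grpA_mul_fn]

/-- The cyclic vector of the regular representation. -/
def vacuum : Verma m l H := (1 : FPS2 m l) ⊗ₜ ((1 : Sym m l) ⊗ₜ single (1 : H) 1)

lemma vermaHom_vacuum : vermaHom m σ c (vacuum m) = 1 := by
  rw [vacuum, vermaHom_tmul, regHom_tmul]; simp

lemma vermaRep_symHom (p : Sym m l) (e : RegRep m l H) :
    vermaRep m σ c hc (symHom m σ c p) ((1 : FPS2 m l) ⊗ₜ e) = (1 : FPS2 m l) ⊗ₜ regMul m p e := by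
  obtain ⟨h1, h2, h3, h4⟩ := (exists_vermaRep m σ c hc).choose_spec
  induction p using MvPolynomial.induction_on generalizing e with
  | C r =>
    have := regMul_sum_smul m (Finset.univ : Finset Unit) (fun _ => r) (fun _ => 1) e
    simp only [Finset.univ_unique, Finset.sum_singleton] at this
    have h1 : regMul m (1 : Sym m l) e = e := by
      have := LinearMap.congr_fun (TensorProduct.map_id (R := ℂ) (M := Sym m l) (N := H →₀ ℂ)) e
      rw [regMul, LinearMap.mulLeft_one]; exact this
    rw [← MvPolynomial.algebraMap_eq, Algebra.algebraMap_eq_smul_one, map_smul, map_one, this, h1,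
      map_smul, map_one, TensorProduct.tmul_smul]
    rfl
  | add p q hp hq =>
    rw [map_add, map_add, LinearMap.add_apply, hp, hq, ← TensorProduct.tmul_add]
    congr 1
    have := regMul_sum_smul m (Finset.univ : Finset Bool) (fun _ => 1) (fun b => if b then p else q) e
    simpa using this.symm
  | mul_X p a hp =>
    rw [map_mul, map_mul, Module.End.mul_apply, ← regMul_regMul, ← hp]
    congr 1
    rcases a with i | j
    · rw [symHom_X]
      change vermaRep m σ c hc (dxA m σ c i) _ = _
      rw [vermaRep, h2, vDx_tmul, (pderiv ℂ _).map_one_eq_zero, TensorProduct.zero_tmul, zero_add]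
    · rw [symHom_X]
      change vermaRep m σ c hc (vecA m σ c j) _ = _
      rw [vermaRep, h3, vVec_one_tmul]

lemma vermaRep_vermaHom (n : Verma m l H) :
    vermaRep m σ c hc (vermaHom m σ c n) (vacuum m) = n := by
  obtain ⟨h1, h2, h3, h4⟩ := (exists_vermaRep m σ c hc).choose_spec
  induction n using TensorProduct.induction_on with
  | zero => rw [map_zero, map_zero, LinearMap.zero_apply]
  | add a b ha hb => rw [map_add, map_add, LinearMap.add_apply, ha, hb]
  | tmul f e =>
    have key : vermaRep m σ c hc (regHom m σ c e) (vacuum m) = (1 : FPS2 m l) ⊗ₜ e := by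
      induction e using TensorProduct.induction_on with
      | zero => rw [map_zero, map_zero, LinearMap.zero_apply, TensorProduct.tmul_zero]
      | add a b ha hb => rw [map_add, map_add, LinearMap.add_apply, ha, hb, TensorProduct.tmul_add]
      | tmul p x =>
        induction x using Finsupp.induction_linear with
        | zero => rw [TensorProduct.tmul_zero, map_zero, map_zero, LinearMap.zero_apply,
            TensorProduct.tmul_zero]
        | add a b ha hb => rw [TensorProduct.tmul_add, map_add, map_add, LinearMap.add_apply, ha,
            hb, TensorProduct.tmul_add]
        | single k r =>
          rw [← mul_one r, ← smul_eq_mul, ← Finsupp.smul_single, TensorProduct.tmul_smul, map_smul,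
            map_smul, LinearMap.smul_apply, regHom_tmul, map_mul, Module.End.mul_apply,
            TensorProduct.tmul_smul]
          congr 1
          have : vermaRep m σ c hc (grpA m σ c k) (vacuum m) =
              (1 : FPS2 m l) ⊗ₜ ((1 : Sym m l) ⊗ₜ single k 1) := by
            rw [vermaRep, h4, vacuum, vGrp_tmul, map_one, regGrp, TensorProduct.map_tmul]
            simp
          rw [this, vermaRep_symHom, regMul, TensorProduct.map_tmul]
          simp
    rw [vermaHom_tmul, map_mul, Module.End.mul_apply, key, vermaRep, h1, vFn_tmul, mul_one]

lemma vermaHom_symm_single (i : Idx m l H) (f : FPS2 m l) :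
    vermaHom m σ c ((vCoord m).symm (single i f)) =
      el m σ c (.fn f) * (List.ofFn fun k => el m σ c (.dx k) ^ i.1 k).prod *
        vecMonomial m σ c i.2.1 i.2.2 := by
  have h : (vCoord m).symm (single i f) = f ⊗ₜ regBasis m i := by
    rw [LinearEquiv.symm_apply_eq]
    ext j : 1
    rw [vCoord_tmul, Module.Basis.repr_self]
    by_cases hij : i = j
    · subst hij; simp
    · rw [single_eq_of_ne (Ne.symm hij), single_eq_of_ne (Ne.symm hij), zero_smul]
  rw [h, vermaHom_tmul, regBasis_apply, regHom_tmul, symHom_monomial, vecMonomial, mul_assoc,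
    mul_assoc]
  rfl

lemma vermaHom_symm (F : Idx m l H →₀ FPS2 m l) :
    vermaHom m σ c ((vCoord m).symm F) = expand m σ c F := by
  classical
  rw [expand]
  conv_lhs => rw [← Finsupp.sum_single F]
  rw [Finsupp.sum, map_sum, map_sum, Finsupp.sum]
  exact sum_congr rfl fun i _ => vermaHom_symm_single m σ c i (F i)

/-- **Poincaré–Birkhoff–Witt**: every element of `𝒜` has a unique expansion
`∑ f_{αJh}(x, y) ∂^α u^J h`. -/
def coefs : HCAlg m σ c ≃ₗ[ℂ] (Idx m l H →₀ FPS2 m l) where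
  toFun a := vCoord m (vermaRep m σ c hc a (vacuum m))
  map_add' a b := by rw [map_add, LinearMap.add_apply, map_add]
  map_smul' r a := by rw [map_smul, LinearMap.smul_apply, map_smul]; rfl
  invFun := expand m σ c
  left_inv a := by
    rw [← vermaHom_symm, LinearEquiv.symm_apply_apply, vermaHom_rep, vermaHom_vacuum, mul_one]
  right_inv F := by
    change vCoord m (vermaRep m σ c hc (expand m σ c F) (vacuum m)) = F
    rw [← vermaHom_symm, vermaRep_vermaHom, LinearEquiv.apply_symm_apply]

lemma coefs_symm_apply (F : Idx m l H →₀ FPS2 m l) : (coefs m σ c hc).symm F = expand m σ c F := rfl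

lemma coefs_expand (F : Idx m l H →₀ FPS2 m l) : coefs m σ c hc (expand m σ c F) = F :=
  (coefs m σ c hc).apply_symm_apply F

lemma expand_coefs (a : HCAlg m σ c) : expand m σ c (coefs m σ c hc a) = a :=
  (coefs m σ c hc).symm_apply_apply a

lemma coefs_fn_mul (f : FPS2 m l) (a : HCAlg m σ c) (i : Idx m l H) :
    coefs m σ c hc (fnHom m σ c f * a) i = f * coefs m σ c hc a i := by
  classical
  obtain ⟨h1, h2, h3, h4⟩ := (exists_vermaRep m σ c hc).choose_spec
  change vCoord m (vermaRep m σ c hc (fnHom m σ c f * a) (vacuum m)) i =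
    f * vCoord m (vermaRep m σ c hc a (vacuum m)) i
  rw [map_mul, Module.End.mul_apply]
  generalize vermaRep m σ c hc a (vacuum m) = n
  rw [vermaRep, h1]
  induction n using TensorProduct.induction_on with
  | zero => simp
  | add a b ha hb => rw [map_add, map_add, map_add, Finsupp.add_apply, Finsupp.add_apply, ha, hb,
      mul_add]
  | tmul g e => rw [vFn_tmul, vCoord_tmul, vCoord_tmul, mul_smul_comm]

lemma coefs_injective_iff {a b : HCAlg m σ c} :
    (∀ i, coefs m σ c hc a i = coefs m σ c hc b i) ↔ a = b :=
  ⟨fun h => (coefs m σ c hc).injective (Finsupp.ext h), fun h i => by rw [h]⟩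

/-- A function and monomial as an element of `𝒜`. -/
lemma coefs_monomial (i : Idx m l H) (f : FPS2 m l) :
    coefs m σ c hc (fnHom m σ c f * symHom m σ c (MvPolynomial.monomial
      (sumElim i.1 i.2.1) 1) * grpA m σ c i.2.2) = single i f := by
  rw [← LinearEquiv.eq_symm_apply, coefs_symm_apply, ← vermaHom_symm, vermaHom_symm_single,
    symHom_monomial, vecMonomial, mul_assoc, mul_assoc, mul_assoc]
  rfl

end PBW

/-! ### Commutators with `φ_c(A)` -/

section InX

variable (l)

/-- The inclusion `ℂ⟦x⟧ ⊆ ℂ⟦x, y⟧` as a homomorphism of algebras. -/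
def inXHom : FPS m →ₐ[ℂ] FPS2 m l := rename Sum.inl

lemma inXHom_X (i : Fin m) : inXHom l (X i : FPS m) = X (Sum.inl i) := rename_X _ _

lemma inXHom_C (r : ℂ) : inXHom l (C r : FPS m) = C r := rename_C _ _

lemma le_order_inXHom {N : ℕ} {f : FPS m} (hf : (N : ℕ∞) ≤ f.order) :
    (N : ℕ∞) ≤ (inXHom l f).order := by
  rw [le_order_iff_coeff] at hf ⊢
  intro d hd
  by_cases h : d ∈ Set.range (Finsupp.mapDomain (Sum.inl : Fin m → Fin m ⊕ Fin l))
  · obtain ⟨e, rfl⟩ := h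
    have h := Finsupp.embDomain_eq_mapDomain
      (⟨Sum.inl, Sum.inl_injective⟩ : Fin m ↪ Fin m ⊕ Fin l) e
    have h' := coeff_embDomain_rename (⟨Sum.inl, Sum.inl_injective⟩ : Fin m ↪ Fin m ⊕ Fin l) f e
    rw [h] at h'
    refine h'.trans (hf e ?_)
    rwa [Finsupp.degree_mapDomain] at hd
  · exact coeff_rename_eq_zero _ _ h

lemma inXHom_eq_subst (f : FPS m) :
    inXHom l f = subst (fun i => (X (Sum.inl i) : FPS2 m l)) f := by
  rw [eq_subst_of_map_X (inXHom l) (fun N f => le_order_inXHom l) f]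
  simp only [inXHom_X]

lemma pderiv_inl_inXHom (f : FPS m) (i : Fin m) :
    pderiv ℂ (Sum.inl i) (inXHom l f) = inXHom l (pderiv ℂ i f) := by
  classical
  rw [inXHom_eq_subst, pderiv_subst (fun i => constantCoeff_X _), sum_eq_single i,
    inXHom_eq_subst]
  · simp
  · intro j _ hj
    rw [pderiv_X_of_ne (by simpa using hj)]; simp
  · simp

lemma pderiv_inr_inXHom (f : FPS m) (j : Fin l) : pderiv ℂ (Sum.inr j) (inXHom l f) = 0 := by
  classical
  rw [inXHom_eq_subst, pderiv_subst (fun i => constantCoeff_X _), sum_eq_zero]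
  intro i _
  rw [pderiv_X_of_ne (by simp)]; simp

variable {l} in
lemma grpHom_inXHom {H : Type*} [Group H] [Fintype H] (σ : H →* GL (Fin l) ℂ) (h : H) (f : FPS m) :
    grpHom m σ h (inXHom l f) = inXHom l f := by
  rw [inXHom_eq_subst, grpHom_eq_subst]
  apply subst_algHom_ext (fun i => constantCoeff_X _) (constantCoeff_grpVar m σ h)
  intro i
  rw [← grpHom_eq_subst, grpHom_X_inl]

end InX

section Comm

variable {B : Matrix (Fin l) (Fin l) (FPS m)}

lemma one_sub_repMat_mul (hB : CommutesWith σ B) (s : H) :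
    (1 - repMat σ s).map (C (σ := Fin m)) * B = B * (1 - repMat σ s).map (C (σ := Fin m)) := by
  have : (1 - repMat σ s).map (C (σ := Fin m)) = 1 - (repMat σ s).map (C (σ := Fin m)) := by
    rw [Matrix.map_sub _ (by simp)]
    congr 1
    exact Matrix.map_one _ (map_zero _) (map_one _)
  rw [this, sub_mul, mul_sub, one_mul, mul_one, hB s]

lemma root_coroot_comm (hB : CommutesWith σ B) {s : H} (hs : s ∈ reflections σ) (i j : Fin l) :
    C (rootVec σ s i) * ∑ k, C (coroot σ s k) * B k j =
      (∑ k, B i k * C (rootVec σ s k)) * C (coroot σ s j) := by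
  have h := congrFun (congrFun (one_sub_repMat_mul hB s) i) j
  simp only [mul_apply, map_apply, one_sub_repMat_apply hs, map_mul] at h
  rw [mul_sum, sum_mul]
  simpa only [mul_assoc] using h

lemma trace_one_sub_eq {s : H} (hs : s ∈ reflections σ) :
    (1 - repMat σ s).trace = ∑ i, rootVec σ s i * coroot σ s i :=
  sum_congr rfl fun i _ => one_sub_repMat_apply hs i i

lemma trace_mul_corootScalar {s : H} (hs : s ∈ reflections σ) :
    C ((1 - repMat σ s).trace) * -corootScalar σ B s =
      ∑ i, C (rootVec σ s i) * ∑ k, C (coroot σ s k) * B k i := by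
  have ht := trace_one_sub_ne_zero hs
  rw [corootScalar, neg_smul, neg_neg, smul_eq_C_mul, ← mul_assoc, ← map_mul,
    mul_inv_cancel₀ ht, map_one, one_mul, Matrix.trace]
  refine sum_congr rfl fun i _ => ?_
  simp only [Matrix.diag_apply, mul_apply, map_apply, one_sub_repMat_apply hs,
    map_mul, mul_sum, mul_assoc]

lemma C_trace_ne_zero {s : H} (hs : s ∈ reflections σ) :
    C (σ := Fin m) ((1 - repMat σ s).trace) ≠ 0 :=
  (map_ne_zero_iff _ C_injective).2 (trace_one_sub_ne_zero hs)

/-- A matrix commuting with `s` preserves the line spanned by the coroot. -/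
lemma coroot_mul (hB : CommutesWith σ B) {s : H} (hs : s ∈ reflections σ) (j : Fin l) :
    ∑ k, C (coroot σ s k) * B k j = -corootScalar σ B s * C (coroot σ s j) := by
  apply mul_left_cancel₀ (C_trace_ne_zero hs)
  rw [← mul_assoc, trace_mul_corootScalar hs, sum_mul]
  conv_lhs => rw [trace_one_sub_eq hs, map_sum, sum_mul]
  refine sum_congr rfl fun i _ => ?_
  rw [map_mul, mul_right_comm, root_coroot_comm hB hs, root_coroot_comm hB hs]
  ring

/-- A matrix commuting with `s` preserves the line spanned by the root. -/
lemma mul_rootVec (hB : CommutesWith σ B) {s : H} (hs : s ∈ reflections σ) (i : Fin l) :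
    ∑ k, B i k * C (rootVec σ s k) = -corootScalar σ B s * C (rootVec σ s i) := by
  apply mul_left_cancel₀ (C_trace_ne_zero hs)
  rw [← mul_assoc, trace_mul_corootScalar hs, sum_mul]
  conv_lhs => rw [trace_one_sub_eq hs, map_sum, sum_mul]
  refine sum_congr rfl fun j _ => ?_
  rw [map_mul, mul_comm, mul_comm (C (rootVec σ s j)), ← mul_assoc, ← root_coroot_comm hB hs]
  ring

lemma mul_dualRootVec (hB : CommutesWith σ B) {s : H} (hs : s ∈ reflections σ) (i : Fin l) :
    ∑ k, B i k * C (dualRootVec σ s k) = -corootScalar σ B s * C (dualRootVec σ s i) := by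
  have h : ∀ q, ∑ k, B i k * C (repMat σ s⁻¹ k q) = ∑ k, C (repMat σ s⁻¹ i k) * B k q := by
    intro q
    have := congrFun (congrFun (hB s⁻¹) i) q
    simpa only [mul_apply, map_apply] using this
  simp only [dualRootVec, map_neg, map_sum, map_mul, mul_neg, neg_mul, mul_sum,
    sum_neg_distrib, neg_neg]
  rw [sum_comm]
  simp only [← mul_assoc]
  simp only [← sum_mul, h]
  simp only [sum_mul]
  rw [sum_comm]
  simp only [mul_assoc]
  simp only [← mul_sum, mul_rootVec hB hs]
  rw [← sum_neg_distrib, mul_sum]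
  exact sum_congr rfl fun k _ => by ring

lemma corootScalar_conj (hB : CommutesWith σ B) (h s : H) :
    corootScalar σ B (h * s * h⁻¹) = corootScalar σ B s := by
  have e : 1 - repMat σ (h * s * h⁻¹) = repMat σ h * (1 - repMat σ s) * repMat σ h⁻¹ := by
    rw [repMat_mul, repMat_mul, mul_sub, sub_mul, mul_one, repMat_mul_inv]
  have e1 : (1 - repMat σ (h * s * h⁻¹)).trace = (1 - repMat σ s).trace := by
    rw [e, Matrix.trace_mul_comm, ← mul_assoc, repMat_inv_mul, one_mul]
  have e2 : ((1 - repMat σ (h * s * h⁻¹)).map (C (σ := Fin m)) * B).trace =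
      ((1 - repMat σ s).map (C (σ := Fin m)) * B).trace := by
    rw [e, Matrix.map_mul, Matrix.map_mul, mul_assoc, ← hB h⁻¹, ← mul_assoc, Matrix.trace_mul_comm,
      ← mul_assoc, ← mul_assoc, ← Matrix.map_mul, repMat_inv_mul,
      Matrix.map_one _ (map_zero _) (map_one _), one_mul]
  rw [corootScalar, corootScalar, e1, e2]

lemma corootScalar_add (B B' : 𝕄) (s : H) :
    corootScalar σ (B + B') s = corootScalar σ B s + corootScalar σ B' s := by
  rw [corootScalar, mul_add, Matrix.trace_add, smul_add]; rfl

lemma corootScalar_smul (p : FPS m) (B : 𝕄) (s : H) :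
    corootScalar σ (p • B) s = p * corootScalar σ B s := by
  rw [corootScalar, corootScalar, Matrix.mul_smul, Matrix.trace_smul, smul_eq_mul, mul_smul_comm]

lemma corootScalar_commutator {A : 𝕄} (hA : CommutesWith σ A)
    (s : H) : corootScalar σ (A * B - B * A) s = 0 := by
  rw [corootScalar, mul_sub, Matrix.trace_sub (_ * _), ← mul_assoc, one_sub_repMat_mul hA,
    mul_assoc, Matrix.trace_mul_comm A, mul_assoc, sub_self, smul_zero]

lemma corootScalar_map_pderiv (B : 𝕄) (s : H) (k : Fin m) :
    corootScalar σ (B.map fun p => pderiv ℂ k p) s = pderiv ℂ k (corootScalar σ B s) := by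
  rw [corootScalar, corootScalar, Derivation.map_smul]
  congr 1
  simp only [Matrix.trace, Matrix.diag_apply, mul_apply, map_sum, map_apply,
    Derivation.leibniz, pderiv_C, mul_zero, add_zero, smul_eq_mul]

end Comm

section PhiC

variable (m) (σ) (c)

/-- Elements of an algebra that satisfy the defining relations of `𝒜`: a homomorphism `𝒜 → A`. -/
structure HCRep (A : Type*) [Ring A] [Algebra ℂ A] where
  F : FPS2 m l →ₐ[ℂ] A
  D : Fin m → A
  U : Fin l → A
  K : H →* A
  K_mul_F : ∀ h f, K h * F f = F (grpHom m σ h f) * K h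
  K_mul_D : ∀ h i, K h * D i = D i * K h
  K_mul_U : ∀ h j, K h * U j = (∑ k, repMat σ h k j • U k) * K h
  D_comm : ∀ i j, D i * D j = D j * D i
  D_mul_U : ∀ i j, D i * U j = U j * D i
  D_mul_F : ∀ i f, D i * F f = F f * D i + F (pderiv ℂ (Sum.inl i) f)
  U_comm : ∀ i j, U i * U j = U j * U i
  U_mul_F : ∀ j f, U j * F f = F f * U j + F (pderiv ℂ (Sum.inr j) f) -
    ∑ s ∈ reflections σ, (dunklConst σ c s * coroot σ s j) • (F (divDiff m σ s f) * K s)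

variable {m σ c} in
/-- The generators of `𝒜` itself. -/
def HCRep.univ : HCRep m σ c (HCAlg m σ c) where
  F := fnHom m σ c
  D := dxA m σ c
  U := vecA m σ c
  K := grpA m σ c
  K_mul_F := grpA_mul_fn m σ c
  K_mul_D := grpA_mul_dx m σ c
  K_mul_U := grpA_mul_vec m σ c
  D_comm := dxA_comm m σ c
  D_mul_U := dxA_mul_vec m σ c
  D_mul_F := dxA_mul_fn m σ c
  U_comm := vecA_comm m σ c
  U_mul_F := vecA_mul_fn m σ c

variable {m σ c} {A : Type*} [Ring A] [Algebra ℂ A] (r : HCRep m σ c A)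

lemma HCRep.exists_hom : ∃ φ : HCAlg m σ c →ₐ[ℂ] A, (∀ f, φ (fnHom m σ c f) = r.F f) ∧
    (∀ i, φ (dxA m σ c i) = r.D i) ∧ (∀ j, φ (vecA m σ c j) = r.U j) ∧
    ∀ h, φ (grpA m σ c h) = r.K h :=
  exists_lift m σ c r.F r.D r.U r.K r.K_mul_F r.K_mul_D r.K_mul_U r.D_comm r.D_mul_U r.D_mul_F
    r.U_comm r.U_mul_F

section RingLie

variable {R ι : Type*} [Ring R] [Algebra ℂ R] (a b c : R) (f : ι → R) (s : Finset ι) (z : ℂ)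

lemma lie_mul' : ⁅a, b * c⁆ = ⁅a, b⁆ * c + b * ⁅a, c⁆ := by noncomm_ring [Ring.lie_def]
lemma mul_lie' : ⁅a * b, c⁆ = a * ⁅b, c⁆ + ⁅a, c⁆ * b := by noncomm_ring [Ring.lie_def]
lemma ring_add_lie : ⁅a + b, c⁆ = ⁅a, c⁆ + ⁅b, c⁆ := by noncomm_ring [Ring.lie_def]
lemma ring_lie_add : ⁅a, b + c⁆ = ⁅a, b⁆ + ⁅a, c⁆ := by noncomm_ring [Ring.lie_def]
lemma ring_neg_lie : ⁅-a, b⁆ = -⁅a, b⁆ := by noncomm_ring [Ring.lie_def]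
lemma ring_lie_neg : ⁅a, -b⁆ = -⁅a, b⁆ := by noncomm_ring [Ring.lie_def]
lemma ring_sum_lie : ⁅∑ i ∈ s, f i, b⁆ = ∑ i ∈ s, ⁅f i, b⁆ := by
  simp only [Ring.lie_def, sum_mul, mul_sum, sum_sub_distrib]
lemma ring_lie_sum : ⁅b, ∑ i ∈ s, f i⁆ = ∑ i ∈ s, ⁅b, f i⁆ := by
  simp only [Ring.lie_def, sum_mul, mul_sum, sum_sub_distrib]
lemma ring_smul_lie : ⁅z • a, b⁆ = z • ⁅a, b⁆ := by simp [Ring.lie_def, smul_sub]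
lemma ring_lie_smul : ⁅a, z • b⁆ = z • ⁅a, b⁆ := by simp [Ring.lie_def, smul_sub]
variable {a b} in
lemma lie_eq_zero_of_comm (h : a * b = b * a) : ⁅a, b⁆ = 0 := by rw [Ring.lie_def, h, sub_self]

end RingLie

namespace HCRep

/-- The subalgebra `ℂ⟦x⟧`. -/
def fx : FPS m →ₐ[ℂ] A := r.F.comp (inXHom l)

/-- The coordinate function `y_j`. -/
def Y (j : Fin l) : A := r.F (X (Sum.inr j))

/-- The element `φ_c(B)`. -/
def phi (B : 𝕄) : A :=
  -(∑ i, ∑ j, r.fx (B i j) * (r.Y j * r.U i)) +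
    ∑ s ∈ reflections σ, dunklConst σ c s • (r.fx (corootScalar σ B s) * (1 - r.K s))

lemma fx_comm_F (p : FPS m) (f : FPS2 m l) : r.F f * r.fx p = r.fx p * r.F f := by
  change r.F f * r.F (inXHom l p) = r.F (inXHom l p) * _
  rw [← map_mul, ← map_mul, mul_comm]

lemma fx_comm_Y (p : FPS m) (j : Fin l) : r.Y j * r.fx p = r.fx p * r.Y j := r.fx_comm_F p _

lemma fx_comm_K (p : FPS m) (h : H) : r.K h * r.fx p = r.fx p * r.K h := by
  change _ * r.F (inXHom l p) = r.F (inXHom l p) * _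
  rw [r.K_mul_F, grpHom_inXHom]

lemma fx_comm_U (p : FPS m) (j : Fin l) : r.U j * r.fx p = r.fx p * r.U j := by
  change _ * r.F (inXHom l p) = r.F (inXHom l p) * _
  rw [r.U_mul_F, pderiv_inr_inXHom, map_zero, add_zero, sum_eq_zero, sub_zero]
  intro s hs
  rw [divDiff_of_invariant m σ hs (grpHom_inXHom σ s p), map_zero, zero_mul, smul_zero]

lemma D_mul_fx (k : Fin m) (p : FPS m) : r.D k * r.fx p = r.fx p * r.D k + r.fx (pderiv ℂ k p) := by
  change _ * r.F (inXHom l p) = r.F (inXHom l p) * _ + r.F (inXHom l _)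
  rw [r.D_mul_F, pderiv_inl_inXHom]

lemma D_mul_Y (k : Fin m) (j : Fin l) : r.D k * r.Y j = r.Y j * r.D k := by
  classical
  rw [Y, r.D_mul_F, pderiv_X_of_ne (by simp), map_zero, add_zero]

lemma U_mul_Y (i j : Fin l) :
    r.U i * r.Y j = r.Y j * r.U i + algebraMap ℂ _ (if i = j then 1 else 0)
      - ∑ s ∈ reflections σ, (dunklConst σ c s * coroot σ s i * dualRootVec σ s j) • r.K s := by
  classical
  rw [Y, r.U_mul_F]
  congr 1
  · congr 1
    rw [pderiv_X]
    by_cases hk : i = j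
    · subst hk; simp
    · rw [Pi.single_eq_of_ne (by simpa using Ne.symm hk), if_neg hk]; simp
  · refine sum_congr rfl fun s hs => ?_
    rw [divDiff_X_inr m σ hs, c_eq_algebraMap, AlgHom.commutes, ← Algebra.smul_def, smul_smul]

/-- `[u_j, s] = (u_j, α_s) · c · s` for a reflection `s` with `1 - s = c ⊗ α_s`. -/
lemma U_mul_K {s : H} (hs : s ∈ reflections σ) (j : Fin l) : r.U j * r.K s = r.K s * r.U j +
      coroot σ s j • ((∑ k, rootVec σ s k • r.U k) * r.K s) := by
  apply mul_eq_mul_add_of_mul_eq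
  rw [r.K_mul_U]
  simp only [repMat_apply_of_reflection hs]
  rw [smul_sum_single_sub (rootVec σ s) (coroot σ s) (r.U) j]

variable {B : Matrix (Fin l) (Fin l) (FPS m)}

/-- `[φ_c(B), f] = -(B y) · ∂_y f`. -/
lemma phi_lie_F (hB : CommutesWith σ B) (f : FPS2 m l) :
    ⁅r.phi B, r.F f⁆ = -∑ i, ∑ j, r.fx (B i j) * (r.Y j * r.F (pderiv ℂ (Sum.inr i) f)) := by
  have h1 : ∀ i, ⁅r.U i, r.F f⁆ = r.F (pderiv ℂ (Sum.inr i) f) -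
      ∑ s ∈ reflections σ, (dunklConst σ c s * coroot σ s i) • (r.F (divDiff m σ s f) * r.K s) := by
    intro i
    rw [Ring.lie_def, r.U_mul_F]; abel
  have h2 : ∀ i j, ⁅r.fx (B i j) * (r.Y j * r.U i), r.F f⁆ =
      r.fx (B i j) * (r.Y j * r.F (pderiv ℂ (Sum.inr i) f)) -
      ∑ s ∈ reflections σ, dunklConst σ c s • (r.F
        (inXHom l (C (coroot σ s i) * B i j) * X (Sum.inr j) * divDiff m σ s f) * r.K s) := by
    intro i j
    have e : ⁅r.Y j, r.F f⁆ = 0 := lie_eq_zero_of_comm (by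
      rw [Y, ← map_mul, ← map_mul, mul_comm])
    have e' : ⁅r.fx (B i j), r.F f⁆ = 0 :=
      lie_eq_zero_of_comm (r.fx_comm_F _ _).symm
    rw [mul_lie', mul_lie', e, e', h1, zero_mul, add_zero, zero_mul, add_zero, mul_sub, mul_sub]
    congr 1
    rw [mul_sum, mul_sum]
    refine sum_congr rfl fun s _ => ?_
    rw [map_mul (inXHom l), inXHom_C, ← smul_eq_C_mul]
    simp only [mul_smul_comm, smul_mul_assoc, map_smul, smul_smul, map_mul, mul_assoc]
    rfl
  have h3 : ∀ s ∈ reflections σ, ∑ i, ∑ j, inXHom l (C (coroot σ s i) * B i j) * X (Sum.inr j) =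
      inXHom l (-corootScalar σ B s) * corootForm m σ s := by
    intro s hs
    rw [sum_comm]
    simp only [← sum_mul, ← map_sum, coroot_mul hB hs]
    rw [corootForm, mul_sum]
    refine sum_congr rfl fun j _ => ?_
    rw [map_mul, inXHom_C, smul_eq_C_mul, mul_assoc]
  have h4 : ∀ s ∈ reflections σ, ⁅r.fx (corootScalar σ B s) * (1 - r.K s),
      r.F f⁆ = r.F (inXHom l (corootScalar σ B s) *
        (corootForm m σ s * divDiff m σ s f)) * r.K s := by
    intro s hs
    have e' : ⁅r.fx (corootScalar σ B s), r.F f⁆ = 0 :=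
      lie_eq_zero_of_comm (r.fx_comm_F _ _).symm
    rw [mul_lie', e', zero_mul, add_zero, corootForm_mul_divDiff m σ hs, map_mul, mul_assoc]
    change _ = r.fx _ * _
    congr 1
    rw [Ring.lie_def, sub_mul, mul_sub, r.K_mul_F, map_sub, sub_mul, one_mul, mul_one]
    abel
  have h5 : ∑ i, ∑ j, ∑ s ∈ reflections σ, dunklConst σ c s • (r.F
        (inXHom l (C (coroot σ s i) * B i j) * X (Sum.inr j) * divDiff m σ s f)
          * r.K s) = ∑ s ∈ reflections σ, dunklConst σ c s • (r.F
        ((∑ i, ∑ j, inXHom l (C (coroot σ s i) * B i j) * X (Sum.inr j)) * divDiff m σ s f)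
          * r.K s) := by
    simp only [sum_mul, map_sum, smul_sum]
    rw [sum_comm]
    conv_rhs => rw [sum_comm]
    rw [sum_comm]
    refine sum_congr rfl fun i _ => ?_
    rw [sum_comm]
  rw [phi, ring_add_lie, ring_neg_lie]
  simp only [ring_sum_lie, ring_smul_lie, h2, sum_sub_distrib]
  rw [neg_sub, sub_add_eq_add_sub, sub_eq_neg_self, h5, ← sum_add_distrib]
  apply sum_eq_zero
  intro s hs
  rw [h3 s hs, h4 s hs, ← smul_add, ← add_mul, ← map_add, map_neg]
  simp [mul_assoc]

/-- `[φ_c(B), u_k] = ∑ B_{ik} u_i`. -/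
lemma phi_lie_U (hB : CommutesWith σ B) (k : Fin l) :
    ⁅r.phi B, r.U k⁆ = ∑ i, r.fx (B i k) * r.U i := by
  classical
  have h1 : ∀ j, ⁅r.Y j, r.U k⁆ = ∑ s ∈ reflections σ,
      (dunklConst σ c s * coroot σ s k * dualRootVec σ s j) • r.K s -
        algebraMap ℂ _ (if k = j then 1 else 0) := by
    intro j
    rw [Ring.lie_def, r.U_mul_Y]; abel
  have h2 : ∀ i j, ⁅r.fx (B i j) * (r.Y j * r.U i), r.U k⁆ =
      ∑ s ∈ reflections σ, (dunklConst σ c s * coroot σ s k) • (r.fx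
        (B i j * C (dualRootVec σ s j)) * (r.K s * r.U i)) -
      if k = j then r.fx (B i j) * r.U i else 0 := by
    intro i j
    have e : ⁅r.U i, r.U k⁆ = 0 := lie_eq_zero_of_comm (r.U_comm _ _)
    have e' : ⁅r.fx (B i j), r.U k⁆ = 0 :=
      lie_eq_zero_of_comm (r.fx_comm_U _ _).symm
    rw [mul_lie', mul_lie', e, e', h1, zero_mul, add_zero, mul_zero, zero_add, sub_mul, mul_sub]
    congr 1
    · rw [sum_mul, mul_sum]
      refine sum_congr rfl fun s _ => ?_
      rw [mul_comm (B i j), ← smul_eq_C_mul]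
      simp only [mul_smul_comm, smul_mul_assoc, map_smul, smul_smul]
    · by_cases h : k = j
      · simp [h]
      · simp [h]
  have h3 : ∀ s ∈ reflections σ, ∑ i, ∑ j, r.fx (B i j * C (dualRootVec σ s j)) *
      (r.K s * r.U i) = r.fx (corootScalar σ B s) * ((∑ q, rootVec σ s q • r.U q) * r.K s) := by
    intro s hs
    simp only [← sum_mul, ← map_sum, mul_dualRootVec hB hs]
    have e : ∀ q, ∑ i, repMat σ s q i * dualRootVec σ s i = -rootVec σ s q := by
      intro q
      simp only [dualRootVec, mul_neg, mul_sum, sum_neg_distrib, ← mul_assoc]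
      rw [sum_comm]
      simp only [← sum_mul, ← mul_apply, repMat_mul_inv]
      simp [one_apply]
    have e2 : ∑ i, dualRootVec σ s i • (r.K s * r.U i) =
        -((∑ q, rootVec σ s q • r.U q) * r.K s) := by
      simp only [r.K_mul_U, smul_sum, smul_smul, ← smul_mul_assoc, ← sum_mul]
      rw [sum_comm]
      simp only [← sum_smul, mul_comm (dualRootVec σ s _), e, neg_smul, sum_neg_distrib, neg_mul]
    have e3 : ∀ i, r.fx (-corootScalar σ B s * C (dualRootVec σ s i)) *
        (r.K s * r.U i) = -(r.fx (corootScalar σ B s) * (dualRootVec σ s i • (r.K s * r.U i))) := by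
      intro i
      rw [mul_comm, ← smul_eq_C_mul, map_smul, map_neg, smul_neg, neg_mul, smul_mul_assoc,
        mul_smul_comm]
    simp only [e3, sum_neg_distrib, ← mul_sum, e2, mul_neg, neg_neg]
  have h4 : ∀ s ∈ reflections σ, ⁅r.fx (corootScalar σ B s) * (1 - r.K s),
      r.U k⁆ = coroot σ s k • (r.fx (corootScalar σ B s) *
        ((∑ q, rootVec σ s q • r.U q) * r.K s)) := by
    intro s hs
    have e' : ⁅r.fx (corootScalar σ B s), r.U k⁆ = 0 :=
      lie_eq_zero_of_comm (r.fx_comm_U _ _).symm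
    rw [mul_lie', e', zero_mul, add_zero, ← mul_smul_comm]
    congr 1
    rw [Ring.lie_def, sub_mul, mul_sub, r.U_mul_K hs, one_mul, mul_one]
    abel
  have h5 : ∑ i, ∑ j, ∑ s ∈ reflections σ, (dunklConst σ c s * coroot σ s k) • (r.fx
        (B i j * C (dualRootVec σ s j)) * (r.K s * r.U i)) =
      ∑ s ∈ reflections σ, (dunklConst σ c s * coroot σ s k) • (∑ i, ∑ j, r.fx
        (B i j * C (dualRootVec σ s j)) * (r.K s * r.U i)) := by
    simp only [smul_sum]
    conv_rhs => rw [sum_comm]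
    refine sum_congr rfl fun i _ => ?_
    rw [sum_comm]
  rw [phi, ring_add_lie, ring_neg_lie]
  simp only [ring_sum_lie, ring_smul_lie, h2, sum_sub_distrib]
  rw [neg_sub, h5, sub_add_eq_add_sub, add_sub_assoc, ← sum_sub_distrib,
    sum_eq_zero (s := reflections σ), add_zero]
  · refine sum_congr rfl fun i _ => ?_
    simp
  · intro s hs
    rw [h3 s hs, h4 s hs, smul_smul, sub_self]

/-- `φ_c(B)` commutes with `H`. -/
lemma phi_comm_K (hc : IsClassFun σ c) (hB : CommutesWith σ B) (h : H) :
    r.phi B * r.K h = r.K h * r.phi B := by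
  have h1 : ∀ i, r.K h * ∑ j, r.fx (B i j) * r.Y j =
      (∑ k, repMat σ h⁻¹ i k • ∑ j, r.fx (B k j) * r.Y j) * r.K h := by
    intro i
    have e : ∀ q, ∑ k, B i k * C (repMat σ h⁻¹ k q) = ∑ k, C (repMat σ h⁻¹ i k) * B k q := fun q => by
      simpa only [mul_apply, map_apply] using congrFun (congrFun (hB h⁻¹) i) q
    have e2 : ∀ j, r.K h * (r.fx (B i j) * r.Y j) =
        ∑ q, r.fx (B i j * C (repMat σ h⁻¹ j q)) * r.Y q * r.K h := by
      intro j
      rw [← mul_assoc, r.fx_comm_K, mul_assoc, Y, r.K_mul_F, grpHom_X_inr, map_sum, sum_mul, mul_sum]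
      refine sum_congr rfl fun q _ => ?_
      rw [mul_comm _ (C _), ← smul_eq_C_mul]
      simp only [map_smul, smul_mul_assoc, mul_smul_comm, mul_assoc]
      rfl
    rw [mul_sum, sum_congr rfl fun j _ => e2 j, sum_comm]
    simp only [← sum_mul, ← map_sum, e]
    simp only [map_sum, ← smul_eq_C_mul, map_smul, smul_sum, sum_mul, smul_mul_assoc]
    rw [sum_comm]
  have h2 : ∀ W : Fin l → A, (∀ i, r.K h * W i = (∑ k, repMat σ h⁻¹ i k • W k) * r.K h) →
      r.K h * ∑ i, W i * r.U i = (∑ i, W i * r.U i) * r.K h := fun W hW => by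
    have e : ∀ i, r.K h * (W i * r.U i) =
        ∑ k, ∑ q, (repMat σ h q i * repMat σ h⁻¹ i k) • (W k * r.U q * r.K h) := fun i => by
      rw [← mul_assoc, hW, mul_assoc, r.K_mul_U]
      simp only [sum_mul, mul_sum, smul_mul_assoc, mul_smul_comm, smul_sum, smul_smul, mul_assoc]
      rw [sum_comm]
    rw [mul_sum, sum_congr rfl fun i _ => e i, sum_comm, sum_mul]
    refine sum_congr rfl fun k _ => ?_
    rw [sum_comm]
    simp only [← sum_smul, ← mul_apply, repMat_mul_inv]
    simp [one_apply]
  have h4 : ∑ i, ∑ j, r.fx (B i j) * (r.Y j * r.U i) =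
      ∑ i, (∑ j, r.fx (B i j) * r.Y j) * r.U i := by simp only [sum_mul, mul_assoc]
  have h3 : ∑ s ∈ reflections σ, r.K h * (dunklConst σ c s •
        (r.fx (corootScalar σ B s) * (1 - r.K s))) =
      (∑ s ∈ reflections σ, dunklConst σ c s •
        (r.fx (corootScalar σ B s) * (1 - r.K s))) * r.K h := by
    rw [sum_mul]
    refine Finset.sum_bij' (fun s _ => h * s * h⁻¹) (fun s _ => h⁻¹ * s * h)
      (fun s hs => conj_mem_reflections hs h)
      (fun s hs => by simpa using conj_mem_reflections hs h⁻¹)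
      (fun s _ => by group) (fun s _ => by group) ?_
    intro s hs
    rw [dunklConst_conj hc hs, corootScalar_conj hB, mul_smul_comm, smul_mul_assoc, ← mul_assoc,
      r.fx_comm_K, mul_assoc, mul_assoc, mul_sub, sub_mul, ← map_mul, ← map_mul,
      inv_mul_cancel_right, mul_one, one_mul]
  rw [phi, h4, add_mul, mul_add, mul_neg, neg_mul, mul_sum (s := reflections σ), h3, h2 _ h1]

lemma phi_comm_fx (hB : CommutesWith σ B) (p : FPS m) : r.phi B * r.fx p = r.fx p * r.phi B := by
  have h := r.phi_lie_F hB (inXHom l p)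
  simp only [pderiv_inr_inXHom, map_zero, mul_zero, sum_const_zero, neg_zero] at h
  rw [Ring.lie_def, sub_eq_zero] at h
  exact h

lemma phi_lie_Y (hB : CommutesWith σ B) (k : Fin l) :
    ⁅r.phi B, r.Y k⁆ = -∑ j, r.fx (B k j) * r.Y j := by
  classical
  rw [Y, r.phi_lie_F hB, sum_eq_single k]
  · simp
  · intro i _ hi
    rw [pderiv_X_of_ne (by simpa using Ne.symm hi)]; simp
  · simp

lemma phi_add (B B' : 𝕄) : r.phi (B + B') = r.phi B + r.phi B' := by
  simp only [phi, Matrix.add_apply, corootScalar_add, map_add, add_mul, smul_add, sum_add_distrib]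
  abel

lemma phi_smul (p : FPS m) (B : 𝕄) : r.phi (p • B) = r.fx p * r.phi B := by
  simp only [phi, Matrix.smul_apply, corootScalar_smul, smul_eq_mul, map_mul, mul_add, mul_neg,
    mul_sum, mul_assoc, mul_smul_comm]

lemma phi_zero : r.phi (0 : 𝕄) = 0 := by
  have := r.phi_smul 0 0
  rwa [map_zero, zero_mul, zero_smul] at this

lemma phi_neg (B : 𝕄) : r.phi (-B) = -r.phi B := by
  rw [eq_neg_iff_add_eq_zero, ← r.phi_add, neg_add_cancel, r.phi_zero]

lemma phi_sub (B B' : 𝕄) : r.phi (B - B') = r.phi B - r.phi B' := by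
  rw [sub_eq_add_neg, r.phi_add, r.phi_neg, sub_eq_add_neg]

lemma phi_sum {ι : Type*} (s : Finset ι) (B : ι → 𝕄) :
    r.phi (∑ i ∈ s, B i) = ∑ i ∈ s, r.phi (B i) := by
  classical
  induction s using Finset.induction_on with
  | empty => simp [r.phi_zero]
  | insert i s hi h => rw [sum_insert hi, sum_insert hi, r.phi_add, h]

/-- `φ_c` is a homomorphism of Lie algebras. -/
lemma phi_lie_phi (hc : IsClassFun σ c) {A : 𝕄} (hA : CommutesWith σ A) :
    ⁅r.phi A, r.phi B⁆ = r.phi (A * B - B * A) := by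
  have h0 : ∀ p : FPS m, ⁅r.phi A, r.fx p⁆ = 0 := fun p =>
    lie_eq_zero_of_comm (r.phi_comm_fx hA p)
  have h1 : ∀ i j, ⁅r.phi A, r.fx (B i j) * (r.Y j * r.U i)⁆ =
      ∑ k, r.fx (A k i * B i j) * (r.Y j * r.U k) -
      ∑ k, r.fx (B i j * A j k) * (r.Y k * r.U i) := by
    intro i j
    rw [lie_mul', h0, zero_mul, zero_add, lie_mul', r.phi_lie_Y hA, r.phi_lie_U hA, neg_mul,
      mul_add, mul_neg, neg_add_eq_sub, mul_sum, mul_sum, sum_mul,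
      mul_sum]
    congr 1
    · refine sum_congr rfl fun k _ => ?_
      rw [← mul_assoc (r.Y j), r.fx_comm_Y, mul_comm (A k i), map_mul]
      simp only [mul_assoc]
    · refine sum_congr rfl fun k _ => ?_
      rw [map_mul]; simp only [mul_assoc]
  have h2 : ∀ s, ⁅r.phi A, r.fx (corootScalar σ B s) * (1 - r.K s)⁆ = 0 := by
    intro s
    apply lie_eq_zero_of_comm
    rw [← mul_assoc, r.phi_comm_fx hA, mul_assoc, mul_assoc]
    congr 1
    rw [mul_sub, sub_mul, r.phi_comm_K hc hA, mul_one, one_mul]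
  conv_lhs => rw [phi.eq_1 r B]
  rw [ring_lie_add, ring_lie_neg]
  simp only [ring_lie_sum, ring_lie_smul, h1, h2, smul_zero, sum_const_zero, add_zero]
  rw [phi]
  simp only [corootScalar_commutator hA, map_zero, zero_mul, smul_zero, sum_const_zero,
    add_zero, Matrix.sub_apply, map_sub, sub_mul, sum_sub_distrib, mul_apply, map_sum,
    sum_mul]
  congr 2
  · calc _ = ∑ j, ∑ i, ∑ k, r.fx (A k i * B i j) * (r.Y j * r.U k) :=
          sum_comm
      _ = ∑ j, ∑ k, ∑ i, r.fx (A k i * B i j) * (r.Y j * r.U k) :=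
          sum_congr rfl fun _ _ => sum_comm
      _ = _ := sum_comm
  · exact sum_congr rfl fun _ _ => sum_comm

/-- `[∂_k, φ_c(B)] = φ_c(∂_k B)`. -/
lemma D_lie_phi (B : 𝕄) (k : Fin m) : r.D k * r.phi B =
      r.phi B * r.D k + r.phi (B.map fun p => pderiv ℂ k p) := by
  have h0 : ∀ p : FPS m, ⁅r.D k, r.fx p⁆ = r.fx (pderiv ℂ k p) := fun p => by
    rw [Ring.lie_def, r.D_mul_fx]; abel
  have h1 : ∀ i j, ⁅r.D k, r.fx (B i j) * (r.Y j * r.U i)⁆ =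
      r.fx (pderiv ℂ k (B i j)) * (r.Y j * r.U i) := by
    intro i j
    rw [lie_mul', h0, lie_mul', lie_eq_zero_of_comm (r.D_mul_Y k j),
      lie_eq_zero_of_comm (r.D_mul_U k i)]
    simp
  have h2 : ∀ s, ⁅r.D k, r.fx (corootScalar σ B s) * (1 - r.K s)⁆ =
      r.fx (pderiv ℂ k (corootScalar σ B s)) * (1 - r.K s) := by
    intro s
    rw [lie_mul', h0, lie_eq_zero_of_comm (a := r.D k) (b := 1 - r.K s), mul_zero, add_zero]
    rw [mul_sub, sub_mul, r.K_mul_D, one_mul, mul_one]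
  rw [← sub_eq_iff_eq_add', ← Ring.lie_def, phi, ring_lie_add, ring_lie_neg]
  simp only [ring_lie_sum, ring_lie_smul, h1, h2]
  rw [phi]
  simp only [corootScalar_map_pderiv, map_apply]

end HCRep

end PhiC

/-! ### The action of formal automorphisms on `𝒜` -/

section Pullback

variable (g : FPS m ≃ₐ[ℂ] FPS m) (b : GL (Fin l) (FPS m))

/-- The components `ρ₀(x), b(x) y` of a formal automorphism of the bundle. -/
def pbVar : Fin m ⊕ Fin l → FPS2 m l :=
  Sum.elim (fun i => inXHom l (g (X i))) (fun j => ∑ k, inXHom l (b.1 j k) * X (Sum.inr k))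

lemma constantCoeff_inXHom (f : FPS m) :
    constantCoeff (inXHom l f) = constantCoeff f := constantCoeff_rename _ _

lemma constantCoeff_pbVar (i : Fin m ⊕ Fin l) : constantCoeff (pbVar g b i) = 0 := by
  rcases i with i | j
  · exact (constantCoeff_inXHom _).trans (algEquiv_X g i)
  · simp [pbVar]

/-- The pullback by a formal automorphism as a homomorphism of algebras. -/
def pbHom : FPS2 m l →ₐ[ℂ] FPS2 m l :=
  substAlgHom (hasSubst_of_zero (constantCoeff_pbVar g b))

lemma pbHom_eq_subst (f : FPS2 m l) : pbHom g b f = subst (pbVar g b) f := by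
  rw [pbHom, substAlgHom_apply]

lemma pullback_eq (f : FPS2 m l) : pullback g b f = pbHom g b f := (pbHom_eq_subst g b f).symm

lemma pbHom_X (i : Fin m ⊕ Fin l) : pbHom g b (X i) = pbVar g b i := substAlgHom_X _ _

lemma pbHom_inXHom (p : FPS m) : pbHom g b (inXHom l p) = inXHom l (g p) := by
  rw [pbHom_eq_subst, inXHom_eq_subst, inXHom_eq_subst, algEquiv_eq_subst g p,
    subst_algHom_ext (fun i => constantCoeff_X _) (constantCoeff_pbVar g b) (fun i => rfl),
    subst_algHom_ext (algEquiv_X g) (fun i => constantCoeff_X _) (fun i => rfl)]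
  congr 1
  funext i
  rw [← pbHom_eq_subst, pbHom_X, ← inXHom_eq_subst]; rfl

lemma pderiv_inl_pbHom (k : Fin m) (f : FPS2 m l) : pderiv ℂ (Sum.inl k) (pbHom g b f) =
      ∑ j, inXHom l (pderiv ℂ k (g (X j))) * pbHom g b (pderiv ℂ (Sum.inl j) f) +
      ∑ j, (∑ p, inXHom l (pderiv ℂ k (b.1 j p)) * X (Sum.inr p)) *
        pbHom g b (pderiv ℂ (Sum.inr j) f) := by
  classical
  rw [pbHom_eq_subst, pderiv_subst (constantCoeff_pbVar g b), Fintype.sum_sum_type]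
  simp only [← pbHom_eq_subst]
  congr 1
  · exact sum_congr rfl fun j _ => by rw [pbVar, Sum.elim_inl, pderiv_inl_inXHom]
  · refine sum_congr rfl fun j _ => ?_
    rw [pbVar, Sum.elim_inr, map_sum]
    congr 1
    refine sum_congr rfl fun p _ => ?_
    rw [Derivation.leibniz, pderiv_inl_inXHom, pderiv_X_of_ne (by simp), smul_zero, zero_add,
      smul_eq_mul, mul_comm]

lemma pderiv_inr_pbHom (q : Fin l) (f : FPS2 m l) : pderiv ℂ (Sum.inr q) (pbHom g b f) =
      ∑ j, inXHom l (b.1 j q) * pbHom g b (pderiv ℂ (Sum.inr j) f) := by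
  classical
  rw [pbHom_eq_subst, pderiv_subst (constantCoeff_pbVar g b), Fintype.sum_sum_type,
    sum_eq_zero, zero_add]
  · simp only [← pbHom_eq_subst]
    refine sum_congr rfl fun j _ => ?_
    rw [pbVar, Sum.elim_inr, map_sum, sum_eq_single q]
    · rw [Derivation.leibniz, pderiv_inr_inXHom, pderiv_X_self]; simp
    · intro p _ hp
      rw [Derivation.leibniz, pderiv_inr_inXHom, pderiv_X_of_ne (by simpa using hp)]; simp
    · simp
  · intro i _
    rw [pbVar, Sum.elim_inl, pderiv_inr_inXHom, zero_mul]

/-- The inverse of the Jacobian matrix of `ρ₀`. -/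
def jacInv : Matrix (Fin m) (Fin m) (FPS m) :=
  Matrix.of fun k j => g (pderiv ℂ j (g.symm (X k)))

lemma jacInv_mul_jac : jacInv g * jac (fun i => g (X i)) = 1 := by
  classical
  ext i k : 1
  have h := pderiv_algEquiv g (g.symm (X i)) k
  rw [AlgEquiv.apply_symm_apply] at h
  rw [mul_apply, one_apply]
  simp only [jacInv, jac, of_apply]
  rw [sum_congr rfl fun j _ => mul_comm _ _, ← h]
  by_cases hik : i = k
  · subst hik; simp
  · rw [pderiv_X_of_ne hik, if_neg hik]

lemma jac_mul_jacInv : jac (fun i => g (X i)) * jacInv g = 1 :=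
  mul_eq_one_comm.1 (jacInv_mul_jac g)

lemma jac_inv_eq : (jac fun i => g (X i))⁻¹ = jacInv g :=
  Matrix.inv_eq_left_inv (jacInv_mul_jac g)

/-- The derivation `ρ₀* ∂_j (ρ₀*)⁻¹`. -/
lemma sum_jacInv_mul (j : Fin m) (p : FPS m) :
    ∑ k, jacInv g k j * pderiv ℂ k p = g (pderiv ℂ j (g.symm p)) := by
  rw [pderiv_algEquiv g.symm p j, map_sum]
  refine sum_congr rfl fun k _ => ?_
  rw [map_mul, AlgEquiv.apply_symm_apply]; rfl

/-- The logarithmic derivative `b⁻¹ ∂_k b`. -/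
def logDer (k : Fin m) : 𝕄 :=
  (b⁻¹).1 * b.1.map fun p => pderiv ℂ k p

lemma pderiv_mul_map (A B : 𝕄) (k : Fin m) :
    (A * B).map (fun p => pderiv ℂ k p) =
      A.map (fun p => pderiv ℂ k p) * B + A * B.map fun p => pderiv ℂ k p := by
  ext i j : 1
  simp only [map_apply, mul_apply, map_sum, Matrix.add_apply,
    ← sum_add_distrib, Derivation.leibniz, smul_eq_mul]
  exact sum_congr rfl fun _ _ => by ring

lemma pderiv_map_one (k : Fin m) :
    (1 : 𝕄).map (fun p => pderiv ℂ k p) = 0 := by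
  ext i j : 1
  rw [map_apply, one_apply]
  split_ifs <;> simp

/-- `∂_k b⁻¹ = -b⁻¹ (∂_k b) b⁻¹`. -/
lemma pderiv_inv (k : Fin m) : (b⁻¹).1.map (fun p => pderiv ℂ k p) = -(logDer b k * (b⁻¹).1) := by
  have h := pderiv_mul_map (b⁻¹).1 b.1 k
  rw [b.inv_mul, pderiv_map_one] at h
  have h2 := congrArg (· * (b⁻¹).1) h
  simp only [zero_mul, add_mul, mul_assoc, b.mul_inv, mul_one] at h2
  rw [eq_neg_iff_add_eq_zero, logDer, mul_assoc]
  exact h2.symm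

lemma mul_logDer (k : Fin m) : b.1 * logDer b k = b.1.map fun p => pderiv ℂ k p := by
  rw [logDer, ← mul_assoc, b.mul_inv, one_mul]

/-- The connection `d + b⁻¹ db` is flat. -/
lemma logDer_flat (k q : Fin m) :
    (logDer b q).map (fun p => pderiv ℂ k p) - (logDer b k).map (fun p => pderiv ℂ q p) +
      (logDer b k * logDer b q - logDer b q * logDer b k) = 0 := by
  have h : ∀ k q, (logDer b q).map (fun p => pderiv ℂ k p) = -(logDer b k * logDer b q) +
      (b⁻¹).1 * (b.1.map fun p => pderiv ℂ q p).map fun p => pderiv ℂ k p := by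
    intro k q
    rw [logDer, pderiv_mul_map, pderiv_inv, neg_mul, mul_assoc, ← logDer]
  have h2 : (b.1.map fun p => pderiv ℂ q p).map (fun p => pderiv ℂ k p) =
      (b.1.map fun p => pderiv ℂ k p).map fun p => pderiv ℂ q p := by
    ext i j : 1
    exact pderiv_pderiv_comm k q _
  rw [h k q, h q k, h2]; abel

end Pullback

section Commutes

variable {A B : Matrix (Fin l) (Fin l) (FPS m)}

lemma CommutesWith.mul (hA : CommutesWith σ A) (hB : CommutesWith σ B) :
    CommutesWith σ (A * B) := fun h => by
  rw [mul_assoc, hB h, ← mul_assoc, hA h, mul_assoc]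

lemma CommutesWith.add (hA : CommutesWith σ A) (hB : CommutesWith σ B) :
    CommutesWith σ (A + B) := fun h => by rw [add_mul, mul_add, hA h, hB h]

lemma CommutesWith.sub (hA : CommutesWith σ A) (hB : CommutesWith σ B) :
    CommutesWith σ (A - B) := fun h => by rw [sub_mul, mul_sub, hA h, hB h]

lemma CommutesWith.smul (p : FPS m) (hA : CommutesWith σ A) : CommutesWith σ (p • A) := fun h => by
  rw [Matrix.smul_mul, Matrix.mul_smul, hA h]

lemma CommutesWith.sum {ι : Type*} {s : Finset ι} {A : ι → 𝕄}
    (hA : ∀ i ∈ s, CommutesWith σ (A i)) : CommutesWith σ (∑ i ∈ s, A i) := fun h => by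
  rw [sum_mul, mul_sum]
  exact sum_congr rfl fun i hi => hA i hi h

lemma CommutesWith.zero : CommutesWith σ (0 : 𝕄) := fun h => by simp

lemma CommutesWith.one : CommutesWith σ (1 : 𝕄) := fun h => by simp

/-- Entrywise application of a `ℂ`-linear map preserves the commutation relations. -/
lemma CommutesWith.map {n : ℕ} (hA : CommutesWith σ A) (f : FPS m →ₗ[ℂ] FPS n) :
    CommutesWith σ (A.map f) := fun h => by
  ext i j : 1
  have := congrFun (congrFun (hA h) i) j
  have h2 := congrArg f this
  simp only [mul_apply, map_apply, map_sum, mul_comm (A _ _), ← smul_eq_C_mul, map_smul] at h2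
  simp only [mul_apply, map_apply, mul_comm (f (A _ _)), ← smul_eq_C_mul]
  exact h2

lemma CommutesWith.logDer {b : ZGroup m σ} (k : Fin m) : CommutesWith σ (logDer b.1 k) :=
  (b⁻¹).2.mul (CommutesWith.map b.2 (pderiv ℂ k).toLinearMap)

end Commutes

namespace HCRep

variable {A : Type*} [Ring A] [Algebra ℂ A] (r : HCRep m σ c A)
variable (g : FPS m ≃ₐ[ℂ] FPS m) (b : ZGroup m σ)

/-- The covariant derivative `∂_k + φ_c(b⁻¹ ∂_k b)`. -/
def nab (k : Fin m) : A := r.D k + r.phi (logDer b.1 k)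

/-- The image of `∂_j` under a formal automorphism. -/
def twD (j : Fin m) : A := ∑ k, r.fx (jacInv g k j) * r.nab b k

/-- The image of `u_j` under a formal automorphism. -/
def twU (j : Fin l) : A := ∑ k, r.fx ((b.1⁻¹).1 k j) * r.U k

lemma nab_mul_fx (k : Fin m) (p : FPS m) :
    r.nab b k * r.fx p = r.fx p * r.nab b k + r.fx (pderiv ℂ k p) := by
  rw [nab, add_mul, r.D_mul_fx, r.phi_comm_fx (CommutesWith.logDer k), mul_add]; abel

lemma nab_comm (hc : IsClassFun σ c) (k q : Fin m) :
    r.nab b k * r.nab b q = r.nab b q * r.nab b k := by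
  rw [← sub_eq_zero, ← Ring.lie_def, nab, nab, ring_add_lie, ring_lie_add, ring_lie_add,
    lie_eq_zero_of_comm (r.D_comm k q), r.phi_lie_phi hc (CommutesWith.logDer k)]
  have h1 : ⁅r.D k, r.phi (logDer b.1 q)⁆ = r.phi ((logDer b.1 q).map fun p => pderiv ℂ k p) := by
    rw [Ring.lie_def, r.D_lie_phi]; abel
  have h2 : ⁅r.phi (logDer b.1 k), r.D q⁆ =
      -r.phi ((logDer b.1 k).map fun p => pderiv ℂ q p) := by
    rw [Ring.lie_def, r.D_lie_phi]; abel
  rw [h1, h2, zero_add, ← r.phi_neg, ← r.phi_add, ← r.phi_add, ← add_assoc, ← sub_eq_add_neg,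
    logDer_flat, r.phi_zero]

lemma twU_comm_fx (j : Fin l) (p : FPS m) : r.twU b j * r.fx p = r.fx p * r.twU b j := by
  rw [twU, sum_mul, mul_sum]
  refine sum_congr rfl fun k _ => ?_
  rw [mul_assoc, r.fx_comm_U, ← mul_assoc, ← mul_assoc, ← map_mul, ← map_mul, mul_comm]

lemma nab_mul_twU (k : Fin m) (j : Fin l) : r.nab b k * r.twU b j = r.twU b j * r.nab b k := by
  rw [← sub_eq_zero, ← Ring.lie_def, twU, ring_lie_sum]
  have h1 : ∀ p, ⁅r.nab b k, r.fx ((b.1⁻¹).1 p j) * r.U p⁆ =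
      r.fx (pderiv ℂ k ((b.1⁻¹).1 p j)) * r.U p +
        ∑ q, r.fx ((logDer b.1 k) q p * (b.1⁻¹).1 p j) * r.U q := by
    intro p
    rw [lie_mul']
    congr 1
    · congr 1
      rw [Ring.lie_def, nab_mul_fx]; abel
    · rw [nab, ring_add_lie, r.phi_lie_U (CommutesWith.logDer k), lie_eq_zero_of_comm (r.D_mul_U _ _),
        zero_add, mul_sum]
      refine sum_congr rfl fun q _ => ?_
      rw [← mul_assoc, ← map_mul, mul_comm (logDer _ _ _ _)]
  simp only [h1, sum_add_distrib]
  rw [sum_comm, ← sum_add_distrib]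
  apply sum_eq_zero
  intro q _
  rw [← sum_mul, ← add_mul, ← map_sum, ← map_add, ← mul_apply]
  have := congrFun (congrFun (pderiv_inv b.1 k) q) j
  rw [map_apply] at this
  rw [this, Matrix.neg_apply, neg_add_cancel, map_zero, zero_mul]

lemma K_mul_nab (hc : IsClassFun σ c) (h : H) (k : Fin m) :
    r.K h * r.nab b k = r.nab b k * r.K h := by
  rw [nab, mul_add, add_mul, r.K_mul_D, r.phi_comm_K hc (CommutesWith.logDer k)]

lemma nab_mul_F (k : Fin m) (f : FPS2 m l) :
    r.nab b k * r.F (pbHom g b.1 f) = r.F (pbHom g b.1 f) * r.nab b k +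
      ∑ j, r.fx (pderiv ℂ k (g (X j))) * r.F (pbHom g b.1 (pderiv ℂ (Sum.inl j) f)) := by
  have h1 : ⁅r.phi (logDer b.1 k), r.F (pbHom g b.1 f)⁆ =
      -r.F (∑ j, (∑ p, inXHom l (pderiv ℂ k (b.1.1 j p)) * X (Sum.inr p)) *
        pbHom g b.1 (pderiv ℂ (Sum.inr j) f)) := by
    rw [r.phi_lie_F (CommutesWith.logDer k)]
    congr 1
    have e : ∀ i p, r.fx (logDer b.1 k i p) * (r.Y p * r.F (pderiv ℂ (Sum.inr i) (pbHom g b.1 f))) =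
        r.F (∑ j, inXHom l (b.1.1 j i * logDer b.1 k i p) * X (Sum.inr p) *
          pbHom g b.1 (pderiv ℂ (Sum.inr j) f)) := by
      intro i p
      rw [fx, Y, AlgHom.comp_apply, ← map_mul, ← map_mul, pderiv_inr_pbHom, mul_sum, mul_sum]
      congr 1
      refine sum_congr rfl fun q _ => ?_
      rw [map_mul]; ring
    simp only [e, ← map_sum]
    congr 1
    simp only [sum_mul]
    calc _ = ∑ i, ∑ j, ∑ p, inXHom l (b.1.1 j i * logDer b.1 k i p) * X (Sum.inr p) *
          pbHom g b.1 (pderiv ℂ (Sum.inr j) f) := sum_congr rfl fun _ _ => sum_comm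
      _ = ∑ j, ∑ i, ∑ p, inXHom l (b.1.1 j i * logDer b.1 k i p) * X (Sum.inr p) *
          pbHom g b.1 (pderiv ℂ (Sum.inr j) f) := sum_comm
      _ = _ := by
        refine sum_congr rfl fun j _ => ?_
        rw [sum_comm]
        refine sum_congr rfl fun p _ => ?_
        rw [← sum_mul, ← sum_mul, ← map_sum, ← mul_apply, mul_logDer, map_apply]
  rw [nab, add_mul, r.D_mul_F, pderiv_inl_pbHom, map_add]
  rw [Ring.lie_def, sub_eq_iff_eq_add] at h1
  rw [h1, mul_add, map_sum]
  simp only [map_mul]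
  change _ + (∑ j, r.fx _ * _ + _) + _ = _
  abel

end HCRep

/-! ### Homomorphisms out of `𝒜` -/

namespace HCRep

variable {A : Type*} [Ring A] [Algebra ℂ A] (r : HCRep m σ c A)

/-- The homomorphism `𝒜 → A` with prescribed values on the generators. -/
def hom : HCAlg m σ c →ₐ[ℂ] A := r.exists_hom.choose

lemma hom_F (f : FPS2 m l) : r.hom (univ.F f) = r.F f := r.exists_hom.choose_spec.1 f
lemma hom_D (i : Fin m) : r.hom (univ.D i) = r.D i := r.exists_hom.choose_spec.2.1 i
lemma hom_U (j : Fin l) : r.hom (univ.U j) = r.U j := r.exists_hom.choose_spec.2.2.1 j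
lemma hom_K (h : H) : r.hom (univ.K h) = r.K h := r.exists_hom.choose_spec.2.2.2 h
lemma hom_fx (p : FPS m) : r.hom (univ.fx p) = r.fx p := r.hom_F _

/-- Homomorphisms out of `𝒜` that agree on the generators are equal. -/
lemma hom_ext {φ ψ : HCAlg m σ c →ₐ[ℂ] A} (h1 : ∀ f, φ (univ.F f) = ψ (univ.F f))
    (h2 : ∀ i, φ (univ.D i) = ψ (univ.D i)) (h3 : ∀ j, φ (univ.U j) = ψ (univ.U j))
    (h4 : ∀ h, φ (univ.K h) = ψ (univ.K h)) : φ = ψ := by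
  refine AlgHom.ext fun a => ?_
  exact HCAlg.mem_of_generators (AlgHom.equalizer φ ψ) h1 h2 h3 h4 a

lemma univ_phi (B : 𝕄) : (univ : HCRep m σ c _).phi B = phiC σ c B := by
  rw [phi, phiC]
  congr 2
  refine sum_congr rfl fun i _ => sum_congr rfl fun j _ => ?_
  rw [el_fn, map_mul, mul_assoc]
  rfl

end HCRep

section Conjugation

lemma univ_hom (a : HCAlg m σ c) : (HCRep.univ : HCRep m σ c _).hom a = a := by
  have : (HCRep.univ : HCRep m σ c _).hom = AlgHom.id ℂ _ :=
    HCRep.hom_ext (fun _ => HCRep.hom_F _ _) (fun _ => HCRep.hom_D _ _) (fun _ => HCRep.hom_U _ _)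
      (fun _ => HCRep.hom_K _ _)
  rw [this]; rfl

end Conjugation

/-! ### Coefficients with respect to the coordinates of the base -/

section YPart

/-- The coefficient of `x^β` in `f(x, y)`, as an element of `ℂ⟦y⟧ ⊆ ℂ⟦x, y⟧`. -/
def yPart (β : Fin m →₀ ℕ) : FPS2 m l →ₗ[ℂ] FPS2 m l :=
  (rename (R := ℂ) (Sum.inr : Fin l → Fin m ⊕ Fin l)).toLinearMap ∘ₗ
    { toFun := xCoeff β
      map_add' := fun _ _ => by
        ext I
        rw [map_add]
        exact map_add (coeff (sumElim β I)) _ _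
      map_smul' := fun _ _ => by
        ext I
        rw [RingHom.id_apply, coeff_smul]
        exact coeff_smul _ (sumElim β I) _ }

lemma yPart_apply (β : Fin m →₀ ℕ) (f : FPS2 m l) :
    yPart β f = rename (R := ℂ) (Sum.inr : Fin l → Fin m ⊕ Fin l) (xCoeff β f) := rfl

lemma embDomain_inr (I : Fin l →₀ ℕ) :
    Finsupp.embDomain (Function.Embedding.inr : Fin l ↪ Fin m ⊕ Fin l) I =
      sumElim (0 : Fin m →₀ ℕ) I := by
  ext (i | j)
  · rw [Finsupp.embDomain_of_notMem_range _ _ _ (by simp)]; rfl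
  · exact Finsupp.embDomain_apply_self _ _ _

lemma embDomain_inl (I : Fin m →₀ ℕ) :
    Finsupp.embDomain (Function.Embedding.inl : Fin m ↪ Fin m ⊕ Fin l) I =
      sumElim I (0 : Fin l →₀ ℕ) := by
  ext (i | j)
  · exact Finsupp.embDomain_apply_self _ _ _
  · rw [Finsupp.embDomain_of_notMem_range _ _ _ (by simp)]; rfl

lemma coeff_yPart (β a : Fin m →₀ ℕ) (I : Fin l →₀ ℕ) (f : FPS2 m l) :
    coeff (sumElim a I) (yPart β f) =
      if a = 0 then coeff (sumElim β I) f else 0 := by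
  split_ifs with h
  · subst h
    rw [yPart_apply, ← embDomain_inr]
    exact coeff_embDomain_rename (Function.Embedding.inr) (xCoeff β f) I
  · rw [yPart_apply]
    apply coeff_rename_eq_zero
    rintro ⟨J, hJ⟩
    apply h
    ext i
    have := DFunLike.congr_fun hJ (Sum.inl i)
    rw [Finsupp.mapDomain_of_notMem_range _ _ (by simp)] at this
    exact this.symm

lemma coeff_inXHom (a : Fin m →₀ ℕ) (I : Fin l →₀ ℕ) (p : FPS m) :
    coeff (sumElim a I) (inXHom l p) = if I = 0 then coeff a p else 0 := by
  change coeff _ (rename Sum.inl p) = _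
  split_ifs with h
  · subst h
    rw [← embDomain_inl]
    exact coeff_embDomain_rename (Function.Embedding.inl) p a
  · apply coeff_rename_eq_zero
    rintro ⟨J, hJ⟩
    apply h
    ext i
    have := DFunLike.congr_fun hJ (Sum.inr i)
    rw [Finsupp.mapDomain_of_notMem_range _ _ (by simp)] at this
    exact this.symm

lemma ext_sumElim {f g : FPS2 m l} (h : ∀ (a : Fin m →₀ ℕ) (I : Fin l →₀ ℕ), coeff (sumElim a I) f =
      coeff (sumElim a I) g) : f = g := by
  ext d
  have : d = sumElim (d.comapDomain Sum.inl Sum.inl_injective.injOn)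
      (d.comapDomain Sum.inr Sum.inr_injective.injOn) := by
    ext (i | j) <;> rfl
  rw [this]; exact h _ _

lemma sumElim_add_single_inl (β : Fin m →₀ ℕ) (I : Fin l →₀ ℕ) (i : Fin m) :
    sumElim (β + single i 1) I =
      sumElim β I + single (Sum.inl i) 1 := by
  classical
  ext (k | k)
  · simp [Finsupp.single_apply]
  · simp

lemma yPart_pderiv_inl (β : Fin m →₀ ℕ) (i : Fin m) (f : FPS2 m l) :
    yPart β (pderiv ℂ (Sum.inl i) f) = ((β i : ℂ) + 1) • yPart (β + single i 1) f := by
  apply ext_sumElim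
  intro a I
  rw [coeff_smul, coeff_yPart, coeff_yPart]
  split_ifs
  · rw [coeff_pderiv, sumElim_add_single_inl, sumElim_inl, mul_comm]
  · simp

lemma multiIndex_induction {P : (Fin m →₀ ℕ) → Prop} (h0 : P 0)
    (hs : ∀ β i, P β → P (β + single i 1)) (β : Fin m →₀ ℕ) : P β := by
  induction hn : β.degree generalizing β with
  | zero => rw [Finsupp.degree_eq_zero_iff] at hn; rwa [hn]
  | succ n ih =>
    have h : β ≠ 0 := by rintro rfl; simp at hn
    obtain ⟨i, hi⟩ := Finsupp.ne_iff.1 h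
    have e : β - single i 1 + single i 1 = β := by
      apply tsub_add_cancel_of_le
      rw [Finsupp.single_le_iff]
      exact Nat.one_le_iff_ne_zero.2 hi
    rw [← e] at hn ⊢
    apply hs
    apply ih
    rw [map_add, Finsupp.degree_single] at hn
    omega

/-- An operator that commutes with the `∂/∂xᵢ` commutes with taking `x`-coefficients when it
commutes with setting `x = 0`. -/
lemma yPart_comm {T : FPS2 m l →ₗ[ℂ] FPS2 m l} (h0 : ∀ f, yPart 0 (T f) = T (yPart 0 f))
    (hT : ∀ i f, pderiv ℂ (Sum.inl i) (T f) = T (pderiv ℂ (Sum.inl i) f)) (β : Fin m →₀ ℕ)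
    (f : FPS2 m l) : yPart β (T f) = T (yPart β f) := by
  induction β using multiIndex_induction generalizing f with
  | h0 => exact h0 f
  | hs β i ih =>
    have hne : ((β i : ℂ) + 1) ≠ 0 := Nat.cast_add_one_ne_zero _
    apply smul_right_injective _ hne
    change ((β i : ℂ) + 1) • _ = ((β i : ℂ) + 1) • _
    rw [← yPart_pderiv_inl, hT, ih, yPart_pderiv_inl, map_smul]

/-- Setting `x = 0`. -/
def yPartZero : FPS2 m l →ₐ[ℂ] FPS2 m l :=
  (rename (R := ℂ) (Sum.inr : Fin l → Fin m ⊕ Fin l)).comp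
    (killCompl (R := ℂ) (Function.Embedding.inr : Fin l ↪ Fin m ⊕ Fin l))

lemma yPart_zero (f : FPS2 m l) : yPart 0 f = yPartZero f := by
  rw [yPart_apply, yPartZero, AlgHom.comp_apply]
  congr 1
  ext I
  rw [coeff_killCompl, embDomain_inr]; rfl

lemma yPartZero_eq_subst (f : FPS2 m l) :
    yPartZero f = subst (Sum.elim (fun _ => 0) fun j => (X (Sum.inr j) : FPS2 m l)) f := by
  rw [eq_subst_of_map_X yPartZero _ f]
  · congr 1
    funext i
    rcases i with i | j
    · rw [yPartZero, AlgHom.comp_apply, killCompl_X_eq_zero (by simp), map_zero, Sum.elim_inl]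
    · rw [yPartZero, AlgHom.comp_apply]
      have := killCompl_X (R := ℂ) (e := (Function.Embedding.inr : Fin l ↪ Fin m ⊕ Fin l)) j
      rw [Function.Embedding.inr_apply] at this
      rw [this, rename_X, Sum.elim_inr]
  · intro N f hf
    rw [le_order_iff_coeff] at hf ⊢
    intro d hd
    obtain ⟨a, I, rfl⟩ : ∃ (a : Fin m →₀ ℕ) (I : Fin l →₀ ℕ), d = sumElim a I :=
      ⟨d.comapDomain Sum.inl Sum.inl_injective.injOn,
        d.comapDomain Sum.inr Sum.inr_injective.injOn, by ext (i | j) <;> rfl⟩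
    rw [← yPart_zero, coeff_yPart]
    split_ifs with h
    · subst h; exact hf _ hd
    · rfl

lemma yPartZero_X_inl (i : Fin m) : yPartZero (X (Sum.inl i) : FPS2 m l) = 0 := by
  rw [yPartZero, AlgHom.comp_apply, killCompl_X_eq_zero (by simp), map_zero]

lemma yPartZero_X_inr (j : Fin l) : yPartZero (X (Sum.inr j) : FPS2 m l) = X (Sum.inr j) := by
  rw [yPartZero, AlgHom.comp_apply]
  have := killCompl_X (R := ℂ) (e := (Function.Embedding.inr : Fin l ↪ Fin m ⊕ Fin l)) j
  rw [Function.Embedding.inr_apply] at this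
  rw [this, rename_X]

lemma constantCoeff_zeroVar (i : Fin m ⊕ Fin l) : constantCoeff
    ((Sum.elim (fun _ => 0) fun j => (X (Sum.inr j) : FPS2 m l)) i) = 0 := by
  rcases i with i | j <;> simp

lemma pderiv_inr_yPartZero (f : FPS2 m l) (j : Fin l) :
    pderiv ℂ (Sum.inr j) (yPartZero f) = yPartZero (pderiv ℂ (Sum.inr j) f) := by
  classical
  rw [yPartZero_eq_subst, pderiv_subst constantCoeff_zeroVar, Fintype.sum_sum_type,
    sum_eq_zero (by simp), zero_add, sum_eq_single j, yPartZero_eq_subst]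
  · simp
  · intro k _ hk
    simp [pderiv_X_of_ne (i := (Sum.inr j : Fin m ⊕ Fin l)) (j := Sum.inr k) (by simpa using hk)]
  · simp

variable (σ)

lemma yPartZero_grpHom (h : H) (f : FPS2 m l) :
    yPartZero (grpHom m σ h f) = grpHom m σ h (yPartZero f) := by
  rw [yPartZero_eq_subst, yPartZero_eq_subst, grpHom_eq_subst, grpHom_eq_subst]
  rw [subst_algHom_ext (constantCoeff_grpVar m σ h) constantCoeff_zeroVar (fun i => rfl)]
  symm
  apply subst_algHom_ext constantCoeff_zeroVar (constantCoeff_grpVar m σ h)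
  rintro (i | j)
  · rw [← yPartZero_eq_subst, ← grpHom_eq_subst, Sum.elim_inl, map_zero, grpVar, Sum.elim_inl,
      yPartZero_X_inl]
  · rw [← yPartZero_eq_subst, ← grpHom_eq_subst, Sum.elim_inr, grpHom_X_inr, grpVar, Sum.elim_inr,
      map_sum]
    simp only [map_smul, yPartZero_X_inr]

lemma yPart_grpHom (h : H) (β : Fin m →₀ ℕ) (f : FPS2 m l) :
    yPart β (grpHom m σ h f) = grpHom m σ h (yPart β f) :=
  yPart_comm (T := (grpHom m σ h).toLinearMap)
    (fun f => by simp only [yPart_zero]; exact yPartZero_grpHom σ h f)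
    (fun i f => pderiv_inl_grpHom m σ h f i) β f

lemma yPart_pderiv_inr (j : Fin l) (β : Fin m →₀ ℕ) (f : FPS2 m l) :
    yPart β (pderiv ℂ (Sum.inr j) f) = pderiv ℂ (Sum.inr j) (yPart β f) :=
  yPart_comm (T := (pderiv ℂ (Sum.inr j)).toLinearMap)
    (fun f => by simp only [yPart_zero]; exact (pderiv_inr_yPartZero f j).symm)
    (fun i f => pderiv_pderiv_comm (Sum.inl i) (Sum.inr j) f) β f

lemma yPart_X_inr_mul (j : Fin l) (β : Fin m →₀ ℕ) (f : FPS2 m l) :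
    yPart β (X (Sum.inr j) * f) = X (Sum.inr j) * yPart β f :=
  yPart_comm (T := mulLeft ℂ (X (Sum.inr j)))
    (fun f => by simp only [yPart_zero, mulLeft_apply, map_mul, yPartZero_X_inr])
    (fun i f => by
      simp only [mulLeft_apply]
      rw [Derivation.leibniz, pderiv_X_of_ne (by simp), smul_zero, add_zero, smul_eq_mul]) β f

lemma yPartZero_corootForm (s : H) :
    yPartZero (corootForm m σ s) = corootForm m σ s := by
  simp only [corootForm, map_sum, map_smul, yPartZero_X_inr]

lemma yPart_divDiff {s : H} (hs : s ∈ reflections σ) (β : Fin m →₀ ℕ) (f : FPS2 m l) :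
    yPart β (divDiff m σ s f) = divDiff m σ s (yPart β f) :=
  yPart_comm (T := divDiff m σ s)
    (fun f => by
      simp only [yPart_zero]
      apply eq_divDiff m σ hs
      rw [← yPartZero_grpHom, ← map_sub, ← corootForm_mul_divDiff m σ hs, map_mul,
        yPartZero_corootForm])
    (fun i f => pderiv_inl_divDiff m σ s f i) β f

lemma yPart_inXHom_mul (β : Fin m →₀ ℕ) (p : FPS m) (f : FPS2 m l) :
    yPart β (inXHom l p * f) = ∑ q ∈ Finset.HasAntidiagonal.antidiagonal β,
      coeff q.1 p • yPart q.2 f := by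
  classical
  apply ext_sumElim
  intro a I
  rw [coeff_yPart, map_sum]
  simp only [coeff_smul, coeff_yPart]
  split_ifs with ha
  · rw [coeff_mul, ← Finsupp.image_sumElim_product_antidiagonal, Finset.sum_image,
      Finset.sum_product]
    · refine sum_congr rfl fun q _ => ?_
      rw [sum_eq_single (0, I)]
      · rw [coeff_inXHom, if_pos rfl]
      · rintro ⟨z, w⟩ hzw hne
        rw [coeff_inXHom, if_neg, zero_mul]
        rintro rfl
        apply hne
        simpa using hzw
      · intro h; exact absurd (by simp) h
    · rintro ⟨⟨a, b⟩, c, d⟩ _ ⟨⟨a', b'⟩, c', d'⟩ _ h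
      simp only [Prod.mk.injEq] at h ⊢
      refine ⟨⟨?_, ?_⟩, ?_, ?_⟩
      · ext i; simpa using DFunLike.congr_fun h.1 (Sum.inl i)
      · ext i; simpa using DFunLike.congr_fun h.2 (Sum.inl i)
      · ext i; simpa using DFunLike.congr_fun h.1 (Sum.inr i)
      · ext i; simpa using DFunLike.congr_fun h.2 (Sum.inr i)
  · simp

end YPart

/-! ### Components with respect to `x^β ∂^α` -/

section Components

variable {A : Type*} [Ring A] [Algebra ℂ A] (r : HCRep m σ c A)

namespace HCRep

/-- The homomorphism `ℂ[∂, u] → A`. -/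
def sym : Sym m l →ₐ[ℂ] A := r.hom.comp (symHom m σ c)

lemma sym_X_inl (i : Fin m) : r.sym (MvPolynomial.X (Sum.inl i)) = r.D i := by
  rw [sym, AlgHom.comp_apply, symHom_X]; exact r.hom_D i

lemma sym_X_inr (j : Fin l) : r.sym (MvPolynomial.X (Sum.inr j)) = r.U j := by
  rw [sym, AlgHom.comp_apply, symHom_X]; exact r.hom_U j

/-- The monomial `∂^α`. -/
def Dp (α : Fin m →₀ ℕ) : A :=
  r.sym (MvPolynomial.monomial (sumElim α (0 : Fin l →₀ ℕ)) 1)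

/-- The monomial `u^J`. -/
def Up (J : Fin l →₀ ℕ) : A :=
  r.sym (MvPolynomial.monomial (sumElim (0 : Fin m →₀ ℕ) J) 1)

lemma Dp_mul_Up (α : Fin m →₀ ℕ) (J : Fin l →₀ ℕ) : r.Dp α * r.Up J =
    r.sym (MvPolynomial.monomial (sumElim α J) 1) := by
  rw [Dp, Up, ← map_mul, MvPolynomial.monomial_mul, mul_one]
  have : sumElim α (0 : Fin l →₀ ℕ) + sumElim (0 : Fin m →₀ ℕ) J =
      sumElim α J := by
    ext (i | i) <;> simp
  rw [this]

lemma Dp_zero : r.Dp 0 = 1 := by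
  rw [Dp, ← map_one r.sym]
  congr 1
  have : sumElim (0 : Fin m →₀ ℕ) (0 : Fin l →₀ ℕ) = 0 := by ext (i | i) <;> simp
  rw [this]; rfl

lemma Up_zero : r.Up 0 = 1 := r.Dp_zero

lemma Dp_add_single (α : Fin m →₀ ℕ) (i : Fin m) : r.Dp (α + single i 1) = r.Dp α * r.D i := by
  rw [Dp, Dp, ← sym_X_inl, ← map_mul, sumElim_add_single_inl]
  congr 1
  rw [MvPolynomial.X, MvPolynomial.monomial_mul, mul_one]

lemma Up_add_single (J : Fin l →₀ ℕ) (j : Fin l) : r.Up (J + single j 1) = r.Up J * r.U j := by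
  rw [Up, Up, ← sym_X_inr, ← map_mul]
  congr 1
  rw [MvPolynomial.X, MvPolynomial.monomial_mul, mul_one]
  have : sumElim (0 : Fin m →₀ ℕ) (J + single j 1) =
      sumElim (0 : Fin m →₀ ℕ) J + single (Sum.inr j) 1 := by
    classical
    ext (i | i) <;> simp [Finsupp.single_apply]
  rw [this]

/-- The subalgebra of `A` generated by the `y_j`, the `u_j` and `H`. -/
def fibreAlg : Subalgebra ℂ A :=
  Algebra.adjoin ℂ (Set.range r.Y ∪ Set.range r.U ∪ Set.range r.K)

lemma Y_mem (j : Fin l) : r.Y j ∈ r.fibreAlg := Algebra.subset_adjoin (.inl (.inl ⟨j, rfl⟩))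
lemma U_mem (j : Fin l) : r.U j ∈ r.fibreAlg := Algebra.subset_adjoin (.inl (.inr ⟨j, rfl⟩))
lemma K_mem (h : H) : r.K h ∈ r.fibreAlg := Algebra.subset_adjoin (.inr ⟨h, rfl⟩)

lemma Up_mem (J : Fin l →₀ ℕ) : r.Up J ∈ r.fibreAlg := by
  induction J using multiIndex_induction with
  | h0 => rw [Up_zero]; exact one_mem _
  | hs J j ih => rw [Up_add_single]; exact mul_mem ih (r.U_mem j)

lemma fibre_comm {t : A} (ht : t ∈ r.fibreAlg) : (∀ i, r.D i * t = t * r.D i) ∧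
    ∀ p, r.fx p * t = t * r.fx p := by
  induction ht using Algebra.adjoin_induction with
  | mem x hx =>
    rcases hx with (⟨j, rfl⟩ | ⟨j, rfl⟩) | ⟨h, rfl⟩
    · exact ⟨fun i => r.D_mul_Y i j, fun p => (r.fx_comm_Y p j).symm⟩
    · exact ⟨fun i => r.D_mul_U i j, fun p => (r.fx_comm_U p j).symm⟩
    · exact ⟨fun i => (r.K_mul_D h i).symm, fun p => (r.fx_comm_K p h).symm⟩
  | algebraMap z => exact ⟨fun i => (Algebra.commutes _ _).symm, fun p => (Algebra.commutes _ _).symm⟩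
  | add x y _ _ hx hy =>
    exact ⟨fun i => by rw [mul_add, add_mul, hx.1, hy.1],
      fun i => by rw [mul_add, add_mul, hx.2, hy.2]⟩
  | mul x y _ _ hx hy =>
    exact ⟨fun i => by rw [← mul_assoc, hx.1, mul_assoc, hy.1, mul_assoc],
      fun i => by rw [← mul_assoc, hx.2, mul_assoc, hy.2, mul_assoc]⟩

lemma D_mul_Dp (i : Fin m) (α : Fin m →₀ ℕ) : r.D i * r.Dp α = r.Dp α * r.D i := by
  rw [Dp, ← sym_X_inl, ← map_mul, ← map_mul, mul_comm]

lemma Dp_mul_fibre {t : A} (ht : t ∈ r.fibreAlg) (α : Fin m →₀ ℕ) : r.Dp α * t = t * r.Dp α := by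
  induction α using multiIndex_induction with
  | h0 => rw [Dp_zero, one_mul, mul_one]
  | hs α i ih => rw [Dp_add_single, mul_assoc, (r.fibre_comm ht).1, ← mul_assoc, ih, mul_assoc]

/-- The elements `f ∂^α u^J h` form a topological basis: `cf` gives the coefficients. -/
def IsPBW (cf : A ≃ₗ[ℂ] (Idx m l H →₀ FPS2 m l)) : Prop :=
  ∀ i f, cf (r.F f * r.Dp i.1 * (r.Up i.2.1 * r.K i.2.2)) = single i f

variable {r} {cf : A ≃ₗ[ℂ] (Idx m l H →₀ FPS2 m l)} (hcf : r.IsPBW cf)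

variable (r cf) in
open Classical in
/-- The coefficient of `x^β ∂^α`. -/
def comp (α β : Fin m →₀ ℕ) : A →ₗ[ℂ] A :=
  (Finsupp.lsum ℂ fun i : Idx m l H => if i.1 = α then
    LinearMap.mulRight ℂ (r.Up i.2.1 * r.K i.2.2) ∘ₗ r.F.toLinearMap ∘ₗ yPart β else 0) ∘ₗ
    cf.toLinearMap

lemma comp_basis [DecidableEq (Fin m →₀ ℕ)] (hcf : r.IsPBW cf) (α α' β : Fin m →₀ ℕ)
    (J : Fin l →₀ ℕ) (h : H) (f : FPS2 m l) :
    r.comp cf α' β (r.F f * r.Dp α * (r.Up J * r.K h)) =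
      if α = α' then r.F (yPart β f) * (r.Up J * r.K h) else 0 := by
  have := hcf (α, J, h) f
  simp only at this
  rw [comp, LinearMap.comp_apply, LinearEquiv.coe_coe, this]
  simp only [Finsupp.lsum_single]
  split_ifs <;> rfl

variable (r) in
/-- The span of the elements `u^J h`. -/
def vecSpan : Submodule ℂ A := Submodule.span ℂ (Set.range fun p : (Fin l →₀ ℕ) × H =>
  r.Up p.1 * r.K p.2)

lemma U_mul_Up (j : Fin l) (J : Fin l →₀ ℕ) : r.U j * r.Up J = r.Up (J + single j 1) := by
  rw [Up_add_single, Up, ← sym_X_inr, ← map_mul, ← map_mul, mul_comm]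

lemma U_mul_mem_vecSpan (j : Fin l) {t : A} (ht : t ∈ r.vecSpan) : r.U j * t ∈ r.vecSpan := by
  induction ht using span_induction with
  | mem x hx =>
    obtain ⟨p, rfl⟩ := hx
    refine subset_span ⟨(p.1 + single j 1, p.2), ?_⟩
    simp only
    rw [← U_mul_Up, mul_assoc]
  | zero => rw [mul_zero]; exact zero_mem _
  | add x y _ _ hx hy => rw [mul_add]; exact add_mem hx hy
  | smul z x _ hx => rw [mul_smul_comm]; exact smul_mem _ _ hx

lemma K_mul_mem_vecSpan (h : H) {t : A} (ht : t ∈ r.vecSpan) : r.K h * t ∈ r.vecSpan := by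
  induction ht using span_induction with
  | mem x hx =>
    obtain ⟨⟨J, k⟩, rfl⟩ := hx
    simp only
    induction J using multiIndex_induction with
    | h0 =>
      refine subset_span ⟨(0, h * k), ?_⟩
      simp only
      rw [Up_zero, map_mul, one_mul, one_mul]
    | hs J j ih =>
      rw [← U_mul_Up, mul_assoc, ← mul_assoc (r.K h), r.K_mul_U, sum_mul, sum_mul]
      refine Submodule.sum_mem _ fun i _ => ?_
      rw [smul_mul_assoc, smul_mul_assoc, mul_assoc]
      exact smul_mem _ _ (U_mul_mem_vecSpan i ih)
  | zero => rw [mul_zero]; exact zero_mem _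
  | add x y _ _ hx hy => rw [mul_add]; exact add_mem hx hy
  | smul z x _ hx => rw [mul_smul_comm]; exact smul_mem _ _ hx

lemma vecSpan_le {t : A} (ht : t ∈ r.vecSpan) : t ∈ r.fibreAlg := by
  have : r.vecSpan ≤ r.fibreAlg.toSubmodule := by
    rw [vecSpan, Submodule.span_le]
    rintro _ ⟨p, rfl⟩
    exact r.fibreAlg.mul_mem (r.Up_mem _) (r.K_mem _)
  exact this ht

variable [DecidableEq (Fin m →₀ ℕ)]

lemma comp_mono_vecSpan (hcf : r.IsPBW cf) {t : A} (ht : t ∈ r.vecSpan)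
    (α α' β : Fin m →₀ ℕ) (f : FPS2 m l) :
    r.comp cf α' β (r.F f * r.Dp α * t) = if α = α' then r.F (yPart β f) * t else 0 := by
  induction ht using span_induction with
  | mem x hx =>
    obtain ⟨p, rfl⟩ := hx
    exact comp_basis hcf α α' β p.1 p.2 f
  | zero => simp
  | add x y _ _ hx hy =>
    rw [mul_add, map_add, hx, hy]; split_ifs
    · rw [mul_add]
    · rw [add_zero]
  | smul z x _ hx =>
    rw [mul_smul_comm, map_smul, hx]; split_ifs
    · rw [mul_smul_comm]
    · rw [smul_zero]

lemma ext_vecSpan (hcf : r.IsPBW cf) {P Q : A →ₗ[ℂ] A}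
    (h : ∀ f α, ∀ t ∈ r.vecSpan, P (r.F f * r.Dp α * t) = Q (r.F f * r.Dp α * t)) (a : A) :
    P a = Q a := by
  obtain ⟨F, rfl⟩ := cf.symm.surjective a
  induction F using Finsupp.induction_linear with
  | zero => simp
  | add F G hF hG => rw [map_add, map_add, map_add, hF, hG]
  | single i f =>
    rw [← hcf i f, LinearEquiv.symm_apply_apply]
    exact h f i.1 _ (subset_span ⟨i.2, rfl⟩)

lemma comp_Y_mul (hcf : r.IsPBW cf) (j : Fin l) (α β : Fin m →₀ ℕ) (a : A) :
    r.comp cf α β (r.Y j * a) = r.Y j * r.comp cf α β a := by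
  refine ext_vecSpan hcf (P := r.comp cf α β ∘ₗ mulLeft ℂ (r.Y j))
    (Q := mulLeft ℂ (r.Y j) ∘ₗ r.comp cf α β) ?_ a
  intro f α' t ht
  simp only [LinearMap.comp_apply, mulLeft_apply]
  rw [Y, ← mul_assoc, ← mul_assoc, ← map_mul, comp_mono_vecSpan hcf ht, comp_mono_vecSpan hcf ht,
    yPart_X_inr_mul]
  split_ifs
  · rw [map_mul, mul_assoc]
  · rw [mul_zero]

lemma comp_K_mul (hcf : r.IsPBW cf) (h : H) (α β : Fin m →₀ ℕ) (a : A) :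
    r.comp cf α β (r.K h * a) = r.K h * r.comp cf α β a := by
  refine ext_vecSpan hcf (P := r.comp cf α β ∘ₗ mulLeft ℂ (r.K h))
    (Q := mulLeft ℂ (r.K h) ∘ₗ r.comp cf α β) ?_ a
  intro f α' t ht
  simp only [LinearMap.comp_apply, mulLeft_apply]
  rw [← mul_assoc, ← mul_assoc, r.K_mul_F, mul_assoc (r.F _), ← r.Dp_mul_fibre (r.K_mem h),
    ← mul_assoc, mul_assoc _ _ t, comp_mono_vecSpan hcf (K_mul_mem_vecSpan h ht),
    comp_mono_vecSpan hcf ht, yPart_grpHom]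
  split_ifs
  · rw [← mul_assoc, ← mul_assoc, r.K_mul_F]
  · rw [mul_zero]

lemma comp_U_mul (hcf : r.IsPBW cf) (j : Fin l) (α β : Fin m →₀ ℕ) (a : A) :
    r.comp cf α β (r.U j * a) = r.U j * r.comp cf α β a := by
  refine ext_vecSpan hcf (P := r.comp cf α β ∘ₗ mulLeft ℂ (r.U j))
    (Q := mulLeft ℂ (r.U j) ∘ₗ r.comp cf α β) ?_ a
  intro f α' t ht
  have hU : ∀ f, r.F f * r.U j * r.Dp α' * t = r.F f * r.Dp α' * (r.U j * t) := fun f => by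
    rw [mul_assoc (r.F _), ← r.Dp_mul_fibre (r.U_mem j), ← mul_assoc, mul_assoc _ _ t]
  have hK : ∀ f h, r.F f * r.K h * r.Dp α' * t = r.F f * r.Dp α' * (r.K h * t) := fun f h => by
    rw [mul_assoc (r.F _), ← r.Dp_mul_fibre (r.K_mem h), ← mul_assoc, mul_assoc _ _ t]
  simp only [LinearMap.comp_apply, mulLeft_apply]
  rw [← mul_assoc, ← mul_assoc, r.U_mul_F, comp_mono_vecSpan hcf ht]
  simp only [sub_mul, add_mul, sum_mul, smul_mul_assoc, map_sub, map_add, map_sum, map_smul,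
    hU, hK, comp_mono_vecSpan hcf ht, comp_mono_vecSpan hcf (U_mul_mem_vecSpan j ht),
    comp_mono_vecSpan hcf (K_mul_mem_vecSpan _ ht)]
  split_ifs
  · rw [← mul_assoc (r.U j), r.U_mul_F]
    simp only [sub_mul, add_mul, sum_mul, smul_mul_assoc, yPart_pderiv_inr, mul_assoc]
    congr 1
    refine sum_congr rfl fun s hs => ?_
    rw [yPart_divDiff σ hs]
  · simp

lemma comp_fibre_mul (hcf : r.IsPBW cf) {t : A} (ht : t ∈ r.fibreAlg) (α β : Fin m →₀ ℕ) (a : A) :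
    r.comp cf α β (t * a) = t * r.comp cf α β a := by
  induction ht using Algebra.adjoin_induction generalizing a with
  | mem x hx =>
    rcases hx with (⟨j, rfl⟩ | ⟨j, rfl⟩) | ⟨h, rfl⟩
    · exact comp_Y_mul hcf j α β a
    · exact comp_U_mul hcf j α β a
    · exact comp_K_mul hcf h α β a
  | algebraMap z => rw [← Algebra.smul_def, ← Algebra.smul_def, map_smul]
  | add x y _ _ hx hy => rw [add_mul, add_mul, map_add, hx, hy]
  | mul x y _ _ hx hy => rw [mul_assoc, hx, hy, mul_assoc]

/-- The formula of `comp_mono` is stable under left multiplication by the fibre algebra. -/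
lemma comp_mono_step (hcf : r.IsPBW cf) {t₁ : A} (ht₁ : t₁ ∈ r.fibreAlg) {α' β : Fin m →₀ ℕ}
    {t₂ : A} (h₂ : ∀ α f, r.comp cf α' β (r.F f * r.Dp α * t₂) =
      if α = α' then r.F (yPart β f) * t₂ else 0) (α : Fin m →₀ ℕ) (f : FPS2 m l) :
    r.comp cf α' β (r.F f * r.Dp α * (t₁ * t₂)) =
      if α = α' then r.F (yPart β f) * (t₁ * t₂) else 0 := by
  induction ht₁ using Algebra.adjoin_induction generalizing α f t₂ with
  | mem x hx =>
    have hcomm : r.F f * r.Dp α * (x * t₂) = r.F f * x * (r.Dp α * t₂) := by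
      rw [mul_assoc, ← mul_assoc (r.Dp α), r.Dp_mul_fibre (Algebra.subset_adjoin hx)]
      simp only [mul_assoc]
    rcases hx with (⟨j, rfl⟩ | ⟨j, rfl⟩) | ⟨h, rfl⟩
    · rw [hcomm, Y, ← map_mul, ← mul_assoc, h₂, mul_comm f, yPart_X_inr_mul,
        mul_comm _ (yPart β f), map_mul, ← mul_assoc]
    · have e : ∀ f, r.F f * r.U j = r.U j * r.F f - r.F (pderiv ℂ (Sum.inr j) f) +
          ∑ s ∈ reflections σ, (dunklConst σ c s * coroot σ s j) •
            (r.K s * r.F (grpHom m σ s⁻¹ (divDiff m σ s f))) := by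
        intro f
        rw [r.U_mul_F]
        simp only [r.K_mul_F, grpHom_grpHom, mul_inv_cancel, grpHom_one]
        abel
      rw [hcomm, e]
      simp only [sub_mul, add_mul, sum_mul, smul_mul_assoc, map_sub, map_add, map_sum,
        map_smul, mul_assoc, comp_fibre_mul hcf (r.U_mem j), comp_fibre_mul hcf (r.K_mem _)]
      simp only [← mul_assoc, h₂]
      split_ifs
      · rw [e]
        simp only [sub_mul, add_mul, sum_mul, smul_mul_assoc, yPart_pderiv_inr]
        simp only [mul_assoc]
        congr 1
        refine sum_congr rfl fun s hs => ?_
        rw [yPart_grpHom, yPart_divDiff σ hs]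
      · simp
    · have e : ∀ f, r.F f * r.K h = r.K h * r.F (grpHom m σ h⁻¹ f) := by
        intro f
        rw [r.K_mul_F, grpHom_grpHom, mul_inv_cancel, grpHom_one]
      rw [hcomm, e, mul_assoc, comp_fibre_mul hcf (r.K_mem h), ← mul_assoc, h₂, yPart_grpHom]
      split_ifs
      · rw [← mul_assoc, ← mul_assoc, ← e]
      · rw [mul_zero]
  | algebraMap z =>
    rw [← Algebra.smul_def, mul_smul_comm, map_smul, h₂]
    split_ifs
    · rw [mul_smul_comm]
    · rw [smul_zero]
  | add x y _ _ ihx ihy =>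
    rw [add_mul, mul_add, map_add, ihx h₂, ihy h₂]
    split_ifs
    · rw [mul_add]
    · rw [add_zero]
  | mul x y _ _ ihx ihy =>
    rw [mul_assoc x]
    exact ihx (fun α f => ihy h₂ α f) α f

lemma comp_mono (hcf : r.IsPBW cf) {t : A} (ht : t ∈ r.fibreAlg)
    (α α' β : Fin m →₀ ℕ) (f : FPS2 m l) :
    r.comp cf α' β (r.F f * r.Dp α * t) = if α = α' then r.F (yPart β f) * t else 0 := by
  have h1 := comp_mono_step hcf ht (t₂ := 1) (fun α f => by
    have := comp_basis hcf α α' β 0 1 f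
    rwa [Up_zero, map_one, one_mul] at this) α f
  rwa [mul_one] at h1

lemma comp_mul_fibre (hcf : r.IsPBW cf) {t : A} (ht : t ∈ r.fibreAlg) (α β : Fin m →₀ ℕ) (a : A) :
    r.comp cf α β (a * t) = r.comp cf α β a * t := by
  refine ext_vecSpan hcf (P := r.comp cf α β ∘ₗ LinearMap.mulRight ℂ t)
    (Q := LinearMap.mulRight ℂ t ∘ₗ r.comp cf α β) ?_ a
  intro f α' t' ht'
  simp only [LinearMap.comp_apply, mulRight_apply]
  rw [mul_assoc, comp_mono hcf (mul_mem (vecSpan_le ht') ht), comp_mono_vecSpan hcf ht']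
  split_ifs
  · rw [mul_assoc]
  · rw [zero_mul]

lemma comp_fx_mul (hcf : r.IsPBW cf) (p : FPS m) (α β : Fin m →₀ ℕ) (a : A) :
    r.comp cf α β (r.fx p * a) = ∑ q ∈ Finset.HasAntidiagonal.antidiagonal β,
      coeff q.1 p • r.comp cf α q.2 a := by
  have := ext_vecSpan hcf (P := r.comp cf α β ∘ₗ mulLeft ℂ (r.fx p))
    (Q := ∑ q ∈ Finset.HasAntidiagonal.antidiagonal β, coeff q.1 p • r.comp cf α q.2) ?_ a
  · simpa using this
  intro f α' t ht
  simp only [LinearMap.comp_apply, mulLeft_apply, LinearMap.sum_apply, LinearMap.smul_apply]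
  change r.comp cf α β (r.F (inXHom l p) * _) = _
  rw [← mul_assoc, ← mul_assoc, ← map_mul, comp_mono_vecSpan hcf ht, yPart_inXHom_mul]
  simp only [comp_mono_vecSpan hcf ht]
  split_ifs
  · rw [map_sum, sum_mul]
    refine sum_congr rfl fun q _ => ?_
    rw [map_smul, smul_mul_assoc]
  · simp

lemma single_add_eq_iff (α α' : Fin m →₀ ℕ) (i : Fin m) :
    α + single i 1 = α' ↔ α' i ≠ 0 ∧ α = α' - single i 1 := by
  constructor
  · rintro rfl
    simp
  · rintro ⟨h, rfl⟩
    apply tsub_add_cancel_of_le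
    rw [Finsupp.single_le_iff]
    exact Nat.one_le_iff_ne_zero.2 h

lemma comp_D_mul (hcf : r.IsPBW cf) (i : Fin m) (α β : Fin m →₀ ℕ) (a : A) :
    r.comp cf α β (r.D i * a) = ((β i : ℂ) + 1) • r.comp cf α (β + single i 1) a +
      if α i = 0 then 0 else r.comp cf (α - single i 1) β a := by
  have := ext_vecSpan hcf (P := r.comp cf α β ∘ₗ mulLeft ℂ (r.D i))
    (Q := ((β i : ℂ) + 1) • r.comp cf α (β + single i 1) +
      if α i = 0 then 0 else r.comp cf (α - single i 1) β) ?_ a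
  · rw [LinearMap.comp_apply, mulLeft_apply, LinearMap.add_apply] at this
    rw [this]
    split_ifs <;> rfl
  intro f α' t ht
  rw [LinearMap.comp_apply, mulLeft_apply, LinearMap.add_apply, LinearMap.smul_apply,
    ← mul_assoc, ← mul_assoc, r.D_mul_F, add_mul, add_mul, map_add, mul_assoc (r.F f), r.D_mul_Dp,
    ← Dp_add_single, comp_mono_vecSpan hcf ht, comp_mono_vecSpan hcf ht, yPart_pderiv_inl,
    comp_mono_vecSpan hcf ht, add_comm]
  congr 1
  · split_ifs
    · rw [map_smul, smul_mul_assoc]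
    · rw [smul_zero]
  · simp only [single_add_eq_iff]
    by_cases h : α i = 0
    · simp [h]
    · simp only [h, ne_eq, not_false_eq_true, true_and, if_false]
      rw [comp_mono_vecSpan hcf ht]

lemma comp_mul_D (hcf : r.IsPBW cf) (i : Fin m) (α β : Fin m →₀ ℕ) (a : A) :
    r.comp cf α β (a * r.D i) = if α i = 0 then 0 else r.comp cf (α - single i 1) β a := by
  have := ext_vecSpan hcf (P := r.comp cf α β ∘ₗ LinearMap.mulRight ℂ (r.D i))
    (Q := if α i = 0 then 0 else r.comp cf (α - single i 1) β) ?_ a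
  · rw [LinearMap.comp_apply, mulRight_apply] at this
    rw [this]
    split_ifs <;> rfl
  intro f α' t ht
  rw [LinearMap.comp_apply, mulRight_apply, mul_assoc,
    ← (r.fibre_comm (vecSpan_le ht)).1, ← mul_assoc, mul_assoc (r.F f), ← Dp_add_single,
    comp_mono_vecSpan hcf ht]
  simp only [single_add_eq_iff]
  by_cases h : α i = 0
  · simp [h]
  · simp only [h, ne_eq, not_false_eq_true, true_and, if_false]
    rw [comp_mono_vecSpan hcf ht]

end HCRep
end Components

/-! ### The components of the flatness equation -/

section Leibniz

/-- The contribution of one variable to the coefficient in the Leibniz rule. -/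
def leibnizFactor (d a k : ℕ) : ℕ := d.choose a * (k + (d - a)).descFactorial (d - a)

/-- The coefficient `binom(δ, α) (κ + δ - α)! / κ!` of the Leibniz rule. -/
def leibnizCoeff (δ α κ : Fin m →₀ ℕ) : ℕ := ∏ k, leibnizFactor (δ k) (α k) (κ k)

lemma leibnizCoeff_eq_zero {δ α κ : Fin m →₀ ℕ} (h : ¬ α ≤ δ) : leibnizCoeff δ α κ = 0 := by
  rw [Finsupp.le_def] at h
  push Not at h
  obtain ⟨k, hk⟩ := h
  exact Finset.prod_eq_zero (Finset.mem_univ k)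
    (by rw [leibnizFactor, Nat.choose_eq_zero_of_lt hk, zero_mul])

lemma leibnizCoeff_self (α κ : Fin m →₀ ℕ) : leibnizCoeff α α κ = 1 := by
  simp [leibnizCoeff, leibnizFactor]

lemma leibnizCoeff_succ (δ α κ : Fin m →₀ ℕ) (i : Fin m) (p : FPS m) :
    (leibnizCoeff (δ + single i 1) α κ : ℂ) * coeff (κ + (δ + single i 1 - α)) p =
      (if α i = 0 then 0 else (leibnizCoeff δ (α - single i 1) κ : ℂ) *
        coeff (κ + (δ - (α - single i 1))) p) +
      leibnizCoeff δ α κ * coeff (κ + (δ - α)) (pderiv ℂ i p) := by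
  classical
  have hs : ∀ k ≠ i, single i 1 k = 0 := fun k hk => single_eq_of_ne hk
  have hR : ∀ δ' α' : Fin m →₀ ℕ, (∀ k ≠ i, δ' k = δ k ∧ α' k = α k) →
      leibnizCoeff δ' α' κ = leibnizFactor (δ' i) (α' i) (κ i) *
        ∏ k ∈ Finset.univ.erase i, leibnizFactor (δ k) (α k) (κ k) := fun δ' α' h =>
    (Finset.mul_prod_erase _ _ (Finset.mem_univ i)).symm.trans (congr_arg _ (prod_congr rfl
      fun k hk => by rw [(h k (Finset.ne_of_mem_erase hk)).1, (h k (Finset.ne_of_mem_erase hk)).2]))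
  have hext : ∀ f g : Fin m →₀ ℕ, f i = g i → (∀ k ≠ i, f k = g k) → f = g := fun f g h h' =>
    Finsupp.ext fun k => by by_cases hk : k = i; exacts [hk ▸ h, h' k hk]
  rw [coeff_pderiv, hR _ α fun k hk => by simp [hs k hk],
    hR δ (α - _) fun k hk => by simp [hs k hk], hR δ α fun _ _ => ⟨rfl, rfl⟩]
  generalize ∏ k ∈ Finset.univ.erase i, leibnizFactor (δ k) (α k) (κ k) = R
  simp only [Finsupp.add_apply, tsub_apply, Finsupp.single_eq_same, leibnizFactor]
  rcases hα : α i with _ | a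
  · rw [hext (κ + (δ + single i 1 - α)) (κ + (δ - α) + single i 1) (by simp [hα]; ring)
      fun k hk => by simp [hs k hk], if_pos rfl]
    simp only [Nat.choose_zero_right, tsub_zero, zero_add, one_mul]
    rw [show κ i + (δ i + 1) = (κ i + δ i) + 1 by ring, Nat.succ_descFactorial_succ]
    push_cast; ring
  · rw [if_neg (Nat.succ_ne_zero _), Nat.add_sub_cancel, Nat.choose_succ_succ]
    have e1 : κ + (δ + single i 1 - α) = κ + (δ - (α - single i 1)) :=
      hext _ _ (by simp; omega) fun k hk => by simp [hs k hk]
    by_cases hd : a + 1 ≤ δ i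
    · obtain ⟨e, he⟩ := Nat.exists_eq_add_of_le hd
      have e2 : κ + (δ - (α - single i 1)) = κ + (δ - α) + single i 1 :=
        hext _ _ (by simp; omega) fun k hk => by simp [hs k hk]
      rw [e1, e2, he, show a + 1 + e + 1 - (a + 1) = e + 1 by omega,
        show a + 1 + e - a = e + 1 by omega, show a + 1 + e - (a + 1) = e by omega,
        show κ i + (e + 1) = (κ i + e) + 1 by ring, Nat.succ_descFactorial_succ]
      push_cast; ring
    · rw [Nat.choose_eq_zero_of_lt (show δ i < a + 1 by omega), e1,
        show δ i + 1 - (a + 1) = δ i - a by omega]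
      push_cast; ring

variable {A : Type*} [Ring A] [Algebra ℂ A] {r : HCRep m σ c A}
  {cf : A ≃ₗ[ℂ] (Idx m l H →₀ FPS2 m l)}

namespace HCRep

open Finset.HasAntidiagonal

lemma comp_mono_mul_fx (hcf : r.IsPBW cf) {t : A} (ht : t ∈ r.vecSpan) (δ α β : Fin m →₀ ℕ)
    (f : FPS2 m l) (p : FPS m) :
    r.comp cf α β (r.F f * r.Dp δ * t * r.fx p) = ∑ q ∈ antidiagonal β,
      ((leibnizCoeff δ α q.1 : ℂ) * coeff (q.1 + (δ - α)) p) • (r.F (yPart q.2 f) * t) := by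
  induction δ using multiIndex_induction generalizing α p with
  | h0 =>
    have e : r.F f * r.Dp 0 * t * r.fx p = r.fx p * (r.F f * r.Dp 0 * t) := by
      rw [Dp_zero, mul_one, mul_assoc, ← (r.fibre_comm (vecSpan_le ht)).2, ← mul_assoc, r.fx_comm_F,
        mul_assoc]
    rw [e, comp_fx_mul hcf]
    refine sum_congr rfl fun q _ => ?_
    rw [comp_mono_vecSpan hcf ht]
    by_cases h : 0 = α
    · subst h; simp [leibnizCoeff_self]
    · rw [if_neg h, leibnizCoeff_eq_zero, smul_zero]
      · simp
      · intro h'; exact h (le_antisymm (zero_le) h')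
  | hs δ i ih =>
    have e : r.F f * r.Dp (δ + single i 1) * t * r.fx p =
        r.F f * r.Dp δ * t * r.fx p * r.D i + r.F f * r.Dp δ * t * r.fx (pderiv ℂ i p) := by
      rw [Dp_add_single, ← mul_assoc, mul_assoc _ (r.D i), (r.fibre_comm (vecSpan_le ht)).1,
        ← mul_assoc, mul_assoc _ (r.D i), r.D_mul_fx, mul_add]
      simp only [mul_assoc]
    rw [e, map_add, comp_mul_D hcf, ih, ih]
    simp only [leibnizCoeff_succ, add_smul, sum_add_distrib, ite_smul, zero_smul]
    congr 1
    split_ifs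
    · simp
    · rfl

lemma exists_of_comp_ne_zero {α β : Fin m →₀ ℕ} {a : A} (h : r.comp cf α β a ≠ 0) :
    ∃ i ∈ (cf a).support, i.1 = α := by
  classical
  by_contra! h'
  apply h
  rw [comp, LinearMap.comp_apply, LinearEquiv.coe_coe, Finsupp.lsum_apply, Finsupp.sum]
  refine sum_eq_zero fun i hi => ?_
  rw [if_neg (h' i hi)]; rfl

lemma comp_mul_fx (hcf : r.IsPBW cf) (p : FPS m) (α β : Fin m →₀ ℕ) (a : A) :
    r.comp cf α β (a * r.fx p) = ∑ q ∈ antidiagonal β, ∑ᶠ γ : Fin m →₀ ℕ,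
      ((leibnizCoeff (α + γ) α q.1 : ℂ) * coeff (q.1 + γ) p) • r.comp cf (α + γ) q.2 a := by
  have hfin : ∀ a : A, ∀ q : (Fin m →₀ ℕ) × (Fin m →₀ ℕ), (Function.support fun γ : Fin m →₀ ℕ =>
      ((leibnizCoeff (α + γ) α q.1 : ℂ) * coeff (q.1 + γ) p) • r.comp cf (α + γ) q.2 a).Finite := by
    intro a q
    refine (((cf a).support.finite_toSet.image fun i => i.1).preimage
      (add_right_injective α).injOn).subset fun γ hγ => ?_
    obtain ⟨i, hi, h⟩ := exists_of_comp_ne_zero (right_ne_zero_of_smul hγ)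
    exact ⟨i, hi, h⟩
  let Q : A →ₗ[ℂ] A := ∑ q ∈ antidiagonal β,
    { toFun := fun a => ∑ᶠ γ : Fin m →₀ ℕ,
        ((leibnizCoeff (α + γ) α q.1 : ℂ) * coeff (q.1 + γ) p) • r.comp cf (α + γ) q.2 a
      map_add' := fun a b => by
        rw [← finsum_add_distrib (hfin a q) (hfin b q)]
        exact finsum_congr fun γ => by rw [map_add, smul_add]
      map_smul' := fun z a => by
        rw [RingHom.id_apply, smul_finsum' _ (hfin a q)]
        exact finsum_congr fun γ => by rw [map_smul, smul_comm] }
  have := ext_vecSpan hcf (P := r.comp cf α β ∘ₗ LinearMap.mulRight ℂ (r.fx p)) (Q := Q) ?_ a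
  · rw [LinearMap.comp_apply, mulRight_apply] at this
    rw [this, LinearMap.sum_apply]
    rfl
  intro f δ t ht
  rw [LinearMap.comp_apply, mulRight_apply, comp_mono_mul_fx hcf ht, LinearMap.sum_apply]
  refine sum_congr rfl fun q _ => ?_
  change _ = ∑ᶠ γ : Fin m →₀ ℕ, ((leibnizCoeff (α + γ) α q.1 : ℂ) * coeff (q.1 + γ) p) •
    r.comp cf (α + γ) q.2 (r.F f * r.Dp δ * t)
  simp only [comp_mono_vecSpan hcf ht]
  by_cases h : α ≤ δ
  · rw [finsum_eq_single _ (δ - α)]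
    · rw [add_tsub_cancel_of_le h, if_pos rfl]
    · intro γ hγ
      rw [if_neg, smul_zero]
      rintro rfl
      exact hγ (by rw [add_tsub_cancel_left])
  · rw [leibnizCoeff_eq_zero h, finsum_eq_zero_of_forall_eq_zero]
    · simp
    · intro γ
      rw [if_neg, smul_zero]
      rintro rfl
      exact h le_self_add

lemma leibnizCoeff_add (α γ κ : Fin m →₀ ℕ) : leibnizCoeff (α + γ) α κ =
    (∏ k, ((α + γ : Fin m →₀ ℕ) k).choose (γ k)) *
      ∏ k, ((κ + γ : Fin m →₀ ℕ) k).descFactorial (γ k) := by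
  rw [leibnizCoeff, ← Finset.prod_mul_distrib]
  refine prod_congr rfl fun k _ => ?_
  rw [leibnizFactor, Finsupp.add_apply, Nat.add_sub_cancel_left, Finsupp.add_apply]
  congr 1
  exact (Nat.choose_symm_add).symm ▸ rfl

lemma finsum_ne_zero_eq {M : Type*} [AddCommGroup M] (f : (Fin m →₀ ℕ) → M) :
    ∑ᶠ (γ : Fin m →₀ ℕ) (_ : γ ≠ 0), f γ = ∑ᶠ γ : Fin m →₀ ℕ, if γ = 0 then 0 else f γ := by
  refine finsum_congr fun γ => ?_
  by_cases h : γ = 0 <;> simp [h]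

lemma finite_support_comp (α ν : Fin m →₀ ℕ) (w : (Fin m →₀ ℕ) → ℂ) (t a : A) :
    (Function.support fun γ : Fin m →₀ ℕ =>
      if γ = 0 then 0 else w γ • (r.comp cf (α + γ) ν a * t)).Finite := by
  refine (((cf a).support.finite_toSet.image fun i => i.1).preimage
    (add_right_injective α).injOn).subset fun γ hγ => ?_
  rw [Function.mem_support] at hγ
  split_ifs at hγ with h0
  · exact absurd rfl hγ
  obtain ⟨i, hi, h⟩ := exists_of_comp_ne_zero (left_ne_zero_of_mul (right_ne_zero_of_smul hγ))
  exact ⟨i, hi, h⟩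

/-- The Leibniz rule, with the term without derivatives of `p` split off. -/
lemma comp_mul_fx' (hcf : r.IsPBW cf) (p : FPS m) (α β : Fin m →₀ ℕ) (a : A) :
    r.comp cf α β (a * r.fx p) = ∑ q ∈ antidiagonal β, coeff q.1 p • r.comp cf α q.2 a +
      ∑ q ∈ antidiagonal β, ∑ᶠ γ : Fin m →₀ ℕ, if γ = 0 then 0 else
      ((leibnizCoeff (α + γ) α q.1 : ℂ) * coeff (q.1 + γ) p) • r.comp cf (α + γ) q.2 a := by
  rw [comp_mul_fx hcf, ← sum_add_distrib]
  refine sum_congr rfl fun q _ => ?_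
  have h := finite_support_comp (r := r) (cf := cf) α q.2
    (fun γ => (leibnizCoeff (α + γ) α q.1 : ℂ) * coeff (q.1 + γ) p) 1 a
  simp only [mul_one] at h
  have h2 : (Function.support fun γ : Fin m →₀ ℕ => if γ = 0 then
      coeff q.1 p • r.comp cf α q.2 a else 0).Finite :=
    (Set.finite_singleton 0).subset fun γ hγ => by by_contra h0; exact hγ (if_neg h0)
  have h3 : coeff q.1 p • r.comp cf α q.2 a = ∑ᶠ γ : Fin m →₀ ℕ, if γ = 0 then
      coeff q.1 p • r.comp cf α q.2 a else 0 := by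
    rw [finsum_eq_single _ 0 fun γ h0 => if_neg h0, if_pos rfl]
  rw [h3, ← finsum_add_distrib h2 h]
  refine finsum_congr fun γ => ?_
  by_cases h0 : γ = 0
  · subst h0; simp [leibnizCoeff_self]
  · simp [h0]

/-- The components of `[∑ᵢ vᵢ ∂ᵢ, a]`. -/
lemma comp_lie_vecField (hcf : r.IsPBW cf) (v : Fin m → FPS m) (α β : Fin m →₀ ℕ) (a : A) :
    r.comp cf α β ⁅∑ i, r.fx (v i) * r.D i, a⁆ =
      ∑ i, (constantCoeff (v i) * ((β i : ℂ) + 1)) • r.comp cf α (β + single i 1) a -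
        vecFieldTerm (fun α β => r.comp cf α β a) v α β := by
  have h1 : ∀ i, r.comp cf α β (r.fx (v i) * r.D i * a) =
      ∑ p ∈ antidiagonal (β + single i 1), (coeff p.1 (v i) * (p.2 i : ℂ)) • r.comp cf α p.2 a +
      if α i = 0 then 0 else ∑ q ∈ antidiagonal β, coeff q.1 (v i) •
        r.comp cf (α - single i 1) q.2 a := by
    intro i
    have h : ∑ p ∈ antidiagonal (β + single i 1),
        (coeff p.1 (v i) * (p.2 i : ℂ)) • r.comp cf α p.2 a = ∑ q ∈ antidiagonal β,
        coeff q.1 (v i) • (((q.2 i : ℂ) + 1) • r.comp cf α (q.2 + single i 1) a) := by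
      symm
      refine Finset.sum_of_injOn (fun q => (q.1, q.2 + single i 1)) ?_ ?_ ?_ ?_
      · rintro ⟨a, b⟩ _ ⟨a', b'⟩ _ h
        simpa using h
      · rintro ⟨a, b⟩ h
        simp only [Finset.mem_coe, mem_antidiagonal] at h ⊢
        rw [← h, add_assoc]
      · rintro ⟨a, b⟩ h hn
        rw [mem_antidiagonal] at h
        have hb : b i = 0 := by
          by_contra hb
          apply hn
          have e : b - single i 1 + single i 1 = b :=
            tsub_add_cancel_of_le (Finsupp.single_le_iff.2 (Nat.one_le_iff_ne_zero.2 hb))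
          refine ⟨(a, b - single i 1), mem_antidiagonal.2 ?_, by simp only [e]⟩
          rw [← e, ← add_assoc] at h
          exact add_right_cancel h
        simp [hb]
      · rintro ⟨a, b⟩ _
        simp [smul_smul]
    rw [mul_assoc, comp_fx_mul hcf, h]
    simp only [comp_D_mul hcf, smul_add, sum_add_distrib]
    congr 1
    split_ifs <;> simp
  have h2 : ∀ i, r.comp cf α β (a * (r.fx (v i) * r.D i)) =
      if α i = 0 then 0 else (∑ q ∈ antidiagonal β, coeff q.1 (v i) •
        r.comp cf (α - single i 1) q.2 a +
        ∑ p ∈ antidiagonal β, ∑ᶠ (γ : Fin m →₀ ℕ) (_ : γ ≠ 0), (coeff (p.1 + γ) (v i) *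
            ((∏ k, ((α + γ - single i 1 : Fin m →₀ ℕ) k).choose (γ k) : ℕ) : ℂ) *
            ((∏ k, ((p.1 + γ) k).descFactorial (γ k) : ℕ) : ℂ)) •
              r.comp cf (α + γ - single i 1) p.2 a) := by
    intro i
    rw [← mul_assoc, comp_mul_D hcf]
    split_ifs with h
    · rfl
    rw [comp_mul_fx' hcf]
    congr 1
    refine sum_congr rfl fun q _ => ?_
    rw [finsum_ne_zero_eq]
    refine finsum_congr fun γ => ?_
    rw [← tsub_add_eq_add_tsub (Finsupp.single_le_iff.2 (Nat.one_le_iff_ne_zero.2 h)),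
      leibnizCoeff_add]
    push_cast
    congr 2
    ring
  have h3 : ∀ i, ∑ p ∈ antidiagonal (β + single i 1),
      (coeff p.1 (v i) * (p.2 i : ℂ)) • r.comp cf α p.2 a =
      (constantCoeff (v i) * ((β i : ℂ) + 1)) • r.comp cf α (β + single i 1) a +
      ∑ p ∈ antidiagonal (β + single i 1), if p.1 = 0 then 0 else
        (coeff p.1 (v i) * (p.2 i : ℂ)) • r.comp cf α p.2 a := by
    intro i
    have hm : ((0, β + single i 1) : (Fin m →₀ ℕ) × (Fin m →₀ ℕ)) ∈
        antidiagonal (β + single i 1) := by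
      rw [mem_antidiagonal]; simp
    rw [← Finset.add_sum_erase _ _ hm, ← Finset.add_sum_erase (antidiagonal _)
      (fun p : (Fin m →₀ ℕ) × (Fin m →₀ ℕ) => if p.1 = 0 then 0 else _) hm]
    rw [if_pos rfl, zero_add]
    congr 1
    · simp
    · refine sum_congr rfl fun p hp => ?_
      rw [if_neg]
      intro h0
      rw [Finset.mem_erase, mem_antidiagonal, h0, zero_add] at hp
      exact hp.1 (Prod.ext h0 hp.2)
  rw [Ring.lie_def, sum_mul, mul_sum, map_sub, map_sum, map_sum]
  rw [sum_congr rfl fun i _ => (h1 i).trans (congrArg (· + _) (h3 i)),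
    sum_congr rfl fun i _ => h2 i, vecFieldTerm, sum_add_distrib,
    sum_add_distrib]
  have h4 : ∀ P Q : Fin m → A, ∑ i, (if α i = 0 then 0 else (P i + Q i)) =
      ∑ i, (if α i = 0 then 0 else P i) + ∑ i, if α i = 0 then 0 else Q i := by
    intro P Q
    rw [← sum_add_distrib]
    refine sum_congr rfl fun i _ => ?_
    split_ifs <;> simp
  rw [h4]
  generalize (∑ i, if α i = 0 then 0 else ∑ q ∈ antidiagonal β, coeff q.1 (v i) •
    r.comp cf (α - single i 1) q.2 a) = P
  rw [add_comm P, add_sub_add_right_eq_sub, ← sub_sub, sub_neg_eq_add]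

variable (r) in
/-- `φ_c(B)` as a combination of elements of `ℂ⟦x⟧` and of the fibre algebra. -/
lemma exists_phi_eq_sum (B : 𝕄) : ∃ (t : (Fin l × Fin l) ⊕ H → A) (p : (Fin l × Fin l) ⊕ H → FPS m),
      (∀ e, t e ∈ r.fibreAlg) ∧ r.phi B = ∑ e, r.fx (p e) * t e ∧
      ∀ κ, r.phi (matCoeff B κ) = ∑ e, coeff κ (p e) • t e := by
  classical
  refine ⟨Sum.elim (fun e => -(r.Y e.2 * r.U e.1)) (fun s => dunklConst σ c s • (1 - r.K s)),
    Sum.elim (fun e => B e.1 e.2) (fun s => if s ∈ reflections σ then corootScalar σ B s else 0),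
    ?_, ?_, ?_⟩
  · rintro (e | s)
    · exact neg_mem (mul_mem (r.Y_mem _) (r.U_mem _))
    · exact Subalgebra.smul_mem _ (sub_mem (one_mem _) (r.K_mem _)) _
  · rw [phi, Fintype.sum_sum_type, Fintype.sum_prod_type]
    simp only [Sum.elim_inl, Sum.elim_inr, mul_neg, sum_neg_distrib]
    congr 1
    rw [← Finset.sum_subset (Finset.subset_univ (reflections σ))]
    · refine sum_congr rfl fun s hs => ?_
      rw [if_pos hs, mul_smul_comm]
    · intro s _ hs
      rw [if_neg hs, map_zero, zero_mul]
  · intro κ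
    have hfx : ∀ z : ℂ, r.fx (C z) = algebraMap ℂ A z := fun z => by rw [← r.fx.commutes]; rfl
    have hcs : ∀ s, corootScalar σ (matCoeff B κ) s = C (coeff κ (corootScalar σ B s)) := by
      intro s
      ext d
      classical
      simp only [corootScalar, matCoeff, coeff_smul, Matrix.trace, Matrix.diag_apply,
        mul_apply, map_apply, map_sum, coeff_C_mul, coeff_C]
      split_ifs <;> simp
    rw [phi, Fintype.sum_sum_type, Fintype.sum_prod_type]
    simp only [Sum.elim_inl, Sum.elim_inr, smul_neg, sum_neg_distrib]
    congr 1
    · simp only [matCoeff, map_apply, hfx, Algebra.smul_def]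
    rw [← Finset.sum_subset (Finset.subset_univ (reflections σ))]
    · refine sum_congr rfl fun s hs => ?_
      rw [if_pos hs, hcs, hfx, ← Algebra.smul_def, smul_comm]
    · intro s _ hs
      rw [if_neg hs, map_zero, zero_smul]

/-- The components of `[φ_c(B), a]`. -/
lemma comp_lie_phi (hcf : r.IsPBW cf) (B : 𝕄) (α β : Fin m →₀ ℕ) (a : A) :
    r.comp cf α β ⁅r.phi B, a⁆ = ∑ p ∈ antidiagonal β, ⁅r.phi (matCoeff B p.1), r.comp cf α p.2 a⁆ -
      ∑ p ∈ antidiagonal β, ∑ᶠ (γ : Fin m →₀ ℕ) (_ : γ ≠ 0),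
        (((∏ k, ((α + γ : Fin m →₀ ℕ) k).choose (γ k) : ℕ) : ℂ) *
          ((∏ k, ((p.1 + γ) k).descFactorial (γ k) : ℕ) : ℂ)) •
            (r.comp cf (α + γ) p.2 a * r.phi (matCoeff B (p.1 + γ))) := by
  obtain ⟨t, p, ht, h1, h2⟩ := r.exists_phi_eq_sum B
  have h3 : r.comp cf α β (r.phi B * a) = ∑ q ∈ antidiagonal β,
      r.phi (matCoeff B q.1) * r.comp cf α q.2 a := by
    rw [h1, sum_mul, map_sum]
    simp only [mul_assoc, comp_fx_mul hcf, comp_fibre_mul hcf (ht _), h2, sum_mul]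
    rw [sum_comm]
    simp only [smul_mul_assoc]
  have h4 : r.comp cf α β (a * r.phi B) = ∑ q ∈ antidiagonal β,
      r.comp cf α q.2 a * r.phi (matCoeff B q.1) +
      ∑ q ∈ antidiagonal β, ∑ᶠ (γ : Fin m →₀ ℕ) (_ : γ ≠ 0),
        (((∏ k, ((α + γ : Fin m →₀ ℕ) k).choose (γ k) : ℕ) : ℂ) *
          ((∏ k, ((q.1 + γ) k).descFactorial (γ k) : ℕ) : ℂ)) •
            (r.comp cf (α + γ) q.2 a * r.phi (matCoeff B (q.1 + γ))) := by
    rw [h1, mul_sum, map_sum]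
    simp only [← mul_assoc, comp_mul_fibre hcf (ht _), comp_mul_fx' hcf, h2, add_mul,
      sum_add_distrib, mul_sum, sum_mul]
    congr 1
    · rw [sum_comm]
      simp only [smul_mul_assoc, mul_smul_comm]
    · rw [sum_comm]
      refine sum_congr rfl fun q _ => ?_
      rw [finsum_ne_zero_eq]
      have e : ∀ e, (∑ᶠ γ : Fin m →₀ ℕ, if γ = 0 then 0 else
          ((leibnizCoeff (α + γ) α q.1 : ℂ) * coeff (q.1 + γ) (p e)) • r.comp cf (α + γ) q.2 a) *
            t e = ∑ᶠ γ : Fin m →₀ ℕ, if γ = 0 then 0 else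
          ((leibnizCoeff (α + γ) α q.1 : ℂ) * coeff (q.1 + γ) (p e)) •
            (r.comp cf (α + γ) q.2 a * t e) := by
        intro e
        have h := finite_support_comp (r := r) (cf := cf) α q.2
          (fun γ => (leibnizCoeff (α + γ) α q.1 : ℂ) * coeff (q.1 + γ) (p e)) 1 a
        simp only [mul_one] at h
        rw [finsum_mul' _ _ h]
        refine finsum_congr fun γ => ?_
        split_ifs
        · rw [zero_mul]
        · rw [smul_mul_assoc]
      simp only [e]
      rw [← finsum_sum_comm]
      · refine finsum_congr fun γ => ?_
        split_ifs
        · simp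
        · rw [leibnizCoeff_add, smul_sum]
          refine sum_congr rfl fun e _ => ?_
          rw [mul_smul_comm, smul_smul]
          push_cast
          rfl
      · intro e _
        exact finite_support_comp _ _ _ _ _
  rw [Ring.lie_def, map_sub, h3, h4, ← sub_sub, ← sum_sub_distrib]
  simp only [Ring.lie_def]

variable (r) in
lemma D_mul_mono {t : A} (ht : t ∈ r.fibreAlg) (j : Fin m) (α : Fin m →₀ ℕ) (f : FPS2 m l) :
    r.D j * (r.F f * r.Dp α * t) =
      r.F f * r.Dp α * t * r.D j + r.F (pderiv ℂ (Sum.inl j) f) * r.Dp α * t := by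
  rw [mul_assoc _ t, ← (r.fibre_comm ht).1, ← mul_assoc, ← mul_assoc, r.D_mul_F, add_mul, add_mul,
    mul_assoc (r.F f), r.D_mul_Dp]
  simp only [mul_assoc]

/-- The components of the equation `d + [∑ᵢ vᵢ ∂ᵢ + φ_c(B), a] = 0`. -/
lemma comp_of_flat (hcf : r.IsPBW cf) {v : Fin m → FPS m} {B : 𝕄}
    {a d : A} (h : d + ⁅∑ i, r.fx (v i) * r.D i + r.phi B, a⁆ = 0) (α β : Fin m →₀ ℕ) :
    ∑ i, (constantCoeff (v i) * ((β i : ℂ) + 1)) • r.comp cf α (β + single i 1) a =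
      -r.comp cf α β d + vecFieldTerm (fun α β => r.comp cf α β a) v α β +
      (-∑ p ∈ antidiagonal β, ⁅r.phi (matCoeff B p.1), r.comp cf α p.2 a⁆ +
      ∑ p ∈ antidiagonal β, ∑ᶠ (γ : Fin m →₀ ℕ) (_ : γ ≠ 0),
        (((∏ k, ((α + γ : Fin m →₀ ℕ) k).choose (γ k) : ℕ) : ℂ) *
          ((∏ k, ((p.1 + γ) k).descFactorial (γ k) : ℕ) : ℂ)) •
            (r.comp cf (α + γ) p.2 a * r.phi (matCoeff B (p.1 + γ)))) := by
  have h2 := congrArg (r.comp cf α β) h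
  rw [ring_add_lie, map_add, map_add, comp_lie_vecField hcf, comp_lie_phi hcf, map_zero] at h2
  rw [← sub_eq_zero]
  refine Eq.trans ?_ h2
  abel

end HCRep

section Recursion

lemma univ_sym : (HCRep.univ : HCRep m σ c _).sym = symHom m σ c := by
  exact AlgHom.ext fun a => univ_hom _

lemma isPBW_univ (hc : IsClassFun σ c) : (HCRep.univ : HCRep m σ c _).IsPBW (coefs m σ c hc) := by
  intro i f
  rw [← coefs_monomial m σ c hc i f, ← mul_assoc, mul_assoc (HCRep.univ.F f), HCRep.Dp_mul_Up,
    univ_sym]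
  rfl

lemma xComponent_eq_comp (hc : IsClassFun σ c) (F : Idx m l H →₀ FPS2 m l) (α β : Fin m →₀ ℕ) :
    xComponent m σ c F α β = HCRep.univ.comp (coefs m σ c hc) α β (expand m σ c F) := by
  classical
  rw [HCRep.comp, LinearMap.comp_apply, LinearEquiv.coe_coe, coefs_expand, xComponent,
    Finsupp.lsum_apply]
  refine Finsupp.sum_congr fun i _ => ?_
  split_ifs
  · rw [LinearMap.comp_apply, LinearMap.comp_apply, mulRight_apply]
    congr 1
    rw [HCRep.Up, univ_sym, symHom_monomial, vecMonomial]
    simp [List.ofFn_const]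
    rfl
  · rfl

/-- The components of `-[Φ_c(v + B), s]`. -/
lemma xComponent_of_flat (hc : IsClassFun σ c) (v : Fin m → FPS m) (B : 𝕄)
    (F dF : Idx m l H →₀ FPS2 m l)
    (h : expand m σ c dF + ⁅PhiC σ c v B, expand m σ c F⁆ = 0) (α β : Fin m →₀ ℕ) :
    ∑ i, (constantCoeff (v i) * ((β i : ℂ) + 1)) • xComponent m σ c F α (β + single i 1) =
      -xComponent m σ c dF α β + vecFieldTerm (xComponent m σ c F) v α β +
        matrixTerm σ c (xComponent m σ c F) B α β := by
  classical
  have h1 : PhiC σ c v B = ∑ i, HCRep.univ.fx (v i) * HCRep.univ.D i + HCRep.univ.phi B := by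
    rw [PhiC, HCRep.univ_phi]; rfl
  rw [h1] at h
  have h2 := HCRep.comp_of_flat (isPBW_univ hc) h α β
  simp only [HCRep.univ_phi, ← xComponent_eq_comp hc] at h2
  exact h2

lemma sum_inv_smul_sum {n : ℕ} {M : Type*} [AddCommGroup M] [Module ℂ M]
    {V : Matrix (Fin n) (Fin n) ℂ} (hV : IsUnit V.det) (w : Fin n → ℂ) (y : Fin n → M)
    (R : Fin n → M) (h : ∀ r, ∑ i, (V r i * w i) • y i = R r) (j : Fin n) :
    w j • y j = ∑ r, V⁻¹ j r • R r := by
  simp only [← h, smul_sum, smul_smul]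
  rw [sum_comm]
  simp only [← mul_assoc, ← sum_smul, ← sum_mul, ← mul_apply, Matrix.nonsing_inv_mul _ hV]
  rw [sum_eq_single j]
  · simp
  · intro i _ hi; rw [one_apply_ne hi.symm, zero_mul, zero_smul]
  · simp

/-- The recursion, in terms of solutions of the flatness equation. -/
lemma xComponent_recursion (hc : IsClassFun σ c) (ξ : Fin m → Fin m → FPS m) (B : Fin m → 𝕄)
    (F : Idx m l H →₀ FPS2 m l) (dF : Fin m → (Idx m l H →₀ FPS2 m l))
    (hV : IsUnit (constMatrix ξ).det)
    (h : ∀ r, expand m σ c (dF r) + ⁅PhiC σ c (ξ r) (B r), expand m σ c F⁆ = 0)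
    (α β : Fin m →₀ ℕ) (j : Fin m) :
    ((β j : ℂ) + 1) • xComponent m σ c F α (β + single j 1) =
      ∑ r, (constMatrix ξ)⁻¹ j r • (-xComponent m σ c (dF r) α β +
        vecFieldTerm (xComponent m σ c F) (ξ r) α β +
        matrixTerm σ c (xComponent m σ c F) (B r) α β) :=
  sum_inv_smul_sum hV (fun i => (β i : ℂ) + 1) _ _
    (fun r => xComponent_of_flat hc (ξ r) (B r) F (dF r) (h r) α β) j

/-- Along `∂/∂xⱼ` a flat section changes by the `x`-derivatives of its coefficients. -/
lemma flat_single (hc : IsClassFun σ c) (j : Fin m) (F dF : Idx m l H →₀ FPS2 m l)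
    (h : expand m σ c dF + ⁅PhiC σ c (Pi.single j 1) 0, expand m σ c F⁆ = 0) (i : Idx m l H) :
    dF i = -pderiv ℂ (Sum.inl j) (F i) := by
  classical
  have h1 : PhiC σ c (Pi.single j 1) 0 = dxA m σ c j := by
    rw [PhiC, ← HCRep.univ_phi, HCRep.phi_zero, add_zero, sum_eq_single j]
    · rw [Pi.single_eq_same]
      change HCRep.univ.fx 1 * HCRep.univ.D j = _
      rw [map_one, one_mul]; rfl
    · intro k _ hk
      rw [Pi.single_eq_of_ne hk]
      change HCRep.univ.fx 0 * _ = _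
      rw [map_zero, zero_mul]
    · simp
  let P : (Idx m l H →₀ FPS2 m l) →ₗ[ℂ] (Idx m l H →₀ FPS2 m l) :=
    Finsupp.mapRange.linearMap (pderiv ℂ (Sum.inl j)).toLinearMap
  have hbr : ∀ F : Idx m l H →₀ FPS2 m l,
      dxA m σ c j * expand m σ c F = expand m σ c F * dxA m σ c j + expand m σ c (P F) := by
    intro F
    simp only [← coefs_symm_apply m σ c hc]
    induction F using Finsupp.induction_linear with
    | zero => simp
    | add F G hF hG => simp only [map_add, mul_add, add_mul, hF, hG]; abel
    | single i f =>
      have hP : P (single i f) = single i (pderiv ℂ (Sum.inl j) f) := by simp [P]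
      rw [hP, ← isPBW_univ hc i f, ← isPBW_univ hc i, LinearEquiv.symm_apply_apply,
        LinearEquiv.symm_apply_apply]
      exact HCRep.univ.D_mul_mono (mul_mem (HCRep.Up_mem _ _) (HCRep.K_mem _ _)) j i.1 f
  rw [h1, Ring.lie_def, hbr, add_sub_cancel_left] at h
  simp only [← coefs_symm_apply m σ c hc] at h
  rw [← map_add, map_eq_zero_iff _ (LinearEquiv.injective _)] at h
  have := DFunLike.congr_fun h i
  exact eq_neg_of_add_eq_zero_left this

end Recursion
end Leibniz

/-! ### Holomorphic functions of several variables -/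

section SeveralVariables

/-- `u` is complex differentiable near `z`. -/
def HoloAt (u : (Fin m → ℂ) → ℂ) (z : Fin m → ℂ) : Prop := ∀ᶠ w in 𝓝 z, DifferentiableAt ℂ u w

lemma HoloAt.self {u : (Fin m → ℂ) → ℂ} {z : Fin m → ℂ} (h : HoloAt u z) :
    DifferentiableAt ℂ u z := h.self_of_nhds

lemma HoloAt.eventually {u : (Fin m → ℂ) → ℂ} {z : Fin m → ℂ} (h : HoloAt u z) :
    ∀ᶠ w in 𝓝 z, HoloAt u w := eventually_eventually_nhds.2 h

/-- A partial derivative of a holomorphic function is holomorphic: it is given by Cauchy's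
integral over a circle in the direction of differentiation, and this integral may be differentiated
under the integral sign because of the Cauchy estimates. -/
lemma HoloAt.fderiv_apply {u : (Fin m → ℂ) → ℂ} {z0 : Fin m → ℂ} (hu : HoloAt u z0)
    (e : Fin m → ℂ) : HoloAt (fun z => fderiv ℂ u z e) z0 := by
  obtain ⟨ρ, hρ, hball⟩ := Metric.eventually_nhds_iff_ball.1 (Filter.Eventually.and hu
    (hu.self.continuousAt.eventually (Metric.ball_mem_nhds _ one_pos)))
  obtain ⟨r, hr0, hre⟩ : ∃ r > 0, r * ‖e‖ ≤ ρ / 4 := by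
    refine ⟨ρ / 4 / (‖e‖ + 1), by positivity, ?_⟩
    rw [div_mul_eq_mul_div, div_le_iff₀ (by positivity)]
    nlinarith [norm_nonneg e]
  have hmem : ∀ z ∈ Metric.ball z0 (ρ / 4), ∀ ζ : ℂ, ‖ζ‖ ≤ r →
      z + ζ • e ∈ Metric.ball z0 (ρ / 2) := fun z hz ζ hζ => by
    have h1 : ‖ζ • e‖ ≤ r * ‖e‖ := by rw [norm_smul]; gcongr
    have h2 := dist_triangle (z + ζ • e) z z0
    rw [dist_self_add_left] at h2
    rw [Metric.mem_ball] at *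
    linarith
  have hsub : ∀ w ∈ Metric.ball z0 (ρ / 2), Metric.ball w (ρ / 2) ⊆ Metric.ball z0 ρ :=
    fun w hw => Metric.ball_subset_ball' (by linarith [Metric.mem_ball.1 hw])
  have hd : ∀ w ∈ Metric.ball z0 (ρ / 2), DifferentiableAt ℂ u w := fun w hw =>
    (hball w (hsub w hw (Metric.mem_ball_self (by positivity)))).1
  have hbound : ∀ w ∈ Metric.ball z0 (ρ / 2), ‖fderiv ℂ u w‖ ≤ 2 / (ρ / 2) := fun w hw => by
    refine Complex.norm_fderiv_le_div_of_mapsTo_ball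
      (fun x hx => (hball x (hsub w hw hx)).1.differentiableWithinAt) (fun x hx => ?_)
      (by positivity)
    have h1 := Metric.mem_ball.1 (hball x (hsub w hw hx)).2
    have h2 := Metric.mem_ball.1 (hball w (hsub w hw (Metric.mem_ball_self (by positivity)))).2
    rw [Metric.mem_closedBall]
    linarith [dist_triangle_right (u x) (u w) (u z0)]
  set k : ℝ → ℂ := fun θ => deriv (circleMap 0 r) θ • (1 / (circleMap 0 r θ - 0) ^ 2) with hk
  set q : ℝ → (Fin m → ℂ) := fun θ => circleMap 0 r θ • e with hq
  have hc := continuous_circleMap 0 r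
  have hkc : Continuous k := by
    simp only [hk, deriv_circleMap]
    exact (by fun_prop : Continuous fun θ => circleMap 0 r θ * Complex.I).smul
      (continuous_const.div (by fun_prop) fun θ => by simp [hr0.ne'])
  have hqc : Continuous q := by fun_prop
  have hqm : ∀ z ∈ Metric.ball z0 (ρ / 4), ∀ θ, z + q θ ∈ Metric.ball z0 (ρ / 2) := fun z hz θ =>
    hmem z hz _ (by simp [abs_of_pos hr0])
  have hF : ∀ z ∈ Metric.ball z0 (ρ / 4), Continuous fun θ => k θ • u (z + q θ) := fun z hz =>
    hkc.smul (continuous_iff_continuousAt.2 fun θ => ContinuousAt.comp (f := fun θ => z + q θ)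
      (hd _ (hqm z hz θ)).continuousAt (by fun_prop))
  have hcauchy : ∀ z ∈ Metric.ball z0 (ρ / 4), fderiv ℂ u z e =
      (2 * Real.pi * Complex.I)⁻¹ • ∫ θ in (0)..(2 * Real.pi), k θ • u (z + q θ) := fun z hz => by
    have hl : ∀ ζ : ℂ, ‖ζ‖ ≤ r → HasDerivAt (fun ζ : ℂ => u (z + ζ • e))
        (fderiv ℂ u (z + ζ • e) e) ζ := fun ζ hζ =>
      (hd _ (hmem z hz ζ hζ)).hasFDerivAt.comp_hasDerivAt ζ
        (by simpa using ((hasDerivAt_id ζ).smul_const e).const_add z)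
    have h2 : DiffContOnCl ℂ (fun ζ : ℂ => u (z + ζ • e)) (Metric.ball 0 r) := by
      refine DifferentiableOn.diffContOnCl fun ζ hζ =>
        (hl ζ ?_).differentiableAt.differentiableWithinAt
      rw [closure_ball _ hr0.ne'] at hζ
      simpa using hζ
    have h3 := h2.deriv_eq_smul_circleIntegral hr0
    rw [(hl 0 (by simpa using hr0.le)).deriv, circleIntegral] at h3
    simp only [zero_smul, add_zero, ← smul_assoc] at h3
    rw [h3, inv_smul_smul₀ Complex.two_pi_I_ne_zero]
  have hdiff : ∀ z ∈ Metric.ball z0 (ρ / 4), DifferentiableAt ℂ (fun z =>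
      ∫ θ in (0)..(2 * Real.pi), k θ • u (z + q θ)) z := fun z hz => by
    have hn := Metric.isOpen_ball.mem_nhds hz
    have : ProperSpace ((Fin m → ℂ) →L[ℂ] ℂ) := FiniteDimensional.proper ℂ _
    refine (intervalIntegral.hasFDerivAt_integral_of_dominated_of_fderiv_le
      (F' := fun z θ => k θ • fderiv ℂ u (z + q θ)) (bound := fun θ => ‖k θ‖ * (2 / (ρ / 2))) hn
      ?_ ((hF z hz).intervalIntegrable _ _) ?_ (.of_forall fun θ _ w hw => ?_)
      ((hkc.norm.mul continuous_const).intervalIntegrable _ _)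
      (.of_forall fun θ _ w hw => ?_)).differentiableAt
    · filter_upwards [hn] with w hw using (hF w hw).aestronglyMeasurable
    · exact hkc.aestronglyMeasurable.smul ((measurable_fderiv ℂ u).comp
        (by fun_prop : Continuous fun θ => z + q θ).measurable).aestronglyMeasurable
    · rw [norm_smul]
      gcongr
      exact hbound _ (hqm w hw θ)
    · have h1 := (hasFDerivAt_comp_add_right (f := u) (q θ)).2 (hd _ (hqm w hw θ)).hasFDerivAt
      exact h1.const_smul (k θ)
  filter_upwards [Metric.ball_mem_nhds z0 (by positivity : 0 < ρ / 4)] with z hz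
  refine ((hdiff z hz).const_smul (2 * Real.pi * Complex.I)⁻¹).congr_of_eventuallyEq ?_
  filter_upwards [Metric.isOpen_ball.mem_nhds hz] with w hw using hcauchy w hw

lemma HoloAt.congr {u v : (Fin m → ℂ) → ℂ} {z : Fin m → ℂ} (hu : HoloAt u z) (h : u =ᶠ[𝓝 z] v) :
    HoloAt v z := by
  filter_upwards [hu, h.eventuallyEq_nhds] with w h1 h2
  exact h2.symm.differentiableAt_iff.2 h1

lemma HoloAt.comp_add {u : (Fin m → ℂ) → ℂ} {z a : Fin m → ℂ} (hu : HoloAt u (z + a)) :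
    HoloAt (fun w => u (w + a)) z := by
  have h : Filter.Tendsto (fun w => w + a) (𝓝 z) (𝓝 (z + a)) :=
    (continuous_id.add continuous_const).continuousAt
  filter_upwards [h.eventually hu] with w hw
  exact (differentiableAt_comp_add_right a).2 hw

lemma HoloAt.fderiv_comm {u : (Fin m → ℂ) → ℂ} {z : Fin m → ℂ} (hu : HoloAt u z)
    (a e : Fin m → ℂ) : fderiv ℂ (fun w => fderiv ℂ u w a) z e =
      fderiv ℂ (fun w => fderiv ℂ u w e) z a := by
  have hd : DifferentiableAt ℂ (fderiv ℂ u) z := by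
    have h1 : fderiv ℂ u = fun w => ∑ i, fderiv ℂ u w (Pi.single i 1) •
        ContinuousLinearMap.proj (R := ℂ) (φ := fun _ : Fin m => ℂ) i := by
      funext w
      ext b
      conv_lhs => rw [← LinearMap.sum_single_apply (fun _ : Fin m => ℂ) b]
      rw [map_sum]
      simp only [FunLike.coe_sum, Finset.sum_apply, _root_.smul_apply,
        ContinuousLinearMap.proj_apply, smul_eq_mul]
      refine sum_congr rfl fun i _ => ?_
      rw [show (Pi.single i (b i) : Fin m → ℂ) = b i • Pi.single i 1 by
        rw [← Pi.single_smul, smul_eq_mul, mul_one], map_smul, smul_eq_mul, mul_comm]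
    rw [h1]
    exact DifferentiableAt.fun_sum fun i _ => ((hu.fderiv_apply _).self).smul_const _
  have h2 := second_derivative_symmetric_of_eventually (𝕜 := ℂ) (f := u) (f' := fderiv ℂ u)
    (x := z) (hu.mono fun w hw => hw.hasFDerivAt) hd.hasFDerivAt a e
  have h3 : ∀ b : Fin m → ℂ, HasFDerivAt (fun w => fderiv ℂ u w b)
      ((fderiv ℂ (fderiv ℂ u) z).flip b) z := fun b => by
    have := hd.hasFDerivAt.clm_apply (hasFDerivAt_const b z)
    simpa using this
  rw [(h3 a).fderiv, (h3 e).fderiv]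
  exact h2.symm

variable (z0 : Fin m → ℂ)

/-- The algebra of functions on `ℂᵐ` that are holomorphic near `z0`. -/
def holoAlg : Subalgebra ℂ ((Fin m → ℂ) → ℂ) where
  carrier := {u | HoloAt u z0}
  mul_mem' h1 h2 := by filter_upwards [h1, h2] with z h1 h2 using h1.mul h2
  add_mem' h1 h2 := by filter_upwards [h1, h2] with z h1 h2 using h1.add h2
  algebraMap_mem' a := .of_forall fun _ => differentiableAt_const a

variable {z0}

/-- The functions vanishing at `z0`. -/
def holoIdeal (z0 : Fin m → ℂ) : Ideal (holoAlg z0) :=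
  RingHom.ker ((Pi.evalRingHom (fun _ : Fin m → ℂ => ℂ) z0).comp (holoAlg z0).toSubring.subtype)

lemma mem_holoIdeal {u : holoAlg z0} : u ∈ holoIdeal z0 ↔ u.1 z0 = 0 := Iff.rfl

/-- The directional derivative. -/
def dirD (e : Fin m → ℂ) (u : holoAlg z0) : holoAlg z0 :=
  ⟨fun z => fderiv ℂ u.1 z e, HoloAt.fderiv_apply u.2 e⟩

/-- A coordinate function. -/
def coordFn (z0 : Fin m → ℂ) (j : Fin m) : holoAlg z0 :=
  ⟨fun z => z j, .of_forall fun _ => differentiableAt_apply j _⟩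

lemma dirD_apply (e : Fin m → ℂ) (u : holoAlg z0) (z : Fin m → ℂ) :
    (dirD e u).1 z = fderiv ℂ u.1 z e := rfl

lemma dirD_coordFn (e : Fin m → ℂ) (j : Fin m) :
    dirD e (coordFn z0 j) = algebraMap ℂ (holoAlg z0) (e j) := by
  apply Subtype.ext
  funext z
  have : HasFDerivAt (fun z : Fin m → ℂ => z j) (ContinuousLinearMap.proj (R := ℂ) j) z :=
    hasFDerivAt_apply j z
  exact congrArg (fun L => L e) this.fderiv

/-- A homomorphism from holomorphic functions near `z0` to formal power series that behaves like
the Taylor expansion in some formal coordinates centred at `z0`. -/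
structure IsTaylor (Φ : holoAlg z0 →ₐ[ℂ] FPS m) : Prop where
  congr : ∀ u v : holoAlg z0, u.1 =ᶠ[𝓝 z0] v.1 → Φ u = Φ v
  comap : ∀ k : ℕ, Ideal.comap Φ (maxIdeal m ^ (k + 1)) = holoIdeal z0 ^ (k + 1)

namespace IsTaylor

variable {Φ : holoAlg z0 →ₐ[ℂ] FPS m}

lemma constantCoeff_eq (h : IsTaylor Φ) (u : holoAlg z0) : constantCoeff (Φ u) = u.1 z0 := by
  have h1 : u - algebraMap ℂ _ (u.1 z0) ∈ holoIdeal z0 ^ (0 + 1) := by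
    rw [zero_add, pow_one, mem_holoIdeal]
    exact sub_self _
  rw [← h.comap, Ideal.mem_comap, zero_add, pow_one, maxIdeal, RingHom.mem_ker, map_sub,
    AlgHom.commutes] at h1
  rw [map_sub, sub_eq_zero] at h1
  rw [h1]
  exact constantCoeff_C _

lemma dirD_mul (h : IsTaylor Φ) (e : Fin m → ℂ) (u v : holoAlg z0) :
    Φ (dirD e (u * v)) = Φ u * Φ (dirD e v) + Φ v * Φ (dirD e u) := by
  rw [← map_mul, ← map_mul, ← map_add]
  apply h.congr
  have hu : HoloAt u.1 z0 := u.2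
  have hv : HoloAt v.1 z0 := v.2
  filter_upwards [hu, hv] with z h1 h2
  change fderiv ℂ (u.1 * v.1) z e = u.1 z * fderiv ℂ v.1 z e + v.1 z * fderiv ℂ u.1 z e
  rw [fderiv_mul h1 h2]
  rfl

lemma dirD_add (h : IsTaylor Φ) (e : Fin m → ℂ) (u v : holoAlg z0) :
    Φ (dirD e (u + v)) = Φ (dirD e u) + Φ (dirD e v) := by
  rw [← map_add]
  apply h.congr
  have hu : HoloAt u.1 z0 := u.2
  have hv : HoloAt v.1 z0 := v.2
  filter_upwards [hu, hv] with z h1 h2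
  change fderiv ℂ (u.1 + v.1) z e = fderiv ℂ u.1 z e + fderiv ℂ v.1 z e
  rw [fderiv_add h1 h2]
  rfl

lemma dirD_algebraMap (h : IsTaylor Φ) (e : Fin m → ℂ) (a : ℂ) :
    Φ (dirD e (algebraMap ℂ _ a)) = 0 := by
  rw [← map_zero Φ]
  apply h.congr
  refine .of_forall fun z => ?_
  have h1 : fderiv ℂ (fun _ : Fin m → ℂ => a) z e = 0 := by
    rw [fderiv_fun_const]
    rfl
  exact h1

lemma fderiv_eq_zero_of_mem_sq {u : holoAlg z0} (hu : u ∈ holoIdeal z0 ^ 2) :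
    fderiv ℂ u.1 z0 = 0 := by
  rw [pow_two] at hu
  induction hu using Submodule.mul_induction_on' with
  | mem_mul_mem a ha b hb =>
    rw [mem_holoIdeal] at ha hb
    change fderiv ℂ (a.1 * b.1) z0 = 0
    rw [fderiv_mul (HoloAt.self a.2) (HoloAt.self b.2), ha, hb]
    refine ContinuousLinearMap.ext fun w => ?_
    change 0 * fderiv ℂ b.1 z0 w + 0 * fderiv ℂ a.1 z0 w = 0
    ring
  | add a _ b _ iha ihb =>
    change fderiv ℂ (a.1 + b.1) z0 = 0
    rw [fderiv_add (HoloAt.self a.2) (HoloAt.self b.2), iha, ihb, add_zero]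

lemma exists_eq_single_of_degree_eq_one {d : Fin m →₀ ℕ} (hd : d.degree = 1) :
    ∃ i, d = single i 1 := by
  obtain ⟨i, hi⟩ : ∃ i, d i ≠ 0 := by
    by_contra! h
    have : d = 0 := Finsupp.ext h
    simp [this] at hd
  have h1 : d = single i 1 + (d - single i 1) :=
    (add_tsub_cancel_of_le (Finsupp.single_le_iff.2 (Nat.one_le_iff_ne_zero.2 hi))).symm
  have h2 : (d - single i 1).degree = 0 := by
    have := congrArg Finsupp.degree h1
    rw [map_add, Finsupp.degree_single] at this
    omega
  rw [Finsupp.degree_eq_zero_iff] at h2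
  exact ⟨i, by rw [h1, h2, add_zero]⟩

/-- The centred coordinate functions. -/
def cen (Φ : holoAlg z0 →ₐ[ℂ] FPS m) (j : Fin m) : FPS m :=
  Φ (coordFn z0 j - algebraMap ℂ _ (z0 j))

lemma constantCoeff_cen (h : IsTaylor Φ) (j : Fin m) : constantCoeff (cen Φ j) = 0 := by
  rw [cen, h.constantCoeff_eq]
  exact sub_self _

lemma pderiv_cen (i j : Fin m) : pderiv ℂ i (cen Φ j) = pderiv ℂ i (Φ (coordFn z0 j)) := by
  rw [cen, map_sub, map_sub, AlgHom.commutes]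
  simp

lemma isUnit_linMat_cen (h : IsTaylor Φ) : IsUnit (linMat (cen Φ)).det := by
  rw [isUnit_iff_ne_zero, Ne, ← Matrix.exists_vecMul_eq_zero_iff]
  rintro ⟨w, hw, hw0⟩
  apply hw
  set u : holoAlg z0 := ∑ j, w j • (coordFn z0 j - algebraMap ℂ _ (z0 j)) with hu
  have h1 : Φ u ∈ maxIdeal m ^ (1 + 1) := by
    rw [mem_maxIdeal_pow_iff, le_order_iff_coeff]
    intro d hd
    have hΦ : Φ u = ∑ j, w j • cen Φ j := by simp [hu, cen]
    rw [hΦ, map_sum]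
    simp only [map_smul, smul_eq_mul]
    rcases Nat.lt_or_ge d.degree 1 with hd0 | hd1
    · have hd0 : d = 0 := by
        rw [← Finsupp.degree_eq_zero_iff]; omega
      subst hd0
      refine sum_eq_zero fun j _ => ?_
      have := h.constantCoeff_cen j
      rw [← coeff_zero_eq_constantCoeff_apply] at this
      rw [this, mul_zero]
    · obtain ⟨i, rfl⟩ := exists_eq_single_of_degree_eq_one (show d.degree = 1 by omega)
      exact congrFun hw0 i
  have h2 : u ∈ Ideal.comap Φ (maxIdeal m ^ (1 + 1)) := h1
  rw [h.comap] at h2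
  have h3 := fderiv_eq_zero_of_mem_sq h2
  have h4 : HasFDerivAt u.1 (∑ j, w j • ContinuousLinearMap.proj (R := ℂ)
      (φ := fun _ : Fin m => ℂ) j) z0 := by
    have h5 : u.1 = fun z => ∑ j, w j • (z j - z0 j) := by
      funext z
      rw [hu, AddSubmonoidClass.coe_finsetSum, Finset.sum_apply]
      rfl
    rw [h5]
    refine HasFDerivAt.fun_sum fun j _ => ?_
    exact ((hasFDerivAt_apply j z0).sub_const (z0 j)).const_smul (w j)
  have h5 := h4.fderiv.symm.trans h3
  funext j
  have h6 := congrArg (fun L => L (Pi.single j 1)) h5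
  simpa [Pi.single_apply] using h6

/-- The difference of the two sides of the chain rule. -/
lemma pderiv_eq (h : IsTaylor Φ) (u : holoAlg z0) (i : Fin m) : pderiv ℂ i (Φ u) =
      ∑ j, Φ (dirD (Pi.single j 1) u) * pderiv ℂ i (Φ (coordFn z0 j)) := by
  set d : holoAlg z0 → FPS m := fun u => pderiv ℂ i (Φ u) -
      ∑ j, Φ (dirD (Pi.single j 1) u) * pderiv ℂ i (Φ (coordFn z0 j)) with hd
  have hadd : ∀ u v, d (u + v) = d u + d v := by
    intro u v
    simp only [hd, map_add, h.dirD_add, add_mul, sum_add_distrib]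
    ring
  have hmul : ∀ u v, d (u * v) = Φ u * d v + Φ v * d u := by
    intro u v
    simp only [hd, map_mul, h.dirD_mul, add_mul, sum_add_distrib, mul_sub,
      mul_sum, Derivation.leibniz, smul_eq_mul, mul_assoc]
    ring
  have hcon : ∀ a : ℂ, d (algebraMap ℂ _ a) = 0 := by
    intro a
    simp only [hd, AlgHom.commutes, h.dirD_algebraMap, zero_mul, sum_const_zero]
    simp
  have hcoord : ∀ j, d (coordFn z0 j) = 0 := by
    intro j
    simp only [hd, dirD_coordFn, AlgHom.commutes]
    rw [sum_eq_single j]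
    · simp
    · intro k _ hk
      simp [hk.symm]
    · simp
  have hpow : ∀ k : ℕ, ∀ u ∈ holoIdeal z0 ^ (k + 1), d u ∈ maxIdeal m ^ k := by
    intro k
    induction k with
    | zero => intro u _; simp
    | succ k ih =>
      intro u hu
      rw [pow_succ'] at hu
      induction hu using Submodule.mul_induction_on' with
      | mem_mul_mem a ha b hb =>
        rw [hmul]
        have h1 : Φ a ∈ maxIdeal m := by
          have := (h.comap 0).symm ▸ (by simpa using ha : a ∈ holoIdeal z0 ^ (0 + 1))
          simpa using this
        have h2 : Φ b ∈ maxIdeal m ^ (k + 1) := by rw [← h.comap] at hb; exact hb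
        refine Ideal.add_mem _ ?_ (Ideal.mul_mem_right _ _ h2)
        rw [pow_succ']
        exact Ideal.mul_mem_mul h1 (ih b hb)
      | add a _ b _ iha ihb => rw [hadd]; exact Ideal.add_mem _ iha ihb
  rw [← sub_eq_zero]
  change d u = 0
  apply eq_zero_of_forall_le_order
  intro N
  rw [← mem_maxIdeal_pow_iff]
  -- `u` agrees to any order with a polynomial in the centred coordinates
  let G := substEquiv (cen Φ) h.constantCoeff_cen h.isUnit_linMat_cen
  let P := truncTotal (N + 1) (G.symm (Φ u))
  let v : holoAlg z0 := aeval (fun j => coordFn z0 j - algebraMap ℂ _ (z0 j)) P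
  have hv : d v = 0 := by
    change d (aeval _ P) = 0
    induction P using MvPolynomial.induction_on with
    | C a => rw [MvPolynomial.aeval_C]; exact hcon a
    | add p q hp hq => rw [map_add, hadd, hp, hq, add_zero]
    | mul_X p j hp =>
      rw [map_mul, hmul, hp, aeval_X, mul_zero, add_zero, sub_eq_add_neg, ← map_neg,
        hadd, hcoord, hcon, add_zero, mul_zero]
  have huv : u - v ∈ holoIdeal z0 ^ (N + 1) := by
    rw [← h.comap, Ideal.mem_comap, map_sub, mem_maxIdeal_pow_iff]
    have h1 : Φ v = G (P : FPS m) := by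
      change Φ (aeval _ P) = _
      rw [substEquiv_apply, subst_coe]
      exact MvPolynomial.comp_aeval_apply _ _ _
    have h2 : Φ u = G (G.symm (Φ u)) := (G.apply_symm_apply _).symm
    rw [h1, h2, ← map_sub]
    exact le_order_algEquiv G _ _ (le_order_sub_truncTotal _ _)
  have := hpow N _ huv
  rwa [sub_eq_add_neg, hadd, show d (-v) = 0 by
    have h3 := hadd v (-v)
    rw [add_neg_cancel, hv, zero_add] at h3
    rw [← h3]
    simpa using hcon 0, add_zero] at this

open Classical in
/-- The extension by zero of `Φ` to all functions. -/
def ext (Φ : holoAlg z0 →ₐ[ℂ] FPS m) (u : (Fin m → ℂ) → ℂ) : FPS m :=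
  if h : HoloAt u z0 then Φ ⟨u, h⟩ else 0

lemma ext_of_holoAt (Φ : holoAlg z0 →ₐ[ℂ] FPS m) {u : (Fin m → ℂ) → ℂ} (h : HoloAt u z0) :
    ext Φ u = Φ ⟨u, h⟩ := dif_pos h

lemma eventually_holoAt_shift (u : holoAlg z0) (a : Fin m → ℂ) :
    ∀ᶠ t : ℂ in 𝓝 0, HoloAt (fun z => u.1 (z + t • a)) z0 := by
  have hu : HoloAt u.1 z0 := u.2
  have h1 : Filter.Tendsto (fun t : ℂ => z0 + t • a) (𝓝 0) (𝓝 z0) := by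
    have : Continuous fun t : ℂ => z0 + t • a := by fun_prop
    simpa using this.tendsto 0
  filter_upwards [h1.eventually hu.eventually] with t ht using HoloAt.comp_add ht

/-- Under translations, the coefficients of the Taylor expansion of a holomorphic function change
at the rate given by its directional derivative. -/
lemma hasDerivAt_coeff_shift (h : IsTaylor Φ) (a : Fin m → ℂ) (β : Fin m →₀ ℕ) :
    ∀ u : holoAlg z0, HasDerivAt
      (fun t : ℂ => coeff β (ext Φ fun z => u.1 (z + t • a)))
      (coeff β (Φ (dirD a u))) 0 := by
  induction hN : β.degree using Nat.strong_induction_on generalizing β with | _ N IH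
  revert hN
  induction β using multiIndex_induction with
  | h0 =>
    intro _ u
    have h1 : (fun t : ℂ => coeff 0 (ext Φ fun z => u.1 (z + t • a))) =ᶠ[𝓝 0]
        fun t : ℂ => u.1 (z0 + t • a) := by
      filter_upwards [eventually_holoAt_shift u a] with t ht
      rw [ext_of_holoAt Φ ht, coeff_zero_eq_constantCoeff_apply, h.constantCoeff_eq]
    rw [coeff_zero_eq_constantCoeff_apply, h.constantCoeff_eq, dirD_apply]
    have h2 : HasDerivAt (fun t : ℂ => z0 + t • a) a 0 := by
      simpa using ((hasDerivAt_id (0 : ℂ)).smul_const a).const_add z0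
    have h3 : HasFDerivAt u.1 (fderiv ℂ u.1 z0) (z0 + (0 : ℂ) • a) := by
      simpa using (HoloAt.self u.2).hasFDerivAt
    exact (h3.comp_hasDerivAt (0 : ℂ) h2).congr_of_eventuallyEq h1
  | hs β i _ =>
    intro hN u
    have hne : ((β i : ℂ) + 1) ≠ 0 := by exact_mod_cast Nat.succ_ne_zero (β i)
    have hco : ∀ q : FPS m, coeff (β + single i 1) q =
        coeff β (pderiv ℂ i q) * ((β i : ℂ) + 1)⁻¹ := by
      intro q
      rw [coeff_pderiv, mul_assoc, mul_inv_cancel₀ hne, mul_one]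
    simp only [hco]
    apply HasDerivAt.mul_const
    have h1 : (fun t : ℂ => coeff β (pderiv ℂ i
          (ext Φ fun z => u.1 (z + t • a)))) =ᶠ[𝓝 0]
        fun t : ℂ => ∑ j, ∑ p ∈ Finset.HasAntidiagonal.antidiagonal β,
          coeff p.1 (ext Φ fun z => (dirD (Pi.single j 1) u).1 (z + t • a)) *
          coeff p.2 (pderiv ℂ i (Φ (coordFn z0 j))) := by
      have h2 : ∀ j : Fin m, ∀ᶠ t : ℂ in 𝓝 0,
          HoloAt (fun z => (dirD (Pi.single j 1) u).1 (z + t • a)) z0 := fun j =>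
        eventually_holoAt_shift _ a
      filter_upwards [eventually_holoAt_shift u a, Filter.eventually_all.2 h2] with t ht ht2
      rw [ext_of_holoAt Φ ht, h.pderiv_eq, map_sum]
      refine sum_congr rfl fun j _ => ?_
      rw [coeff_mul, ext_of_holoAt Φ (ht2 j)]
      refine sum_congr rfl fun p _ => ?_
      congr 3
      apply Subtype.ext
      funext z
      exact congrArg (fun L => L (Pi.single j 1)) (fderiv_comp_add_right (𝕜 := ℂ) (f := u.1) (t • a))
    have h2 : coeff β (pderiv ℂ i (Φ (dirD a u))) =
        ∑ j, ∑ p ∈ Finset.HasAntidiagonal.antidiagonal β,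
          coeff p.1 (Φ (dirD a (dirD (Pi.single j 1) u))) *
          coeff p.2 (pderiv ℂ i (Φ (coordFn z0 j))) := by
      rw [h.pderiv_eq, map_sum]
      refine sum_congr rfl fun j _ => ?_
      rw [coeff_mul]
      refine sum_congr rfl fun p _ => ?_
      congr 2
      apply h.congr
      filter_upwards [HoloAt.eventually u.2] with z hz
      exact hz.fderiv_comm _ _
    rw [h2]
    refine HasDerivAt.congr_of_eventuallyEq ?_ h1
    refine HasDerivAt.fun_sum fun j _ => HasDerivAt.fun_sum fun p hp => HasDerivAt.mul_const ?_ _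
    refine IH p.1.degree ?_ p.1 rfl _
    have h3 := congrArg Finsupp.degree (Finset.HasAntidiagonal.mem_antidiagonal.1 hp)
    rw [map_add] at h3 hN
    rw [Finsupp.degree_single] at hN
    omega

end IsTaylor

end SeveralVariables

/-! ### Differentiable families of formal power series -/

section CoeffDeriv

variable {σ τ : Type*}

/-- The coefficients of the family `q` of power series are differentiable at `t`, with the
coefficients of `q'` as derivatives. -/
def HasCoeffDeriv (q : ℂ → MvPowerSeries σ ℂ) (q' : MvPowerSeries σ ℂ) (t : ℂ) : Prop :=
  ∀ d, HasDerivAt (fun s => coeff d (q s)) (coeff d q') t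

namespace HasCoeffDeriv

variable {q r : ℂ → MvPowerSeries σ ℂ} {q' r' : MvPowerSeries σ ℂ} {t : ℂ}

lemma const (f : MvPowerSeries σ ℂ) (t : ℂ) : HasCoeffDeriv (fun _ => f) 0 t := fun d => by
  simpa using hasDerivAt_const t (coeff d f)

lemma congr (h : HasCoeffDeriv q q' t) (he : ∀ᶠ s in 𝓝 t, r s = q s) : HasCoeffDeriv r q' t :=
  fun d => (h d).congr_of_eventuallyEq (by filter_upwards [he] with s hs; rw [hs])

lemma add (h : HasCoeffDeriv q q' t) (h' : HasCoeffDeriv r r' t) :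
    HasCoeffDeriv (fun s => q s + r s) (q' + r') t := fun d => by
  simpa using (h d).fun_add (h' d)

lemma neg (h : HasCoeffDeriv q q' t) : HasCoeffDeriv (fun s => -q s) (-q') t := fun d => by
  simpa using (h d).fun_neg

lemma sum {ι : Type*} {s : Finset ι} {q : ι → ℂ → MvPowerSeries σ ℂ}
    {q' : ι → MvPowerSeries σ ℂ} (h : ∀ i ∈ s, HasCoeffDeriv (q i) (q' i) t) :
    HasCoeffDeriv (fun x => ∑ i ∈ s, q i x) (∑ i ∈ s, q' i) t := fun d => by
  simpa using HasDerivAt.fun_sum fun i hi => h i hi d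

lemma mul (h : HasCoeffDeriv q q' t) (h' : HasCoeffDeriv r r' t) :
    HasCoeffDeriv (fun s => q s * r s) (q' * r t + q t * r') t := fun d => by
  classical
  simp only [map_add, coeff_mul, ← sum_add_distrib]
  exact HasDerivAt.fun_sum fun p _ => (h p.1).mul (h' p.2)

lemma smul {a : ℂ → ℂ} {a' : ℂ} (ha : HasDerivAt a a' t) (h : HasCoeffDeriv q q' t) :
    HasCoeffDeriv (fun s => a s • q s) (a' • q t + a t • q') t := fun d => by
  simpa using ha.fun_mul (h d)

lemma linear (f g : MvPowerSeries σ ℂ) (t : ℂ) : HasCoeffDeriv (fun s => f + s • g) g t := by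
  simpa using (const f t).add ((const g t).smul (hasDerivAt_id t))

lemma pderiv (h : HasCoeffDeriv q q' t) (i : σ) :
    HasCoeffDeriv (fun s => pderiv ℂ i (q s)) (pderiv ℂ i q') t :=
  fun d => by
    simp only [coeff_pderiv]
    exact (h _).mul_const _

variable {a : σ → ℂ → MvPowerSeries τ ℂ} {a' : σ → MvPowerSeries τ ℂ}

lemma aeval [Fintype σ] (ha : ∀ i, HasCoeffDeriv (a i) (a' i) t) (p : MvPolynomial σ ℂ) :
    HasCoeffDeriv (fun s => MvPolynomial.aeval (fun i => a i s) p)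
      (∑ i, MvPolynomial.aeval (fun i => a i t) (MvPolynomial.pderiv i p) * a' i) t := by
  classical
  induction p using MvPolynomial.induction_on with
  | C z =>
    simp only [MvPolynomial.aeval_C, MvPolynomial.pderiv_C, map_zero, zero_mul, sum_const_zero]
    exact const _ t
  | add p q hp hq =>
    simp only [map_add, add_mul, sum_add_distrib]
    exact hp.add hq
  | mul_X p j hp =>
    have h1 := hp.mul (ha j)
    simp only [map_mul, aeval_X]
    convert h1 using 1
    rw [sum_mul]
    have h2 : ∀ i, MvPolynomial.aeval (fun i => a i t)
          (MvPolynomial.pderiv i (p * MvPolynomial.X j)) * a' i =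
        MvPolynomial.aeval (fun i => a i t) (MvPolynomial.pderiv i p) * a' i * a j t +
          if i = j then MvPolynomial.aeval (fun i => a i t) p * a' j else 0 := by
      intro i
      rw [MvPolynomial.pderiv_mul, MvPolynomial.pderiv_X]
      split_ifs with hij
      · subst hij
        simp only [map_add, map_mul, aeval_X, Pi.single_eq_same, map_one]
        ring
      · rw [Pi.single_eq_of_ne (Ne.symm hij)]
        simp only [map_add, map_mul, aeval_X, map_zero]
        ring
    rw [sum_congr rfl fun i _ => h2 i, sum_add_distrib]
    simp

/-- The chain rule for a differentiable family of formal substitutions into a differentiable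
family of power series. -/
lemma subst [Fintype σ] [Finite τ] (ha0 : ∀ i s, constantCoeff (a i s) = 0)
    (ha : ∀ i, HasCoeffDeriv (a i) (a' i) t) (hq : HasCoeffDeriv q q' t) :
    HasCoeffDeriv (fun s => subst (fun i => a i s) (q s))
      (subst (fun i => a i t) q' +
        ∑ i, MvPowerSeries.subst (fun i => a i t) (MvPowerSeries.pderiv ℂ i (q t)) * a' i) t := by
  classical
  intro d
  set N := d.degree + 2 with hN
  set S : Finset (σ →₀ ℕ) := (Finsupp.finite_of_degree_lt N).toFinset with hS
  have htr : ∀ p : MvPowerSeries σ ℂ, truncTotal N p =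
      ∑ e ∈ S, coeff e p • MvPolynomial.monomial e (1 : ℂ) := by
    intro p
    ext e
    rw [coeff_truncTotal_eq_ite, MvPolynomial.coeff_sum]
    simp only [MvPolynomial.coeff_smul, MvPolynomial.coeff_monomial, smul_eq_mul, mul_ite, mul_one,
      mul_zero, Finset.sum_ite_eq', hS, Set.Finite.mem_toFinset, Set.mem_ofPred_eq]
  have hae : ∀ (b : σ → MvPowerSeries τ ℂ) (p : MvPowerSeries σ ℂ),
      MvPolynomial.aeval b (truncTotal N p) =
        ∑ e ∈ S, coeff e p • MvPolynomial.aeval b (MvPolynomial.monomial e (1 : ℂ)) := by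
    intro b p
    rw [htr, map_sum]
    simp only [map_smul]
  have h1 : HasCoeffDeriv (fun s => MvPolynomial.aeval (fun i => a i s) (truncTotal N (q s)))
      (MvPolynomial.aeval (fun i => a i t) (truncTotal N q') +
        ∑ i, MvPolynomial.aeval (fun i => a i t) (MvPolynomial.pderiv i (truncTotal N (q t))) *
          a' i) t := by
    simp only [hae]
    have h2 := HasCoeffDeriv.sum (s := S) fun e _ =>
      (HasCoeffDeriv.aeval ha (MvPolynomial.monomial e 1)).smul (hq e)
    convert h2 using 1
    rw [sum_add_distrib]
    congr 1
    simp only [smul_sum]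
    rw [sum_comm]
    refine sum_congr rfl fun i _ => ?_
    rw [htr, map_sum, map_sum, sum_mul]
    refine sum_congr rfl fun e _ => ?_
    rw [Derivation.map_smul, map_smul, smul_mul_assoc]
  have h3 := h1 d
  have hdN : d.degree < N := by omega
  have h4 : ∀ i, coeff d (MvPowerSeries.subst (fun i => a i t)
        (MvPowerSeries.pderiv ℂ i (q t)) * a' i) =
      coeff d (MvPolynomial.aeval (fun i => a i t)
        (MvPolynomial.pderiv i (truncTotal N (q t))) * a' i) := by
    intro i
    have hs := hasSubst_of_zero (fun i => ha0 i t)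
    have h5 : MvPolynomial.aeval (fun i => a i t) (MvPolynomial.pderiv i (truncTotal N (q t))) =
        MvPowerSeries.subst (fun i => a i t)
          (MvPowerSeries.pderiv ℂ i ((truncTotal N (q t) : MvPolynomial σ ℂ) :
            MvPowerSeries σ ℂ)) := by
      rw [← subst_coe, pderiv_coe]
    rw [h5, ← sub_eq_zero, ← map_sub, ← sub_mul, ← subst_sub hs, ← map_sub]
    have h6 : ((d.degree + 1 : ℕ) : ℕ∞) ≤ (MvPowerSeries.subst (fun i => a i t)
        (MvPowerSeries.pderiv ℂ i (q t - (truncTotal N (q t) : MvPolynomial σ ℂ)))).order :=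
      le_order_subst_of_le (fun i => ha0 i t) (le_order_pderiv i (le_order_sub_truncTotal _ _))
    have h7 : ((d.degree + 1 : ℕ) : ℕ∞) + 0 ≤ _ :=
      le_order_mul_of_le h6 (zero_le (a := (a' i).order))
    rw [add_zero] at h7
    exact le_order_iff_coeff.1 h7 d (Nat.lt_succ_self _)
  have h8 : coeff d (MvPowerSeries.subst (fun i => a i t) q' +
        ∑ i, MvPowerSeries.subst (fun i => a i t) (MvPowerSeries.pderiv ℂ i (q t)) * a' i) =
      coeff d (MvPolynomial.aeval (fun i => a i t) (truncTotal N q') +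
        ∑ i, MvPolynomial.aeval (fun i => a i t) (MvPolynomial.pderiv i (truncTotal N (q t))) *
          a' i) := by
    rw [map_add, map_add, map_sum, map_sum, sum_congr rfl fun i _ => h4 i,
      coeff_subst_truncTotal (fun i => ha0 i t) q' d hdN]
  rw [h8]
  refine h3.congr_of_eventuallyEq (.of_forall fun s => ?_)
  exact coeff_subst_truncTotal (fun i => ha0 i s) (q s) d hdN

end HasCoeffDeriv

end CoeffDeriv

/-! ### Germs of holomorphic functions in a chart -/

section Charts

variable {Y : Type*} [TopologicalSpace Y] [ChartedSpace (Fin m → ℂ) Y]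
  [IsManifold 𝓘(ℂ, Fin m → ℂ) ω Y]

lemma mdifferentiableAt_iff_comp_symm {E : Type*} [NormedAddCommGroup E] [NormedSpace ℂ E]
    {y₀ p : Y} (hp : p ∈ (chart y₀).source) (f : Y → E) :
    MDifferentiableAt 𝓘(ℂ, Fin m → ℂ) 𝓘(ℂ, E) f p ↔
      DifferentiableAt ℂ (f ∘ (chart y₀).symm) (chart y₀ p) := by
  have : IsManifold 𝓘(ℂ, Fin m → ℂ) 1 Y := IsManifold.of_le (n := ω) le_top
  rw [mdifferentiableAt_iff_source_of_mem_source hp]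
  simp only [mfld_simps]
  exact mdifferentiableAt_iff_differentiableAt

lemma eventually_mdifferentiableAt_iff {E : Type*} [NormedAddCommGroup E] [NormedSpace ℂ E]
    {y₀ p : Y} (hp : p ∈ (chart y₀).source) (f : Y → E) :
    (∀ᶠ q in 𝓝 p, MDifferentiableAt 𝓘(ℂ, Fin m → ℂ) 𝓘(ℂ, E) f q) ↔ ∀ᶠ z in 𝓝 (chart y₀ p),
        DifferentiableAt ℂ (f ∘ (chart y₀).symm) z := by
  rw [OpenPartialHomeomorph.eventually_nhds _ _ hp]
  refine Filter.eventually_congr ?_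
  filter_upwards [(chart y₀).open_source.mem_nhds hp] with q hq
  exact mdifferentiableAt_iff_comp_symm hq f

lemma coe_mem_holGerms_iff {y : Y} {f : Y → ℂ} : (f : Germ (𝓝 y) ℂ) ∈ holGerms m y ↔
      ∀ᶠ p in 𝓝 y, MDifferentiableAt 𝓘(ℂ, Fin m → ℂ) 𝓘(ℂ) f p := by
  constructor
  · rintro ⟨f', hf', h⟩
    have h1 : f' =ᶠ[𝓝 y] f := Germ.coe_eq.1 hf'
    filter_upwards [h, h1.eventuallyEq_nhds] with p hp hp1
    exact hp.congr_of_eventuallyEq hp1.symm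
  · exact fun h => ⟨f, rfl, h⟩

lemma coe_mem_holGerms_iff_holoAt {y₀ p : Y} (hp : p ∈ (chart y₀).source)
    {f : Y → ℂ} : (f : Germ (𝓝 p) ℂ) ∈ holGerms m p ↔ HoloAt (f ∘ (chart y₀).symm) (chart y₀ p) :=
  coe_mem_holGerms_iff.trans (eventually_mdifferentiableAt_iff hp f)

lemma comp_chart_mem_holGerms {y₀ p : Y} (hp : p ∈ (chart y₀).source)
    {u : (Fin m → ℂ) → ℂ} (hu : HoloAt u (chart y₀ p)) :
    ((fun q => u (chart y₀ q) : Y → ℂ) : Germ (𝓝 p) ℂ) ∈ holGerms m p := by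
  rw [coe_mem_holGerms_iff_holoAt hp]
  refine hu.congr ?_
  filter_upwards [(chart y₀).open_target.mem_nhds ((chart y₀).map_source hp)] with z hz
  simp [(chart y₀).right_inv hz]

variable {y₀ p q : Y} (hp : p ∈ (chartAt (Fin m → ℂ) y₀).source) (hq : q ∈ (chartAt (Fin m → ℂ) y₀).source)

/-- The germ of a holomorphic function given in a chart. -/
def chartGerm : holoAlg (chart y₀ p) →+* holGerms m p where
  toFun u := ⟨_, comp_chart_mem_holGerms hp u.2⟩
  map_one' := rfl
  map_mul' _ _ := rfl
  map_zero' := rfl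
  map_add' _ _ := rfl

lemma chartGerm_eq_iff {u v : holoAlg (chart y₀ p)} :
    chartGerm hp u = chartGerm hp v ↔ u.1 =ᶠ[𝓝 (chart y₀ p)] v.1 := by
  rw [Subtype.ext_iff]
  change ((fun q => u.1 (chart y₀ q) : Y → ℂ) : Germ (𝓝 p) ℂ) =
    ((fun q => v.1 (chart y₀ q) : Y → ℂ) : Germ (𝓝 p) ℂ) ↔ _
  rw [Germ.coe_eq]
  exact (OpenPartialHomeomorph.eventually_nhds _ (fun z => u.1 z = v.1 z) hp).symm

lemma chartGerm_surjective : Function.Surjective (chartGerm (m := m) hp) := by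
  rintro ⟨_, f, rfl, hf⟩
  refine ⟨⟨f ∘ (chart y₀).symm, (eventually_mdifferentiableAt_iff hp f).1 hf⟩, Subtype.ext ?_⟩
  apply Germ.coe_eq.2
  filter_upwards [(chart y₀).open_source.mem_nhds hp] with q hq
  simp [(chart y₀).left_inv hq]

lemma comap_chartGerm_germIdeal :
    Ideal.comap (chartGerm hp) (germIdeal m p) = holoIdeal (chart y₀ p) := rfl

/-- A function vanishing near `z0` lies in all powers of the ideal of functions vanishing at
`z0`, as it is its own product with the indicator function of its support. -/
lemma ker_chartGerm_le (k : ℕ) : RingHom.ker (chartGerm hp) ≤ holoIdeal (chart y₀ p) ^ (k + 1) := by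
  classical
  intro u hu
  rw [RingHom.mem_ker, ← map_zero (chartGerm hp), chartGerm_eq_iff] at hu
  have hu' : ∀ᶠ z in 𝓝 (chart y₀ p), u.1 z = 0 := hu
  have h0 : HoloAt (fun z => if u.1 z = 0 then (0 : ℂ) else 1) (chart y₀ p) := by
    refine HoloAt.congr (u := fun _ => 0) (.of_forall fun _ => differentiableAt_const _) ?_
    filter_upwards [hu'] with z hz
    simp [hz]
  let χ : holoAlg (chart y₀ p) := ⟨_, h0⟩
  have hχ : χ ∈ holoIdeal (chart y₀ p) := by
    rw [mem_holoIdeal]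
    exact if_pos hu'.self_of_nhds
  have h1 : u = u * χ ^ (k + 1) := by
    apply Subtype.ext
    funext z
    change u.1 z = u.1 z * (if u.1 z = 0 then (0 : ℂ) else 1) ^ (k + 1)
    split_ifs with h
    · simp [h]
    · simp
  rw [h1]
  exact Ideal.mul_mem_left _ _ (Ideal.pow_mem_pow hχ _)

lemma comap_chartGerm_germIdeal_pow (k : ℕ) : Ideal.comap (chartGerm hp) (germIdeal m p ^ (k + 1)) =
      holoIdeal (chart y₀ p) ^ (k + 1) := by
  have h1 : germIdeal m p = Ideal.map (chartGerm hp) (holoIdeal (chart y₀ p)) := by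
    rw [← comap_chartGerm_germIdeal hp, Ideal.map_comap_of_surjective _ (chartGerm_surjective hp)]
  rw [h1, ← Ideal.map_pow, Ideal.comap_map_of_surjective _ (chartGerm_surjective hp)]
  exact sup_eq_left.2 (ker_chartGerm_le hp k)

variable (φ : FormalCoord m Y)

/-- The Taylor expansion in formal coordinates of functions given in the preferred chart at the
base point. -/
def FormalCoord.taylor : holoAlg (chart φ.base φ.base) →ₐ[ℂ] FPS m where
  toRingHom := φ.hom.comp (chartGerm (mem_chart_source _ φ.base))
  commutes' a := φ.hom_const a

lemma FormalCoord.taylor_apply (u : holoAlg (chart φ.base φ.base)) :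
    φ.taylor u = φ.hom (chartGerm (mem_chart_source _ φ.base) u) := rfl

lemma FormalCoord.isTaylor : IsTaylor φ.taylor where
  congr u v h := by
    rw [taylor_apply, taylor_apply, (chartGerm_eq_iff (mem_chart_source _ φ.base)).2 h]
  comap k := by
    rw [← comap_chartGerm_germIdeal_pow, ← φ.comap_pow, Ideal.comap_comap]
    rfl

lemma FormalCoord.pull_of_mem {f : Y → ℂ}
    (h : (f : Germ (𝓝 φ.base) ℂ) ∈ holGerms m φ.base) : φ.pull f = φ.hom ⟨_, h⟩ := by
  rw [FormalCoord.pull]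
  exact dif_pos h

lemma FormalCoord.pull_eq_taylor {f : Y → ℂ} (h : (f : Germ (𝓝 φ.base) ℂ) ∈ holGerms m φ.base) :
    φ.pull f = φ.taylor ⟨f ∘ (chart φ.base).symm,
      (coe_mem_holGerms_iff_holoAt (mem_chart_source _ φ.base)).1 h⟩ := by
  rw [φ.pull_of_mem h, taylor_apply]
  congr 1
  apply Subtype.ext
  apply Germ.coe_eq.2
  filter_upwards [(chart φ.base).open_source.mem_nhds (mem_chart_source _ φ.base)] with q hq
  simp [(chart φ.base).left_inv hq]

/-! ### Translations in a chart -/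

/-- The translation in the chart at `y₀` that takes `p` to `q`. -/
def chartTrans (y₀ p q : Y) (x : Y) : Y :=
  (chart y₀).symm (chart y₀ x + (chart y₀ q - chart y₀ p))

lemma tendsto_chartTrans (hp : p ∈ (chart y₀).source) (hq : q ∈ (chart y₀).source) :
    Filter.Tendsto (chartTrans (m := m) y₀ p q) (𝓝 p) (𝓝 q) := by
  have h1 : Filter.Tendsto (fun x => chart y₀ x +
      (chart y₀ q - chart y₀ p)) (𝓝 p)
      (𝓝 (chart y₀ p + (chart y₀ q - chart y₀ p))) :=
    ((chart y₀).continuousAt hp).add continuousAt_const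
  have h2 := (chart y₀).tendsto_symm hq
  rw [add_sub_cancel] at h1
  exact h2.comp h1

lemma chart_chartTrans (hp : p ∈ (chart y₀).source) (hq : q ∈ (chart y₀).source) :
    ∀ᶠ x in 𝓝 p, chart y₀ (chartTrans (m := m) y₀ p q x) =
      chart y₀ x + (chart y₀ q - chart y₀ p) := by
  have h1 := ((chart y₀).continuousAt hp).add
    (continuousAt_const (y := chart y₀ q - chart y₀ p))
  have h3 : chart y₀ p +
      (chart y₀ q - chart y₀ p) ∈ (chart y₀).target := by
    rw [add_sub_cancel]
    exact (chart y₀).map_source hq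
  filter_upwards [h1.eventually ((chart y₀).open_target.mem_nhds h3)] with x hx
  exact (chart y₀).right_inv hx

lemma chartTrans_chartTrans (hp : p ∈ (chart y₀).source) (hq : q ∈ (chart y₀).source) :
    ∀ᶠ x in 𝓝 p, chartTrans (m := m) y₀ q p (chartTrans (m := m) y₀ p q x) = x := by
  filter_upwards [chart_chartTrans hp hq, (chart y₀).open_source.mem_nhds hp] with x hx hx2
  rw [chartTrans, hx, add_assoc, sub_add_sub_cancel, sub_self, add_zero, (chart y₀).left_inv hx2]

lemma comp_chartTrans_mem {f : Germ (𝓝 q) ℂ} (hf : f ∈ holGerms m q) :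
    f.compTendsto _ (tendsto_chartTrans hp hq) ∈ holGerms m p := by
  obtain ⟨u, hu⟩ := chartGerm_surjective hq ⟨f, hf⟩
  have hu' : ((fun q => u.1 (chart y₀ q) : Y → ℂ) : Germ (𝓝 q) ℂ) = f :=
    congrArg Subtype.val hu
  rw [← hu', Germ.coe_compTendsto]
  have h1 : HoloAt (fun z => u.1 (z + (chart y₀ q - chart y₀ p)))
      (chart y₀ p) := by
    apply HoloAt.comp_add
    rw [add_sub_cancel]
    exact u.2
  have h2 := comp_chart_mem_holGerms hp h1
  convert h2 using 1
  apply Germ.coe_eq.2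
  filter_upwards [chart_chartTrans hp hq] with x hx
  simp [hx]

/-- The isomorphism of the rings of germs at two points of a chart given by translation. -/
def transEquiv : holGerms m q ≃+* holGerms m p where
  toFun f := ⟨f.1.compTendsto _ (tendsto_chartTrans hp hq), comp_chartTrans_mem hp hq f.2⟩
  invFun f := ⟨f.1.compTendsto _ (tendsto_chartTrans hq hp), comp_chartTrans_mem hq hp f.2⟩
  left_inv := by
    rintro ⟨_, f, rfl, hf⟩
    apply Subtype.ext
    apply Germ.coe_eq.2
    filter_upwards [chartTrans_chartTrans hq hp] with x hx
    simp [hx]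
  right_inv := by
    rintro ⟨_, f, rfl, hf⟩
    apply Subtype.ext
    apply Germ.coe_eq.2
    filter_upwards [chartTrans_chartTrans hp hq] with x hx
    simp [hx]
  map_mul' := by
    rintro ⟨_, f, rfl, hf⟩ ⟨_, f', rfl, hf'⟩
    rfl
  map_add' := by
    rintro ⟨_, f, rfl, hf⟩ ⟨_, f', rfl, hf'⟩
    rfl

lemma chartTrans_self_apply (hq : q ∈ (chart y₀).source) : chartTrans (m := m) y₀ p q p = q := by
  rw [chartTrans, add_sub_cancel, (chart y₀).left_inv hq]

lemma comap_transEquiv (k : ℕ) :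
    Ideal.comap (transEquiv hp hq : holGerms m q →+* holGerms m p) (germIdeal m p ^ k) =
      germIdeal m q ^ k := by
  have h1 : Ideal.comap (transEquiv hp hq : holGerms m q →+* holGerms m p) (germIdeal m p) =
      germIdeal m q := by
    ext ⟨_, f, rfl, hf⟩
    change f (chartTrans (m := m) y₀ p q p) = 0 ↔ f q = 0
    rw [chartTrans_self_apply hq]
  rw [← h1]
  change Ideal.comap (transEquiv hp hq) _ = Ideal.comap (transEquiv hp hq) _ ^ k
  rw [← Ideal.map_symm, ← Ideal.map_symm, Ideal.map_pow]

/-- The formal coordinate system at a nearby point obtained by translation in the preferred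
chart. -/
def FormalCoord.transport {q : Y} (hq : q ∈ (chart φ.base).source) : FormalCoord m Y where
  base := q
  hom := φ.hom.comp (transEquiv (mem_chart_source _ φ.base) hq : holGerms m q →+* _)
  hom_const a := φ.hom_const a
  comap_pow k := by rw [← Ideal.comap_comap, φ.comap_pow, comap_transEquiv]
  surj_mod k p := by
    obtain ⟨f, hf⟩ := φ.surj_mod k p
    refine ⟨(transEquiv (mem_chart_source _ φ.base) hq).symm f, ?_⟩
    simpa using hf

lemma FormalCoord.pull_transport {q : Y} (hq : q ∈ (chart φ.base).source) {f : Y → ℂ}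
    (hf : (f : Germ (𝓝 q) ℂ) ∈ holGerms m q) :
    (φ.transport hq).pull f = IsTaylor.ext φ.taylor
      (fun z => (f ∘ (chart φ.base).symm)
        (z + (chart φ.base q - chart φ.base φ.base))) := by
  have h1 : HoloAt (fun z => (f ∘ (chart φ.base).symm)
        (z + (chart φ.base q - chart φ.base φ.base)))
      (chart φ.base φ.base) := by
    apply HoloAt.comp_add
    rw [add_sub_cancel]
    exact (coe_mem_holGerms_iff_holoAt hq).1 hf
  rw [IsTaylor.ext_of_holoAt _ h1, (φ.transport hq).pull_of_mem hf, taylor_apply]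
  rfl

lemma FormalCoord.pull_act (g : FPS m ≃ₐ[ℂ] FPS m) (f : Y → ℂ) :
    (φ.act g).pull f = g (φ.pull f) := by
  by_cases h : (f : Germ (𝓝 φ.base) ℂ) ∈ holGerms m φ.base
  · rw [φ.pull_of_mem h, (φ.act g).pull_of_mem h]
    rfl
  · have h1 : (φ.act g).pull f = 0 := by rw [FormalCoord.pull]; exact dif_neg h
    have h2 : φ.pull f = 0 := by rw [FormalCoord.pull]; exact dif_neg h
    rw [h1, h2, map_zero]

/-! ### Paths of formal coordinate systems -/

lemma vecField_apply (v : Fin m → FPS m) (f : FPS m) : vecField v f = ∑ i, v i * pderiv ℂ i f := by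
  simp [vecField]

lemma vecField_mul (v : Fin m → FPS m) (f g : FPS m) :
    vecField v (f * g) = f * vecField v g + vecField v f * g := by
  simp only [vecField_apply, Derivation.leibniz, smul_eq_mul, mul_sum, sum_mul, ← sum_add_distrib]
  exact sum_congr rfl fun i _ => by ring

/-- The automorphisms `x ↦ x - t w(x)`, for `w` vanishing at the origin and small `t`. -/
def autFamily (w : Fin m → FPS m) (hw : ∀ i, constantCoeff (w i) = 0) (t : ℂ) :
    FPS m ≃ₐ[ℂ] FPS m := by
  classical
  exact if h : IsUnit (linMat fun i => (X i : FPS m) - t • w i).det then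
    substEquiv (fun i => X i - t • w i) (fun i => by simp [smul_eq_C_mul, hw]) h else AlgEquiv.refl

lemma eventually_autFamily (w : Fin m → FPS m) (hw : ∀ i, constantCoeff (w i) = 0) :
    ∀ᶠ t in 𝓝 (0 : ℂ), ∀ f, autFamily w hw t f = subst (fun i => X i - t • w i) f := by
  have h1 : Continuous fun t : ℂ => (linMat fun i => (X i : FPS m) - t • w i).det := by
    apply Continuous.matrix_det
    refine continuous_matrix fun i j => ?_
    simp only [linMat, of_apply, map_sub, map_smul, smul_eq_mul]
    fun_prop
  have h2 : (linMat fun i => (X i : FPS m) - (0 : ℂ) • w i).det = 1 := by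
    have : (linMat fun i => (X i : FPS m) - (0 : ℂ) • w i) = 1 := by
      classical
      ext i j
      simp [linMat, coeff_index_single_X, one_apply, eq_comm]
    rw [this, Matrix.det_one]
  have h3 := h1.continuousAt.eventually_ne (x := (0 : ℂ)) (y := (0 : ℂ))
    (by rw [h2]; exact one_ne_zero)
  filter_upwards [h3] with t ht f
  rw [autFamily, dif_pos (isUnit_iff_ne_zero.2 ht), substEquiv_apply]

lemma autFamily_zero (w : Fin m → FPS m) (hw : ∀ i, constantCoeff (w i) = 0) (f : FPS m) :
    autFamily w hw 0 f = f := by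
  rw [(eventually_autFamily w hw).self_of_nhds f]
  have : (fun i => (X i : FPS m) - (0 : ℂ) • w i) = X := by funext i; simp
  rw [this, subst_self]
  rfl

lemma HasCoeffDeriv.autFamily {w : Fin m → FPS m} (hw : ∀ i, constantCoeff (w i) = 0)
    {q : ℂ → FPS m} {q' : FPS m} (hq : HasCoeffDeriv q q' 0) :
    HasCoeffDeriv (fun t => FormalGeometry.autFamily w hw t (q t))
      (q' - ∑ i, w i * MvPowerSeries.pderiv ℂ i (q 0)) 0 := by
  have h1 : ∀ i, HasCoeffDeriv (fun t : ℂ => (X i : FPS m) - t • w i) (-w i) 0 := fun i => by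
    simpa [sub_eq_add_neg] using HasCoeffDeriv.linear (X i) (-w i) 0
  have h2 := HasCoeffDeriv.subst (a := fun i t => (X i : FPS m) - t • w i)
    (fun i s => by simp [smul_eq_C_mul, hw]) h1 hq
  have h3 : (fun i => (X i : FPS m) - (0 : ℂ) • w i) = X := by funext i; simp
  simp only [h3, subst_self, id] at h2
  refine HasCoeffDeriv.congr (q' := _) ?_
    ((eventually_autFamily w hw).mono fun t ht => ht (q t))
  convert h2 using 1
  rw [sub_eq_add_neg, ← sum_neg_distrib]
  congr 1
  exact sum_congr rfl fun i _ => by ring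

/-- The point `y + t a` in the preferred chart at `y`, for small `t`. -/
def movePoint (y : Y) (a : Fin m → ℂ) (t : ℂ) : Y := by
  classical
  exact if chart y y + t • a ∈ (chart y).target then
    (chart y).symm (chart y y + t • a) else y

lemma movePoint_mem (y : Y) (a : Fin m → ℂ) (t : ℂ) : movePoint y a t ∈ (chart y).source := by
  rw [movePoint]
  split_ifs with h
  · exact (chart y).map_target h
  · exact mem_chart_source _ y

lemma movePoint_zero (y : Y) (a : Fin m → ℂ) : movePoint y a 0 = y := by
  rw [movePoint, zero_smul, add_zero, if_pos (mem_chart_target _ y),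
    (chart y).left_inv (mem_chart_source _ y)]

lemma eventually_movePoint_mem_target (y : Y) (a : Fin m → ℂ) :
    ∀ᶠ t in 𝓝 (0 : ℂ), chart y y + t • a ∈ (chart y).target := by
  have h1 : Continuous fun t : ℂ => chart y y + t • a := by fun_prop
  apply h1.continuousAt.eventually
  simp only [zero_smul, add_zero]
  exact (chart y).open_target.mem_nhds (mem_chart_target _ y)

lemma eventually_chart_movePoint (y : Y) (a : Fin m → ℂ) :
    ∀ᶠ t in 𝓝 (0 : ℂ), chart y (movePoint y a t) - chart y y = t • a := by
  filter_upwards [eventually_movePoint_mem_target y a] with t ht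
  rw [movePoint, if_pos ht, (chart y).right_inv ht, add_sub_cancel_left]

lemma tendsto_movePoint (y : Y) (a : Fin m → ℂ) : Filter.Tendsto (movePoint y a) (𝓝 0) (𝓝 y) := by
  have h1 : Filter.Tendsto (fun t : ℂ => chart y y + t • a) (𝓝 0)
      (𝓝 (chart y y)) := by
    have : Continuous fun t : ℂ => chart y y + t • a := by fun_prop
    simpa using this.tendsto 0
  refine (((chart y).tendsto_symm (mem_chart_source _ y)).comp h1).congr' ?_
  filter_upwards [eventually_movePoint_mem_target y a] with t ht
  rw [movePoint, if_pos ht]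
  rfl

/-- Every tangent vector `ω⁻¹(v)` is the sum of the velocity of a translation in the chart and of
that of a path of formal automorphisms. -/
lemma FormalCoord.exists_splitting (v : Fin m → FPS m) :
    ∃ (a : Fin m → ℂ) (w : Fin m → FPS m), (∀ i, constantCoeff (w i) = 0) ∧
      ∀ u, φ.taylor (dirD a u) - ∑ i, w i * pderiv ℂ i (φ.taylor u) = -vecField v (φ.taylor u) := by
  set J := jac (fun j => φ.taylor (coordFn (chart φ.base φ.base) j)) with hJ
  have hT := φ.isTaylor
  have hJu : IsUnit J.det := by
    have h1 : J = jac (IsTaylor.cen φ.taylor) := by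
      ext1 i k
      exact (IsTaylor.pderiv_cen k i).symm
    rw [h1, isUnit_det_iff_constantCoeff, constantCoeff_jac]
    exact hT.isUnit_linMat_cen
  -- the derivative along `a` is the vector field `J⁻¹ a` in formal coordinates, and `a` is chosen
  -- so that `w = J⁻¹ a + v` vanishes at the origin
  set a : Fin m → ℂ := -((J.map (constantCoeff (R := ℂ))).mulVec fun i => constantCoeff (v i))
    with ha
  set w : Fin m → FPS m := (J⁻¹).mulVec (fun j => C (a j)) + v with hw
  refine ⟨a, w, ?_, ?_⟩
  · intro i
    have h2 : (J⁻¹).map (constantCoeff (R := ℂ)) * J.map (constantCoeff (R := ℂ)) = 1 := by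
      rw [← Matrix.map_mul, Matrix.nonsing_inv_mul _ hJu]
      exact Matrix.map_one _ (map_zero _) (map_one _)
    rw [hw, Pi.add_apply, map_add, RingHom.map_mulVec]
    have h3 : (constantCoeff ∘ fun j => (C (a j) : FPS m)) = a := funext fun _ => by simp
    rw [h3, ha, Matrix.mulVec_neg, mulVec_mulVec, h2, one_mulVec, Pi.neg_apply, neg_add_cancel]
  · intro u
    have h1 : dirD a u = ∑ j, algebraMap ℂ _ (a j) * dirD (Pi.single j 1) u := by
      refine Subtype.ext (funext fun z => ?_)
      rw [AddSubmonoidClass.coe_finsetSum, Finset.sum_apply]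
      change fderiv ℂ u.1 z a = ∑ j, a j * fderiv ℂ u.1 z (Pi.single j 1)
      conv_lhs => rw [pi_eq_sum_univ' a]
      simp only [map_sum, map_smul, smul_eq_mul]
    have hb : ∀ j, ∑ i, J j i * (J⁻¹).mulVec (fun j => C (a j)) i = C (a j) := fun j => by
      have := mulVec_mulVec (fun j => (C (a j) : FPS m)) J J⁻¹
      rw [Matrix.mul_nonsing_inv _ hJu, one_mulVec] at this
      exact congrFun this j
    have hJJ : φ.taylor (dirD a u) =
        ∑ i, (J⁻¹).mulVec (fun j => C (a j)) i * pderiv ℂ i (φ.taylor u) := by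
      rw [sum_congr rfl fun i _ => by rw [hT.pderiv_eq, mul_sum], sum_comm, h1, map_sum]
      refine sum_congr rfl fun j _ => ?_
      rw [map_mul, AlgHom.commutes]
      change C (a j) * _ = _
      rw [← hb, sum_mul]
      exact sum_congr rfl fun i _ => (by ring : _ = _ * (_ * J j i))
    rw [hJJ, ← sum_sub_distrib, vecField_apply, ← sum_neg_distrib]
    exact sum_congr rfl fun i _ => by rw [hw, Pi.add_apply]; ring

lemma FormalCoord.hasCoeffDeriv_pull_transport (a : Fin m → ℂ) {f : Y → ℂ}
    (hf : (f : Germ (𝓝 φ.base) ℂ) ∈ holGerms m φ.base) :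
    HasCoeffDeriv (fun t => (φ.transport (movePoint_mem φ.base a t)).pull f)
      (φ.taylor (dirD a ⟨f ∘ (chart φ.base).symm,
        (coe_mem_holGerms_iff_holoAt (mem_chart_source _ φ.base)).1 hf⟩)) 0 := by
  intro β
  refine (φ.isTaylor.hasDerivAt_coeff_shift a β _).congr_of_eventuallyEq ?_
  have h1 : ∀ᶠ q in 𝓝 φ.base, (f : Germ (𝓝 q) ℂ) ∈ holGerms m q :=
    (eventually_eventually_nhds.2 (coe_mem_holGerms_iff.1 hf)).mono
      fun q hq => coe_mem_holGerms_iff.2 hq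
  filter_upwards [eventually_chart_movePoint φ.base a,
    (tendsto_movePoint φ.base a).eventually h1] with t ht ht2
  rw [φ.pull_transport _ ht2, ht]

lemma FormalCoord.pull_transport_zero (a : Fin m → ℂ) {f : Y → ℂ}
    (hf : (f : Germ (𝓝 φ.base) ℂ) ∈ holGerms m φ.base) :
    (φ.transport (movePoint_mem φ.base a 0)).pull f = φ.pull f := by
  rw [φ.pull_transport _ (coe_mem_holGerms_iff.2 (by
    rw [movePoint_zero]; exact coe_mem_holGerms_iff.1 hf)), φ.pull_eq_taylor hf, movePoint_zero,
    sub_self]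
  simp only [add_zero]
  exact IsTaylor.ext_of_holoAt _ _

/-- The path `[φ_t]` with initial velocity `ω⁻¹(v)`. -/
def FormalCoord.path (a : Fin m → ℂ) (w : Fin m → FPS m)
    (hw : ∀ i, constantCoeff (w i) = 0) (t : ℂ) : FormalCoord m Y :=
  (φ.transport (movePoint_mem φ.base a t)).act (autFamily w hw t)

lemma FormalCoord.hasCoeffDeriv_pull_path (v : Fin m → FPS m)
    (a : Fin m → ℂ) (w : Fin m → FPS m) (hw : ∀ i, constantCoeff (w i) = 0)
    (h : ∀ u, φ.taylor (dirD a u) - ∑ i, w i * pderiv ℂ i (φ.taylor u) =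
        -vecField v (φ.taylor u)) {f : Y → ℂ}
    (hf : (f : Germ (𝓝 φ.base) ℂ) ∈ holGerms m φ.base) :
    HasCoeffDeriv (fun t => (φ.path a w hw t).pull f) (-vecField v (φ.pull f)) 0 := by
  have h1 := HasCoeffDeriv.autFamily hw (φ.hasCoeffDeriv_pull_transport a hf)
  rw [φ.pull_transport_zero a hf, φ.pull_eq_taylor hf, h, ← φ.pull_eq_taylor hf] at h1
  simp only [FormalCoord.path, FormalCoord.pull_act]
  exact h1

lemma FormalCoord.pull_path_zero
    (a : Fin m → ℂ) (w : Fin m → FPS m) (hw : ∀ i, constantCoeff (w i) = 0)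
    {f : Y → ℂ} (hf : (f : Germ (𝓝 φ.base) ℂ) ∈ holGerms m φ.base) :
    (φ.path a w hw 0).pull f = φ.pull f := by
  rw [FormalCoord.path, FormalCoord.pull_act, autFamily_zero, φ.pull_transport_zero a hf]

lemma chart_mem_holGerms (y : Y) (j : Fin m) :
    ((fun p => chart y p j : Y → ℂ) : Germ (𝓝 y) ℂ) ∈ holGerms m y :=
  comp_chart_mem_holGerms (mem_chart_source _ y) (u := fun z => z j)
    (.of_forall fun _ => differentiableAt_apply j _)

/-- The derivative of a function of finitely many coordinates along a path. -/
lemma HasCoordDeriv.hasDerivAt {Pt κ : Type*} {O : Set Pt} {z : Pt → κ → ℂ} {f : Pt → ℂ} {p : Pt}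
    {w : κ → ℂ} {d : ℂ} (h : HasCoordDeriv O z f p w d) {γ : ℂ → Pt} {t : ℂ}
    (hO : ∀ᶠ s in 𝓝 t, γ s ∈ O) (hz : ∀ i, HasDerivAt (fun s => z (γ s) i) (w i) t)
    (h0 : ∀ i, z (γ t) i = z p i) : HasDerivAt (fun s => f (γ s)) d t := by
  obtain ⟨S, V, g, ⟨hp, hV, hpV, hg, hf⟩, rfl⟩ := h
  have h1 : HasDerivAt (fun s => (fun i : S => z (γ s) i)) (fun i : S => w i) t :=
    hasDerivAt_pi.2 fun i => hz i
  have h2 : (fun i : S => z (γ t) i) = fun i : S => z p i := funext fun i => h0 i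
  have h3 : HasFDerivAt g (fderiv ℂ g fun i : S => z p i) (fun i : S => z (γ t) i) := by
    rw [h2]
    exact ((hg _ hpV).differentiableAt (hV.mem_nhds hpV)).hasFDerivAt
  have h4 := h3.comp_hasDerivAt t h1
  refine h4.congr_of_eventuallyEq ?_
  have h5 : ∀ᶠ s in 𝓝 t, (fun i : S => z (γ s) i) ∈ V :=
    h1.continuousAt.eventually (hV.mem_nhds (by
      change (fun i : S => z (γ t) i) ∈ V
      rw [h2]; exact hpV))
  filter_upwards [hO, h5] with s hs hs5 using hf _ hs hs5

lemma FormalCoord.HasLieDeriv.unique {f : FormalCoord m Y → ℂ} {φ : FormalCoord m Y}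
    {v : Fin m → FPS m} {d d' : ℂ} (h : FormalCoord.HasLieDeriv f φ v d)
    (h' : FormalCoord.HasLieDeriv f φ v d') : d = d' := by
  obtain ⟨a, w, hw, haw⟩ := φ.exists_splitting v
  have key : ∀ {e : ℂ}, FormalCoord.HasLieDeriv f φ v e →
      HasDerivAt (fun t => f (φ.path a w hw t)) e 0 := by
    rintro e ⟨O, hO, hOs, hd⟩
    have hφ : φ.base ∈ O := by
      obtain ⟨S, V, g, ⟨hp, -⟩, -⟩ := hd
      exact hp
    refine hd.hasDerivAt ?_ (fun i => ?_) fun i => ?_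
    · exact (tendsto_movePoint φ.base a).eventually (hO.mem_nhds hφ)
    · exact φ.hasCoeffDeriv_pull_path v a w hw haw (chart_mem_holGerms φ.base i.1) i.2
    · rw [FormalCoord.jetCoord, φ.pull_path_zero a w hw (chart_mem_holGerms φ.base i.1)]
      rfl
  exact (key h).unique (key h')

end Charts

/-! ### Frames of the normal bundle -/

section NormalBundle

variable {X Y G : Type*} [TopologicalSpace X] [ChartedSpace (Fin (m + l) → ℂ) X]
  [IsManifold 𝓘(ℂ, Fin (m + l) → ℂ) ω X] [Group G] [MulAction G X]
  [TopologicalSpace Y] [ChartedSpace (Fin m → ℂ) Y] [IsManifold 𝓘(ℂ, Fin m → ℂ) ω Y]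
  {H : Subgroup G} [Fintype H] {σ : H →* GL (Fin l) ℂ} {ι : Y → X}

lemma IsStratumPiece.smul_eq (hι : IsStratumPiece m l H ι) (h : H) (y : Y) :
    (h : G) • ι y = ι y := by
  obtain ⟨x₀, _, O, _, hr⟩ := hι.range_eq
  have h1 : ι y ∈ Set.range ι := ⟨y, rfl⟩
  rw [hr] at h1
  have h2 : ι y ∈ isotropyType X H := connectedComponentIn_subset _ _ h1.2
  have h4 : MulAction.stabilizer G (ι y) = H := h2
  have h3 : (h : G) ∈ MulAction.stabilizer G (ι y) := by rw [h4]; exact h.2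
  exact h3

/-- The rank of the normal bundle is at most `l`: its fibres are disjoint from the tangent spaces
of the stratum, on which `H` acts trivially. -/
lemma IsStratumPiece.finrank_normalSpace_le (hι : IsStratumPiece m l H ι)
    (hG : ∀ g : G, MDifferentiable 𝓘(ℂ, Fin (m + l) → ℂ) 𝓘(ℂ, Fin (m + l) → ℂ)
      (fun x : X => g • x)) (y : Y) :
    Module.finrank ℂ (normalSpace m l H (ι y)) ≤ l := by
  set T : (Fin m → ℂ) →ₗ[ℂ] (Fin (m + l) → ℂ) :=
    (mfderiv 𝓘(ℂ, Fin m → ℂ) 𝓘(ℂ, Fin (m + l) → ℂ) ι y).toLinearMap with hT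
  have hinj : Function.Injective T := hι.immersion y
  have hfix : ∀ (h : H) (w : Fin m → ℂ), isotropyMap m l (h : G) (ι y) (T w) = T w := by
    intro h w
    have h1 : (fun x : X => (h : G) • x) ∘ ι = ι := funext fun z => hι.smul_eq h z
    have h2 := mfderiv_comp y (hG (h : G) (ι y)) (hι.holomorphic y)
    rw [h1] at h2
    have h3 := congrArg (fun L => L w) h2
    exact h3.symm
  have hdis : Disjoint (LinearMap.range T) (normalSpace m l H (ι y)) := by
    rw [Submodule.disjoint_def]
    rintro _ ⟨w, rfl⟩ hw
    rw [normalSpace, LinearMap.mem_ker, LinearMap.sum_apply] at hw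
    have h1 : ∑ h : H, (isotropyMap m l (h : G) (ι y)).toLinearMap (T w) = ∑ _h : H, T w :=
      sum_congr rfl fun h _ => hfix h w
    rw [h1, Finset.sum_const, Finset.card_univ] at hw
    exact (smul_eq_zero.1 hw).resolve_left Fintype.card_ne_zero
  have h1 := Submodule.finrank_add_finrank_le_of_disjoint hdis
  rw [LinearMap.finrank_range_of_inj hinj] at h1
  simp only [Module.finrank_fintype_fun_eq_card, Fintype.card_fin] at h1
  omega

lemma localExpr_injective (hc : Continuous ι) (y : Y) : ∀ᶠ p in 𝓝 y,
    Function.Injective ((trivializationAt (Fin (m + l) → ℂ)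
      (TangentSpace 𝓘(ℂ, Fin (m + l) → ℂ)) (ι y)).continuousLinearMapAt ℂ (ι p)) := by
  have h1 : ∀ᶠ p in 𝓝 y, ι p ∈ (trivializationAt (Fin (m + l) → ℂ)
      (TangentSpace 𝓘(ℂ, Fin (m + l) → ℂ)) (ι y)).baseSet :=
    hc.continuousAt.eventually ((trivializationAt (Fin (m + l) → ℂ)
      (TangentSpace 𝓘(ℂ, Fin (m + l) → ℂ)) (ι y)).open_baseSet.mem_nhds
        (FiberBundle.mem_baseSet_trivializationAt' _))
  filter_upwards [h1] with p hp v w hvw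
  rw [← Bundle.Trivialization.symmL_continuousLinearMapAt (R := ℂ) _ hp v, hvw,
    Bundle.Trivialization.symmL_continuousLinearMapAt _ hp]

/-- Coordinates with respect to a local frame of the normal bundle are holomorphic, by Cramer's
rule. -/
lemma IsLocalFrame.exists_coords (hdim : ∀ y, Module.finrank ℂ (normalSpace m l H (ι y)) ≤ l)
    (hc : Continuous ι) {O : Set Y} (hO : IsOpen O) {e : Fin l → Y → (Fin (m + l) → ℂ)}
    (he : IsLocalFrame m H σ ι O e) {y : Y} (hy : y ∈ O) {a : Y → (Fin (m + l) → ℂ)}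
    (ha : (a : Germ (𝓝 y) (Fin (m + l) → ℂ)) ∈ normalGerms H ι y) :
    ∃ n : Fin l → Y → ℂ, (∀ j, (n j : Germ (𝓝 y) ℂ) ∈ holGerms m y) ∧
      ∀ᶠ p in 𝓝 y, a p = ∑ j, n j p • e j p := by
  have hspan : ∀ p ∈ O, ∀ v ∈ normalSpace m l H (ι p), ∃ x : Fin l → ℂ, ∑ j, x j • e j p = v := by
    intro p hp v hv
    obtain ⟨hep, hli, -⟩ := he p hp
    rwa [← Submodule.mem_span_range_iff_exists_fun, Submodule.eq_of_le_of_finrank_le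
      (S₂ := normalSpace m l H (ι p)) (Submodule.span_le.2 ?_)
      ((hdim p).trans_eq (by rw [finrank_span_eq_card hli, Fintype.card_fin]))]
    rintro _ ⟨j, rfl⟩
    obtain ⟨b, hb, h1, -⟩ := hep j
    change e j p ∈ _
    exact (Germ.coe_eq.1 hb).self_of_nhds ▸ h1.self_of_nhds
  obtain ⟨a', ha', han, had⟩ := ha
  -- a linear map that takes the frame at `y` to a basis of `ℂˡ`
  set E : Y → (Fin l → Fin (m + l) → ℂ) := fun p j => localExpr ι y (e j) p with hE
  have hEd : ∀ j, ∀ᶠ p in 𝓝 y,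
      MDifferentiableAt 𝓘(ℂ, Fin m → ℂ) 𝓘(ℂ, Fin (m + l) → ℂ) (fun p => E p j) p := by
    intro j
    obtain ⟨b, hb, -, h1⟩ := (he y hy).1 j
    filter_upwards [h1, (Germ.coe_eq.1 hb).eventuallyEq_nhds] with p hp hp2
    refine hp.congr_of_eventuallyEq (hp2.mono fun q hq => ?_)
    simp only [hE, localExpr, hq]
  obtain ⟨L, hL⟩ := LinearMap.exists_leftInverse_of_injective (Fintype.linearCombination ℂ (E y))
    (LinearMap.ker_eq_bot.2 ((he y hy).2.1.map' _ (LinearMap.ker_eq_bot.2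
      (localExpr_injective hc y).self_of_nhds)).fintypeLinearCombination_injective)
  set G : (Fin l → Fin (m + l) → ℂ) →ₗ[ℂ] ((Fin l → ℂ) →L[ℂ] (Fin l → ℂ)) :=
    LinearMap.toContinuousLinearMap.toLinearMap ∘ₗ LinearMap.compRight ℂ L ∘ₗ
      Fintype.bilinearCombination ℂ ℂ with hG
  have hu : ∀ᶠ p in 𝓝 y, IsUnit (G (E p)) := by
    have h1 : ContinuousAt (fun p => G (E p)) y :=
      G.continuous_of_finiteDimensional.continuousAt.comp
        (continuousAt_pi.2 fun j => (hEd j).self_of_nhds.continuousAt)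
    have h2 : G (E y) = 1 := ContinuousLinearMap.ext fun x => LinearMap.congr_fun hL x
    exact h1.eventually (Units.isOpen.mem_nhds (show IsUnit (G (E y)) from h2 ▸ isUnit_one))
  refine ⟨fun j p => Ring.inverse (G (E p)) (L (localExpr ι y a' p)) j, fun j => ?_, ?_⟩
  · rw [coe_mem_holGerms_iff]
    filter_upwards [Filter.eventually_all.2 hEd, had, hu] with p h1 h2 h3
    have h4 : DifferentiableAt ℂ (fun z : (Fin l → Fin (m + l) → ℂ) × (Fin (m + l) → ℂ) =>
        Ring.inverse (G z.1) (L z.2) j) (E p, localExpr ι y a' p) := by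
      refine differentiableAt_pi.1 (DifferentiableAt.clm_apply ?_ ?_) j
      · exact (differentiableAt_inverse (𝕜 := ℂ) h3).comp (E p, localExpr ι y a' p)
          (G.toContinuousLinearMap.differentiableAt.comp _ differentiableAt_fst)
      · exact L.toContinuousLinearMap.differentiableAt.comp _ differentiableAt_snd
    have hp := mem_chart_source (Fin m → ℂ) p
    have h5 : MDifferentiableAt 𝓘(ℂ, Fin m → ℂ) 𝓘(ℂ, Fin l → Fin (m + l) → ℂ) E p :=
      (mdifferentiableAt_iff_comp_symm hp _).2 (differentiableAt_pi.2 fun j =>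
        (mdifferentiableAt_iff_comp_symm hp _).1 (h1 j))
    exact h4.comp_mdifferentiableAt (f := fun p => (E p, localExpr ι y a' p)) (h5.prodMk_space h2)
  · filter_upwards [Germ.coe_eq.1 ha', han, hu, hO.mem_nhds hy] with p h1 h2 h3 hp
    obtain ⟨x, hx⟩ := hspan p hp _ h2
    have h4 : L (localExpr ι y a' p) = G (E p) x := by
      change L _ = L (∑ j, x j • E p j)
      rw [localExpr, ← hx]
      refine congrArg L ((map_sum _ _ _).trans (sum_congr rfl fun j _ => map_smul _ _ _))
    have h5 : Ring.inverse (G (E p)) (G (E p) x) = x :=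
      congrArg (fun T => T x) (Ring.inverse_mul_cancel _ h3)
    rw [h4, h5, hx, h1]

end NormalBundle

/-! ### Paths in the bundle of formal coordinates of the normal bundle -/

section NormalPaths

variable {X Y G : Type*} [TopologicalSpace X] [ChartedSpace (Fin (m + l) → ℂ) X]
  [IsManifold 𝓘(ℂ, Fin (m + l) → ℂ) ω X] [Group G] [MulAction G X]
  [TopologicalSpace Y] [ChartedSpace (Fin m → ℂ) Y] [IsManifold 𝓘(ℂ, Fin m → ℂ) ω Y]
  {H : Subgroup G} [Fintype H] {σ : H →* GL (Fin l) ℂ} {ι : Y → X}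

variable (m H σ ι) in
/-- A holomorphic frame `e` of the normal bundle over an open set `O`, with the bound on the rank of
the bundle and the continuity of `ι`, which make the germs of the frame bases. -/
structure FrameData (O : Set Y) (e : Fin l → Y → (Fin (m + l) → ℂ)) : Prop where
  dim : ∀ y, Module.finrank ℂ (normalSpace m l H (ι y)) ≤ l
  cont : Continuous ι
  isOpen : IsOpen O
  frame : IsLocalFrame m H σ ι O e

local notation "𝒩" => normalGerms (m := m) (l := l) H ι

-- shortcuts for instance search
instance (p : Y) : Module (holGerms m p) (𝒩 p) :=
  Submodule.module _

instance (p : Y) : SMul (holGerms m p) (𝒩 p) :=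
  Submodule.smul _

variable {O : Set Y} {e : Fin l → Y → (Fin (m + l) → ℂ)} (he : FrameData m H σ ι O e)
  {p : Y} (hp : p ∈ O)

lemma coe_sum_germ {κ E : Type*} [AddCommMonoid E] (f : κ → Y → E) (s : Finset κ) :
    ((fun q => ∑ j ∈ s, f j q : Y → E) : Germ (𝓝 p) E) = ∑ j ∈ s, (f j : Germ (𝓝 p) E) := by
  rw [← Finset.sum_fn]
  exact map_sum (Germ.coeAddHom (𝓝 p)) f s

namespace FrameData

/-- The germ of a frame section. -/
def germ (j : Fin l) : 𝒩 p := ⟨(e j : Germ (𝓝 p) _), (he.frame p hp).1 j⟩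

lemma sum_coe (n : Fin l → Y → ℂ) (hn : ∀ j, (n j : Germ (𝓝 p) ℂ) ∈ holGerms m p) :
    (∑ j, (⟨_, hn j⟩ : holGerms m p) • he.germ hp j : 𝒩 p).1 =
      ((fun q => ∑ j, n j q • e j q : Y → (Fin (m + l) → ℂ)) : Germ (𝓝 p) _) := by
  rw [AddSubmonoidClass.coe_finsetSum, coe_sum_germ]
  rfl

lemma linearIndependent : LinearIndependent (holGerms m p) (he.germ hp) := by
  rw [Fintype.linearIndependent_iff]
  intro g hg
  have hrep : ∀ j, ∃ n : Y → ℂ, ((n : Germ (𝓝 p) ℂ)) = (g j).1 := fun j => by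
    obtain ⟨f, hf, -⟩ := (g j).2
    exact ⟨f, hf⟩
  choose n hn using hrep
  have hmem : ∀ j, (n j : Germ (𝓝 p) ℂ) ∈ holGerms m p := fun j => by rw [hn j]; exact (g j).2
  have hgj : ∀ j, g j = ⟨_, hmem j⟩ := fun j => Subtype.ext (hn j).symm
  have h1 := congrArg Subtype.val hg
  rw [sum_congr rfl fun j _ => by rw [hgj j], he.sum_coe hp n hmem] at h1
  have h2 : ∀ᶠ q in 𝓝 p, ∑ j, n j q • e j q = 0 := Germ.coe_eq.1 h1
  intro i
  rw [hgj i]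
  apply Subtype.ext
  apply Germ.coe_eq.2
  filter_upwards [h2, he.isOpen.mem_nhds hp] with q hq hqO
  exact Fintype.linearIndependent_iff.1 (he.frame q hqO).2.1 _ hq i

lemma exists_eq_sum {a : Y → (Fin (m + l) → ℂ)} (ha : (a : Germ (𝓝 p) _) ∈ 𝒩 p) :
    ∃ (n : Fin l → Y → ℂ) (hn : ∀ j, (n j : Germ (𝓝 p) ℂ) ∈ holGerms m p),
      (∀ᶠ q in 𝓝 p, a q = ∑ j, n j q • e j q) ∧
      (⟨_, ha⟩ : 𝒩 p) = ∑ j, (⟨_, hn j⟩ : holGerms m p) • he.germ hp j := by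
  obtain ⟨n, hn, h⟩ := he.frame.exists_coords he.dim he.cont he.isOpen hp ha
  refine ⟨n, hn, h, Subtype.ext ?_⟩
  rw [he.sum_coe hp n hn]
  exact Germ.coe_eq.2 h

/-- The basis of the module of germs of sections given by a local frame. -/
def basis : Module.Basis (Fin l) (holGerms m p) (𝒩 p) :=
  Module.Basis.mk (he.linearIndependent hp) (by
    rintro ⟨_, a, rfl, ha⟩ -
    obtain ⟨n, hn, -, h⟩ := he.exists_eq_sum hp ⟨a, rfl, ha⟩
    rw [h]
    exact Submodule.sum_mem _ fun j _ => smul_mem _ _ (subset_span ⟨j, rfl⟩))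

lemma basis_apply (j : Fin l) : he.basis hp j = he.germ hp j := Module.Basis.mk_apply _ _ j

lemma repr_eq {x : 𝒩 p} {g : Fin l → holGerms m p}
    (h : x = ∑ j, g j • he.germ hp j) (j : Fin l) : (he.basis hp).repr x j = g j := by
  rw [h]
  simp only [← basis_apply]
  exact congrFun ((he.basis hp).repr_sum_self g) j

/-- The group acts on the coordinates with respect to the frame through `σ`. -/
lemma repr_translate (h : H) {x x' : 𝒩 p} (hx : IsTranslate H ι h x.1 x'.1) (i : Fin l) :
    (he.basis hp).repr x' i = ∑ j, constGerm m p (repMat σ h i j) * (he.basis hp).repr x j := by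
  obtain ⟨a, a', ha, ha', haa⟩ := hx
  have hma : (a : Germ (𝓝 p) _) ∈ 𝒩 p := by rw [ha]; exact x.2
  have hxa : x = ⟨_, hma⟩ := Subtype.ext ha.symm
  obtain ⟨n, hn, hna, hsum⟩ := he.exists_eq_sum hp hma
  have hs : ∀ i, ((fun q => ∑ j, repMat σ h i j * n j q : Y → ℂ) : Germ (𝓝 p) ℂ) =
      (∑ j, constGerm m p (repMat σ h i j) * ⟨_, hn j⟩ : holGerms m p).1 := fun i => by
    rw [AddSubmonoidClass.coe_finsetSum, coe_sum_germ]
    rfl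
  have hn' := fun i => (hs i).symm ▸ Subtype.prop _
  have hx' : x' = ∑ i, (⟨_, hn' i⟩ : holGerms m p) • he.germ hp i := by
    apply Subtype.ext
    rw [he.sum_coe hp _ hn', ← ha']
    apply Germ.coe_eq.2
    filter_upwards [haa, hna, he.isOpen.mem_nhds hp] with q h1 h2 hq
    rw [h1, h2, map_sum]
    simp only [map_smul, (he.frame q hq).2.2, smul_sum, sum_smul, smul_smul]
    rw [sum_comm]
    exact sum_congr rfl fun i _ => sum_congr rfl fun j _ => by rw [mul_comm]
  rw [he.repr_eq hp hx', sum_congr rfl fun j _ => by rw [he.repr_eq hp (hxa.trans hsum) j]]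
  exact Subtype.ext (hs i)

/-- A translate of a frame section. -/
lemma isTranslate_germ (h : H) (j : Fin l) : IsTranslate H ι h (he.germ hp j).1
      (∑ i, constGerm m p (repMat σ h i j) • he.germ hp i : 𝒩 p).1 := by
  refine ⟨e j, fun q => ∑ i, repMat σ h i j • e i q, rfl, ?_, ?_⟩
  · exact (he.sum_coe hp (fun i _ => repMat σ h i j) fun i => (constGerm m p _).2).symm
  · filter_upwards [he.isOpen.mem_nhds hp] with q hq
    exact ((he.frame q hq).2.2 h j).symm

end FrameData

variable (φ : NormalCoord m H σ ι) (hφ : φ.base ∈ O)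

/-- The matrix `B⁻¹ (e_j ∘ φ₀)` of a frame of the normal bundle. -/
def FrameData.mat (φ : NormalCoord m H σ ι) (hφ : φ.base ∈ O) :
    𝕄 := Matrix.of fun i j => φ.frame (he.germ hφ j) i

lemma FrameData.frame_eq (n : 𝒩 φ.base) :
    φ.frame n = (he.mat φ hφ).mulVec fun j => φ.hom ((he.basis hφ).repr n j) := by
  conv_lhs => rw [← (he.basis hφ).sum_repr n]
  rw [map_sum]
  funext i
  rw [Finset.sum_apply]
  refine sum_congr rfl fun j _ => ?_
  rw [map_smulₛₗ, he.basis_apply, Pi.smul_apply, smul_eq_mul, mul_comm]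
  rfl

lemma FrameData.span_col :
    Submodule.span (FPS m) (Set.range fun j => φ.frame (he.germ hφ j)) = ⊤ := by
  rw [eq_top_iff, ← φ.frame_span, Submodule.span_le]
  rintro _ ⟨n, rfl⟩
  rw [← (he.basis hφ).sum_repr n, map_sum]
  refine Submodule.sum_mem _ fun j _ => ?_
  rw [map_smulₛₗ, he.basis_apply]
  exact smul_mem _ _ (subset_span ⟨j, rfl⟩)

lemma FrameData.isUnit_mat : IsUnit (he.mat φ hφ) := by
  rw [← Matrix.mulVec_surjective_iff_isUnit]
  intro v
  have hv : v ∈ Submodule.span (FPS m) (Set.range fun j => φ.frame (he.germ hφ j)) := by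
    rw [he.span_col φ hφ]; trivial
  obtain ⟨x, hx⟩ := (Submodule.mem_span_range_iff_exists_fun _).1 hv
  refine ⟨x, ?_⟩
  rw [← hx]
  funext i
  change ∑ j, he.mat φ hφ i j * x j = _
  rw [Finset.sum_apply]
  refine sum_congr rfl fun j _ => ?_
  rw [Pi.smul_apply, smul_eq_mul, mul_comm]
  rfl

lemma FrameData.commutesWith_mat : CommutesWith σ (he.mat φ hφ) := by
  intro h
  ext1 k j
  have h1 := φ.frame_equivariant h _ _ (he.isTranslate_germ hφ h j)
  have h2 := congrFun h1 k
  rw [map_sum, Finset.sum_apply] at h2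
  refine Eq.trans ?_ h2
  rw [mul_apply]
  refine sum_congr rfl fun i _ => ?_
  rw [map_smulₛₗ, φ.hom_const, Pi.smul_apply, smul_eq_mul, mul_comm]
  rfl

/-- The semilinear map with prescribed values on a local frame. -/
def FrameData.semilin {q : Y} (hq : q ∈ O) (ψ : holGerms m q →+* FPS m) (P : 𝕄) :
    𝒩 q →ₛₗ[ψ] (Fin l → FPS m) where
  toFun n := P.mulVec fun j => ψ ((he.basis hq).repr n j)
  map_add' n n' := by
    rw [← Matrix.mulVec_add]
    congr 1
    funext j
    rw [map_add, Finsupp.add_apply, map_add]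
    rfl
  map_smul' f n := by
    rw [← Matrix.mulVec_smul]
    congr 1
    funext j
    rw [map_smul, Finsupp.smul_apply, smul_eq_mul, map_mul]
    rfl

lemma FrameData.semilin_apply {q : Y} (hq : q ∈ O) (ψ : holGerms m q →+* FPS m) (P : 𝕄) (n : 𝒩 q) :
    he.semilin hq ψ P n = P.mulVec fun j => ψ ((he.basis hq).repr n j) := rfl

lemma FrameData.semilin_germ {q : Y} (hq : q ∈ O) (ψ : holGerms m q →+* FPS m) (P : 𝕄) (j : Fin l) :
    he.semilin hq ψ P (he.germ hq j) = P.col j := by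
  classical
  rw [he.semilin_apply, ← he.basis_apply]
  have h1 : (fun k => ψ ((he.basis hq).repr (he.basis hq j) k)) = Pi.single j 1 := by
    funext k
    rw [Module.Basis.repr_self, Finsupp.single_apply, Pi.single_apply]
    simp only [eq_comm (a := j)]
    split_ifs
    · exact map_one _
    · exact map_zero _
  rw [h1, Matrix.mulVec_single_one]

lemma FrameData.semilin_equivariant {q : Y} (hq : q ∈ O)
    {ψ : holGerms m q →+* FPS m} (hψ : ∀ a, ψ (constGerm m q a) = C a)
    {P : 𝕄} (hP : CommutesWith σ P) (h : H)
    (n n' : 𝒩 q)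
    (hn : IsTranslate H ι h n.1 n'.1) :
    he.semilin hq ψ P n' = ((repMat σ h).map (C (σ := Fin m))).mulVec (he.semilin hq ψ P n) := by
  rw [he.semilin_apply, he.semilin_apply, mulVec_mulVec, ← hP h, ← mulVec_mulVec]
  congr 1
  funext i
  rw [he.repr_translate hq h hn, map_sum]
  refine sum_congr rfl fun j _ => ?_
  rw [map_mul, hψ]
  rfl

/-- The point of `Coor(𝒩)` at a nearby point obtained by translation in the preferred chart and
in a local frame. -/
def NormalCoord.transport {q : Y}
    (hq : q ∈ (chart φ.base).source) (hqO : q ∈ O) : NormalCoord m H σ ι where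
  toFormalCoord := φ.toFormalCoord.transport hq
  frame := he.semilin hqO (φ.toFormalCoord.transport hq).hom (he.mat φ hφ)
  frame_span := by
    rw [eq_top_iff, ← he.span_col φ hφ, Submodule.span_le]
    rintro _ ⟨j, rfl⟩
    exact subset_span ⟨he.germ hqO j, he.semilin_germ hqO _ _ j⟩
  frame_equivariant := fun h n n' hn => he.semilin_equivariant hqO
    (φ.toFormalCoord.transport hq).hom_const (he.commutesWith_mat φ hφ) h n n' hn

lemma NormalCoord.pullSection_of_mem {a : Y → (Fin (m + l) → ℂ)}
    (h : (a : Germ (𝓝 φ.base) _) ∈ 𝒩 φ.base) :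
    φ.pullSection a = φ.frame ⟨_, h⟩ := by
  rw [NormalCoord.pullSection]
  exact dif_pos h

lemma NormalCoord.pullSection_act (g : FPS m ≃ₐ[ℂ] FPS m) (b : ZGroup m σ)
    (a : Y → (Fin (m + l) → ℂ)) : (φ.act g b).pullSection a =
      ((b⁻¹ : ZGroup m σ) : GL (Fin l) (FPS m)).1.mulVec fun i => g (φ.pullSection a i) := by
  by_cases h : (a : Germ (𝓝 φ.base) _) ∈ 𝒩 φ.base
  · rw [φ.pullSection_of_mem h, (φ.act g b).pullSection_of_mem h]
    rfl
  · have h1 : (φ.act g b).pullSection a = 0 := by rw [NormalCoord.pullSection]; exact dif_neg h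
    have h2 : φ.pullSection a = 0 := by rw [NormalCoord.pullSection]; exact dif_neg h
    rw [h1, h2]
    funext i
    simp [Matrix.mulVec, dotProduct]

/-- The column of a section with given coordinates in a frame. -/
lemma NormalCoord.pullSection_eq_sum {a : Y → (Fin (m + l) → ℂ)}
    (ha : (a : Germ (𝓝 φ.base) _) ∈ 𝒩 φ.base)
    {n : Fin l → Y → ℂ} (hn : ∀ j, (n j : Germ (𝓝 φ.base) ℂ) ∈ holGerms m φ.base)
    (h : ∀ᶠ q in 𝓝 φ.base, a q = ∑ j, n j q • e j q) :
    φ.pullSection a = (he.mat φ hφ).mulVec fun j => φ.pull (n j) := by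
  rw [φ.pullSection_of_mem ha, he.frame_eq φ hφ]
  congr 1
  funext j
  rw [φ.pull_of_mem (hn j)]
  congr 1
  apply he.repr_eq hφ (g := fun j => ⟨_, hn j⟩)
  apply Subtype.ext
  rw [he.sum_coe hφ n hn]
  exact Germ.coe_eq.2 h

/-- The matrices `(1 - t b')⁻¹`, for small `t`. -/
def matFamily {b' : 𝕄} (hb : CommutesWith σ b') (t : ℂ) : ZGroup m σ := by
  classical
  exact if h : IsUnit (1 - t • b').det then
    (⟨Matrix.nonsingInvUnit _ h, fun k => by
      change (1 - t • b') * _ = _ * (1 - t • b')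
      rw [sub_mul, mul_sub, one_mul, mul_one, Matrix.smul_mul, Matrix.mul_smul, hb k]⟩ :
        ZGroup m σ)⁻¹ else 1

lemma eventually_matFamily {b' : 𝕄} (hb : CommutesWith σ b') : ∀ᶠ t in 𝓝 (0 : ℂ),
      (((matFamily hb t)⁻¹ : ZGroup m σ) : GL (Fin l) (FPS m)).1 = 1 - t • b' := by
  have h1 : Continuous fun t : ℂ => (1 - t • b'.map (constantCoeff (R := ℂ))).det := by
    apply Continuous.matrix_det
    fun_prop
  have h2 := h1.continuousAt.eventually_ne (x := (0 : ℂ)) (y := (0 : ℂ)) (by simp)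
  filter_upwards [h2] with t ht
  have h3 : IsUnit (1 - t • b').det := by
    rw [isUnit_det_iff_constantCoeff]
    have : (1 - t • b').map (constantCoeff (R := ℂ)) =
        1 - t • b'.map (constantCoeff (R := ℂ)) := by
      ext i j
      simp [one_apply, apply_ite, smul_eq_C_mul]
    rw [this]
    exact isUnit_iff_ne_zero.2 ht
  rw [matFamily, dif_pos h3, inv_inv]
  rfl

/-- The path in `Coor(𝒩)` combining a translation in the chart and the frame with a path of
formal automorphisms. -/
def NormalCoord.path (a : Fin m → ℂ) (w : Fin m → FPS m) (hw : ∀ i, constantCoeff (w i) = 0)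
    {b' : 𝕄} (hb : CommutesWith σ b') (t : ℂ) :
    NormalCoord m H σ ι := by
  classical
  exact if h : movePoint φ.base a t ∈ O then
    (φ.transport he hφ (movePoint_mem φ.base a t) h).act (autFamily w hw t) (matFamily hb t)
  else φ

section Path

variable {φ} {a : Fin m → ℂ}
    {w : Fin m → FPS m} (hw : ∀ i, constantCoeff (w i) = 0)
    {b' : Matrix (Fin l) (Fin l) (FPS m)} (hb : CommutesWith σ b')

lemma NormalCoord.path_eq {t : ℂ} (h : movePoint φ.base a t ∈ O) : φ.path he hφ a w hw hb t =
      (φ.transport he hφ (movePoint_mem φ.base a t) h).act (autFamily w hw t) (matFamily hb t) := by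
  rw [NormalCoord.path, dif_pos h]

lemma NormalCoord.eventually_movePoint_mem (he : FrameData m H σ ι O e) (hφ : φ.base ∈ O) : ∀ᶠ t in 𝓝 (0 : ℂ), movePoint φ.base a t ∈ O :=
  (tendsto_movePoint φ.base a).eventually (he.isOpen.mem_nhds hφ)

lemma NormalCoord.eventually_toFormalCoord_path :
    ∀ᶠ t in 𝓝 (0 : ℂ), (φ.path he hφ a w hw hb t).toFormalCoord =
      φ.toFormalCoord.path a w hw t := by
  filter_upwards [NormalCoord.eventually_movePoint_mem he hφ] with t ht
  rw [NormalCoord.path_eq he hφ hw hb ht]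
  rfl

lemma NormalCoord.mat_transport {q : Y} (hq : q ∈ (chart φ.base).source)
    (hqO : q ∈ O) : he.mat (φ.transport he hφ hq hqO) hqO = he.mat φ hφ := by
  ext1 i j
  exact congrFun (he.semilin_germ hqO _ _ j) i

lemma NormalCoord.eventually_pullSection_path {s : Y → (Fin (m + l) → ℂ)}
    (hs : ∀ᶠ q in 𝓝 φ.base, (s : Germ (𝓝 q) _) ∈ 𝒩 q)
    {n : Fin l → Y → ℂ} (hn : ∀ j, (n j : Germ (𝓝 φ.base) ℂ) ∈ holGerms m φ.base)
    (h : ∀ᶠ q in 𝓝 φ.base, s q = ∑ j, n j q • e j q) :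
    ∀ᶠ t in 𝓝 (0 : ℂ), (φ.path he hφ a w hw hb t).pullSection s =
      (1 - t • b').mulVec fun i => autFamily w hw t (∑ j, he.mat φ hφ i j *
        (φ.toFormalCoord.transport (movePoint_mem φ.base a t)).pull (n j)) := by
  have h1 : ∀ᶠ q in 𝓝 φ.base, ∀ j, (n j : Germ (𝓝 q) ℂ) ∈ holGerms m q :=
    Filter.eventually_all.2 fun j =>
      (eventually_eventually_nhds.2 (coe_mem_holGerms_iff.1 (hn j))).mono
        fun q hq => coe_mem_holGerms_iff.2 hq
  filter_upwards [NormalCoord.eventually_movePoint_mem he hφ, eventually_matFamily hb,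
    (tendsto_movePoint φ.base a).eventually h1, (tendsto_movePoint φ.base a).eventually hs,
    (tendsto_movePoint φ.base a).eventually (eventually_eventually_nhds.2 h)]
    with t ht hmat h1 h2 h3
  rw [NormalCoord.path_eq he hφ hw hb ht, NormalCoord.pullSection_act, hmat,
    (φ.transport he hφ (movePoint_mem φ.base a t) ht).pullSection_eq_sum he ht h2 h1 h3,
    NormalCoord.mat_transport]
  rfl

/-- The velocity of the path is the prescribed tangent vector, in terms of any holomorphic section
of the normal bundle. -/
lemma NormalCoord.hasCoeffDeriv_pullSection_path {v : Fin m → FPS m}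
    (hsplit : ∀ u, φ.taylor (dirD a u) - ∑ i, w i * pderiv ℂ i (φ.taylor u) =
        -vecField v (φ.taylor u)) {A : 𝕄}
    (hbP : b' * he.mat φ hφ =
      A * he.mat φ hφ + ((he.mat φ hφ).map (vecField v) - (he.mat φ hφ).map (vecField w)))
    {s : Y → (Fin (m + l) → ℂ)}
    (hs : ∀ᶠ q in 𝓝 φ.base, (s : Germ (𝓝 q) _) ∈ 𝒩 q)
    (i : Fin l) :
    HasCoeffDeriv (fun t => (φ.path he hφ a w hw hb t).pullSection s i)
        (-(vecField v (φ.pullSection s i) + A.mulVec (φ.pullSection s) i)) 0 ∧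
      (φ.path he hφ a w hw hb 0).pullSection s = φ.pullSection s := by
  obtain ⟨n, hn, h, -⟩ := he.exists_eq_sum hφ hs.self_of_nhds
  have hev := NormalCoord.eventually_pullSection_path he hφ (a := a) hw hb hs hn h
  set P := he.mat φ hφ with hP
  have hp : φ.pullSection s = P.mulVec fun j => φ.pull (n j) :=
    φ.pullSection_eq_sum he hφ hs.self_of_nhds hn h
  have h0 : ∀ j, (φ.toFormalCoord.transport (movePoint_mem φ.base a 0)).pull (n j) =
      φ.pull (n j) := fun j => φ.toFormalCoord.pull_transport_zero a (hn j)
  constructor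
  · choose N' hN' hN'v using show ∀ j, ∃ N' : FPS m, HasCoeffDeriv (fun t =>
        (φ.toFormalCoord.transport (movePoint_mem φ.base a t)).pull (n j)) N' 0 ∧
        N' = vecField w (φ.pull (n j)) - vecField v (φ.pull (n j)) from fun j => by
      refine ⟨_, φ.toFormalCoord.hasCoeffDeriv_pull_transport a (hn j), ?_⟩
      have h1 := hsplit ⟨n j ∘ (chart φ.base).symm,
        (coe_mem_holGerms_iff_holoAt (mem_chart_source _ φ.base)).1 (hn j)⟩
      rw [← φ.toFormalCoord.pull_eq_taylor (hn j), ← vecField_apply, sub_eq_iff_eq_add] at h1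
      rw [h1]
      ring
    have h1 : ∀ k, HasCoeffDeriv (fun t => ∑ j, P k j *
        (φ.toFormalCoord.transport (movePoint_mem φ.base a t)).pull (n j))
        (∑ j, P k j * N' j) 0 := fun k => HasCoeffDeriv.sum fun j _ => by
      simpa using (HasCoeffDeriv.const (P k j) 0).mul (hN' j)
    have h2 := fun k => HasCoeffDeriv.autFamily hw (h1 k)
    have h3 : ∀ k, HasCoeffDeriv (fun t : ℂ => (1 - t • b') i k) (-b' i k) 0 := fun k => by
      have := HasCoeffDeriv.linear ((1 : 𝕄) i k) (-b' i k) 0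
      simpa [sub_eq_add_neg] using this
    have h4 := HasCoeffDeriv.sum (s := Finset.univ) fun k _ => (h3 k).mul (h2 k)
    refine HasCoeffDeriv.congr (q' := _) ?_ (hev.mono fun t ht => congrFun ht i)
    change HasCoeffDeriv (fun t => ∑ k, (1 - t • b') i k * autFamily w hw t (∑ j, P k j *
        (φ.toFormalCoord.transport (movePoint_mem φ.base a t)).pull (n j))) _ 0
    convert h4 using 1
    simp only [autFamily_zero, h0, zero_smul, sub_zero]
    have h5 : ∀ k, ∑ j, P k j * φ.pull (n j) = φ.pullSection s k := fun k => by rw [hp]; rfl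
    simp only [h5, sum_add_distrib, ← vecField_apply]
    have h6 : ∀ x : Fin l → FPS m, ∑ k, (1 : 𝕄) i k * x k = x i :=
      fun x => congrFun (one_mulVec x) i
    rw [h6]
    have h7 : ∑ k, -b' i k * φ.pullSection s k = -(b'.mulVec (φ.pullSection s) i) := by
      rw [Matrix.mulVec, dotProduct, ← sum_neg_distrib]
      exact sum_congr rfl fun k _ => by ring
    rw [h7]
    have h8 : b'.mulVec (φ.pullSection s) i = A.mulVec (φ.pullSection s) i +
        ∑ j, (vecField v (P i j) - vecField w (P i j)) * φ.pull (n j) := by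
      rw [hp, mulVec_mulVec, hbP, Matrix.add_mulVec, Pi.add_apply, ← mulVec_mulVec]
      rfl
    rw [h8]
    have h9 : ∀ v : Fin m → FPS m, vecField v (φ.pullSection s i) =
        ∑ j, (P i j * vecField v (φ.pull (n j)) + vecField v (P i j) * φ.pull (n j)) := by
      intro v
      rw [hp]
      simp only [Matrix.mulVec, dotProduct, map_sum, vecField_mul]
    rw [h9, h9]
    simp only [hN'v, sub_mul, mul_sub, sum_add_distrib, sum_sub_distrib]
    ring
  · rw [hev.self_of_nhds, hp]
    simp only [autFamily_zero, h0, zero_smul, sub_zero, one_mulVec]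
    rfl

end Path

/-- The derivative of a function along a tangent vector does not depend on the chart domain, the
frame and the finitely many coordinates in which it is computed. -/
lemma NormalCoord.HasLieDeriv.unique
    (hdim : ∀ y, Module.finrank ℂ (normalSpace m l H (ι y)) ≤ l) (hc : Continuous ι)
    {f : NormalCoord m H σ ι → ℂ} {φ : NormalCoord m H σ ι}
    {v : Fin m → FPS m} {A : 𝕄} (hA : CommutesWith σ A) {d d' : ℂ}
    (h : NormalCoord.HasLieDeriv f φ v A d) (h' : NormalCoord.HasLieDeriv f φ v A d') :
    d = d' := by
  obtain ⟨O, e, hO, hOs, hfr, hd⟩ := id h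
  have he : FrameData m H σ ι O e := ⟨hdim, hc, hO, hfr⟩
  have hφ : φ.base ∈ O := by
    obtain ⟨S, V, g, ⟨hp, -⟩, -⟩ := hd
    exact hp
  obtain ⟨a, w, hw, haw⟩ := φ.toFormalCoord.exists_splitting v
  set P := he.mat φ hφ with hP
  have hPc : CommutesWith σ P := he.commutesWith_mat φ hφ
  let Pz : ZGroup m σ := ⟨(he.isUnit_mat φ hφ).unit, hPc⟩
  -- the translated frame has columns `P`, and `b'` is such that `v(P) + A P = w(P) + b' P`
  set b' := A + (P.map (vecField v) - P.map (vecField w)) *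
    ((Pz⁻¹ : ZGroup m σ) : GL (Fin l) (FPS m)).1 with hb'
  have hb : CommutesWith σ b' :=
    hA.add (((hPc.map _).sub (hPc.map _)).mul (Pz⁻¹).2)
  have hPP : ((Pz⁻¹ : ZGroup m σ) : GL (Fin l) (FPS m)).1 * P = 1 :=
    (Pz : GL (Fin l) (FPS m)).inv_mul
  have hbP : b' * P = A * P + (P.map (vecField v) - P.map (vecField w)) := by
    rw [hb', add_mul, mul_assoc _ _ P, hPP, mul_one]
  have key : ∀ {d : ℂ}, NormalCoord.HasLieDeriv f φ v A d →
      HasDerivAt (fun t => f (φ.path he hφ a w hw hb t)) d 0 := by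
    rintro d ⟨O', e', hO', hOs', hfr', hd'⟩
    have hφ' : φ.base ∈ O' := by
      obtain ⟨S, V, g, ⟨hp, -⟩, -⟩ := hd'
      exact hp
    have hform := NormalCoord.eventually_toFormalCoord_path he hφ (a := a) hw hb
    have hsec : ∀ j, ∀ᶠ q in 𝓝 φ.base,
        (e' j : Germ (𝓝 q) (Fin (m + l) → ℂ)) ∈ 𝒩 q := fun j => by
      filter_upwards [hO'.mem_nhds hφ'] with q hq using (hfr' q hq).1 j
    refine hd'.hasDerivAt ?_ ?_ ?_
    · filter_upwards [hform, (tendsto_movePoint φ.base a).eventually (hO'.mem_nhds hφ')]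
        with t ht ht2
      change (φ.path he hφ a w hw hb t).toFormalCoord.base ∈ O'
      rw [ht]
      exact ht2
    · rintro (i | i)
      · have h1 := φ.toFormalCoord.hasCoeffDeriv_pull_path v a w hw haw
          (chart_mem_holGerms φ.base i.1) i.2
        refine h1.congr_of_eventuallyEq (hform.mono fun t ht => ?_)
        change FormalCoord.jetCoord φ.base (φ.path he hφ a w hw hb t).toFormalCoord i = _
        rw [ht]
        rfl
      · exact (NormalCoord.hasCoeffDeriv_pullSection_path he hφ hw hb haw hbP
          (hsec i.1.2) i.1.1).1 i.2
    · rintro (i | i)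
      · change FormalCoord.jetCoord φ.base (φ.path he hφ a w hw hb 0).toFormalCoord i = _
        rw [hform.self_of_nhds, FormalCoord.jetCoord, φ.toFormalCoord.pull_path_zero a w hw
          (chart_mem_holGerms φ.base i.1)]
        rfl
      · change coeff i.2
          ((φ.path he hφ a w hw hb 0).pullSection (e' i.1.2) i.1.1) = _
        rw [(NormalCoord.hasCoeffDeriv_pullSection_path he hφ hw hb haw hbP (hsec i.1.2) i.1.1).2]
        rfl
  exact (key h).unique (key h')

end NormalPaths

/-! ### Families depending on a parameter: linear maps and matrices -/

section CoeffDiff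
variable {σ : Type*} [Finite σ]

/-- A linear map that lowers the order by a bounded amount acts on differentiable families. -/
lemma HasCoeffDeriv.map {τ : Type*} {q : ℂ → MvPowerSeries σ ℂ} {q' : MvPowerSeries σ ℂ} {t : ℂ}
    (T : MvPowerSeries σ ℂ →ₗ[ℂ] MvPowerSeries τ ℂ) (k : ℕ)
    (hT : ∀ (N : ℕ) f, ((N + k : ℕ) : ℕ∞) ≤ f.order → (N : ℕ∞) ≤ (T f).order)
    (h : HasCoeffDeriv q q' t) : HasCoeffDeriv (fun s => T (q s)) (T q') t := by
  classical
  intro d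
  set N := d.degree + 1 + k
  set S : Finset (σ →₀ ℕ) := (Finsupp.finite_of_degree_lt N).toFinset with hS
  have key : ∀ f : MvPowerSeries σ ℂ, coeff d (T f) =
      ∑ e ∈ S, coeff e f * coeff d (T (monomial e 1)) := by
    intro f
    have h1 : ((d.degree + 1 : ℕ) : ℕ∞) ≤ (T (f - ∑ e ∈ S, coeff e f • monomial e 1)).order := by
      refine hT _ _ (le_order_iff_coeff.2 fun e he => ?_)
      have : e ∈ S := by simpa [hS] using he
      simp [coeff_monomial, this]
    have h2 := le_order_iff_coeff.1 h1 d (Nat.lt_succ_self _)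
    rw [map_sub, map_sub, sub_eq_zero] at h2
    simpa using h2
  have e : (fun s => coeff d (T (q s))) = fun s => _ := funext fun s => key (q s)
  rw [e, key q']
  exact HasDerivAt.fun_sum fun e _ => (h e).mul_const _

/-- The coefficients of the family `q` of power series are differentiable at `t`. -/
def CoeffDiff (q : ℂ → MvPowerSeries σ ℂ) (t : ℂ) : Prop := ∃ q', HasCoeffDeriv q q' t

namespace CoeffDiff
variable {ι : Type*} {t : ℂ} {q r : ℂ → MvPowerSeries σ ℂ}

lemma of_coeff (h : ∀ d, DifferentiableAt ℂ (fun s => coeff d (q s)) t) : CoeffDiff q t :=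
  ⟨fun d => deriv (fun s => coeff d (q s)) t, fun d => (h d).hasDerivAt⟩

lemma coeff (h : CoeffDiff q t) (d : σ →₀ ℕ) :
    DifferentiableAt ℂ (fun s => coeff d (q s)) t :=
  (h.choose_spec d).differentiableAt

lemma mul (hq : CoeffDiff q t) (hr : CoeffDiff r t) : CoeffDiff (fun s => q s * r s) t :=
  ⟨_, hq.choose_spec.mul hr.choose_spec⟩

lemma sum {S : Finset ι} {q : ι → ℂ → MvPowerSeries σ ℂ} (h : ∀ i ∈ S, CoeffDiff (q i) t) :
    CoeffDiff (fun s => ∑ i ∈ S, q i s) t := by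
  choose! q' hq' using h
  exact ⟨_, HasCoeffDeriv.sum hq'⟩

lemma prod {S : Finset ι} {q : ι → ℂ → MvPowerSeries σ ℂ} (h : ∀ i ∈ S, CoeffDiff (q i) t) :
    CoeffDiff (fun s => ∏ i ∈ S, q i s) t := by
  classical
  induction S using Finset.induction_on with
  | empty => exact ⟨0, by simpa using HasCoeffDeriv.const _ t⟩
  | insert i S hi ih =>
    simp only [Finset.prod_insert hi]
    exact (h i (by simp)).mul (ih fun j hj => h j (by simp [hj]))

lemma det [Fintype ι] [DecidableEq ι] {M : ℂ → Matrix ι ι (MvPowerSeries σ ℂ)}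
    (h : ∀ i j, CoeffDiff (fun s => M s i j) t) : CoeffDiff (fun s => (M s).det) t := by
  simp only [Matrix.det_apply']
  exact sum fun e _ => mul ⟨0, HasCoeffDeriv.const _ t⟩ (prod fun i _ => h _ _)

lemma inv (h : CoeffDiff q t) (h0 : constantCoeff (q t) ≠ 0) : CoeffDiff (fun s => (q s)⁻¹) t := by
  classical
  have h1 : DifferentiableAt ℂ (fun s => (constantCoeff (q s))⁻¹) t := by
    have := (h.coeff 0).fun_inv (by simpa using h0)
    simpa using this
  refine of_coeff fun d => ?_
  induction d using WellFoundedLT.induction with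
  | ind d ih =>
    have e : (fun s => MvPowerSeries.coeff d (q s)⁻¹) = fun s => _ :=
      funext fun s => coeff_inv d (q s)
    rw [e]
    split_ifs
    · exact h1
    · refine h1.neg.fun_mul (DifferentiableAt.fun_sum fun p _ => ?_)
      split_ifs with hp
      · exact (h.coeff _).fun_mul (ih _ hp)
      · exact differentiableAt_const _

end CoeffDiff

lemma HasCoeffDeriv.unique {q : ℂ → MvPowerSeries σ ℂ} {q₁ q₂ : MvPowerSeries σ ℂ} {t : ℂ}
    (h₁ : HasCoeffDeriv q q₁ t) (h₂ : HasCoeffDeriv q q₂ t) : q₁ = q₂ :=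
  ext fun d => (h₁ d).unique (h₂ d)

/-- The derivative of the inverse of a family of matrices of power series. -/
lemma HasCoeffDeriv.matrix_inv {ι : Type*} [Fintype ι] [DecidableEq ι] {D : Set ℂ}
    (hD : IsOpen D) {M N : ℂ → Matrix ι ι (MvPowerSeries σ ℂ)}
    {M' : Matrix ι ι (MvPowerSeries σ ℂ)} {t : ℂ} (ht : t ∈ D)
    (hMN : ∀ s ∈ D, M s * N s = 1) (h : ∀ i j, HasCoeffDeriv (fun s => M s i j) (M' i j) t)
    (i j : ι) : HasCoeffDeriv (fun s => N s i j) ((-(N t * M' * N t)) i j) t := by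
  have hev : ∀ᶠ s in 𝓝 t, M s * N s = 1 := Filter.eventually_of_mem (hD.mem_nhds ht) hMN
  have hM : ∀ i j, CoeffDiff (fun s => M s i j) t := fun i j => ⟨_, h i j⟩
  have hN : ∀ i j, CoeffDiff (fun s => N s i j) t := by
    intro i j
    have h1 : CoeffDiff (fun s => ((M s).det)⁻¹ * (M s).adjugate i j) t := by
      refine (CoeffDiff.inv (.det hM) ?_).mul ?_
      · have := congr_arg (fun X => constantCoeff (Matrix.det X)) (hMN t ht)
        simp only [Matrix.det_mul, map_mul, Matrix.det_one, map_one] at this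
        exact left_ne_zero_of_mul_eq_one this
      · simp only [Matrix.adjugate_apply]
        refine CoeffDiff.det fun a e => ?_
        by_cases ha : a = j
        · subst ha; simp only [Matrix.updateRow_self]; exact ⟨0, .const _ t⟩
        · simp only [Matrix.updateRow_ne ha]; exact hM a e
    refine ⟨_, h1.choose_spec.congr ?_⟩
    filter_upwards [hev] with s hs
    have h2 : (M s).det * (N s).det = 1 := by rw [← Matrix.det_mul, hs, Matrix.det_one]
    have h3 : constantCoeff (M s).det ≠ 0 := by
      have := congr_arg constantCoeff h2
      rw [map_mul, map_one] at this
      exact left_ne_zero_of_mul_eq_one this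
    have h4 : (M s).adjugate = (M s).det • N s := by
      rw [← mul_one (M s).adjugate, ← hs, ← mul_assoc, Matrix.adjugate_mul, Matrix.smul_mul,
        one_mul]
    rw [h4, Matrix.smul_apply, smul_eq_mul, ← mul_assoc, MvPowerSeries.inv_mul_cancel _ h3, one_mul]
  choose N' hN' using hN
  have h5 : M' * N t + M t * Matrix.of N' = 0 := by
    ext a e : 1
    have h6 : HasCoeffDeriv (fun s => ∑ k, M s a k * N s k e)
        (∑ k, (M' a k * N t k e + M t a k * N' k e)) t := .sum fun k _ => (h a k).mul (hN' k e)
    have h7 : HasCoeffDeriv (fun s => ∑ k, M s a k * N s k e) 0 t :=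
      (HasCoeffDeriv.const ((1 : Matrix ι ι (MvPowerSeries σ ℂ)) a e) t).congr (by
        filter_upwards [hev] with s hs
        rw [← mul_apply, hs])
    rw [sum_add_distrib] at h6
    exact h6.unique h7
  have hNM : N t * M t = 1 := mul_eq_one_comm.1 (hMN t ht)
  have h8 : Matrix.of N' = -(N t * M' * N t) := by
    rw [mul_assoc, ← mul_neg, ← eq_neg_of_add_eq_zero_right h5, ← mul_assoc, hNM, one_mul]
  rw [← h8]
  exact hN' i j

end CoeffDiff

/-! ### Linear differential equations in the algebra -/

section Family
/-- A class of functions that vanish at `t₀` and are closed under differentiation is zero. -/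
lemma eqOn_zero_of_deriv_mem {D : Set ℂ} (hD : IsOpen D) (hDc : IsPreconnected D) {t₀ : ℂ}
    (h0 : t₀ ∈ D) {K : Set (ℂ → ℂ)} (hK : ∀ g ∈ K, g t₀ = 0 ∧ ∃ g' ∈ K, ∀ t ∈ D, HasDerivAt g (g' t) t)
    {g : ℂ → ℂ} (hg : g ∈ K) : ∀ t ∈ D, g t = 0 := by
  have han : ∀ g ∈ K, AnalyticOnNhd ℂ g D := fun g hg =>
    DifferentiableOn.analyticOnNhd (fun t ht =>
      ((hK g hg).2.choose_spec.2 t ht).differentiableAt.differentiableWithinAt) hD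
  -- the order of vanishing at `t₀` is one more than that of the derivative, which lies in `K`
  have hord : ∀ n : ℕ, ∀ g ∈ K, (n : ℕ∞) ≤ analyticOrderAt g t₀ := by
    intro n
    induction n with
    | zero => intro g _; simp
    | succ n ih =>
      intro g hg
      obtain ⟨hg0, g', hg', hd⟩ := hK g hg
      have h1 := (han g hg t₀ h0).analyticOrderAt_deriv_add_one
      rw [hg0] at h1
      simp only [sub_zero] at h1
      have h2 : analyticOrderAt (deriv g) t₀ = analyticOrderAt g' t₀ := by
        refine analyticOrderAt_congr ?_
        filter_upwards [hD.mem_nhds h0] with t ht using (hd t ht).deriv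
      rw [← h1, h2, Nat.cast_add, Nat.cast_one]
      exact add_le_add_left (ih g' hg') 1
  have h3 : ∀ᶠ t in 𝓝 t₀, g t = 0 :=
    analyticOrderAt_eq_top.1 (ENat.eq_top_iff_forall_ge.2 fun n => hord n g hg)
  exact (han g hg).eqOn_zero_of_preconnected_of_eventuallyEq_zero hDc h0 h3

variable {A : Type*} [Ring A] [Algebra ℂ A]

/-- The families `w(t) ∈ A`, `t ∈ D`, that are finite sums `∑ F(G_i(t)) b_i` with constants `b_i`
and differentiable families `G_i` of functions, together with their derivatives `w'`. -/
inductive Fam (r : HCRep m σ c A) (D : Set ℂ) : (ℂ → A) → (ℂ → A) → Prop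
  | term (G G' : ℂ → FPS2 m l) (b : A) (h : ∀ t ∈ D, HasCoeffDeriv G (G' t) t) :
      Fam r D (fun t => r.F (G t) * b) (fun t => r.F (G' t) * b)
  | add {w w' v v' : ℂ → A} : Fam r D w w' → Fam r D v v' →
      Fam r D (fun t => w t + v t) (fun t => w' t + v' t)
  | congr {w w' v v' : ℂ → A} : Fam r D w w' → (∀ t ∈ D, v t = w t) → (∀ t ∈ D, v' t = w' t) →
      Fam r D v v'

namespace Fam
variable {r : HCRep m σ c A} {D : Set ℂ} {w w' v v' : ℂ → A}

lemma const (b : A) : Fam r D (fun _ => b) fun _ => 0 :=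
  congr (term (fun _ => 1) (fun _ => 0) b fun t _ => .const 1 t) (by simp) (by simp)

lemma sum {ι : Type*} {s : Finset ι} {w w' : ι → ℂ → A} (h : ∀ i ∈ s, Fam r D (w i) (w' i)) :
    Fam r D (fun t => ∑ i ∈ s, w i t) fun t => ∑ i ∈ s, w' i t := by
  classical
  induction s using Finset.induction_on with
  | empty => simpa using const 0
  | insert i s hi ih =>
    simp only [sum_insert hi]
    exact (h i (by simp)).add (ih fun j hj => h j (by simp [hj]))

lemma F_mul {G G' : ℂ → FPS2 m l} (hG : ∀ t ∈ D, HasCoeffDeriv G (G' t) t) (h : Fam r D w w') :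
    Fam r D (fun t => r.F (G t) * w t) fun t => r.F (G' t) * w t + r.F (G t) * w' t := by
  induction h with
  | term E E' b hE =>
    refine congr (term (fun t => G t * E t) (fun t => G' t * E t + G t * E' t) b fun t ht =>
      (hG t ht).mul (hE t ht)) (fun t _ => ?_) fun t _ => ?_
    · rw [map_mul, mul_assoc]
    · rw [map_add, map_mul, map_mul, add_mul, mul_assoc, mul_assoc]
  | add _ _ h₁ h₂ =>
    refine congr (h₁.add h₂) (fun t _ => mul_add _ _ _) fun t _ => ?_
    rw [mul_add, mul_add]; abel
  | congr _ e e' h₁ =>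
    exact congr h₁ (fun t ht => by rw [e t ht]) fun t ht => by rw [e t ht, e' t ht]

lemma const_smul (a : ℂ) (h : Fam r D w w') :
    Fam r D (fun t => a • w t) fun t => a • w' t := by
  have e : ∀ x, r.F (C a) * x = a • x := fun x => by rw [Algebra.smul_def, ← r.F.commutes]; rfl
  simpa [e] using F_mul (G := fun _ => C a) (fun t _ => .const _ t) h

lemma neg (h : Fam r D w w') : Fam r D (fun t => -w t) fun t => -w' t := by
  simpa using h.const_smul (-1)

lemma sub (h : Fam r D w w') (h' : Fam r D v v') :
    Fam r D (fun t => w t - v t) fun t => w' t - v' t := by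
  simpa [sub_eq_add_neg] using h.add h'.neg

/-- Left multiplication by an element that can be moved past functions. -/
lemma const_mul_of_term {a : A}
    (ha : ∀ (G G' : ℂ → FPS2 m l) (b : A), (∀ t ∈ D, HasCoeffDeriv G (G' t) t) →
      Fam r D (fun t => a * (r.F (G t) * b)) fun t => a * (r.F (G' t) * b))
    (h : Fam r D w w') : Fam r D (fun t => a * w t) fun t => a * w' t := by
  induction h with
  | term G G' b hG => exact ha G G' b hG
  | add _ _ h₁ h₂ => simpa only [mul_add] using h₁.add h₂
  | congr _ e e' h₁ =>
    exact congr h₁ (fun t ht => by rw [e t ht]) fun t ht => by rw [e' t ht]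

end Fam

/-- The image of a representation is generated by the generators. -/
def HCRep.Generates (r : HCRep m σ c A) : Prop :=
  ∀ S : Subalgebra ℂ A, (∀ f, r.F f ∈ S) → (∀ i, r.D i ∈ S) → (∀ j, r.U j ∈ S) →
    (∀ h, r.K h ∈ S) → ∀ a, a ∈ S

namespace Fam
variable {r : HCRep m σ c A} {D : Set ℂ} {w w' v v' : ℂ → A}

lemma const_mul (hr : r.Generates) (a : A) : ∀ {w w' : ℂ → A}, Fam r D w w' →
    Fam r D (fun t => a * w t) fun t => a * w' t := by
  let S : Subalgebra ℂ A :=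
    { carrier := {a | ∀ {w w' : ℂ → A}, Fam r D w w' → Fam r D (fun t => a * w t) fun t => a * w' t}
      mul_mem' := fun ha hb _ _ h => by simpa only [mul_assoc] using ha (hb h)
      add_mem' := fun ha hb _ _ h => by simpa only [add_mul] using (ha h).add (hb h)
      algebraMap_mem' := fun z _ _ h => by simpa only [Algebra.smul_def] using h.const_smul z }
  refine fun {w w'} => (show a ∈ S from hr S ?_ ?_ ?_ ?_ a)
  · intro f w w' h
    simpa using F_mul (G := fun _ => f) (fun t _ => .const f t) h
  · refine fun i w w' h => const_mul_of_term (fun G G' b hG => ?_) h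
    refine congr ((term G G' (r.D i * b) hG).add (term _ _ b fun t ht =>
      (hG t ht).pderiv (Sum.inl i))) (fun t _ => ?_) fun t _ => ?_ <;>
    rw [← mul_assoc, r.D_mul_F, add_mul, mul_assoc]
  · refine fun j w w' h => const_mul_of_term (fun G G' b hG => ?_) h
    have e : ∀ f, r.U j * (r.F f * b) = r.F f * (r.U j * b) +
        r.F (pderiv ℂ (Sum.inr j) f) * b - ∑ s ∈ reflections σ,
          (dunklConst σ c s * coroot σ s j) • (r.F (divDiff m σ s f) * (r.K s * b)) := by
      intro f
      rw [← mul_assoc, r.U_mul_F, sub_mul, add_mul, mul_assoc, sum_mul]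
      simp only [smul_mul_assoc, mul_assoc]
    simp only [e]
    exact ((term G G' _ hG).add (term _ _ b fun t ht => (hG t ht).pderiv _)).sub
      (sum fun s _ => (term _ _ _ fun t ht => (hG t ht).map (divDiff m σ s) 1
        fun _ _ hf => le_order_divDiff m σ hf).const_smul _)
  · refine fun h w w' hw => const_mul_of_term (fun G G' b hG => ?_) hw
    refine congr (term _ _ (r.K h * b) fun t ht => (hG t ht).map (grpHom m σ h).toLinearMap 0
      fun _ _ hf => le_order_grpHom m σ h hf) (fun t _ => ?_) fun t _ => ?_ <;>
    · rw [← mul_assoc, r.K_mul_F, mul_assoc]; rfl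

lemma mul (hr : r.Generates) (h : Fam r D w w') (h' : Fam r D v v') :
    Fam r D (fun t => w t * v t) fun t => w' t * v t + w t * v' t := by
  induction h with
  | term G G' b hG => simpa only [mul_assoc] using F_mul hG (const_mul hr b h')
  | add _ _ h₁ h₂ =>
    refine congr (h₁.add h₂) (fun t _ => add_mul _ _ _) fun t _ => ?_
    rw [add_mul, add_mul]; abel
  | congr _ e e' h₁ =>
    exact congr h₁ (fun t ht => by rw [e t ht]) fun t ht => by rw [e t ht, e' t ht]

/-- As the families are holomorphic, the derivative of a family is a family. -/
lemma exists_deriv (hD : IsOpen D) (h : Fam r D w w') : ∃ w'', Fam r D w' w'' := by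
  induction h with
  | term G G' b hG =>
    refine ⟨_, term G' (fun t d => deriv (fun s => coeff d (G' s)) t) b fun t ht d => ?_⟩
    have h1 : DifferentiableOn ℂ (fun s => coeff d (G s)) D := fun s hs =>
      (hG s hs d).differentiableAt.differentiableWithinAt
    have h2 := (h1.deriv hD).differentiableAt (hD.mem_nhds ht)
    refine (h2.congr_of_eventuallyEq ?_).hasDerivAt
    filter_upwards [hD.mem_nhds ht] with s hs using (hG s hs d).deriv.symm
  | add _ _ h₁ h₂ =>
    obtain ⟨_, h₁⟩ := h₁
    obtain ⟨_, h₂⟩ := h₂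
    exact ⟨_, h₁.add h₂⟩
  | congr _ e e' h₁ =>
    obtain ⟨_, h₁⟩ := h₁
    exact ⟨_, congr h₁ e' fun _ _ => rfl⟩

lemma hasCoeffDeriv (hD : IsOpen D) (cf : A →ₗ[ℂ] (Idx m l H →₀ FPS2 m l))
    (hcf : ∀ f a i, cf (r.F f * a) i = f * cf a i) (h : Fam r D w w') (i : Idx m l H) :
    ∀ t ∈ D, HasCoeffDeriv (fun s => cf (w s) i) (cf (w' t) i) t := by
  induction h with
  | term G G' b hG =>
    intro t ht
    simp only [hcf]
    simpa using (hG t ht).mul (.const (cf b i) t)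
  | add _ _ h₁ h₂ =>
    intro t ht
    simp only [map_add, Finsupp.add_apply]
    exact (h₁ t ht).add (h₂ t ht)
  | congr _ e e' h₁ =>
    intro t ht
    rw [e' t ht]
    refine (h₁ t ht).congr ?_
    filter_upwards [hD.mem_nhds ht] with s hs
    rw [e s hs]

/-- Uniqueness for the linear differential equation `z' = -[Φ, z]`. -/
lemma eq_zero_of_ode (hr : r.Generates) (hD : IsOpen D) (hDc : IsPreconnected D) {t₀ : ℂ}
    (h0 : t₀ ∈ D) (cf : A →ₗ[ℂ] (Idx m l H →₀ FPS2 m l)) (hcf : ∀ f a i, cf (r.F f * a) i = f * cf a i)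
    {z Φ Φ' : ℂ → A} (hΦ : Fam r D Φ Φ') (hz : Fam r D z fun t => -⁅Φ t, z t⁆) (hz0 : z t₀ = 0)
    (i : Idx m l H) : ∀ t ∈ D, cf (z t) i = 0 := by
  -- the coefficients of the elements of the two-sided ideal generated by `z`
  let K : Submodule ℂ (ℂ → ℂ) := Submodule.span ℂ {g | ∃ (a a' b b' : ℂ → A) (i : Idx m l H)
    (d : Fin m ⊕ Fin l →₀ ℕ), Fam r D a a' ∧ Fam r D b b' ∧
      g = fun s => coeff d (cf (a s * z s * b s) i)}
  have hmem : ∀ {a a' b b' : ℂ → A} (i d), Fam r D a a' → Fam r D b b' →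
      (fun s => coeff d (cf (a s * z s * b s) i)) ∈ K := fun {a a' b b'} i d ha hb =>
    subset_span ⟨a, a', b, b', i, d, ha, hb, rfl⟩
  have hK : ∀ g ∈ K, g t₀ = 0 ∧ ∃ g' ∈ K, ∀ t ∈ D, HasDerivAt g (g' t) t := by
    intro g hg
    induction hg using span_induction with
    | mem g hg =>
      obtain ⟨a, a', b, b', i, d, ha, hb, rfl⟩ := hg
      obtain ⟨a'', ha'⟩ := ha.exists_deriv hD
      obtain ⟨b'', hb'⟩ := hb.exists_deriv hD
      refine ⟨by simp [hz0], _, add_mem (sub_mem (add_mem (hmem i d ha' hb) (hmem i d ha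
        (hΦ.mul hr hb))) (hmem i d (ha.mul hr hΦ) hb)) (hmem i d ha hb'), fun t ht => ?_⟩
      convert ((ha.mul hr hz).mul hr hb).hasCoeffDeriv hD cf hcf i t ht d using 1
      simp only [Pi.add_apply, Pi.sub_apply, ← map_add, ← map_sub, ← Finsupp.add_apply,
        ← Finsupp.sub_apply]
      congr 4
      rw [Ring.lie_def]
      noncomm_ring
    | zero => exact ⟨rfl, 0, zero_mem _, fun t _ => hasDerivAt_const t 0⟩
    | add g₁ g₂ _ _ h₁ h₂ =>
      obtain ⟨e₁, g₁', h₁, d₁⟩ := h₁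
      obtain ⟨e₂, g₂', h₂, d₂⟩ := h₂
      exact ⟨by simp [e₁, e₂], _, add_mem h₁ h₂, fun t ht => (d₁ t ht).add (d₂ t ht)⟩
    | smul x g _ h₁ =>
      obtain ⟨e₁, g₁', h₁, d₁⟩ := h₁
      exact ⟨by simp [e₁], _, K.smul_mem x h₁, fun t ht => (d₁ t ht).const_smul x⟩
  intro t ht
  ext d
  rw [map_zero]
  refine eqOn_zero_of_deriv_mem hD hDc h0 hK (g := fun s => coeff d (cf (z s) i)) ?_ t ht
  simpa using hmem i d (Fam.const (r := r) (D := D) 1) (Fam.const (r := r) (D := D) 1)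

/-- A family of matrices gives a family in the algebra. -/
lemma phi {B B' : ℂ → 𝕄}
    (hB : ∀ t ∈ D, ∀ i j, HasCoeffDeriv (fun s => B s i j) (B' t i j) t) :
    Fam r D (fun t => r.phi (B t)) fun t => r.phi (B' t) := by
  have hin : ∀ {p : ℂ → FPS m} {p' : FPS m} {t : ℂ}, HasCoeffDeriv p p' t →
      HasCoeffDeriv (fun s => inXHom l (p s)) (inXHom l p') t := fun h =>
    h.map (inXHom l).toLinearMap 0 fun _ _ hf => le_order_inXHom l hf
  refine (sum fun i _ => sum fun j _ => term _ _ _ fun t ht => hin (hB t ht i j)).neg.add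
    (sum fun s _ => (term _ _ _ fun t ht => hin ?_).const_smul _)
  have e : ∀ X : 𝕄, corootScalar σ X s =
      ∑ i, ∑ j, (-((1 - repMat σ s).trace)⁻¹ * (1 - repMat σ s) i j) • X j i := by
    intro X
    simp only [corootScalar, Matrix.trace, Matrix.diag, mul_apply, smul_sum,
      map_apply, mul_smul, smul_eq_C_mul _ ((1 - repMat σ s) _ _)]
  simp only [e]
  refine .sum fun i _ => .sum fun j _ => ?_
  generalize -((1 - repMat σ s).trace)⁻¹ * (1 - repMat σ s) i j = x
  simpa using (hB t ht j i).smul (hasDerivAt_const t x)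

lemma fx_mul {p p' : ℂ → FPS m} (hp : ∀ t ∈ D, HasCoeffDeriv p (p' t) t) (h : Fam r D w w') :
    Fam r D (fun t => r.fx (p t) * w t) fun t => r.fx (p' t) * w t + r.fx (p t) * w' t :=
  F_mul (fun t ht => (hp t ht).map (inXHom l).toLinearMap 0 fun _ _ hf => le_order_inXHom l hf) h

end Fam
end Family

/-! ### The infinitesimal action of a path of formal automorphisms -/

section Motion
variable {A : Type*} [Ring A] [Algebra ℂ A]
  (g : FPS m ≃ₐ[ℂ] FPS m) (b : ZGroup m σ) (δ : Fin m → FPS m)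
  (β : Matrix (Fin l) (Fin l) (FPS m))

/-- The vector field part of `-ρ⁻¹ dρ/dt`, for `dρ/dt = (δ(x), β(x) y)` at `ρ = (g, b)`. -/
def velX (k : Fin m) : FPS m := -∑ a, jacInv g k a * δ a

/-- The linear part of `-ρ⁻¹ dρ/dt`, relative to the horizontal fields of the trivial connection
transported by `ρ`. -/
def velM : 𝕄 := (b.1⁻¹).1 * β

/-- The matrix part of `-ρ⁻¹ dρ/dt`. -/
def velA : 𝕄 := velM b β + ∑ i, velX g δ i • logDer b.1 i

variable {β} in
lemma commutesWith_velM (hβ : CommutesWith σ β) : CommutesWith σ (velM b β) := .mul (b⁻¹).2 hβ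

variable {β} in
lemma commutesWith_velA (hβ : CommutesWith σ β) : CommutesWith σ (velA g b δ β) :=
  (commutesWith_velM b hβ).add (.sum fun i _ => .smul _ (.logDer i))

lemma sum_velX_mul (i : Fin m) : ∑ k, velX g δ k * pderiv ℂ k (g (X i)) = -δ i := by
  simp only [velX, neg_mul, sum_neg_distrib, sum_mul]
  rw [sum_comm]
  have h := fun a => congrFun (congrFun (jac_mul_jacInv g) i) a
  simp only [mul_apply, jac, of_apply] at h
  have e : ∀ a, ∑ k, jacInv g k a * δ a * pderiv ℂ k (g (X i)) =
      (1 : Matrix (Fin m) (Fin m) (FPS m)) i a * δ a := by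
    intro a
    rw [← h a, sum_mul]
    exact sum_congr rfl fun k _ => by ring
  simp [e, one_apply]

/-- The transported coordinate fields commute. -/
lemma sum_jacInv_mul_pderiv_jacInv (a j k : Fin m) : ∑ i, jacInv g i a * pderiv ℂ i (jacInv g k j) =
      ∑ i, jacInv g i j * pderiv ℂ i (jacInv g k a) := by
  rw [sum_jacInv_mul, sum_jacInv_mul]
  simp only [jacInv, of_apply, AlgEquiv.symm_apply_apply]
  rw [pderiv_pderiv_comm]

lemma velX_bracket_jacInv (k j : Fin m) :
    ∑ i, (velX g δ i * pderiv ℂ i (jacInv g k j) - jacInv g i j * pderiv ℂ i (velX g δ k)) =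
      (jacInv g * jac δ * jacInv g) k j := by
  have h1 : ∀ i, velX g δ i * pderiv ℂ i (jacInv g k j) =
      -∑ a, δ a * (jacInv g i a * pderiv ℂ i (jacInv g k j)) := fun i => by
    rw [velX, neg_mul, sum_mul]
    exact congr_arg _ (sum_congr rfl fun a _ => by ring)
  have h2 : ∀ i, jacInv g i j * pderiv ℂ i (velX g δ k) =
      -(∑ a, δ a * (jacInv g i j * pderiv ℂ i (jacInv g k a)) +
        ∑ a, jacInv g k a * pderiv ℂ i (δ a) * jacInv g i j) := fun i => by
    rw [velX, map_neg, map_sum, mul_neg, ← sum_add_distrib, mul_sum]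
    refine congr_arg _ (sum_congr rfl fun a _ => ?_)
    rw [Derivation.leibniz, smul_eq_mul, smul_eq_mul]; ring
  simp only [h1, h2, sum_sub_distrib, sum_neg_distrib, sum_add_distrib]
  rw [sum_comm (f := fun i a => δ a * (jacInv g i a * _)),
    sum_comm (f := fun i a => δ a * (jacInv g i j * _))]
  simp only [← mul_sum, sum_jacInv_mul_pderiv_jacInv g _ j k]
  rw [sub_neg_eq_add, neg_add_cancel_left]
  simp only [mul_apply, jac, of_apply, sum_mul]

namespace HCRep
variable (r : HCRep m σ c A)

/-- The element `Φ_c(v + A)` of the velocity of a path. -/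
def vel : A := ∑ i, r.fx (velX g δ i) * r.nab b i + r.phi (velM b β)

lemma vel_eq : r.vel g b δ β = ∑ i, r.fx (velX g δ i) * r.D i + r.phi (velA g b δ β) := by
  simp only [vel, nab, velA, phi_add, phi_sum, phi_smul, mul_add, sum_add_distrib]
  abel

variable {β} (hβ : CommutesWith σ β)

/-- The derivative of the substitution `f ↦ ρ* f`. -/
def _root_.FormalGeometry.pbDeriv (β : 𝕄) (f : FPS2 m l) : FPS2 m l :=
  ∑ i, pbHom g b.1 (pderiv ℂ i f) * Sum.elim (fun i => inXHom l (δ i))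
    (fun j => ∑ k, inXHom l (β j k) * X (Sum.inr k)) i

include hβ in
lemma vel_lie_F (f : FPS2 m l) :
    ⁅r.vel g b δ β, r.F (pbHom g b.1 f)⁆ = -r.F (pbDeriv g b δ β f) := by
  have h1 : ∀ i, ⁅r.nab b i, r.F (pbHom g b.1 f)⁆ = r.F (∑ j, inXHom l (pderiv ℂ i (g (X j))) *
      pbHom g b.1 (pderiv ℂ (Sum.inl j) f)) := fun i => by
    rw [Ring.lie_def, r.nab_mul_F g b, add_sub_cancel_left, map_sum]
    simp only [map_mul]; rfl
  have h2 : ∀ i, ⁅r.fx (velX g δ i), r.F (pbHom g b.1 f)⁆ = 0 := fun i =>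
    lie_eq_zero_of_comm (r.fx_comm_F _ _).symm
  have h3 : ∀ i j, r.fx (velM b β i j) * (r.Y j * r.F (pderiv ℂ (Sum.inr i) (pbHom g b.1 f))) =
      r.F (inXHom l (velM b β i j) * (X (Sum.inr j) * pderiv ℂ (Sum.inr i) (pbHom g b.1 f))) :=
    fun i j => by rw [map_mul, map_mul]; rfl
  rw [vel, ring_add_lie, ring_sum_lie, r.phi_lie_F (commutesWith_velM b hβ)]
  simp only [mul_lie', h1, h2, zero_mul, add_zero, h3]
  simp only [fx, AlgHom.comp_apply, ← map_mul, ← map_sum, ← map_neg, ← map_add]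
  congr 1
  rw [pbDeriv, Fintype.sum_sum_type, neg_add]
  congr 1
  · simp only [mul_sum, ← mul_assoc, ← map_mul, Sum.elim_inl]
    rw [sum_comm]
    simp only [← sum_mul, ← map_sum, sum_velX_mul, map_neg, neg_mul, sum_neg_distrib]
    simp only [mul_comm]
  · refine congr_arg _ ?_
    have hb : b.1.1 * velM b β = β := by
      rw [velM, ← mul_assoc, show b.1.1 * (b.1⁻¹).1 = 1 from b.1.mul_inv, one_mul]
    have e : ∀ q j, ∑ i, inXHom l (b.1.1 q i) * inXHom l (velM b β i j) = inXHom l (β q j) := by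
      intro q j
      simp only [← map_mul, ← map_sum, ← mul_apply, hb]
    simp only [pderiv_inr_pbHom, Sum.elim_inr, mul_sum, ← e, sum_mul]
    refine (sum_congr rfl fun i _ => sum_comm).trans ?_
    rw [sum_comm]
    refine sum_congr rfl fun q _ => ?_
    rw [sum_comm]
    exact sum_congr rfl fun j _ => sum_congr rfl fun i _ => by ring

include hβ in
lemma vel_lie_twU (j : Fin l) : ⁅r.vel g b δ β, r.twU b j⁆ =
    ∑ k, r.fx ((velM b β * (b.1⁻¹).1) k j) * r.U k := by
  have h1 : ∀ i, ⁅r.nab b i, r.twU b j⁆ = 0 := fun i =>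
    lie_eq_zero_of_comm (r.nab_mul_twU b i j)
  have h2 : ∀ i, ⁅r.fx (velX g δ i), r.twU b j⁆ = 0 := fun i =>
    lie_eq_zero_of_comm (r.twU_comm_fx b j _).symm
  have h3 : ∀ i, ⁅r.phi (velM b β), r.fx i⁆ = 0 := fun i =>
    lie_eq_zero_of_comm (r.phi_comm_fx (commutesWith_velM b hβ) _)
  rw [vel, ring_add_lie, ring_sum_lie]
  simp only [mul_lie', h1, h2, mul_zero, zero_mul, add_zero, sum_const_zero, zero_add]
  rw [twU, ring_lie_sum]
  simp only [lie_mul', h3, zero_mul, zero_add, r.phi_lie_U (commutesWith_velM b hβ),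
    mul_sum, mul_apply, map_sum, map_mul, sum_mul]
  rw [sum_comm]
  refine sum_congr rfl fun q _ => sum_congr rfl fun j _ => ?_
  rw [← mul_assoc, ← map_mul, ← map_mul, mul_comm (velM b β q j)]

/-- The derivative of the flat connection `∂_k + φ_c(b⁻¹ ∂_k b)`. -/
def _root_.FormalGeometry.logDerDeriv (β : 𝕄) (k : Fin m) : 𝕄 :=
  logDer b.1 k * velM b β - velM b β * logDer b.1 k + (velM b β).map fun p => pderiv ℂ k p

include hβ in
lemma vel_lie_twD (hc : IsClassFun σ c) (j : Fin m) : ⁅r.vel g b δ β, r.twD g b j⁆ =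
      ∑ k, (r.fx ((jacInv g * jac δ * jacInv g) k j) * r.nab b k -
        r.fx (jacInv g k j) * r.phi (logDerDeriv b β k)) := by
  have hM := commutesWith_velM b hβ
  have hf : ∀ k p, ⁅r.nab b k, r.fx p⁆ = r.fx (pderiv ℂ k p) := fun k p => by
    rw [Ring.lie_def, r.nab_mul_fx, add_sub_cancel_left]
  have hf' : ∀ k p, ⁅r.fx p, r.nab b k⁆ = -r.fx (pderiv ℂ k p) := fun k p => by
    rw [← hf, Ring.lie_def, Ring.lie_def, neg_sub]
  have hn : ∀ i k, ⁅r.nab b i, r.nab b k⁆ = 0 := fun i k =>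
    lie_eq_zero_of_comm (r.nab_comm b hc i k)
  have hff : ∀ p q, ⁅r.fx p, r.fx q⁆ = 0 := fun p q =>
    lie_eq_zero_of_comm (by rw [← map_mul, ← map_mul, mul_comm])
  have hp : ∀ p, ⁅r.phi (velM b β), r.fx p⁆ = 0 := fun p =>
    lie_eq_zero_of_comm (r.phi_comm_fx hM p)
  have hpn : ∀ k, ⁅r.phi (velM b β), r.nab b k⁆ = -r.phi (logDerDeriv b β k) := fun k => by
    have h := r.D_lie_phi (velM b β) k
    rw [nab, ring_lie_add, r.phi_lie_phi hc hM, Ring.lie_def, h, logDerDeriv, phi_add, phi_sub,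
      phi_sub]
    abel
  rw [vel, twD, ring_add_lie, ring_sum_lie, ring_lie_sum (b := r.phi _)]
  simp only [ring_lie_sum, mul_lie', lie_mul', hf, hf', hn, hff, hp, hpn]
  simp only [mul_zero, zero_mul, add_zero, zero_add, mul_neg, sub_eq_add_neg, sum_add_distrib]
  refine congr_arg (· + _) ?_
  have h1 : ∀ k, r.fx ((jacInv g * jac δ * jacInv g) k j) = ∑ i, (r.fx (velX g δ i) *
      r.fx (pderiv ℂ i (jacInv g k j)) - r.fx (jacInv g i j) * r.fx (pderiv ℂ i (velX g δ k))) :=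
    fun k => by
      rw [← velX_bracket_jacInv, map_sum]
      simp only [map_sub, map_mul]
  simp only [h1, sum_mul, sub_mul, sum_sub_distrib]
  rw [sum_comm, sub_eq_add_neg]
  simp only [neg_mul, mul_neg, sum_neg_distrib, mul_assoc]

end HCRep

variable (m σ) in
/-- A path `ρ_t(x, y) = (ρ_{0,t}(x), b_t(x) y)` of formal automorphisms that is affine linear in
`t`, over an open connected set of parameters. -/
structure AutPath where
  D : Set ℂ
  isOpen : IsOpen D
  isPreconnected : IsPreconnected D
  g : ℂ → FPS m ≃ₐ[ℂ] FPS m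
  b : ℂ → ZGroup m σ
  δ : Fin m → FPS m
  β : 𝕄
  comm : CommutesWith σ β
  deriv_g : ∀ t ∈ D, ∀ i, HasCoeffDeriv (fun s => g s (X i)) (δ i) t
  deriv_b : ∀ t ∈ D, ∀ i j, HasCoeffDeriv (fun s => (b s).1.1 i j) (β i j) t

namespace AutPath
variable (p : AutPath m σ) {t : ℂ}

lemma deriv_jacInv (ht : t ∈ p.D) (k j : Fin m) :
    HasCoeffDeriv (fun s => jacInv (p.g s) k j)
      (-((jacInv (p.g t) * jac p.δ * jacInv (p.g t)) k j)) t :=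
  HasCoeffDeriv.matrix_inv p.isOpen ht (fun s _ => jac_mul_jacInv (p.g s))
    (fun i j => (p.deriv_g t ht i).pderiv j) k j

lemma deriv_b_inv (ht : t ∈ p.D) (i j : Fin l) :
    HasCoeffDeriv (fun s => (((p.b s).1)⁻¹).1 i j)
      (-((velM (p.b t) p.β * ((p.b t).1⁻¹).1) i j)) t :=
  HasCoeffDeriv.matrix_inv p.isOpen ht (fun s _ => (p.b s).1.mul_inv) (p.deriv_b t ht) i j

lemma deriv_logDer (ht : t ∈ p.D) (k : Fin m) (i j : Fin l) :
    HasCoeffDeriv (fun s => logDer (p.b s).1 k i j) (logDerDeriv (p.b t) p.β k i j) t := by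
  have h := HasCoeffDeriv.sum (s := Finset.univ) fun q _ =>
    (p.deriv_b_inv ht i q).mul ((p.deriv_b t ht q j).pderiv k)
  have e : p.β.map (fun f => pderiv ℂ k f) = (p.b t).1.1.map (fun f => pderiv ℂ k f) *
      velM (p.b t) p.β + (p.b t).1.1 * (velM (p.b t) p.β).map fun f => pderiv ℂ k f := by
    rw [← pderiv_mul_map, velM, ← mul_assoc,
      show (p.b t).1.1 * ((p.b t).1⁻¹).1 = 1 from (p.b t).1.mul_inv, one_mul]
  have e' : logDerDeriv (p.b t) p.β k = -(velM (p.b t) p.β * ((p.b t).1⁻¹).1) *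
      (p.b t).1.1.map (fun f => pderiv ℂ k f) +
        ((p.b t).1⁻¹).1 * p.β.map fun f => pderiv ℂ k f := by
    rw [e, mul_add, ← mul_assoc, ← mul_assoc,
      show ((p.b t).1⁻¹).1 * (p.b t).1.1 = 1 from (p.b t).1.inv_mul, one_mul, neg_mul, mul_assoc,
      logDerDeriv, logDer]
    abel
  rw [e', Matrix.add_apply, mul_apply, mul_apply, ← sum_add_distrib]
  exact h

lemma deriv_pbHom (ht : t ∈ p.D) (f : FPS2 m l) :
    HasCoeffDeriv (fun s => pbHom (p.g s) (p.b s).1 f) (pbDeriv (p.g t) (p.b t) p.δ p.β f) t := by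
  have hin : ∀ {q : ℂ → FPS m} {q' : FPS m}, HasCoeffDeriv q q' t →
      HasCoeffDeriv (fun s => inXHom l (q s)) (inXHom l q') t := fun h =>
    h.map (inXHom l).toLinearMap 0 fun _ _ hf => le_order_inXHom l hf
  simp only [pbHom_eq_subst]
  convert HasCoeffDeriv.subst (a := fun i s => pbVar (p.g s) (p.b s).1 i) (t := t)
    (a' := Sum.elim (fun i => inXHom l (p.δ i)) fun j => ∑ k, inXHom l (p.β j k) * X (Sum.inr k))
    (fun i s => constantCoeff_pbVar _ _ i) ?_ (.const f t) using 1
  · rw [← pbHom_eq_subst, map_zero, zero_add, pbDeriv]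
    exact sum_congr rfl fun i _ => by rw [← pbHom_eq_subst]
  · rintro (i | j)
    · exact hin (p.deriv_g t ht i)
    · change HasCoeffDeriv (fun s => ∑ k, inXHom l ((p.b s).1.1 j k) * X (Sum.inr k))
        (∑ k, inXHom l (p.β j k) * X (Sum.inr k)) t
      refine .sum fun k _ => ?_
      simpa using (hin (p.deriv_b t ht j k)).mul (.const (X (Sum.inr k)) t)

end AutPath
end Motion

/-! ### The action of formal automorphisms on the algebra -/

section Action

lemma finite_det_one_add_smul_eq_zero {n : Type*} [Fintype n] [DecidableEq n] (L : Matrix n n ℂ) :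
    {t : ℂ | (1 + t • L).det = 0}.Finite := by
  set P : Polynomial ℂ := (1 + (Polynomial.X : Polynomial ℂ) • L.map Polynomial.C).det with hP
  have he : ∀ t, P.eval t = (1 + t • L).det := by
    intro t
    rw [hP, ← Polynomial.coe_evalRingHom, RingHom.map_det]
    congr 1
    ext i j
    by_cases h : i = j <;> simp [h] <;> ring
  have h0 : P ≠ 0 := by
    intro h
    have := he 0
    rw [h] at this
    simp at this
  refine (P.roots.toFinset.finite_toSet).subset fun t ht => ?_
  simp only [Finset.mem_coe, Multiset.mem_toFinset, Polynomial.mem_roots h0, Polynomial.IsRoot.def,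
    he]
  exact ht

/-- Every formal automorphism `(x, y) ↦ (ρ₀(x), b(x) y)` is joined to the identity by an affine
linear path, defined outside of a finite set of parameters. -/
lemma exists_autPath (g : FPS m ≃ₐ[ℂ] FPS m) (b : ZGroup m σ) :
    ∃ p : AutPath m σ, 0 ∈ p.D ∧ 1 ∈ p.D ∧ p.g 0 = AlgEquiv.refl ∧ p.b 0 = 1 ∧ p.g 1 = g ∧
      p.b 1 = b := by
  classical
  set δ : Fin m → FPS m := fun i => g (X i) - X i with hδ
  set β : 𝕄 := b.1.1 - 1 with hβ
  have hβc : CommutesWith σ β := CommutesWith.sub b.2 .one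
  have ha : ∀ (t : ℂ) i, constantCoeff (X i + t • δ i) = 0 := fun t i => by simp [hδ, algEquiv_X]
  have hlin : ∀ t : ℂ, linMat (fun i => X i + t • δ i) = 1 + t • linMat δ := by
    intro t
    ext i j
    simp [linMat, coeff_X, one_apply, Finsupp.single_left_inj, eq_comm]
  have hcon : ∀ t : ℂ, (1 + t • β).map (constantCoeff (R := ℂ)) =
      1 + t • β.map (constantCoeff (R := ℂ)) := by
    intro t
    ext i j
    by_cases h : i = j <;> simp [h]
  -- the parameters at which the linear terms of both components are invertible
  set D : Set ℂ := {t | (1 + t • linMat δ).det = 0}ᶜ ∩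
    {t | (1 + t • β.map (constantCoeff (R := ℂ))).det = 0}ᶜ with hD
  have hDg : ∀ t ∈ D, IsUnit (linMat fun i => X i + t • δ i).det := fun t ht => by
    rw [hlin]; exact isUnit_iff_ne_zero.2 ht.1
  have hDb : ∀ t ∈ D, IsUnit (1 + t • β).det := fun t ht => by
    rw [isUnit_det_iff_constantCoeff, hcon]; exact isUnit_iff_ne_zero.2 ht.2
  have hfin := (finite_det_one_add_smul_eq_zero (linMat δ)).union
    (finite_det_one_add_smul_eq_zero (β.map (constantCoeff (R := ℂ))))
  have hD' : D = _ := (Set.compl_union _ _).symm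
  have hDo : IsOpen D := by rw [hD']; exact hfin.isClosed.isOpen_compl
  -- the values outside of `D` are irrelevant
  let gg : ℂ → FPS m ≃ₐ[ℂ] FPS m := fun t =>
    if h : t ∈ D then substEquiv _ (ha t) (hDg t h) else AlgEquiv.refl
  let bb : ℂ → ZGroup m σ := fun t => if h : t ∈ D then
    ⟨Matrix.nonsingInvUnit _ (hDb t h), CommutesWith.add .one
      (hβc.map (t • (LinearMap.id : FPS m →ₗ[ℂ] FPS m)))⟩ else 1
  have hg : ∀ t ∈ D, ∀ i, gg t (X i) = X i + t • δ i := fun t ht i => by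
    simp only [gg, dif_pos ht, substEquiv_X]
  have hb : ∀ t ∈ D, (bb t).1.1 = 1 + t • β := fun t ht => by simp only [bb, dif_pos ht]; rfl
  have hext : ∀ g₁ g₂ : FPS m ≃ₐ[ℂ] FPS m, (∀ i, g₁ (X i) = g₂ (X i)) → g₁ = g₂ := fun g₁ g₂ h =>
    AlgEquiv.ext fun f => by rw [algEquiv_eq_subst g₁, algEquiv_eq_subst g₂, funext h]
  have h0 : 0 ∈ D := by simp [hD]
  have h1 : 1 ∈ D := by
    have e1 : 1 + linMat δ = linMat fun i => g (X i) := by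
      rw [← one_smul ℂ (linMat δ), ← hlin]; simp [hδ]
    have e2 : 1 + β.map (constantCoeff (R := ℂ)) = b.1.1.map (constantCoeff (R := ℂ)) := by
      rw [← one_smul ℂ (β.map _), ← hcon]; simp [hβ]
    refine ⟨?_, ?_⟩ <;> simp only [Set.mem_compl_iff, Set.mem_ofPred_eq, one_smul]
    · rw [e1]; exact (isUnit_linMat_algEquiv g).ne_zero
    · rw [e2]
      exact ((isUnit_det_iff_constantCoeff _).1 ((Matrix.isUnit_iff_isUnit_det _).1 b.1.isUnit)).ne_zero
  refine ⟨⟨D, hDo, ?_, gg, bb, δ, β, hβc, fun t ht i => ?_, fun t ht i j => ?_⟩, h0, h1,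
    hext _ _ fun i => ?_, Subtype.ext (Units.ext ?_), hext _ _ fun i => ?_,
    Subtype.ext (Units.ext ?_)⟩
  · rw [hD']
    exact (hfin.countable.isConnected_compl_of_one_lt_rank (by simp)).isPreconnected
  · refine (HasCoeffDeriv.linear (X i) (δ i) t).congr ?_
    filter_upwards [hDo.mem_nhds ht] with s hs using hg s hs i
  · refine (HasCoeffDeriv.linear ((1 : 𝕄) i j) (β i j) t).congr ?_
    filter_upwards [hDo.mem_nhds ht] with s hs
    rw [hb s hs]; rfl
  · simp [hg 0 h0]
  · simp [hb 0 h0]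
  · simp [hg 1 h1, hδ]
  · simp [hb 1 h1, hβ]

section Flat
variable {A : Type*} [Ring A] [Algebra ℂ A] (r : HCRep m σ c A)
  (g : FPS m ≃ₐ[ℂ] FPS m) (b : ZGroup m σ)

/-- The images of the generators of `𝒜` under a formal automorphism, extended to the free
algebra. -/
def HCRep.gen : FreeAlgebra ℂ (Gen m l H) →ₐ[ℂ] A := FreeAlgebra.lift ℂ fun
  | .fn f => r.F (pbHom g b.1 f)
  | .dx j => r.twD g b j
  | .vec j => r.twU b j
  | .grp h => r.K h

namespace AutPath
variable (p : AutPath m σ)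

/-- The solutions of the differential equation `w' = -[Φ, w]` along a path of automorphisms. -/
def Flat (w : ℂ → A) : Prop :=
  Fam r p.D w fun t => -⁅r.vel (p.g t) (p.b t) p.δ p.β, w t⁆

variable {p r}

lemma Flat.congr {w v : ℂ → A} (hw : p.Flat r w) (h : ∀ t, v t = w t) : p.Flat r v := by
  rwa [funext h]

lemma Flat.add {w v : ℂ → A} (hw : p.Flat r w) (hv : p.Flat r v) :
    p.Flat r fun t => w t + v t :=
  Fam.congr (Fam.add hw hv) (fun _ _ => rfl) fun t _ => by
    beta_reduce
    rw [ring_lie_add, neg_add]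

lemma Flat.sub {w v : ℂ → A} (hw : p.Flat r w) (hv : p.Flat r v) :
    p.Flat r fun t => w t - v t :=
  Fam.congr (Fam.sub hw hv) (fun _ _ => rfl) fun t _ => by
    beta_reduce
    rw [sub_eq_add_neg (w t), ring_lie_add, ring_lie_neg, neg_add, sub_eq_add_neg]

variable (p) in
/-- The images of a fixed word in the generators under the automorphisms `ρ_t` solve the
differential equation. -/
lemma flat_gen (hc : IsClassFun σ c) (hr : r.Generates) (x : FreeAlgebra ℂ (Gen m l H)) :
    p.Flat r fun t => r.gen (p.g t) (p.b t) x := by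
  induction x using FreeAlgebra.induction with
  | grade0 z =>
    refine Fam.congr (.const (algebraMap ℂ A z)) (fun t _ => AlgHom.commutes _ _) fun t _ => ?_
    beta_reduce
    rw [AlgHom.commutes, lie_eq_zero_of_comm (Algebra.commutes z _).symm, neg_zero]
  | mul x y hx hy =>
    refine Fam.congr (Fam.mul hr hx hy) (fun t _ => map_mul _ _ _) fun t _ => ?_
    beta_reduce
    rw [map_mul, lie_mul', neg_add, neg_mul, mul_neg]
  | add x y hx hy => exact (hx.add hy).congr fun t => map_add _ _ _
  | grade1 a =>
    simp only [HCRep.gen, FreeAlgebra.lift_ι_apply]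
    cases a with
    | fn f =>
      refine Fam.congr (.term _ _ 1 fun t ht => p.deriv_pbHom ht f) (fun t _ => (mul_one _).symm)
        fun t _ => ?_
      rw [mul_one, r.vel_lie_F _ _ _ p.comm, neg_neg]
    | dx j =>
      refine Fam.congr (.sum (s := Finset.univ) fun k _ => Fam.fx_mul
        (fun t ht => p.deriv_jacInv ht k j) ((Fam.const (r := r) (r.D k)).add
          (Fam.phi fun t ht => p.deriv_logDer ht k))) (fun t _ => rfl) fun t _ => ?_
      rw [r.vel_lie_twD _ _ _ p.comm hc, ← sum_neg_distrib]
      refine sum_congr rfl fun k _ => ?_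
      rw [map_neg, zero_add, neg_mul, neg_sub, sub_eq_neg_add]; rfl
    | vec j =>
      refine Fam.congr (.sum (s := Finset.univ) fun k _ => Fam.fx_mul
        (fun t ht => p.deriv_b_inv ht k j) (.const (r.U k))) (fun t _ => rfl) fun t _ => ?_
      rw [r.vel_lie_twU _ _ _ p.comm, ← sum_neg_distrib]
      exact sum_congr rfl fun k _ => by rw [map_neg, mul_zero, add_zero, neg_mul]
    | grp h =>
      refine Fam.congr (.const (r.K h)) (fun t _ => rfl) fun t _ => ?_
      have e : ⁅r.vel (p.g t) (p.b t) p.δ p.β, r.K h⁆ = 0 := by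
        refine lie_eq_zero_of_comm ?_
        rw [HCRep.vel, add_mul, mul_add, r.phi_comm_K hc (commutesWith_velM _ p.comm),
          mul_sum, sum_mul]
        refine congr_arg (· + _) (sum_congr rfl fun i _ => ?_)
        rw [← mul_assoc, r.fx_comm_K, mul_assoc, mul_assoc, r.K_mul_nab _ hc]
      rw [← neg_zero, ← e]

lemma generates_univ : (HCRep.univ : HCRep m σ c _).Generates := HCAlg.mem_of_generators

/-- A solution that vanishes at one parameter is zero. -/
lemma Flat.eq_zero (hc : IsClassFun σ c) {w : ℂ → HCAlg m σ c} (hw : p.Flat HCRep.univ w)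
    {t₀ : ℂ} (h0 : t₀ ∈ p.D) (hw0 : w t₀ = 0) {t : ℂ} (ht : t ∈ p.D) : w t = 0 := by
  have hvel : Fam (HCRep.univ : HCRep m σ c _) p.D
      (fun t => HCRep.univ.vel (p.g t) (p.b t) p.δ p.β) _ :=
    (Fam.sum (s := Finset.univ) fun i _ => Fam.fx_mul (fun t ht => (HasCoeffDeriv.sum
      (s := Finset.univ) fun a _ => (p.deriv_jacInv ht i a).mul (.const (p.δ a) t)).neg)
        ((Fam.const (HCRep.univ.D i)).add (Fam.phi fun t ht => p.deriv_logDer ht i))).add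
      (Fam.phi fun t ht i j => HasCoeffDeriv.sum (s := Finset.univ) fun q _ =>
        (p.deriv_b_inv ht i q).mul (.const (p.β q j) t))
  rw [← coefs_injective_iff m σ c hc, map_zero]
  exact fun i => Fam.eq_zero_of_ode generates_univ p.isOpen p.isPreconnected h0
    (coefs m σ c hc).toLinearMap (coefs_fn_mul m σ c hc) hvel hw hw0 i t ht

end AutPath
end Flat

open HCRep (univ)

lemma gen_refl_one (x : FreeAlgebra ℂ (Gen m l H)) :
    (univ : HCRep m σ c _).gen AlgEquiv.refl 1 x = RingQuot.mkAlgHom ℂ (Rel m σ c) x := by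
  have hB : ∀ k, logDer (1 : ZGroup m σ).1 k = 0 := fun k => by
    rw [logDer]
    exact (congr_arg _ (pderiv_map_one k)).trans (mul_zero _)
  suffices h : (univ : HCRep m σ c _).gen AlgEquiv.refl 1 = RingQuot.mkAlgHom ℂ (Rel m σ c) from
    DFunLike.congr_fun h x
  refine FreeAlgebra.hom_ext (funext fun a => (FreeAlgebra.lift_ι_apply _ _).trans ?_)
  cases a with
  | fn f =>
    have e : pbVar AlgEquiv.refl (1 : ZGroup m σ).1 = X := by
      funext i
      rcases i with i | j
      · exact inXHom_X _ _
      · simp [pbVar, one_apply]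
    change univ.F (pbHom AlgEquiv.refl (1 : ZGroup m σ).1 f) = univ.F f
    rw [pbHom_eq_subst, e, subst_self, id]
  | dx i =>
    change ∑ k, univ.fx (pderiv ℂ i (X k)) * (univ.D k +
      univ.phi (logDer (1 : ZGroup m σ).1 k)) = univ.D i
    simp only [hB, HCRep.phi_zero, add_zero]
    rw [sum_eq_single i]
    · simp
    · intro k _ hk; rw [pderiv_X_of_ne hk]; simp
    · simp
  | vec j =>
    change ∑ k, univ.fx (((1 : ZGroup m σ).1⁻¹).1 k j) * univ.U k = univ.U j
    rw [sum_eq_single j]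
    · simp
    · intro k _ hk; simp [one_apply_ne hk]
    · simp
  | grp h => rfl

/-- The relations of `𝒜` are preserved: along a path from the identity, the difference of the
images of the two sides of a relation solves a linear differential equation and vanishes at the
start. -/
lemma gen_eq_of_rel (hc : IsClassFun σ c) (g : FPS m ≃ₐ[ℂ] FPS m) (b : ZGroup m σ)
    ⦃x y : FreeAlgebra ℂ (Gen m l H)⦄ (h : Rel m σ c x y) :
    (univ : HCRep m σ c _).gen g b x = univ.gen g b y := by
  obtain ⟨p, h0, h1, hg0, hb0, rfl, rfl⟩ := exists_autPath g b
  refine sub_eq_zero.1 (((p.flat_gen hc AutPath.generates_univ x).sub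
    (p.flat_gen hc AutPath.generates_univ y)).eq_zero hc h0 ?_ h1)
  rw [hg0, hb0, gen_refl_one, gen_refl_one, RingQuot.mkAlgHom_rel ℂ h, sub_self]

variable (hc : IsClassFun σ c) (g : FPS m ≃ₐ[ℂ] FPS m) (b : ZGroup m σ)

/-- The action of a formal automorphism on `𝒜`, as an endomorphism. -/
def autHom : HCAlg m σ c →ₐ[ℂ] HCAlg m σ c :=
  RingQuot.liftAlgHom ℂ ⟨univ.gen g b, gen_eq_of_rel hc g b⟩

lemma autHom_mk (x : FreeAlgebra ℂ (Gen m l H)) :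
    autHom hc g b (RingQuot.mkAlgHom ℂ (Rel m σ c) x) = univ.gen g b x :=
  RingQuot.liftAlgHom_mkAlgHom_apply _ _ _ _

lemma autHom_el (a : Gen m l H) : autHom hc g b (el m σ c a) = univ.gen g b (gen a) :=
  autHom_mk hc g b _

lemma autHom_F (f : FPS2 m l) : autHom hc g b (univ.F f) = univ.F (pbHom g b.1 f) :=
  (autHom_el hc g b _).trans (FreeAlgebra.lift_ι_apply _ _)

lemma autHom_D (j : Fin m) : autHom hc g b (univ.D j) = univ.twD g b j :=
  (autHom_el hc g b _).trans (FreeAlgebra.lift_ι_apply _ _)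

lemma autHom_U (j : Fin l) : autHom hc g b (univ.U j) = univ.twU b j :=
  (autHom_el hc g b _).trans (FreeAlgebra.lift_ι_apply _ _)

lemma autHom_K (h : H) : autHom hc g b (univ.K h) = univ.K h :=
  (autHom_el hc g b _).trans (FreeAlgebra.lift_ι_apply _ _)

lemma autHom_refl_one (a : HCAlg m σ c) : autHom hc AlgEquiv.refl 1 a = a := by
  obtain ⟨x, rfl⟩ := RingQuot.mkAlgHom_surjective ℂ (Rel m σ c) a
  rw [autHom_mk, gen_refl_one]

lemma AutPath.flat_autHom (p : AutPath m σ) (a : HCAlg m σ c) :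
    p.Flat univ fun t => autHom hc (p.g t) (p.b t) a := by
  obtain ⟨x, rfl⟩ := RingQuot.mkAlgHom_surjective ℂ (Rel m σ c) a
  exact (p.flat_gen hc AutPath.generates_univ x).congr fun t => autHom_mk hc _ _ _

lemma pbHom_surjective : Function.Surjective (pbHom g b.1) := by
  have e : linMat (pbVar g b.1) = Matrix.fromBlocks (linMat fun i => g (X i)) 0 0
      (b.1.1.map (constantCoeff (R := ℂ))) := by
    have h : ∀ {ι : Type _} (a : ι → MvPowerSeries ι ℂ) i j,
        linMat a i j = constantCoeff (pderiv ℂ j (a i)) := fun a i j => by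
      simp [linMat, ← coeff_zero_eq_constantCoeff_apply, coeff_pderiv]
    ext (i | i) (j | j) <;> rw [h, pbVar]
    · rw [Sum.elim_inl, pderiv_inl_inXHom, constantCoeff_inXHom, Matrix.fromBlocks_apply₁₁, h]
    · rw [Sum.elim_inl, pderiv_inr_inXHom, map_zero]; rfl
    · simp [Derivation.leibniz, pderiv_X_of_ne]
    · simp [Derivation.leibniz, pderiv_X, Pi.single_apply, apply_ite constantCoeff,
        constantCoeff_inXHom]
  have h : IsUnit (linMat (pbVar g b.1)).det := by
    rw [e, Matrix.det_fromBlocks_zero₂₁]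
    exact (isUnit_linMat_algEquiv g).mul ((isUnit_det_iff_constantCoeff _).1
      ((Matrix.isUnit_iff_isUnit_det _).1 b.1.isUnit))
  rw [show ⇑(pbHom g b.1) = subst (pbVar g b.1) from funext (pbHom_eq_subst g b.1)]
  exact (bijective_subst (constantCoeff_pbVar g b.1) h).2

/-- Injectivity holds since a solution of the differential equation that vanishes at the end of a
path vanishes at its start; surjectivity holds since the generators are combinations of their
images. -/
lemma autHom_bijective : Function.Bijective (autHom hc g b) := by
  constructor
  · obtain ⟨p, h0, h1, hg0, hb0, rfl, rfl⟩ := exists_autPath g b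
    refine (injective_iff_map_eq_zero _).2 fun a ha => ?_
    have := (p.flat_autHom hc a).eq_zero hc h1 ha h0
    rwa [hg0, hb0, autHom_refl_one] at this
  · have hF : ∀ f, univ.F f ∈ (autHom hc g b).range := fun f => by
      obtain ⟨f, rfl⟩ := pbHom_surjective g b f
      exact ⟨_, autHom_F hc g b f⟩
    have hU : ∀ j, univ.U j ∈ (autHom hc g b).range := fun j => by
      have e : (univ : HCRep m σ c _).U j = ∑ k, univ.fx (b.1.1 k j) * univ.twU b k := by
        simp only [HCRep.twU, mul_sum, ← mul_assoc, ← map_mul]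
        rw [sum_comm]
        simp only [← sum_mul, ← map_sum, mul_comm (b.1.1 _ _), ← mul_apply]
        rw [show (b.1⁻¹).1 * b.1.1 = 1 from b.1.inv_mul, sum_eq_single j]
        · simp
        · intro k _ hk; simp [one_apply_ne hk]
        · simp
      exact e ▸ sum_mem fun k _ => mul_mem (hF _) ⟨_, autHom_U hc g b k⟩
    have hK : ∀ h, univ.K h ∈ (autHom hc g b).range := fun h => ⟨_, autHom_K hc g b h⟩
    refine fun a => HCAlg.mem_of_generators (autHom hc g b).range hF (fun j => ?_) hU hK a
    change univ.D j ∈ _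
    have e : (univ : HCRep m σ c _).D j = ∑ k, univ.fx (jac (fun i => g (X i)) k j) *
        univ.twD g b k - univ.phi (logDer b.1 j) := by
      simp only [HCRep.twD, mul_sum, ← mul_assoc, ← map_mul]
      rw [sum_comm]
      simp only [← sum_mul, ← map_sum, mul_comm (jac _ _ _), ← mul_apply]
      rw [mul_eq_one_comm.1 (jac_mul_jacInv g), sum_eq_single j]
      · simp [HCRep.nab]
      · intro k _ hk; simp [one_apply_ne hk]
      · simp
    rw [e, HCRep.phi]
    exact sub_mem (sum_mem fun k _ => mul_mem (hF _) ⟨_, autHom_D hc g b k⟩)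
      (add_mem (neg_mem (sum_mem fun _ _ => sum_mem fun _ _ => mul_mem (hF _)
        (mul_mem (hF _) (hU _)))) (sum_mem fun s _ => Subalgebra.smul_mem _
          (mul_mem (hF _) (sub_mem (one_mem _) (hK s))) _))

/-- The action of a formal automorphism on `𝒜`. -/
def autAlg : HCAlg m σ c ≃ₐ[ℂ] HCAlg m σ c :=
  AlgEquiv.ofBijective (autHom hc g b) (autHom_bijective hc g b)

lemma isConjAction_autAlg : IsConjAction σ c g b.1 (autAlg hc g b) where
  map_fn f := by
    rw [pullback_eq]
    exact autHom_F hc g b f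
  map_grp h := autHom_K hc g b h
  map_vec j := autHom_U hc g b j
  map_dx j := by
    refine (autHom_D hc g b j).trans ?_
    change ∑ k, univ.fx (jacInv g k j) * (univ.D k + univ.phi (logDer b.1 k)) = _
    simp only [HCRep.univ_phi, ← jac_inv_eq]
    rfl

end Action

/-! ### Flat families along a path of automorphisms -/

section Transport

/-- A holomorphic family of finitely supported families has uniformly finite support: otherwise
infinitely many entries are not identically zero, each has only countably many zeros, and there
is a parameter at which none of them vanishes. -/
lemma exists_uniform_support {I κ : Type*} [Countable I] {D : Set ℂ} (hD : IsOpen D)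
    (hDc : IsPreconnected D) (h0 : D.Nonempty) (a : ℂ → I → κ → ℂ)
    (ha : ∀ i d, DifferentiableOn ℂ (fun s => a s i d) D)
    (hfin : ∀ t ∈ D, {i | ∃ d, a t i d ≠ 0}.Finite) :
    ∃ S : Finset I, ∀ i ∉ S, ∀ d, ∀ t ∈ D, a t i d = 0 := by
  set Z : Set I := {i | ∃ d, ∃ t ∈ D, a t i d ≠ 0} with hZ
  suffices h : Z.Finite from ⟨h.toFinset, fun i hi d t ht => by
    by_contra hne
    exact hi (h.mem_toFinset.2 ⟨d, t, ht, hne⟩)⟩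
  choose d hd using fun i : Z => i.2
  have hc : (⋃ i : Z, {t | t ∈ D ∧ a t i (d i) = 0}).Countable := by
    refine Set.countable_iUnion fun i => ?_
    obtain ⟨t, ht, hne⟩ := hd i
    have h1 := ((ha i (d i)).analyticOnNhd hD).eqOn_zero_or_eventually_ne_zero_of_preconnected hDc
    rcases h1 with h1 | h1
    · exact absurd (h1 ht) hne
    · have h2 : IsDiscrete ({t | a t i (d i) = 0} ∩ D) := by
        refine isDiscrete_of_codiscreteWithin ?_
        filter_upwards [h1] with t ht using ht
      have := h2.to_subtype
      have h3 := TopologicalSpace.separableSpace_iff_countable.1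
        (inferInstance : TopologicalSpace.SeparableSpace ↥({t | a t i (d i) = 0} ∩ D))
      refine (Set.countable_coe_iff.1 h3).mono fun t ht => ?_
      exact ⟨ht.2, ht.1⟩
  obtain ⟨t, ht, hne⟩ := (hc.dense_compl ℂ).inter_open_nonempty D hD h0
  exact (hfin t ht).subset fun i hi => ⟨d ⟨i, hi⟩, fun h => hne
    (Set.mem_iUnion.2 ⟨⟨i, hi⟩, ht, h⟩)⟩

variable (hc : IsClassFun σ c)

/-- A flat family along a path of automorphisms is transported by the automorphisms. -/
lemma AutPath.expand_eq (p : AutPath m σ) (h0 : 0 ∈ p.D) (F dF : ℂ → Idx m l H →₀ FPS2 m l)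
    (hF : ∀ t ∈ p.D, ∀ i, HasCoeffDeriv (fun s => F s i) (dF t i) t)
    (hflat : ∀ t ∈ p.D, expand m σ c (dF t) +
      ⁅PhiC σ c (velX (p.g t) p.δ) (velA (p.g t) (p.b t) p.δ p.β), expand m σ c (F t)⁆ = 0) :
    ∀ t ∈ p.D, expand m σ c (F t) =
      autAlg hc (p.g t) (p.b t) ((autAlg hc (p.g 0) (p.b 0)).symm (expand m σ c (F 0))) := by
  classical
  obtain ⟨S, hS⟩ := exists_uniform_support p.isOpen p.isPreconnected ⟨0, h0⟩
    (fun t i d => coeff d (F t i))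
    (fun i d t ht => (hF t ht i d).differentiableAt.differentiableWithinAt)
    (fun t ht => (F t).support.finite_toSet.subset fun i ⟨d, hd⟩ => by
      rw [Finset.mem_coe, Finsupp.mem_support_iff]
      rintro h; exact hd (by rw [h, map_zero]))
  have hS' : ∀ i ∉ S, ∀ t ∈ p.D, F t i = 0 := fun i hi t ht =>
    ext fun d => hS i hi d t ht
  have hdS : ∀ i ∉ S, ∀ t ∈ p.D, dF t i = 0 := fun i hi t ht =>
    (hF t ht i).unique ((HasCoeffDeriv.const 0 t).congr (by
      filter_upwards [p.isOpen.mem_nhds ht] with s hs using hS' i hi s hs))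
  have hexp : ∀ a : Idx m l H →₀ FPS2 m l, (∀ i ∉ S, a i = 0) → expand m σ c a =
      ∑ i ∈ S, HCRep.univ.F (a i) * ((List.ofFn fun k => el m σ c (.dx k) ^ i.1 k).prod *
        vecMonomial m σ c i.2.1 i.2.2) := by
    intro a ha
    rw [expand, Finsupp.sum_of_support_subset (s := S)]
    · exact sum_congr rfl fun i _ => mul_assoc _ _ _
    · intro i hi
      by_contra h
      exact Finsupp.mem_support_iff.1 hi (ha i h)
    · intro i _
      rw [show el m σ c (.fn 0) = 0 from map_zero (fnHom m σ c), zero_mul, zero_mul]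
  set x := (autAlg hc (p.g 0) (p.b 0)).symm (expand m σ c (F 0)) with hx
  have hΦ : ∀ t, PhiC σ c (velX (p.g t) p.δ) (velA (p.g t) (p.b t) p.δ p.β) =
      (HCRep.univ : HCRep m σ c _).vel (p.g t) (p.b t) p.δ p.β := fun t => by
    rw [HCRep.vel_eq, HCRep.univ_phi]; rfl
  have hw : p.Flat HCRep.univ fun t => expand m σ c (F t) := by
    refine (Fam.sum (s := S) fun i _ => Fam.term _ _ _ fun t ht => hF t ht i).congr
      (fun t ht => hexp _ fun i hi => hS' i hi t ht) fun t ht => ?_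
    rw [← hexp _ fun i hi => hdS i hi t ht, ← hΦ, eq_comm]
    exact eq_neg_of_add_eq_zero_left (hflat t ht)
  refine fun t ht => sub_eq_zero.1 ((hw.sub (p.flat_autHom hc x)).eq_zero hc h0 ?_ ht)
  exact sub_eq_zero.2 ((autAlg hc (p.g 0) (p.b 0)).apply_symm_apply _).symm

end Transport

/-! ### Pullbacks along a path of formal automorphisms -/

section LinearPath

namespace AutPath
variable (p : AutPath m σ) {t : ℂ}

lemma deriv_g_apply (ht : t ∈ p.D) (f : FPS m) :
    HasCoeffDeriv (fun s => p.g s f) (-vecField (velX (p.g t) p.δ) (p.g t f)) t := by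
  have h := HasCoeffDeriv.subst (fun i s => algEquiv_X (p.g s) i) (p.deriv_g t ht) (.const f t)
  simp only [← algEquiv_eq_subst, map_zero, zero_add] at h
  convert h using 1
  rw [vecField_apply, ← sum_neg_distrib]
  simp only [pderiv_algEquiv (p.g t) f, mul_sum, ← mul_assoc]
  simp only [sum_neg_distrib]
  rw [sum_comm]
  simp only [← sum_mul, sum_velX_mul, neg_mul, sum_neg_distrib, neg_neg]
  exact sum_congr rfl fun i _ => mul_comm _ _

lemma deriv_mulVec (ht : t ∈ p.D) (q : Fin l → FPS m) (a : Fin l) :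
    HasCoeffDeriv (fun s => ((p.b s).1⁻¹).1.mulVec (fun i => p.g s (q i)) a)
      (-(vecField (velX (p.g t) p.δ) (((p.b t).1⁻¹).1.mulVec (fun i => p.g t (q i)) a) +
        (velA (p.g t) (p.b t) p.δ p.β).mulVec (((p.b t).1⁻¹).1.mulVec fun i => p.g t (q i)) a)) t := by
  have h := HasCoeffDeriv.sum (s := Finset.univ) fun k _ =>
    (p.deriv_b_inv ht a k).mul (p.deriv_g_apply ht (q k))
  convert h using 1
  · rfl
  set u : Fin l → FPS m := fun i => p.g t (q i)
  set v := velX (p.g t) p.δ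
  have e1 : vecField v (((p.b t).1⁻¹).1.mulVec u a) =
      ∑ k, ((-(∑ i, v i • logDer (p.b t).1 i) * ((p.b t).1⁻¹).1) a k * u k +
        ((p.b t).1⁻¹).1 a k * vecField v (u k)) := by
    rw [Matrix.mulVec, dotProduct, map_sum]
    refine sum_congr rfl fun k _ => ?_
    have e2 : vecField v (((p.b t).1⁻¹).1 a k) =
        (-(∑ i, v i • logDer (p.b t).1 i) * ((p.b t).1⁻¹).1) a k := by
      rw [vecField_apply, neg_mul, sum_mul, Matrix.neg_apply, Matrix.sum_apply, ← sum_neg_distrib]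
      refine sum_congr rfl fun i _ => ?_
      have := congrFun (congrFun (pderiv_inv (p.b t).1 i) a) k
      rw [map_apply, Matrix.neg_apply] at this
      rw [this, Matrix.smul_mul, Matrix.smul_apply, smul_eq_mul, mul_neg]
    rw [vecField_mul, add_comm, e2]
  rw [e1, mulVec_mulVec, velA, add_mul, Matrix.mulVec, dotProduct, ← sum_add_distrib,
    ← sum_neg_distrib]
  refine sum_congr rfl fun k _ => ?_
  simp only [Matrix.add_apply, Matrix.neg_mul, Matrix.neg_apply]
  change _ = -(velM (p.b t) p.β * ((p.b t).1⁻¹).1) a k * u k + _ * -vecField v (u k)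
  ring

end AutPath
end LinearPath

/-! ### Flat sections over the bundle of formal coordinates of the normal bundle -/

section FlatSection
variable {X Y G : Type*} [TopologicalSpace X] [ChartedSpace (Fin (m + l) → ℂ) X]
  [IsManifold 𝓘(ℂ, Fin (m + l) → ℂ) ω X] [Group G] [MulAction G X]
  [TopologicalSpace Y] [ChartedSpace (Fin m → ℂ) Y] [IsManifold 𝓘(ℂ, Fin m → ℂ) ω Y]
  {H : Subgroup G} [Fintype H] {σ : H →* GL (Fin l) ℂ} {ι : Y → X} {c : H → ℂ}

lemma NormalCoord.act_refl_one (φ : NormalCoord m H σ ι) : φ.act AlgEquiv.refl 1 = φ := by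
  obtain ⟨φ₀, f, h1, h2⟩ := φ
  have e : NormalCoord.actFrame AlgEquiv.refl 1 ⟨φ₀, f, h1, h2⟩ = f := by
    refine LinearMap.ext fun n => ?_
    exact one_mulVec _
  have key : ∀ f' h1' h2', f' = f →
      (⟨φ₀, f', h1', h2'⟩ : NormalCoord m H σ ι) = ⟨φ₀, f, h1, h2⟩ := by
    rintro _ _ _ rfl; rfl
  exact key _ _ _ e

/-- The jet coordinates along the orbit of a path of formal automorphisms move with the velocity
`ω⁻¹(v + A)`. -/
lemma NormalCoord.hasDerivAt_act (p : AutPath m σ) {t : ℂ} (ht : t ∈ p.D)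
    (φ : NormalCoord m H σ ι) {f : NormalCoord m H σ ι → ℂ} {d : ℂ}
    (h : NormalCoord.HasLieDeriv f (φ.act (p.g t) (p.b t)) (velX (p.g t) p.δ)
      (velA (p.g t) (p.b t) p.δ p.β) d) :
    HasDerivAt (fun s => f (φ.act (p.g s) (p.b s))) d t := by
  obtain ⟨O, e, _, _, _, hd⟩ := h
  refine hd.hasDerivAt (γ := fun s => φ.act (p.g s) (p.b s)) ?_ ?_ fun _ => rfl
  · obtain ⟨_, _, _, ⟨hO, _⟩, _⟩ := hd
    exact .of_forall fun s => hO
  · rintro (⟨i, α⟩ | ⟨⟨a, j⟩, α⟩)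
    · have h1 := p.deriv_g_apply ht (φ.pull fun q => chart φ.base q i) α
      simp only [← FormalCoord.pull_act] at h1
      rw [map_neg] at h1
      exact h1
    · have h1 := p.deriv_mulVec ht (φ.pullSection (e j)) a α
      rw [map_neg] at h1
      have h2 : ∀ s, (φ.act (p.g s) (p.b s)).pullSection (e j) =
          ((p.b s).1⁻¹).1.mulVec fun i => p.g s (φ.pullSection (e j) i) := fun s =>
        φ.pullSection_act _ _ _
      simp only [← h2] at h1
      exact h1

variable {s : NormalCoord m H σ ι → HCAlg m σ c} {F : NormalCoord m H σ ι → Idx m l H →₀ FPS2 m l}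
  (hc : IsClassFun σ c)

/-- Flat sections are equivariant: both sides satisfy the same linear differential equation along
a path from the identity to the given automorphism. -/
lemma IsFlatSection.equivariant (hs : IsFlatSection c s F) (g : FPS m ≃ₐ[ℂ] FPS m)
    (b : ZGroup m σ) (φ : NormalCoord m H σ ι) : s (φ.act g b) = autAlg hc g b (s φ) := by
  obtain ⟨p, h0, h1, hg0, hb0, hg1, hb1⟩ := exists_autPath g b
  have hfl : ∀ t, ∃ dF : Idx m l H →₀ FPS2 m l, t ∈ p.D →
      (∀ i, HasCoeffDeriv (fun s => F (φ.act (p.g s) (p.b s)) i) (dF i) t) ∧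
      expand m σ c dF + ⁅PhiC σ c (velX (p.g t) p.δ) (velA (p.g t) (p.b t) p.δ p.β),
        expand m σ c (F (φ.act (p.g t) (p.b t)))⁆ = 0 := by
    intro t
    by_cases ht : t ∈ p.D
    · obtain ⟨dF, hd, he⟩ := hs.flat (φ.act (p.g t) (p.b t)) (velX (p.g t) p.δ)
        (velA (p.g t) (p.b t) p.δ p.β) (commutesWith_velA _ _ _ p.comm)
      refine ⟨dF, fun _ => ⟨fun i d => ?_, by rw [← hs.expansion]; exact he⟩⟩
      exact NormalCoord.hasDerivAt_act p ht φ (hd i d)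
    · exact ⟨0, fun h => absurd h ht⟩
  choose dF hdF using hfl
  have h := p.expand_eq hc h0 (fun t => F (φ.act (p.g t) (p.b t))) dF
    (fun t ht => (hdF t ht).1) (fun t ht => (hdF t ht).2) 1 h1
  simp only [hg0, hb0, hg1, hb1, NormalCoord.act_refl_one, ← hs.expansion] at h
  rw [h, (AlgEquiv.symm_apply_eq _).2 (autHom_refl_one hc (s φ)).symm]

variable (hdim : ∀ y, Module.finrank ℂ (normalSpace m l H (ι y)) ≤ l) (hcont : Continuous ι)

include hc hdim hcont in
/-- The derivatives in the coordinate directions determine the coefficients of positive order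
in `x`. -/
lemma IsFlatSection.eq_of_coeff_zero {s' : NormalCoord m H σ ι → HCAlg m σ c}
    {F' : NormalCoord m H σ ι → Idx m l H →₀ FPS2 m l} (hs : IsFlatSection c s F)
    (hs' : IsFlatSection c s' F')
    (h0 : ∀ φ i (I : Fin l →₀ ℕ), coeff (sumElim (0 : Fin m →₀ ℕ) I) (F φ i) =
        coeff (sumElim (0 : Fin m →₀ ℕ) I) (F' φ i)) :
    s = s' ∧ F = F' := by
  classical
  have key : ∀ (β : Fin m →₀ ℕ) φ i (I : Fin l →₀ ℕ),
      coeff (sumElim β I) (F φ i) = coeff (sumElim β I) (F' φ i) := by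
    intro β
    induction β using multiIndex_induction with
    | h0 => exact h0
    | hs β j ih =>
      intro φ i I
      obtain ⟨dF, hd, he⟩ := hs.flat φ (Pi.single j 1) 0 CommutesWith.zero
      obtain ⟨dF', hd', he'⟩ := hs'.flat φ (Pi.single j 1) 0 CommutesWith.zero
      rw [hs.expansion] at he
      rw [hs'.expansion] at he'
      have h1 := hd i (sumElim β I)
      simp only [ih] at h1
      have h2 := NormalCoord.HasLieDeriv.unique hdim hcont CommutesWith.zero h1
        (hd' i (sumElim β I))
      rw [flat_single hc j _ _ he, flat_single hc j _ _ he', map_neg, map_neg, neg_inj,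
        coeff_pderiv, coeff_pderiv] at h2
      have e : sumElim β I + single (Sum.inl j) 1 =
          sumElim (β + single j 1) I := by
        ext (k | k)
        · simp [Finsupp.single_apply]
        · simp
      rw [e] at h2
      exact mul_right_cancel₀ (by norm_cast) h2
  have hF : F = F' := by
    refine funext fun φ => Finsupp.ext fun i => ext fun d => ?_
    have e : d = sumElim (d.comapDomain Sum.inl Sum.inl_injective.injOn)
        (d.comapDomain Sum.inr Sum.inr_injective.injOn) := by
      ext (k | k) <;> simp
    rw [e]
    exact key _ φ i _
  refine ⟨funext fun φ => ?_, hF⟩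
  rw [hs.expansion, hs'.expansion, hF]

include hc hdim hcont in
lemma IsFlatSection.recursion (hs : IsFlatSection c s F) (φ : NormalCoord m H σ ι)
    (ξ : Fin m → Fin m → FPS m) (A : Fin m → 𝕄)
    (dF : Fin m → Idx m l H →₀ FPS2 m l) (hV : IsUnit (constMatrix ξ).det)
    (hA : ∀ r, CommutesWith σ (A r))
    (hd : ∀ r i d, NormalCoord.HasLieDeriv (fun φ => coeff d (F φ i)) φ (ξ r) (A r)
      (coeff d (dF r i))) (α β : Fin m →₀ ℕ) (j : Fin m) :
    ((β j : ℂ) + 1) • xComponent m σ c (F φ) α (β + single j 1) =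
      ∑ r, (constMatrix ξ)⁻¹ j r • (-xComponent m σ c (dF r) α β +
        vecFieldTerm (xComponent m σ c (F φ)) (ξ r) α β +
        matrixTerm σ c (xComponent m σ c (F φ)) (A r) α β) := by
  refine xComponent_recursion hc ξ A (F φ) dF hV (fun r => ?_) α β j
  obtain ⟨dF', hd', he⟩ := hs.flat φ (ξ r) (A r) (hA r)
  have e : dF r = dF' := Finsupp.ext fun i => ext fun d =>
    NormalCoord.HasLieDeriv.unique hdim hcont (hA r) (hd r i d) (hd' i d)
  rw [e, ← hs.expansion]
  exact he

end FlatSection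

/-! ### Formal differential operators as a Cherednik algebra of rank zero -/

section Weyl
variable {n : ℕ}

variable (n) in
/-- The algebra `D̂ₙ ⊗̂ Ĥ_{1,c}(ℂˡ, H)` for `l = 0` and the trivial group. -/
abbrev WAlg : Type _ := HCAlg n (1 : Unit →* GL (Fin 0) ℂ) 0

variable (n) in
/-- The identification of `ℂ⟦x⟧` with the ring of series in `x` and no further variables. -/
def xEquiv : FPS n ≃ₐ[ℂ] FPS2 n 0 := renameEquiv ℂ (Equiv.sumEmpty (Fin n) (Fin 0)).symm

lemma xEquiv_apply (p : FPS n) : xEquiv n p = inXHom 0 p := rfl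

lemma xEquiv_symm_pderiv (f : FPS2 n 0) (i : Fin n) :
    (xEquiv n).symm (pderiv ℂ (Sum.inl i) f) = pderiv ℂ i ((xEquiv n).symm f) := by
  obtain ⟨p, rfl⟩ := (xEquiv n).surjective f
  rw [AlgEquiv.symm_apply_apply, xEquiv_apply, pderiv_inl_inXHom, ← xEquiv_apply,
    AlgEquiv.symm_apply_apply]

lemma hc_zero {H : Type*} [Group H] (σ : H →* GL (Fin 0) ℂ) : IsClassFun σ (0 : H → ℂ) :=
  fun _ _ _ => rfl

variable (n) in
/-- The action of formal differential operators on power series. -/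
def weylRep : HCRep n (1 : Unit →* GL (Fin 0) ℂ) 0 (Module.End ℂ (FPS n)) where
  F := (Algebra.lmul ℂ (FPS n)).comp (xEquiv n).symm.toAlgHom
  D i := (pderiv ℂ i).toLinearMap
  U := Fin.elim0
  K := 1
  K_mul_F h f := by rw [Subsingleton.elim h 1, grpHom_one]; simp
  K_mul_D h i := by simp
  K_mul_U h j := j.elim0
  D_comm i j := LinearMap.ext fun p => pderiv_pderiv_comm _ _ _
  D_mul_U i j := j.elim0
  D_mul_F i f := by
    refine LinearMap.ext fun p => ?_
    change pderiv ℂ i ((xEquiv n).symm f * p) = (xEquiv n).symm f * pderiv ℂ i p +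
      (xEquiv n).symm (pderiv ℂ (Sum.inl i) f) * p
    rw [xEquiv_symm_pderiv, Derivation.leibniz, smul_eq_mul, smul_eq_mul, mul_comm p]
  U_comm i := i.elim0
  U_mul_F j := j.elim0

lemma weylRep_fx (p : FPS n) : (weylRep n).fx p = mulLeft ℂ p := by
  change Algebra.lmul ℂ (FPS n) ((xEquiv n).symm (xEquiv n p)) = _
  rw [AlgEquiv.symm_apply_apply]; rfl

lemma HCRep.phi_eq_zero {A : Type*} [Ring A] [Algebra ℂ A]
    (r : HCRep n (1 : Unit →* GL (Fin 0) ℂ) 0 A) (B : Matrix (Fin 0) (Fin 0) (FPS n)) :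
    r.phi B = 0 := by
  simp [HCRep.phi, dunklConst]

/-- The family of coefficients of a differential operator, as a family indexed by the monomials
of the algebra. -/
def liftIdx (a : (Fin n →₀ ℕ) →₀ FPS n) : Idx n 0 Unit →₀ FPS2 n 0 :=
  (a.mapRange (inXHom 0) (map_zero _)).equivMapDomain
    ⟨fun α => (α, 0, ()), fun i => i.1, fun _ => rfl,
      fun _ => Prod.ext rfl (Subsingleton.elim _ _)⟩

lemma liftIdx_apply (a : (Fin n →₀ ℕ) →₀ FPS n) (i : Idx n 0 Unit) :
    liftIdx a i = inXHom 0 (a i.1) := rfl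

lemma weylRep_expand (a : (Fin n →₀ ℕ) →₀ FPS n) :
    (weylRep n).hom (expand n 1 0 (liftIdx a)) = diffOp a := by
  classical
  rw [expand, liftIdx, Finsupp.equivMapDomain_eq_mapDomain, Finsupp.sum_mapDomain_index_inj
    (Equiv.injective _), Finsupp.sum_mapRange_index, diffOp, Finsupp.sum, Finsupp.sum, map_sum]
  · refine sum_congr rfl fun α _ => ?_
    rw [map_mul, map_mul, map_list_prod, List.map_ofFn, vecMonomial, List.ofFn_zero,
      List.prod_nil, one_mul]
    have h1 : (weylRep n).hom (el n 1 0 (.fn (inXHom 0 (a α)))) = mulLeft ℂ (a α) := by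
      rw [← weylRep_fx]; exact HCRep.hom_F _ _
    have h2 : ∀ k, (weylRep n).hom (el n 1 0 (.dx k)) = (pderiv ℂ k).toLinearMap := fun k =>
      HCRep.hom_D _ k
    have h3 : (weylRep n).hom (el n 1 0 (.grp ())) = 1 := HCRep.hom_K _ ()
    change (weylRep n).hom (el n 1 0 (.fn (inXHom 0 (a α)))) * _ *
      (weylRep n).hom (el n 1 0 (.grp ())) = _
    rw [h1, h3, mul_one]
    congr 3
    funext k
    simp [h2]
  · intro i
    rw [show el n (1 : Unit →* GL (Fin 0) ℂ) 0 (.fn 0) = 0 from map_zero (fnHom n _ 0), zero_mul,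
      zero_mul]

/-- The exponential series `exp(∑ λᵢ xᵢ)`. -/
def expSeries (x : Fin n → ℂ) : FPS n := fun d => ∏ i, x i ^ d i / (d i).factorial

lemma pderiv_expSeries (x : Fin n → ℂ) (i : Fin n) :
    pderiv ℂ i (expSeries x) = x i • expSeries x := by
  ext d
  rw [coeff_pderiv, map_smul, smul_eq_mul]
  change (∏ k, x k ^ (d + single i 1 : Fin n →₀ ℕ) k /
    ((d + single i 1 : Fin n →₀ ℕ) k).factorial) *
    ((d i : ℂ) + 1) = x i * ∏ k, x k ^ d k / (d k).factorial
  rw [Fintype.prod_eq_mul_prod_compl i, Fintype.prod_eq_mul_prod_compl i (fun k => x k ^ d k / _)]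
  have e : ∏ k ∈ {i}ᶜ, x k ^ (d + single i 1 : Fin n →₀ ℕ) k /
      ((d + single i 1 : Fin n →₀ ℕ) k).factorial =
      ∏ k ∈ {i}ᶜ, x k ^ d k / ((d k).factorial : ℂ) := by
    refine prod_congr rfl fun k hk => ?_
    have : i ≠ k := fun h => by simp [h] at hk
    simp [this]
  rw [e]
  simp only [Finsupp.add_apply, Finsupp.single_eq_same, Nat.factorial_succ, Nat.cast_mul,
    Nat.cast_add, Nat.cast_one]
  have : ((d i : ℂ) + 1) ≠ 0 := by norm_cast
  have h2 : ((d i).factorial : ℂ) ≠ 0 := by exact_mod_cast (d i).factorial_ne_zero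
  field_simp
  ring

lemma List.prod_ofFn_apply_of_eigen {M : Type*} [AddCommGroup M] [Module ℂ M] {k : ℕ}
    (f : Fin k → Module.End ℂ M) (x : Fin k → ℂ) (v : M) (h : ∀ i, f i v = x i • v) :
    (List.ofFn f).prod v = (∏ i, x i) • v := by
  induction k with
  | zero => simp
  | succ k ih =>
    rw [List.ofFn_succ, List.prod_cons, Module.End.mul_apply, ih _ (fun i => x i.succ)
      fun i => h i.succ, map_smul, h, Fin.prod_univ_succ, smul_smul, mul_comm]

/-- A differential operator is determined by its action on exponential series. -/
lemma diffOp_injective {a : (Fin n →₀ ℕ) →₀ FPS n} (h : diffOp a = 0) : a = 0 := by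
  classical
  have h1 : ∀ x : Fin n → ℂ, a.sum (fun α f => (∏ i, x i ^ α i) • f) = 0 := by
    intro x
    have h2 := congrArg (fun T => T (expSeries x)) h
    simp only [diffOp, Finsupp.sum, LinearMap.sum_apply, Module.End.mul_apply,
      LinearMap.zero_apply] at h2
    have h3 : ∀ α : Fin n →₀ ℕ, (List.ofFn fun i =>
        (pderiv ℂ i).toLinearMap ^ α i).prod (expSeries x) = (∏ i, x i ^ α i) • expSeries x := by
      refine fun α => List.prod_ofFn_apply_of_eigen _ _ _ fun i => ?_
      induction α i with
      | zero => simp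
      | succ k ih =>
        rw [pow_succ', Module.End.mul_apply, ih, map_smul, pow_succ, mul_smul]
        exact congr_arg _ (pderiv_expSeries x i)
    simp only [h3, mulLeft_apply, mul_smul_comm, ← smul_mul_assoc, ← sum_mul] at h2
    refine (mul_eq_zero.1 h2).resolve_right fun h4 => ?_
    have h5 : coeff 0 (expSeries x) = 1 := by
      change ∏ i, x i ^ (0 : Fin n →₀ ℕ) i / ((0 : Fin n →₀ ℕ) i).factorial = (1 : ℂ)
      simp
    rw [h4, map_zero] at h5
    exact zero_ne_one h5
  refine Finsupp.ext fun α => ext fun d => ?_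
  -- the coefficients of `x^d` are those of a polynomial that vanishes at all exponents
  set P : MvPolynomial (Fin n) ℂ :=
    ∑ α ∈ a.support, MvPolynomial.monomial α (coeff d (a α)) with hPdef
  have hP : P = 0 := by
    refine MvPolynomial.funext fun x => ?_
    rw [map_zero, ← map_zero (coeff d), ← h1 x, Finsupp.sum, map_sum, map_sum]
    refine sum_congr rfl fun α _ => ?_
    rw [MvPolynomial.eval_monomial, Finsupp.prod_pow, map_smul, smul_eq_mul, mul_comm]
  have h2 := congrArg (MvPolynomial.coeff α) hP
  simp only [hPdef, MvPolynomial.coeff_sum, MvPolynomial.coeff_monomial, Finset.sum_ite_eq',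
    MvPolynomial.coeff_zero] at h2
  by_cases hα : α ∈ a.support
  · simpa [hα] using h2
  · simp [Finsupp.notMem_support_iff.1 hα]

lemma weylRep_hom_injective {x : WAlg n} (h : (weylRep n).hom x = 0) : x = 0 := by
  set a := coefs n _ 0 (hc_zero _) x with ha
  let a' : (Fin n →₀ ℕ) →₀ FPS n := (a.equivMapDomain
    ⟨fun i => i.1, fun α => (α, 0, ()), fun i => Prod.ext rfl (Subsingleton.elim _ _),
      fun _ => rfl⟩).mapRange (xEquiv n).symm (map_zero _)
  have h1 : liftIdx a' = a := by
    refine Finsupp.ext fun i => ?_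
    rw [liftIdx_apply, ← xEquiv_apply]
    exact (AlgEquiv.apply_symm_apply _ _).trans (congr_arg a (Prod.ext rfl (Subsingleton.elim _ _)))
  have h2 : x = expand n _ 0 (liftIdx a') := by rw [h1, ha, expand_coefs]
  rw [h2, weylRep_expand] at h
  rw [h2, diffOp_injective h, show liftIdx (0 : (Fin n →₀ ℕ) →₀ FPS n) = 0 from
    Finsupp.ext fun _ => map_zero (inXHom 0), expand, Finsupp.sum_zero_index]

lemma weylRep_PhiC (v : Fin n → FPS n) (B : Matrix (Fin 0) (Fin 0) (FPS n)) :
    (weylRep n).hom (PhiC 1 0 v B) = vecField v := by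
  rw [PhiC, ← HCRep.univ_phi, HCRep.phi_eq_zero, add_zero, map_sum, vecField]
  refine sum_congr rfl fun i _ => ?_
  rw [map_mul, ← weylRep_fx]
  exact congr_arg₂ _ (HCRep.hom_F _ _) (HCRep.hom_D _ _)

lemma weylRep_autAlg (g : FPS n ≃ₐ[ℂ] FPS n) (x : WAlg n) :
    (weylRep n).hom (autAlg (hc_zero _) g 1 x) =
      g.toLinearMap ∘ₗ (weylRep n).hom x ∘ₗ g.symm.toLinearMap := by
  suffices h : (weylRep n).hom.comp (autHom (hc_zero _) g 1) =
      (g.toLinearEquiv.conjAlgEquiv ℂ).toAlgHom.comp (weylRep n).hom from DFunLike.congr_fun h x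
  refine HCRep.hom_ext (fun f => ?_) (fun i => ?_) (fun j => j.elim0) fun h => ?_
  · obtain ⟨p, rfl⟩ := (xEquiv n).surjective f
    rw [AlgHom.comp_apply, AlgHom.comp_apply, autHom_F, HCRep.hom_F, HCRep.hom_F]
    change (weylRep n).F (pbHom g _ (inXHom 0 p)) = g.toLinearMap ∘ₗ (weylRep n).fx p ∘ₗ _
    rw [pbHom_inXHom]
    change (weylRep n).fx (g p) = _
    rw [weylRep_fx, weylRep_fx]
    refine LinearMap.ext fun q => ?_
    change g p * q = g (p * g.symm q)
    rw [map_mul, AlgEquiv.apply_symm_apply]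
  · rw [AlgHom.comp_apply, AlgHom.comp_apply, autHom_D, HCRep.twD, HCRep.hom_D]
    refine LinearMap.ext fun q => ?_
    simp only [HCRep.nab, map_sum, map_mul, map_add, HCRep.hom_fx, HCRep.hom_D,
      HCRep.phi_eq_zero, add_zero, weylRep_fx, LinearMap.sum_apply]
    exact sum_jacInv_mul g i q
  · rw [AlgHom.comp_apply, AlgHom.comp_apply, autHom_K, HCRep.hom_K]
    exact LinearMap.ext fun q => (AlgEquiv.apply_symm_apply g q).symm

lemma expand_liftIdx_flat {a da : (Fin n →₀ ℕ) →₀ FPS n} {v : Fin n → FPS n}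
    (h : diffOp da + ⁅vecField v, diffOp a⁆ = 0) (B : Matrix (Fin 0) (Fin 0) (FPS n)) :
    expand n (1 : Unit →* GL (Fin 0) ℂ) 0 (liftIdx da) +
      ⁅PhiC (1 : Unit →* GL (Fin 0) ℂ) 0 v B, expand n 1 0 (liftIdx a)⁆ = 0 := by
  apply weylRep_hom_injective
  rw [Ring.lie_def] at h ⊢
  rw [map_add, map_sub, map_mul, map_mul, weylRep_expand, weylRep_expand, weylRep_PhiC]
  exact h

end Weyl

/-! ### Flat sections over the bundle of formal coordinates of a complex manifold -/

section FlatDSection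
variable {n : ℕ} {U : Type*} [TopologicalSpace U] [ChartedSpace (Fin n → ℂ) U]
  [IsManifold 𝓘(ℂ, Fin n → ℂ) ω U]

lemma coeff_inXHom_zero (p : FPS n) (β : Fin n →₀ ℕ) (I : Fin 0 →₀ ℕ) :
    coeff (sumElim β I) (inXHom 0 p) = coeff β p := by
  rw [← coeff_embDomain_rename ⟨Sum.inl, Sum.inl_injective⟩ p β]
  have e : sumElim β I =
      Finsupp.embDomain (⟨Sum.inl, Sum.inl_injective⟩ : Fin n ↪ Fin n ⊕ Fin 0) β := by
    ext (k | k)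
    · exact (Finsupp.embDomain_apply_self ⟨Sum.inl, Sum.inl_injective⟩ β k).symm
    · exact k.elim0
  rw [e]; rfl

lemma FormalCoord.act_refl (φ : FormalCoord n U) : φ.act AlgEquiv.refl = φ := rfl

lemma FormalCoord.hasDerivAt_act {σ : Unit →* GL (Fin 0) ℂ} (p : AutPath n σ) {t : ℂ}
    (ht : t ∈ p.D) (φ : FormalCoord n U) {f : FormalCoord n U → ℂ} {d : ℂ}
    (h : FormalCoord.HasLieDeriv f (φ.act (p.g t)) (velX (p.g t) p.δ) d) :
    HasDerivAt (fun s => f (φ.act (p.g s))) d t := by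
  obtain ⟨O, _, _, hd⟩ := h
  refine hd.hasDerivAt (γ := fun s => φ.act (p.g s)) ?_ (fun ⟨i, α⟩ => ?_) fun _ => rfl
  · obtain ⟨_, _, _, ⟨hO, _⟩, _⟩ := hd
    exact .of_forall fun s => hO
  · have h1 := p.deriv_g_apply ht (φ.pull fun q => chartAt (Fin n → ℂ) φ.base q i) α
    simp only [← FormalCoord.pull_act] at h1
    rw [map_neg] at h1
    exact h1

variable {s : FormalCoord n U → DHat n} {F : FormalCoord n U → (Fin n →₀ ℕ) →₀ FPS n}

lemma IsFlatDSection.equivariant (hs : IsFlatDSection s F) (g : FPS n ≃ₐ[ℂ] FPS n)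
    (φ : FormalCoord n U) : (s (φ.act g) : Module.End ℂ (FPS n)) =
      g.toLinearMap ∘ₗ (s φ : Module.End ℂ (FPS n)) ∘ₗ g.symm.toLinearMap := by
  obtain ⟨p, h0, h1, hg0, hb0, hg1, hb1⟩ := exists_autPath g (1 : ZGroup n (1 : Unit →* GL (Fin 0) ℂ))
  have hfl : ∀ t, ∃ dF : (Fin n →₀ ℕ) →₀ FPS n, t ∈ p.D →
      (∀ α, HasCoeffDeriv (fun s => F (φ.act (p.g s)) α) (dF α) t) ∧
      diffOp dF + ⁅vecField (velX (p.g t) p.δ), diffOp (F (φ.act (p.g t)))⁆ = 0 := by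
    intro t
    by_cases ht : t ∈ p.D
    · obtain ⟨dF, hd, he⟩ := hs.flat (φ.act (p.g t)) (velX (p.g t) p.δ)
      refine ⟨dF, fun _ => ⟨fun i d => ?_, by rw [← hs.expansion]; exact he⟩⟩
      exact FormalCoord.hasDerivAt_act p ht φ (hd i d)
    · exact ⟨0, fun h => absurd h ht⟩
  choose dF hdF using hfl
  have h := p.expand_eq (hc_zero _) h0 (fun t => liftIdx (F (φ.act (p.g t))))
    (fun t => liftIdx (dF t))
    (fun t ht i => ((hdF t ht).1 i.1).map (inXHom 0).toLinearMap 0 fun _ _ hf =>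
      le_order_inXHom 0 hf)
    (fun t ht => expand_liftIdx_flat (hdF t ht).2 _) 1 h1
  simp only [hg0, hb0, hg1, hb1, FormalCoord.act_refl] at h
  rw [(AlgEquiv.symm_apply_eq _).2 (autHom_refl_one (hc_zero _) _).symm] at h
  have h2 := congrArg (weylRep n).hom h
  rwa [weylRep_autAlg, weylRep_expand, weylRep_expand, ← hs.expansion, ← hs.expansion] at h2

lemma IsFlatDSection.eq_of_coeff_zero {s' : FormalCoord n U → DHat n}
    {F' : FormalCoord n U → (Fin n →₀ ℕ) →₀ FPS n} (hs : IsFlatDSection s F)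
    (hs' : IsFlatDSection s' F')
    (h0 : ∀ φ α, constantCoeff (F φ α) = constantCoeff (F' φ α)) :
    s = s' ∧ F = F' := by
  classical
  have hsingle : ∀ {j : Fin n} {a da : (Fin n →₀ ℕ) →₀ FPS n},
      diffOp da + ⁅vecField (Pi.single j 1), diffOp a⁆ = 0 → ∀ α, da α = -pderiv ℂ j (a α) := by
    intro j a da h α
    have h1 := flat_single (hc_zero _) j _ _ (expand_liftIdx_flat h 0) (α, 0, ())
    rw [liftIdx_apply, liftIdx_apply, pderiv_inl_inXHom, ← map_neg] at h1
    exact (xEquiv n).injective h1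
  have key : ∀ (β : Fin n →₀ ℕ) φ α,
      coeff β (F φ α) = coeff β (F' φ α) := by
    intro β
    induction β using multiIndex_induction with
    | h0 => exact h0
    | hs β j ih =>
      intro φ α
      obtain ⟨dF, hd, he⟩ := hs.flat φ (Pi.single j 1)
      obtain ⟨dF', hd', he'⟩ := hs'.flat φ (Pi.single j 1)
      rw [hs.expansion] at he
      rw [hs'.expansion] at he'
      have h1 := hd α β
      simp only [ih] at h1
      have h2 := FormalCoord.HasLieDeriv.unique h1 (hd' α β)
      rw [hsingle he, hsingle he', map_neg, map_neg, neg_inj, coeff_pderiv, coeff_pderiv] at h2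
      exact mul_right_cancel₀ (by norm_cast) h2
  have hF : F = F' := funext fun φ => Finsupp.ext fun α => ext fun β => key β φ α
  refine ⟨funext fun φ => Subtype.ext ?_, hF⟩
  rw [hs.expansion, hs'.expansion, hF]

lemma xComponent_liftIdx (a : (Fin n →₀ ℕ) →₀ FPS n) (α β : Fin n →₀ ℕ) :
    xComponent n (1 : Unit →* GL (Fin 0) ℂ) 0 (liftIdx a) α β =
      algebraMap ℂ (WAlg n) (coeff β (a α)) := by
  classical
  have hel : ∀ p : FPS n, el n (1 : Unit →* GL (Fin 0) ℂ) 0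
      (.fn (rename Sum.inr (xCoeff β (inXHom 0 p)))) = algebraMap ℂ (WAlg n) (coeff β p) := by
    intro p
    have e : xCoeff β (inXHom 0 p) = C (coeff β p) := by
      ext I
      rw [Subsingleton.elim I 0, coeff_zero_C]
      exact coeff_inXHom_zero p β 0
    rw [e, rename_C, el_fn]
    exact (fnHom n _ 0).commutes _
  have hK : el n (1 : Unit →* GL (Fin 0) ℂ) 0 (.grp ()) = 1 := HCRep.univ.K.map_one
  rw [xComponent, Finsupp.sum_eq_single (α, 0, ())]
  · rw [if_pos rfl, liftIdx_apply, hel, vecMonomial, List.ofFn_zero, List.prod_nil, one_mul, hK,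
      mul_one]
  · intro i _ hi
    rw [if_neg fun h => hi (Prod.ext h (Subsingleton.elim _ _))]
  · intro _
    have h := hel 0
    rw [map_zero, map_zero, map_zero] at h
    rw [if_pos rfl, h, zero_mul]

lemma IsFlatDSection.recursion (hs : IsFlatDSection s F) (φ : FormalCoord n U)
    (ξ : Fin n → Fin n → FPS n) (dF : Fin n → (Fin n →₀ ℕ) →₀ FPS n)
    (hV : IsUnit (constMatrix ξ).det)
    (hd : ∀ r α β, FormalCoord.HasLieDeriv (fun φ => coeff β (F φ α)) φ (ξ r)
      (coeff β (dF r α))) (α β : Fin n →₀ ℕ) (j : Fin n) :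
    ((β j : ℂ) + 1) * coeff (β + single j 1) (F φ α) =
      ∑ r, (constMatrix ξ)⁻¹ j r * (-coeff β (dF r α) +
        vecFieldTerm (fun α β => coeff β (F φ α)) (ξ r) α β) := by
  have hfl : ∀ r, diffOp (dF r) + ⁅vecField (ξ r), diffOp (F φ)⁆ = 0 := by
    intro r
    obtain ⟨dF', hd', he⟩ := hs.flat φ (ξ r)
    have e : dF r = dF' := Finsupp.ext fun α => ext fun β =>
      FormalCoord.HasLieDeriv.unique (hd r α β) (hd' α β)
    rw [e, ← hs.expansion]
    exact he
  have h := xComponent_recursion (hc_zero _) ξ 0 _ _ hV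
    (fun r => expand_liftIdx_flat (hfl r) 0) α β j
  have : Nontrivial (WAlg n) := (weylRep n).hom.toRingHom.domain_nontrivial
  have hinj : Function.Injective (algebraMap ℂ (WAlg n)) := (algebraMap ℂ (WAlg n)).injective
  have hmt : ∀ S, matrixTerm (1 : Unit →* GL (Fin 0) ℂ) 0 S
      (0 : Matrix (Fin 0) (Fin 0) (FPS n)) α β = 0 := by
    intro S
    have hphi : ∀ B : Matrix (Fin 0) (Fin 0) (FPS n), phiC (1 : Unit →* GL (Fin 0) ℂ) 0 B = 0 :=
      fun B => by rw [← HCRep.univ_phi, HCRep.phi_eq_zero]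
    simp [matrixTerm, hphi, Ring.lie_def]
  have hvt : ∀ v, vecFieldTerm (xComponent n (1 : Unit →* GL (Fin 0) ℂ) 0 (liftIdx (F φ))) v α β =
      algebraMap ℂ (WAlg n) (vecFieldTerm (fun α β => coeff β (F φ α)) v α β) := by
    intro v
    have hfs : ∀ f : (Fin n →₀ ℕ) → ℂ, algebraMap ℂ (WAlg n) (∑ᶠ (γ) (_ : γ ≠ 0), f γ) =
        ∑ᶠ (γ) (_ : γ ≠ 0), algebraMap ℂ (WAlg n) (f γ) := fun f =>
      ((algebraMap ℂ (WAlg n)).toAddMonoidHom.map_finsum_of_injective hinj _).trans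
        (finsum_congr fun γ =>
          (algebraMap ℂ (WAlg n)).toAddMonoidHom.map_finsum_of_injective hinj _)
    rw [vecFieldTerm, vecFieldTerm, map_add, map_neg, map_sum, map_sum]
    congr 2
    · refine sum_congr rfl fun i _ => ?_
      rw [map_sum]
      refine sum_congr rfl fun p _ => ?_
      split_ifs
      · rw [map_zero]
      · rw [xComponent_liftIdx, smul_eq_mul, map_mul, Algebra.smul_def]
    · refine funext fun i => ?_
      split_ifs
      · rw [map_zero]
      · rw [map_sum]
        refine sum_congr rfl fun p _ => ?_
        rw [hfs]
        refine finsum_congr fun γ => finsum_congr fun _ => ?_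
        rw [xComponent_liftIdx, smul_eq_mul, map_mul, Algebra.smul_def]
  apply hinj
  simp only [xComponent_liftIdx, Pi.zero_apply, hmt, add_zero, hvt] at h
  rw [map_mul, map_sum, ← Algebra.smul_def]
  refine h.trans (sum_congr rfl fun r _ => ?_)
  rw [map_mul, map_add, map_neg, Algebra.smul_def]

end FlatDSection

end FormalGeometry

end

theorem mainTheorem7
    {m l : ℕ}
    -- a complex manifold with a holomorphic action of a finite group
    {X : Type*} [TopologicalSpace X] [T2Space X] [ChartedSpace (Fin (m + l) → ℂ) X]
    [IsManifold 𝓘(ℂ, Fin (m + l) → ℂ) ω X]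
    {G : Type*} [Group G] [Finite G] [MulAction G X]
    (hG : ∀ g : G, MDifferentiable 𝓘(ℂ, Fin (m + l) → ℂ) 𝓘(ℂ, Fin (m + l) → ℂ)
      (fun x : X => g • x))
    -- a stratum of codimension `l` with stabilizer `H` and slice representation `σ`
    (H : Subgroup G) [Fintype H] (σ : H →* GL (Fin l) ℂ)
    {Y : Type*} [TopologicalSpace Y] [ChartedSpace (Fin m → ℂ) Y]
    [IsManifold 𝓘(ℂ, Fin m → ℂ) ω Y]
    (ι : Y → X) (hι : FormalGeometry.IsStratumPiece m l H ι)
    (hσ : FormalGeometry.IsSliceRep m H σ ι)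
    -- the parameters of the Cherednik algebra
    (c : H → ℂ)
    (hc : ∀ h s : H, FormalGeometry.IsReflection σ s → c (h * s * h⁻¹) = c s)
    -- a complex manifold, for instance an open subset of the principal stratum
    {n : ℕ} {U : Type*} [TopologicalSpace U] [T2Space U] [ChartedSpace (Fin n → ℂ) U]
    [IsManifold 𝓘(ℂ, Fin n → ℂ) ω U] :
    -- flat sections of `Coor(𝒩) × 𝒜`
    (∀ (s : FormalGeometry.NormalCoord m H σ ι → FormalGeometry.HCAlg m σ c)
      (F : FormalGeometry.NormalCoord m H σ ι →
        (FormalGeometry.Idx m l H →₀ FormalGeometry.FPS2 m l)),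
      FormalGeometry.IsFlatSection c s F →
      -- equivariance
      (∀ (g : FormalGeometry.FPS m ≃ₐ[ℂ] FormalGeometry.FPS m)
        (b : FormalGeometry.ZGroup m σ),
        ∃ τ : FormalGeometry.HCAlg m σ c ≃ₐ[ℂ] FormalGeometry.HCAlg m σ c,
          FormalGeometry.IsConjAction σ c g b.1 τ ∧ ∀ φ, s (φ.act g b) = τ (s φ)) ∧
      -- the coefficients of order zero in `x` determine the section
      (∀ (s' : FormalGeometry.NormalCoord m H σ ι → FormalGeometry.HCAlg m σ c)
        (F' : FormalGeometry.NormalCoord m H σ ι →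
          (FormalGeometry.Idx m l H →₀ FormalGeometry.FPS2 m l)),
        FormalGeometry.IsFlatSection c s' F' →
        (∀ φ i (I : Fin l →₀ ℕ),
          MvPowerSeries.coeff (Finsupp.sumElim (0 : Fin m →₀ ℕ) I) (F φ i) =
            MvPowerSeries.coeff (Finsupp.sumElim (0 : Fin m →₀ ℕ) I) (F' φ i)) →
        s = s' ∧ F = F') ∧
      -- the recursion
      (∀ (φ : FormalGeometry.NormalCoord m H σ ι) (ξ : Fin m → Fin m → FormalGeometry.FPS m)
        (A : Fin m → Matrix (Fin l) (Fin l) (FormalGeometry.FPS m))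
        (dF : Fin m → (FormalGeometry.Idx m l H →₀ FormalGeometry.FPS2 m l)),
        IsUnit (FormalGeometry.constMatrix ξ).det →
        (∀ r, FormalGeometry.CommutesWith σ (A r)) →
        (∀ r i d, FormalGeometry.NormalCoord.HasLieDeriv
          (fun φ => MvPowerSeries.coeff d (F φ i)) φ (ξ r) (A r)
          (MvPowerSeries.coeff d (dF r i))) →
        ∀ (α β : Fin m →₀ ℕ) (j : Fin m),
          ((β j : ℂ) + 1) •
              FormalGeometry.xComponent m σ c (F φ) α (β + Finsupp.single j 1) =
            ∑ r, (FormalGeometry.constMatrix ξ)⁻¹ j r •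
              (-FormalGeometry.xComponent m σ c (dF r) α β +
                FormalGeometry.vecFieldTerm (FormalGeometry.xComponent m σ c (F φ)) (ξ r) α β +
                FormalGeometry.matrixTerm σ c (FormalGeometry.xComponent m σ c (F φ))
                  (A r) α β))) ∧
    -- flat sections of `Coor(U) × D̂ₙ`
    (∀ (s : FormalGeometry.FormalCoord n U → FormalGeometry.DHat n)
      (F : FormalGeometry.FormalCoord n U → ((Fin n →₀ ℕ) →₀ FormalGeometry.FPS n)),
      FormalGeometry.IsFlatDSection s F →
      -- equivariance
      (∀ (g : FormalGeometry.FPS n ≃ₐ[ℂ] FormalGeometry.FPS n)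
        (φ : FormalGeometry.FormalCoord n U),
        (s (φ.act g) : Module.End ℂ (FormalGeometry.FPS n)) =
          g.toLinearMap ∘ₗ (s φ : Module.End ℂ (FormalGeometry.FPS n)) ∘ₗ
            g.symm.toLinearMap) ∧
      -- the coefficients of order zero in `x` determine the section
      (∀ (s' : FormalGeometry.FormalCoord n U → FormalGeometry.DHat n)
        (F' : FormalGeometry.FormalCoord n U → ((Fin n →₀ ℕ) →₀ FormalGeometry.FPS n)),
        FormalGeometry.IsFlatDSection s' F' →
        (∀ φ α, MvPowerSeries.constantCoeff (F φ α) = MvPowerSeries.constantCoeff (F' φ α)) →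
        s = s' ∧ F = F') ∧
      -- the recursion
      (∀ (φ : FormalGeometry.FormalCoord n U) (ξ : Fin n → Fin n → FormalGeometry.FPS n)
        (dF : Fin n → ((Fin n →₀ ℕ) →₀ FormalGeometry.FPS n)),
        IsUnit (FormalGeometry.constMatrix ξ).det →
        (∀ r α β, FormalGeometry.FormalCoord.HasLieDeriv
          (fun φ => MvPowerSeries.coeff β (F φ α)) φ (ξ r)
          (MvPowerSeries.coeff β (dF r α))) →
        ∀ (α β : Fin n →₀ ℕ) (j : Fin n),
          ((β j : ℂ) + 1) * MvPowerSeries.coeff (β + Finsupp.single j 1) (F φ α) =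
            ∑ r, (FormalGeometry.constMatrix ξ)⁻¹ j r *
              (-MvPowerSeries.coeff β (dF r α) +
                FormalGeometry.vecFieldTerm
                  (fun α β => MvPowerSeries.coeff β (F φ α)) (ξ r) α β))) := by
  have hdim := hι.finrank_normalSpace_le hG
  have hcont := hι.embedding.continuous
  refine ⟨fun s F hs => ⟨fun g b => ⟨FormalGeometry.autAlg hc g b,
    FormalGeometry.isConjAction_autAlg hc g b, fun φ => hs.equivariant hc g b φ⟩,
    fun s' F' hs' h0 => hs.eq_of_coeff_zero hc hdim hcont hs' h0,
    fun φ ξ A dF hV hA hd α β j => hs.recursion hc hdim hcont φ ξ A dF hV hA hd α β j⟩,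
    fun s F hs => ⟨hs.equivariant, fun s' F' hs' h0 => hs.eq_of_coeff_zero hs' h0,
      fun φ ξ dF hV hd α β j => hs.recursion φ ξ dF hV hd α β j⟩⟩
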